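/- **Setting.** Let $n\ge 1$, $T>0$, and let $A(t,x)=(a_{ij}(t,x))$ be real symmetric matrices, $(t,x)\in[-T,T]\times\mathbb R^n$, uniformly positive definite and bounded ($|\xi|^2/C_A\le\sum a_{ij}(t,x)\xi_i\xi_j\le C_A|\xi|^2$), with $C^{1,1}$ entries; precisely, the $a_{ij}$ are Lipschitz in $(t,x)$, and their gradients $\nabla_x a_{ij}$ exist and are Lipschitz in $(t,x)$. Put $q(t,x,\xi)=(\sum a_{ij}(t,x)\xi_i\xi_j)^{1/2}$ and $\mathbf T=\partial_t^2-\sum a_{ij}(t,x)\partial_{x_i}\partial_{x_j}$. *Frame.* For every $k\in\mathbb N=\{0,1,\dots\}$ choose in the annulus $2^{k-1}\le|\xi|<2^k$ a finite set of points $2^k\omega_{i,k}$, $i\in I_k$, with pairwise distances $>2^{k/2}$ and with as many points as possible. Fix $\varepsilon>0$ and $C_\varepsilon>0$. For $\gamma=(i,k,\alpha)$, $\alpha\in\mathbb Z^n$, let $\xi_\gamma=2^k\omega_{i,k}$, $\Delta x_\gamma=C_\varepsilon2^{-k/2-\varepsilon k}$, $x_\gamma=\Delta x_\gamma\alpha$,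 $$\phi_\gamma(x)=\Big(\tfrac{|\xi_\gamma|\Delta x_\gamma}{2\pi}\Big)^{n/2}e^{\,i\xi_\gamma\cdot(x-x_\gamma)-|\xi_\gamma||x-x_\gamma|^2}.$$ Let $P_1^0f=\{\int\overline{\phi_\gamma}f\}_\gamma$ (the duality pairing if $f$ is a distribution), $P_2^0\{c(\gamma)\}=\sum_\gamma c(\gamma)\phi_\gamma$ and $\Pi^0=P_2^0P_1^0$. *Propagation.* For $t'\in[-T,T]$ let $(x_\gamma^\pm,\xi_\gamma^\pm)(t,t')$ solve $\dot x=\mp q_\xi,\ \dot\xi=\pm q_x$ (the Hamilton equations of $\tau\mp q$) on $[-T,T]$ with value $(x_\gamma,\xi_\gamma)$ at $t=t'$; these solutions exist. Let $$\phi_\gamma^\pm(t,t',x)=\Big(\tfrac{|\xi_\gamma^\pm(t,t')|\Delta x_\gamma}{2\pi}\Big)^{n/2}e^{\,i\xi_\gamma^\pm\cdot(x-x_\gamma^\pm)-|\xi_\gamma^\pm||x-x_\gamma^\pm|^2},\qquad \Omega_\gamma^\pm=\frac{\phi_\gamma^\pm}{q(t',x_\gamma,\xi_\gamma)}.$$ The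 operators $\mathbf T\mathcal C(t,t')$ and $\mathbf T\mathcal S(t,t')$ are defined by $\Pi^0\,\mathbf T\mathcal C(t,t')\,\Pi^0=P_2^0B_{\mathbf T\mathcal C}P_1^0$ and $\Pi^0\,\mathbf T\mathcal S(t,t')\,\Pi^0=P_2^0B_{\mathbf T\mathcal S}P_1^0$ with the matrices $$b_{\mathbf T\mathcal C}(\gamma,\gamma')=\tfrac12\int\overline{\phi_\gamma}\,\mathbf T(\phi_{\gamma'}^++\phi_{\gamma'}^-)\,dx,\qquad b_{\mathbf T\mathcal S}(\gamma,\gamma')=\tfrac12\int\overline{\phi_\gamma}\,\mathbf T(\Omega_{\gamma'}^+-\Omega_{\gamma'}^-)\,dx .$$ Call $t\in(-T,T)$ *regular* for $t'$ if all curves $(x_\gamma^\pm,\xi_\gamma^\pm)(\cdot,t')$ are twice differentiable at $t$, so that $\partial_t^2\phi_\gamma^\pm$ exists at $t$. **Theorem 4.** For every $n$ and $\varepsilon$ there is $C_0>0$ such that, whenever $0<C_\varepsilon\le C_0$, the following holds for every choice of the points $\omega_{i,k}$, every $T$ and every $A$ as above. For each $t'\in[-T,T]$ almost every $t\in(-T,T)$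 is regular. For each $m\in[-1,2]$ there is a constant $K$ such that for all $t'\in[-T,T]$ and all $t\in(-T,T)$ regular for $t'$, the above equations determine unique linear operators $$\mathbf T\mathcal C(t,t'):H^{m+1}(\mathbb R^n)\to H^m(\mathbb R^n),\qquad \mathbf T\mathcal S(t,t'):H^{m}(\mathbb R^n)\to H^m(\mathbb R^n),$$ and both are bounded with operator norm at most $K$. Thus $\mathbf T\mathcal C(t,t')$ has order one, $\mathbf T\mathcal S(t,t')$ has order zero, and the norms are uniformly bounded in $t,t'$. -/

import Mathlib

open Set MeasureTheory
open scoped SchwartzMap Gradient ContDiff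

noncomputable section

/-! ### Complex Gaussians -/

/-- Euclidean space `ℝⁿ`. -/
abbrev Space (n : ℕ) : Type := EuclideanSpace ℝ (Fin n)

/-- The complex Gaussian packet centred at `x₀` with frequency `ξ₀` and lattice step `δ`:
`(|ξ₀| δ / 2π)^{n/2} exp (i ξ₀ · (x - x₀) - |ξ₀| |x - x₀|²)`. -/
def packet {n : ℕ} (δ : ℝ) (x₀ ξ₀ x : Space n) : ℂ :=
  (((‖ξ₀‖ * δ / (2 * Real.pi)) ^ ((n : ℝ) / 2) : ℝ) : ℂ) *
    Complex.exp (Complex.I * ((inner ℝ ξ₀ (x - x₀) : ℝ) : ℂ)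
      - ((‖ξ₀‖ * ‖x - x₀‖ ^ 2 : ℝ) : ℂ))

theorem norm_iteratedFDeriv_cexp_le (i : ℕ) (z : ℂ) :
    ‖iteratedFDeriv ℝ i Complex.exp z‖ ≤ Real.exp z.re := by
  have h : ContDiffAt ℂ i Complex.exp z := Complex.contDiff_exp.contDiffAt
  rw [← h.restrictScalars_iteratedFDeriv (𝕜 := ℝ)]
  simp only [Function.comp_apply, ContinuousMultilinearMap.norm_restrictScalars]
  rw [norm_iteratedFDeriv_eq_norm_iteratedDeriv]
  have : iteratedDeriv i Complex.exp = Complex.exp := by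
    rw [iteratedDeriv_eq_iterate, Complex.iter_deriv_exp]
  rw [this, Complex.norm_exp]

theorem one_add_pow_mul_exp_le (c : ℝ) (hc : 0 < c) (N : ℕ) (r : ℝ) (hr : 0 ≤ r) :
    (1 + r) ^ N * Real.exp (-(c * r ^ 2)) ≤ N.factorial * Real.exp (1 + 1 / (4 * c)) := by
  have h1 : (1 + r) ^ N ≤ N.factorial * Real.exp (1 + r) := by
    have := Real.pow_div_factorial_le_exp (1 + r) (by positivity) N
    rwa [div_le_iff₀ (by positivity), mul_comm] at this
  calc (1 + r) ^ N * Real.exp (-(c * r ^ 2))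
      ≤ N.factorial * Real.exp (1 + r) * Real.exp (-(c * r ^ 2)) := by gcongr
    _ = N.factorial * Real.exp (1 + r - c * r ^ 2) := by
        rw [mul_assoc, ← Real.exp_add]; ring_nf
    _ ≤ _ := by
        gcongr
        have : r - c * r ^ 2 ≤ 1 / (4 * c) := by
          rw [le_div_iff₀ (by positivity)]
          nlinarith [sq_nonneg (2 * c * r - 1)]
        linarith

/-- A complex Gaussian centred at the origin, as a Schwartz function. -/
def centredGaussian {n : ℕ} (c : ℝ) (hc : 0 < c) (ξ₀ : Space n) : 𝓢(Space n, ℂ) where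
  toFun x := Complex.exp (Complex.I * ((inner ℝ ξ₀ x : ℝ) : ℂ) - ((c * ‖x‖ ^ 2 : ℝ) : ℂ))
  smooth' := by
    have h2 : ContDiff ℝ ∞ (fun x : Space n => ‖x‖ ^ 2) := contDiff_norm_sq ℝ
    have h3 : ContDiff ℝ ∞ (fun r : ℝ => (r : ℂ)) := Complex.ofRealCLM.contDiff
    have h4 : ContDiff ℝ ∞ (fun x : Space n => inner ℝ ξ₀ x) :=
      (innerSL ℝ ξ₀).contDiff
    exact Complex.contDiff_exp.comp
      ((contDiff_const.mul (h3.comp h4)).sub (h3.comp (contDiff_const.mul h2)))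
  decay' := by
    intro k m
    set p : Space n → ℂ := fun x =>
      Complex.I * ((inner ℝ ξ₀ x : ℝ) : ℂ) - ((c * ‖x‖ ^ 2 : ℝ) : ℂ) with hp
    have hpt : p.HasTemperateGrowth := by
      have h1 : (fun x : Space n => ((inner ℝ ξ₀ x : ℝ) : ℂ)).HasTemperateGrowth :=
        Function.HasTemperateGrowth.comp Function.Complex.hasTemperateGrowth_ofReal
          (Function.hasTemperateGrowth_inner_right ξ₀)
      have h2 : (fun x : Space n => ((c * ‖x‖ ^ 2 : ℝ) : ℂ)).HasTemperateGrowth :=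
        Function.HasTemperateGrowth.comp Function.Complex.hasTemperateGrowth_ofReal
          ((Function.HasTemperateGrowth.const c).mul (Function.hasTemperateGrowth_norm_sq _))
      exact ((Function.HasTemperateGrowth.const Complex.I).mul h1).sub h2
    obtain ⟨K, C, hC, hb⟩ := hpt.norm_iteratedFDeriv_le_uniform m
    refine ⟨m.factorial * (1 + C) ^ m *
      ((k + K * m).factorial * Real.exp (1 + 1 / (4 * c))), fun x => ?_⟩
    have hre : (p x).re = -(c * ‖x‖ ^ 2) := by
      simp only [hp, Complex.sub_re, Complex.mul_re, Complex.I_re, Complex.ofReal_re,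
        Complex.I_im, Complex.ofReal_im]
      ring
    have h1x : (1 : ℝ) ≤ 1 + ‖x‖ := by linarith [norm_nonneg x]
    have hD : ‖iteratedFDeriv ℝ m (Complex.exp ∘ p) x‖ ≤
        m.factorial * Real.exp (p x).re * ((1 + C) * (1 + ‖x‖) ^ K) ^ m := by
      refine norm_iteratedFDeriv_comp_le (N := ∞) Complex.contDiff_exp hpt.1
        (by exact_mod_cast le_top) x (fun i _ => norm_iteratedFDeriv_cexp_le i _) ?_
      intro i hi him
      refine (hb i him x).trans ?_
      have hone : (1 : ℝ) ≤ (1 + C) * (1 + ‖x‖) ^ K := by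
        have : (1 : ℝ) ≤ (1 + ‖x‖) ^ K := one_le_pow₀ h1x
        nlinarith
      calc C * (1 + ‖x‖) ^ K ≤ (1 + C) * (1 + ‖x‖) ^ K := by gcongr; linarith
        _ ≤ _ := le_self_pow₀ hone (by omega)
    change ‖x‖ ^ k * ‖iteratedFDeriv ℝ m (Complex.exp ∘ p) x‖ ≤ _
    calc ‖x‖ ^ k * ‖iteratedFDeriv ℝ m (Complex.exp ∘ p) x‖
        ≤ (1 + ‖x‖) ^ k *
          (m.factorial * Real.exp (p x).re * ((1 + C) * (1 + ‖x‖) ^ K) ^ m) := by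
          gcongr
          linarith
      _ = m.factorial * (1 + C) ^ m *
          ((1 + ‖x‖) ^ (k + K * m) * Real.exp (-(c * ‖x‖ ^ 2))) := by
          rw [hre, mul_pow, pow_add, pow_mul]; ring
      _ ≤ _ := by
          exact mul_le_mul_of_nonneg_left (one_add_pow_mul_exp_le c hc _ _ (norm_nonneg x))
            (by positivity)

theorem packet_eq {n : ℕ} (δ : ℝ) (x₀ ξ₀ : Space n) (h : 0 < ‖ξ₀‖) :
    packet δ x₀ ξ₀ = ⇑((((‖ξ₀‖ * δ / (2 * Real.pi)) ^ ((n : ℝ) / 2) : ℝ) : ℂ) •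
      SchwartzMap.compSubConstCLM ℂ x₀ (centredGaussian ‖ξ₀‖ h ξ₀)) := by
  ext x
  rfl

/-- The packet, as a Schwartz function. -/
def packetSchwartz {n : ℕ} (δ : ℝ) (x₀ ξ₀ : Space n) (h : ξ₀ ≠ 0) : 𝓢(Space n, ℂ) where
  toFun := packet δ x₀ ξ₀
  smooth' := by rw [packet_eq δ x₀ ξ₀ (norm_pos_iff.2 h)]; exact SchwartzMap.smooth' _
  decay' := by rw [packet_eq δ x₀ ξ₀ (norm_pos_iff.2 h)]; exact SchwartzMap.decay' _

/-! ### The frame -/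

/-- `S` lies in the dyadic annulus `2^{k-1} ≤ |ξ| < 2^k` and its points are pairwise more than
`2^{k/2}` apart. -/
def IsSeparatedInAnnulus {n : ℕ} (k : ℕ) (S : Finset (Space n)) : Prop :=
  (∀ ξ ∈ S, (2 : ℝ) ^ k / 2 ≤ ‖ξ‖ ∧ ‖ξ‖ < (2 : ℝ) ^ k) ∧
  ∀ ξ ∈ S, ∀ η ∈ S, ξ ≠ η → (2 : ℝ) ^ ((k : ℝ) / 2) < ‖ξ - η‖

/-- A choice of the frequencies `2^k ω_{i,k}`: in every dyadic annulus a separated set with as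
many points as possible. -/
structure FrequencyLattice (n : ℕ) where
  /-- the frequencies of level `k` -/
  pts : ℕ → Finset (Space n)
  separated : ∀ k, IsSeparatedInAnnulus k (pts k)
  maximal : ∀ k (S : Finset (Space n)), IsSeparatedInAnnulus k S → S.card ≤ (pts k).card

/-- The frame index `γ = (i, k, α)`; the index `i` is replaced by the frequency itself. -/
structure FrameIndex {n : ℕ} (Λ : FrequencyLattice n) where
  /-- the dyadic level -/
  k : ℕ
  /-- the frequency `ξ_γ` -/
  freq : Space n
  mem : freq ∈ Λ.pts k
  /-- the position in the integer lattice -/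
  pos : Fin n → ℤ

namespace FrameIndex

variable {n : ℕ} {Λ : FrequencyLattice n}

theorem freq_ne_zero (γ : FrameIndex Λ) : γ.freq ≠ 0 := by
  have h := ((Λ.separated γ.k).1 _ γ.mem).1
  have h2 : (0 : ℝ) < (2 : ℝ) ^ γ.k / 2 := by positivity
  exact norm_pos_iff.1 (h2.trans_le h)

/-- The lattice step `Δx_γ = C 2^{-k/2 - ε k}`. -/
def step (ε C : ℝ) (γ : FrameIndex Λ) : ℝ :=
  C * (2 : ℝ) ^ (-(γ.k : ℝ) / 2 - ε * (γ.k : ℝ))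

/-- The centre `x_γ = Δx_γ α`. -/
def centre (ε C : ℝ) (γ : FrameIndex Λ) : Space n :=
  WithLp.toLp 2 (fun i => γ.step ε C * (γ.pos i : ℝ))

/-- The frame function `φ_γ`. -/
def frameFun (ε C : ℝ) (γ : FrameIndex Λ) : 𝓢(Space n, ℂ) :=
  packetSchwartz (γ.step ε C) (γ.centre ε C) γ.freq γ.freq_ne_zero

/-- The complex conjugate of the frame function `φ_γ`. -/
def frameFunConj (ε C : ℝ) (γ : FrameIndex Λ) : 𝓢(Space n, ℂ) :=
  SchwartzMap.postcompCLM (𝕜 := ℝ) (Complex.conjCLE : ℂ →L[ℝ] ℂ) (γ.frameFun ε C)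

end FrameIndex

/-- The analysis operator `P₁⁰`: the frame coefficients `c(γ) = ∫ conj φ_γ f` of a tempered
distribution `f`. -/
def frameCoeff {n : ℕ} {Λ : FrequencyLattice n} (ε C : ℝ) (f : 𝓢'(Space n, ℂ))
    (γ : FrameIndex Λ) : ℂ :=
  f (γ.frameFunConj ε C)

/-- `g = P₂⁰ c`: the series `∑ c(γ) φ_γ` converges (unconditionally, as tempered distributions)
to `g`. -/
def IsSynthesis {n : ℕ} {Λ : FrequencyLattice n} (ε C : ℝ) (c : FrameIndex Λ → ℂ)
    (g : 𝓢'(Space n, ℂ)) : Prop :=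
  HasSum (fun γ => c γ • (SchwartzMap.toTemperedDistributionCLM (Space n) ℂ volume
    (γ.frameFun ε C) : 𝓢'(Space n, ℂ))) g

/-! ### Sobolev spaces -/

/-- The Sobolev space `H^s(ℝⁿ)`, as a space of tempered distributions. -/
def Sobolev (n : ℕ) (s : ℝ) : Submodule ℂ (𝓢'(Space n, ℂ)) where
  carrier := {f | TemperedDistribution.MemSobolev s 2 f}
  add_mem' hf hg := hf.add hg
  zero_mem' := TemperedDistribution.memSobolev_fun_zero _ _ s 2
  smul_mem' c _ hf := hf.smul c

/-- The norm of `H^s(ℝⁿ)`: the `L²` norm of the (unique) `L²` function which represents the Bessel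
potential of order `s` of `f`. -/
def sobolevNorm {n : ℕ} {s : ℝ} (f : Sobolev n s) : ℝ :=
  ‖Classical.choose (show TemperedDistribution.MemSobolev s 2 (f : 𝓢'(Space n, ℂ)) from f.2)‖

/-- The linear operator `A : H^r → H^s` satisfies `Π⁰ A Π⁰ f = P₂⁰ B P₁⁰ f` for all `f ∈ H^r`,
where `B` is the matrix with entries `b` and `Π⁰ = P₂⁰ P₁⁰`; all series converge. In the formula,
`h = Π⁰ f`, `d = B P₁⁰ f` and `g` is the common value of the two sides. -/
def HasFrameMatrix {n : ℕ} {Λ : FrequencyLattice n} (ε C : ℝ)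
    (b : FrameIndex Λ → FrameIndex Λ → ℂ) (r s : ℝ) (A : Sobolev n r →ₗ[ℂ] Sobolev n s) : Prop :=
  ∀ f : Sobolev n r, ∃ (h : Sobolev n r) (d : FrameIndex Λ → ℂ) (g : 𝓢'(Space n, ℂ)),
    IsSynthesis ε C (frameCoeff (Λ := Λ) ε C (f : 𝓢'(Space n, ℂ))) (h : 𝓢'(Space n, ℂ)) ∧
    (∀ γ, HasSum (fun γ' => b γ γ' * frameCoeff ε C (f : 𝓢'(Space n, ℂ)) γ') (d γ)) ∧
    IsSynthesis ε C d g ∧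
    IsSynthesis ε C (frameCoeff (Λ := Λ) ε C (A h : 𝓢'(Space n, ℂ))) g

/-- The matrix `b` determines, through `Π⁰ A Π⁰ = P₂⁰ B P₁⁰`, exactly one linear operator
`A : H^r → H^s`, and this operator is bounded with norm at most `K`. -/
def DefinesBoundedOperator {n : ℕ} {Λ : FrequencyLattice n} (ε C : ℝ)
    (b : FrameIndex Λ → FrameIndex Λ → ℂ) (r s K : ℝ) : Prop :=
  ∃ A : Sobolev n r →ₗ[ℂ] Sobolev n s,
    HasFrameMatrix ε C b r s A ∧
    (∀ A' : Sobolev n r →ₗ[ℂ] Sobolev n s, HasFrameMatrix ε C b r s A' → A' = A) ∧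
    ∀ f : Sobolev n r, sobolevNorm (A f) ≤ K * sobolevNorm f

/-! ### The wave operator and its bicharacteristics -/

/-- The coefficient matrix `A(t, x)`. -/
abbrev CoeffField (n : ℕ) : Type := ℝ → Space n → Matrix (Fin n) (Fin n) ℝ

/-- Symmetric, uniformly elliptic and bounded coefficients on `[-T, T] × ℝⁿ` which are Lipschitz
in `(t, x)` and whose first derivatives in `x` exist and are Lipschitz in `(t, x)`. -/
structure IsC11Coefficient {n : ℕ} (T : ℝ) (a : CoeffField n) : Prop where
  symm : ∀ t ∈ Icc (-T) T, ∀ x, (a t x).IsSymm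
  elliptic : ∃ C > (0 : ℝ), ∀ t ∈ Icc (-T) T, ∀ x ξ : Space n,
    ‖ξ‖ ^ 2 / C ≤ ∑ i, ∑ j, a t x i j * ξ i * ξ j ∧
      ∑ i, ∑ j, a t x i j * ξ i * ξ j ≤ C * ‖ξ‖ ^ 2
  lipschitz : ∃ C : ℝ, ∀ t ∈ Icc (-T) T, ∀ t' ∈ Icc (-T) T, ∀ x x' : Space n, ∀ i j,
    |a t x i j - a t' x' i j| ≤ C * (|t - t'| + ‖x - x'‖)
  differentiable : ∀ t ∈ Icc (-T) T, ∀ i j, Differentiable ℝ (fun x => a t x i j)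
  gradient_lipschitz : ∃ C : ℝ, ∀ t ∈ Icc (-T) T, ∀ t' ∈ Icc (-T) T, ∀ x x' : Space n, ∀ i j,
    ‖gradient (fun y => a t y i j) x - gradient (fun y => a t' y i j) x'‖
      ≤ C * (|t - t'| + ‖x - x'‖)

/-- `q(t, x, ξ) = (∑ a_{ij}(t, x) ξ_i ξ_j)^{1/2}`. -/
def symbolQ {n : ℕ} (a : CoeffField n) (t : ℝ) (x ξ : Space n) : ℝ :=
  Real.sqrt (∑ i, ∑ j, a t x i j * ξ i * ξ j)

/-- `z = (x, ξ)` solves on `[-T, T]` the Hamilton equations `x' = -σ q_ξ`, `ξ' = σ q_x` of the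
Hamiltonian `τ - σ q`, with `z(t') = (x₀, ξ₀)`. -/
structure IsBicharacteristic {n : ℕ} (T : ℝ) (a : CoeffField n) (σ t' : ℝ) (x₀ ξ₀ : Space n)
    (z : ℝ → Space n × Space n) : Prop where
  initial : z t' = (x₀, ξ₀)
  equation : ∀ t ∈ Icc (-T) T, HasDerivWithinAt z
    (-(σ • gradient (fun η => symbolQ a t (z t).1 η) (z t).2),
      σ • gradient (fun y => symbolQ a t y (z t).2) (z t).1) (Icc (-T) T) t

/-- The bicharacteristic `t ↦ (x(t, t', x₀, ξ₀), ξ(t, t', x₀, ξ₀))`: for `σ = 1` this is the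
evolution `U(t, t')`, for `σ = -1` the evolution `V(t, t')`. -/
def bichar {n : ℕ} (T : ℝ) (a : CoeffField n) (σ t' : ℝ) (x₀ ξ₀ : Space n) :
    ℝ → Space n × Space n :=
  Classical.epsilon (IsBicharacteristic T a σ t' x₀ ξ₀)

/-- The wave operator `T u = ∂_t² u - ∑ a_{ij} ∂_i ∂_j u`. -/
def waveOp {n : ℕ} (a : CoeffField n) (u : ℝ → Space n → ℂ) (t : ℝ) (x : Space n) : ℂ :=
  deriv (fun τ => deriv (fun s => u s x) τ) t
    - ∑ i, ∑ j, (a t x i j : ℂ) *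
      lineDeriv ℝ (fun y => lineDeriv ℝ (u t) y (EuclideanSpace.single j 1)) x
        (EuclideanSpace.single i 1)

section Propagation

variable {n : ℕ} {Λ : FrequencyLattice n} (ε C T : ℝ) (a : CoeffField n)

/-- The bicharacteristic with initial data `(x_γ, ξ_γ)` at time `t'`. -/
def frameCurve (σ t' : ℝ) (γ : FrameIndex Λ) : ℝ → Space n × Space n :=
  bichar T a σ t' (γ.centre ε C) γ.freq

/-- The propagated frame functions `φ_γ^±(t, t', x)`, with `σ = ±1`. -/
def propagated (σ t' : ℝ) (γ : FrameIndex Λ) (t : ℝ) (x : Space n) : ℂ :=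
  packet (γ.step ε C) (frameCurve ε C T a σ t' γ t).1 (frameCurve ε C T a σ t' γ t).2 x

/-- `(φ_γ^+ + φ_γ^-) / 2`. -/
def cosFun (t' : ℝ) (γ : FrameIndex Λ) (t : ℝ) (x : Space n) : ℂ :=
  (1 / 2) * (propagated ε C T a 1 t' γ t x + propagated ε C T a (-1) t' γ t x)

/-- `(Ω_γ^+ - Ω_γ^-) / 2`, where `Ω_γ^± = φ_γ^± / q(t', x_γ, ξ_γ)`. -/
def sinFun (t' : ℝ) (γ : FrameIndex Λ) (t : ℝ) (x : Space n) : ℂ :=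
  (1 / 2) * (propagated ε C T a 1 t' γ t x / (symbolQ a t' (γ.centre ε C) γ.freq : ℂ)
    - propagated ε C T a (-1) t' γ t x / (symbolQ a t' (γ.centre ε C) γ.freq : ℂ))

/-- The matrix entries `∫ conj φ_γ · T u_{γ'}(t, ·)`. -/
def waveMatrix (u : FrameIndex Λ → ℝ → Space n → ℂ) (t : ℝ) (γ γ' : FrameIndex Λ) : ℂ :=
  ∫ x, (starRingEnd ℂ) (γ.frameFun ε C x) * waveOp a (u γ') t x

/-- At the time `t` all bicharacteristics which start at time `t'` from the points `(x_γ, ξ_γ)`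
are twice differentiable, so that `∂_t²` can be applied to the propagated frame functions. -/
def IsRegularTime (Λ : FrequencyLattice n) (t' t : ℝ) : Prop :=
  ∀ γ : FrameIndex Λ, ∀ σ ∈ ({1, -1} : Set ℝ),
    DifferentiableAt ℝ (deriv (frameCurve ε C T a σ t' γ)) t

end Propagation

end

/-!
On the Fourier side `H^s` is a weighted `L²` space, and a packet of frequency `ζ` is a Gaussian of
width `|ζ|^{1/2}` about `ζ`, modulated according to its position (`fourier_packet`). Summation over
the positions of one frequency is a Poisson summation (`hasSum_lattice_coeff`). Its zeroth term is
multiplication by the squared Gaussian, its other terms are `O(C²)` for the lattice constant `C`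
(`exists_lattice_correlation`). The squared Gaussians of all frequencies add up to a function
between two positive constants, since the frequencies are separated and, by maximality, near every
point (`exists_near_freq`). Hence for small `C` the operator `Π⁰` is close to a multiple of the
identity, and invertible on every `H^s` in question (`exists_frame_inverse`). If the wave operator
`𝐓` maps the transported packet `φ_γ^±` to a function which is represented by `v_γ` in `H^m`, the
operator sought is `h ↦ ∑ c(γ) v_γ` with `c` the frame coefficients of `(Π⁰)⁻¹ h`; it is unique
because `Π⁰` is injective, and bounded as soon as sums `∑ d(γ) v_γ` are bounded in `H^m` by an `ℓ²`
norm of `d` with weights `2^{k r}` (`definesBoundedOperator_of_vectors`).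

The Hamilton field is homogeneous in the frequency and Lipschitz, so the flow exists and changes
distances in phase space, with frequencies in units of `2^k`, by bounded factors only
(`CoeffBounds.exists_separation`). The transported packets of one level therefore fill phase space
with bounded density (`exists_frame_count`), and almost every time is regular, by Rademacher's
theorem (`ae_isRegularTime`). The Hamilton equations cancel the terms of `𝐓 φ_γ^±` of order two
(`eikonal_identity`): it is `φ_γ^±` times an amplitude of size `2^k`, a polynomial in `x - x_γ^±`,
up to second order Taylor remainders of the coefficients times second derivatives (`exists_amp_eq`).

At one level, packet sums are bounded in `L²` by Schur's test for the localized Gram matrix. This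
includes amplitudes with Taylor remainders: expanded about an arbitrary point they are finite sums
of products of a function of `x` and a function of the packet (`PacketSystem.Tame`). Different
levels are almost orthogonal, since integration by parts moves derivatives from the higher to the
lower level (`PacketSystem.TameD.exists_bound`). As the coefficients are only `C^{1,1}`, the extreme
orders `m = -1` and `m = 2` are reached by duality: `𝐓` of a packet sum is paired with test
functions, and derivatives are moved to or from the test function, the last one against a Lipschitz
coefficient as in `norm_integral_lipschitz_mul_le` (`WavePackets.weakBound_amp`,
`WavePackets.weakBoundTwo_amp`). The orders `-1 < m < 2` follow by interpolation: with the bounds of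
both extreme orders at every level, only the levels near a given frequency contribute there
(`exists_interpolation`). This gives the weights `2^{k (m + 1)}`, hence order one for the cosine;
the factor `1 / q ~ 2^{-k}` of the sine gains the other order.
-/

noncomputable section

variable {n : ℕ}

open scoped FourierTransform
open Real
open scoped ComplexConjugate
open Finset (sum_congr sum_le_sum mul_sum sum_mul sum_nonneg sum_add_distrib sum_comm
  sum_neg_distrib sum_insert sum_sub_distrib single_le_sum mem_insert_self mem_insert_of_mem)
open Complex (norm_real conj_ofReal continuous_ofReal ofReal_mul I)

/-! ### Bounded Lipschitz functions -/

/-- `f` is bounded and Lipschitz on `S`. -/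
def BddLip {α : Type*} [PseudoMetricSpace α] (S : Set α) (f : α → ℝ) : Prop :=
  ∃ K : ℝ, 0 ≤ K ∧ (∀ p ∈ S, |f p| ≤ K) ∧ ∀ p ∈ S, ∀ p' ∈ S, |f p - f p'| ≤ K * dist p p'

namespace BddLip

variable {α : Type*} [PseudoMetricSpace α] {S : Set α} {f g : α → ℝ}

lemma const (c : ℝ) : BddLip S (fun _ => c) :=
  ⟨|c|, abs_nonneg _, fun _ _ => le_rfl, fun _ _ _ _ => by simp; positivity⟩

lemma add (hf : BddLip S f) (hg : BddLip S g) : BddLip S (fun p => f p + g p) := by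
  obtain ⟨K, hK, h1, h2⟩ := hf
  obtain ⟨L, hL, h3, h4⟩ := hg
  refine ⟨K + L, by positivity, fun p hp => (abs_add_le _ _).trans (add_le_add (h1 p hp) (h3 p hp)),
    fun p hp p' hp' => ?_⟩
  have := abs_add_le (f p - f p') (g p - g p')
  have e : f p + g p - (f p' + g p') = f p - f p' + (g p - g p') := by ring
  rw [e, add_mul]
  exact this.trans (add_le_add (h2 p hp p' hp') (h4 p hp p' hp'))

lemma mul (hf : BddLip S f) (hg : BddLip S g) : BddLip S (fun p => f p * g p) := by
  obtain ⟨K, hK, h1, h2⟩ := hf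
  obtain ⟨L, hL, h3, h4⟩ := hg
  refine ⟨K * L + K * L, by positivity, fun p hp => ?_, fun p hp p' hp' => ?_⟩
  · rw [abs_mul]
    have := mul_le_mul (h1 p hp) (h3 p hp) (abs_nonneg _) hK
    nlinarith
  · have e : f p * g p - f p' * g p' = f p * (g p - g p') + (f p - f p') * g p' := by ring
    rw [e]
    refine (abs_add_le _ _).trans ?_
    rw [abs_mul, abs_mul]
    have a1 := mul_le_mul (h1 p hp) (h4 p hp p' hp') (abs_nonneg _) hK
    have a2 := mul_le_mul (h2 p hp p' hp') (h3 p' hp') (abs_nonneg _) (by positivity)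
    linarith

lemma sum {ι : Type*} (s : Finset ι) {f : ι → α → ℝ} (h : ∀ i ∈ s, BddLip S (f i)) :
    BddLip S (fun p => ∑ i ∈ s, f i p) := by
  classical
  induction s using Finset.induction_on with
  | empty => simpa using const (S := S) 0
  | insert i s hi ih =>
    simp only [sum_insert hi]
    exact (h i (by simp)).add (ih fun j hj => h j (by simp [hj]))

lemma inv (hf : BddLip S f) {c : ℝ} (hc : 0 < c) (h : ∀ p ∈ S, c ≤ f p) :
    BddLip S (fun p => (f p)⁻¹) := by
  obtain ⟨K, hK, h1, h2⟩ := hf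
  refine ⟨c⁻¹ + K / c ^ 2, by positivity, fun p hp => ?_, fun p hp p' hp' => ?_⟩
  · have := h p hp
    rw [abs_inv, abs_of_pos (hc.trans_le this)]
    have h3 : (f p)⁻¹ ≤ c⁻¹ := inv_anti₀ hc this
    have : 0 ≤ K / c ^ 2 := by positivity
    linarith
  · have a := h p hp
    have b := h p' hp'
    have a0 := hc.trans_le a
    have b0 := hc.trans_le b
    rw [inv_sub_inv a0.ne' b0.ne', abs_div, abs_of_pos (mul_pos a0 b0), div_le_iff₀ (mul_pos a0 b0),
      abs_sub_comm]
    have h3 := h2 p hp p' hp'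
    have h4 : c ^ 2 ≤ f p * f p' := by nlinarith
    have h5 : K * dist p p' = K / c ^ 2 * dist p p' * c ^ 2 := by field_simp
    calc |f p - f p'| ≤ K / c ^ 2 * dist p p' * c ^ 2 := by rw [← h5]; exact h3
      _ ≤ (c⁻¹ + K / c ^ 2) * dist p p' * (f p * f p') := by
        gcongr
        have : 0 ≤ c⁻¹ := by positivity
        linarith

lemma sqrt (hf : BddLip S f) {c : ℝ} (hc : 0 < c) (h : ∀ p ∈ S, c ≤ f p) :
    BddLip S (fun p => √(f p)) := by
  obtain ⟨K, hK, h1, h2⟩ := hf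
  have hs : 0 < √c := sqrt_pos.2 hc
  refine ⟨√K + K / √c, by positivity, fun p hp => ?_, fun p hp p' hp' => ?_⟩
  · rw [abs_of_nonneg (sqrt_nonneg _)]
    have : √(f p) ≤ √K := sqrt_le_sqrt ((le_abs_self _).trans (h1 p hp))
    have : 0 ≤ K / √c := by positivity
    linarith
  · have a : √c ≤ √(f p) := sqrt_le_sqrt (h p hp)
    have e : (√(f p) - √(f p')) * (√(f p) + √(f p')) = f p - f p' := by
      have e1 := mul_self_sqrt (hc.le.trans (h p hp))
      have e2 := mul_self_sqrt (hc.le.trans (h p' hp'))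
      linear_combination e1 - e2
    have h3 : |√(f p) - √(f p')| * √c ≤ K * dist p p' := by
      calc |√(f p) - √(f p')| * √c ≤ |√(f p) - √(f p')| * |√(f p) + √(f p')| := by
            gcongr
            rw [abs_of_nonneg (by positivity)]
            linarith [sqrt_nonneg (f p')]
        _ ≤ _ := by rw [← abs_mul, e]; exact h2 p hp p' hp'
    have h4 : |√(f p) - √(f p')| ≤ K / √c * dist p p' := by
      rw [div_mul_eq_mul_div, le_div_iff₀ hs]; exact h3
    refine h4.trans ?_
    gcongr
    linarith [sqrt_nonneg K]

/-- A bounded Lipschitz function extends to the whole space, below a given Lipschitz majorant. -/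
lemma exists_extension (hf : BddLip S f) {M : α → ℝ} {KM : NNReal} (hM : LipschitzWith KM M)
    (hM0 : ∀ p, 0 ≤ M p) (hfM : ∀ p ∈ S, |f p| ≤ M p) :
    ∃ (g : α → ℝ) (L : NNReal), LipschitzWith L g ∧ (∀ p ∈ S, g p = f p) ∧ (∀ p, |g p| ≤ L) ∧
      ∀ p, |g p| ≤ M p := by
  obtain ⟨K, hK, h1, h2⟩ := hf
  lift K to NNReal using hK
  have hK : (0 : ℝ) ≤ K := K.2
  have hL : LipschitzOnWith K f S := LipschitzOnWith.of_dist_le_mul fun x hx y hy => by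
    rw [dist_eq]; exact h2 x hx y hy
  obtain ⟨g, hg, hgf⟩ := hL.extend_real
  have hm : LipschitzWith (max KM 0) (fun p => min (M p) (K : ℝ)) := hM.min (LipschitzWith.const K)
  have hm' : LipschitzWith (max KM 0) (fun p => -min (M p) K) := hm.neg
  have hG := hm'.max (hg.min hm)
  have hm0 : ∀ p, 0 ≤ min (M p) K := fun p => le_min (hM0 p) hK
  have key : ∀ p, |max (-min (M p) K) (min (g p) (min (M p) K))| ≤ min (M p) K := by
    intro p
    rw [abs_le]
    exact ⟨le_max_left _ _, max_le (by linarith [hm0 p]) (min_le_right _ _)⟩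
  refine ⟨_, max K (max (max KM 0) (max K (max KM 0))), hG.weaken (le_max_right _ _),
    fun p hp => ?_, fun p => (key p).trans ((min_le_right _ _).trans ?_),
    fun p => (key p).trans (min_le_left _ _)⟩
  · rw [← hgf hp]
    have := abs_le.1 (le_min (hfM p hp) (h1 p hp))
    rw [min_eq_left this.2, max_eq_right this.1]
  · rw [NNReal.coe_max]
    exact le_max_left _ _

end BddLip

/-! ### Two-sided Gronwall estimate -/

lemma norm_le_exp_mul_of_norm_deriv_le {E : Type*} [NormedAddCommGroup E] [NormedSpace ℝ E]
    {lo hi K : ℝ} (hK : 0 ≤ K) {d d' : ℝ → E}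
    (hd : ∀ t ∈ Icc lo hi, HasDerivWithinAt d (d' t) (Icc lo hi) t)
    (hb : ∀ t ∈ Icc lo hi, ‖d' t‖ ≤ K * ‖d t‖) {s t : ℝ} (hs : s ∈ Icc lo hi)
    (ht : t ∈ Icc lo hi) : ‖d t‖ ≤ exp (K * (hi - lo)) * ‖d s‖ := by
  have fwd : ∀ {lo hi : ℝ} {d d' : ℝ → E}
      (_ : ∀ t ∈ Icc lo hi, HasDerivWithinAt d (d' t) (Icc lo hi) t)
      (_ : ∀ t ∈ Icc lo hi, ‖d' t‖ ≤ K * ‖d t‖) {s t : ℝ} (_ : s ∈ Icc lo hi)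
      (_ : t ∈ Icc lo hi), s ≤ t → ‖d t‖ ≤ exp (K * (hi - lo)) * ‖d s‖ := by
    intro lo hi d d' hd hb s t hs ht hst
    have hsub : Icc s t ⊆ Icc lo hi := Icc_subset_Icc hs.1 ht.2
    have := norm_le_gronwallBound_of_norm_deriv_right_le (f := d) (f' := d') (δ := ‖d s‖) (K := K)
      (ε := 0) (a := s) (b := t)
      (fun u hu => ((hd u (hsub hu)).continuousWithinAt).mono hsub)
      (fun u hu => by
        have hu' := hsub (Ico_subset_Icc_self hu)
        refine (hd u hu').mono_of_mem_nhdsWithin ?_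
        have : Icc u t ∈ nhdsWithin u (Ici u) := Icc_mem_nhdsGE hu.2
        exact Filter.mem_of_superset this (Icc_subset_Icc hu'.1 ht.2))
      le_rfl (fun u hu => by simpa using hb u (hsub (Ico_subset_Icc_self hu))) t ⟨hst, le_rfl⟩
    rw [gronwallBound_ε0, mul_comm] at this
    refine this.trans ?_
    gcongr
    · exact ht.2
    · exact hs.1
  rcases le_total s t with h | h
  · exact fwd hd hb hs ht h
  · have hn : ∀ u : ℝ, u ∈ Icc (-hi) (-lo) → -u ∈ Icc lo hi := fun u hu =>
      ⟨by linarith [hu.2], by linarith [hu.1]⟩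
    have := fwd (lo := -hi) (hi := -lo) (d := fun u => d (-u)) (d' := fun u => -d' (-u))
      (fun u hu => by
        have h1 := (hd (-u) (hn u hu)).scomp u (hasDerivAt_neg u).hasDerivWithinAt
          (fun v hv => hn v hv)
        have h2 : (-1 : ℝ) • d' (-u) = -d' (-u) := by simp
        rw [h2] at h1
        exact h1)
      (fun u hu => by simpa using hb (-u) (hn u hu)) (s := -s) (t := -t)
      ⟨by linarith [hs.2], by linarith [hs.1]⟩ ⟨by linarith [ht.2], by linarith [ht.1]⟩
      (by linarith)
    simp only [neg_neg] at this
    convert this using 3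
    ring

/-! ### The Hamilton field -/

/-- The gradient of the coefficient `a_{ij}(t, ·)` at `x`. -/
def coeffGrad (a : CoeffField n) (t : ℝ) (x : Space n) (i j : Fin n) : Space n :=
  gradient (fun y => a t y i j) x

/-- The quadratic form `∑ a_{ij}(t, x) ξ_i ξ_j`. -/
def quadForm (a : CoeffField n) (t : ℝ) (x ξ : Space n) : ℝ :=
  ∑ i, ∑ j, a t x i j * ξ i * ξ j

/-- A single constant for all the bounds on the coefficients. -/
structure CoeffBounds (T : ℝ) (a : CoeffField n) (K : ℝ) : Prop where
  one_le : 1 ≤ K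
  bound : ∀ t ∈ Icc (-T) T, ∀ x i j, |a t x i j| ≤ K
  lip : ∀ t ∈ Icc (-T) T, ∀ t' ∈ Icc (-T) T, ∀ x x' : Space n, ∀ i j,
    |a t x i j - a t' x' i j| ≤ K * (|t - t'| + ‖x - x'‖)
  grad_bound : ∀ t ∈ Icc (-T) T, ∀ x i j, ‖coeffGrad a t x i j‖ ≤ K
  grad_lip : ∀ t ∈ Icc (-T) T, ∀ t' ∈ Icc (-T) T, ∀ x x' : Space n, ∀ i j,
    ‖coeffGrad a t x i j - coeffGrad a t' x' i j‖ ≤ K * (|t - t'| + ‖x - x'‖)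
  ell : ∀ t ∈ Icc (-T) T, ∀ x ξ : Space n,
    ‖ξ‖ ^ 2 / K ≤ quadForm a t x ξ ∧ quadForm a t x ξ ≤ K * ‖ξ‖ ^ 2

lemma quadForm_single (a : CoeffField n) (t : ℝ) (x : Space n) (i : Fin n) (c : ℝ) :
    quadForm a t x (EuclideanSpace.single i c) = a t x i i * c * c := by
  simp [quadForm, ite_mul, mul_ite, PiLp.single_apply]

lemma quadForm_single_add (a : CoeffField n) (t : ℝ) (x : Space n) {i j : Fin n} (c : ℝ) :
    quadForm a t x (EuclideanSpace.single i 1 + EuclideanSpace.single j c) =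
      a t x i i + a t x i j * c + a t x j i * c + a t x j j * c * c := by
  simp [quadForm, mul_add, add_mul, sum_add_distrib, PiLp.single_apply]
  ring

lemma IsC11Coefficient.exists_bounds {T : ℝ} {a : CoeffField n} (h : IsC11Coefficient T a) :
    ∃ K, CoeffBounds T a K := by
  obtain ⟨C₁, hC₁, e⟩ := h.elliptic
  obtain ⟨C₂, l⟩ := h.lipschitz
  obtain ⟨C₃, g⟩ := h.gradient_lipschitz
  have hpos : ∀ t ∈ Icc (-T) T, ∀ x ξ : Space n, 0 ≤ quadForm a t x ξ := fun t ht x ξ =>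
    le_trans (by positivity) (e t ht x ξ).1
  have hdiag : ∀ t ∈ Icc (-T) T, ∀ x i, a t x i i ≤ C₁ ∧ 0 ≤ a t x i i := by
    intro t ht x i
    have h1 := (e t ht x (EuclideanSpace.single i 1)).2
    have h2 := hpos t ht x (EuclideanSpace.single i 1)
    change quadForm a t x _ ≤ _ at h1
    rw [quadForm_single] at h1 h2
    simp at h1 h2
    exact ⟨h1, h2⟩
  have hb : ∀ t ∈ Icc (-T) T, ∀ x i j, |a t x i j| ≤ C₁ := by
    intro t ht x i j
    rcases eq_or_ne i j with rfl | _
    · rw [abs_of_nonneg (hdiag t ht x i).2]; exact (hdiag t ht x i).1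
    · have hs : a t x j i = a t x i j := (h.symm t ht x).apply i j
      have h1 := hpos t ht x (EuclideanSpace.single i 1 + EuclideanSpace.single j 1)
      have h2 := hpos t ht x (EuclideanSpace.single i 1 + EuclideanSpace.single j (-1))
      rw [quadForm_single_add a t x (i := i) (j := j)] at h1 h2
      rw [hs] at h1 h2
      have := (hdiag t ht x i).1
      have := (hdiag t ht x j).1
      rw [abs_le]
      constructor <;> linarith
  set K : ℝ := 1 + C₁ + |C₂| + |C₃| with hK
  have k1 : C₁ ≤ K := by rw [hK]; linarith [abs_nonneg C₂, abs_nonneg C₃]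
  have k2 : C₂ ≤ K := by rw [hK]; linarith [abs_nonneg C₂, abs_nonneg C₃, le_abs_self C₂]
  have k3 : C₃ ≤ K := by rw [hK]; linarith [abs_nonneg C₂, abs_nonneg C₃, le_abs_self C₃]
  have k0 : 1 ≤ K := by rw [hK]; linarith [abs_nonneg C₂, abs_nonneg C₃]
  have hl : ∀ t ∈ Icc (-T) T, ∀ t' ∈ Icc (-T) T, ∀ x x' : Space n, ∀ i j,
    |a t x i j - a t' x' i j| ≤ K * (|t - t'| + ‖x - x'‖) := fun t ht t' ht' x x' i j =>
      (l t ht t' ht' x x' i j).trans (by gcongr)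
  refine ⟨K, k0, fun t ht x i j => (hb t ht x i j).trans k1, hl, fun t ht x i j => ?_,
    fun t ht t' ht' x x' i j => (g t ht t' ht' x x' i j).trans (by gcongr), fun t ht x ξ => ?_⟩
  · rw [coeffGrad, gradient, LinearIsometryEquiv.norm_map]
    have hK0 : 0 ≤ K := by linarith
    clear_value K
    lift K to NNReal using hK0
    have : LipschitzWith K (fun y => a t y i j) := by
      refine LipschitzWith.of_dist_le_mul fun x y => ?_
      have := hl t ht t ht x y i j
      rw [dist_eq, dist_eq_norm]
      simpa using this
    exact norm_fderiv_le_of_lipschitz ℝ this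
  · refine ⟨le_trans ?_ (e t ht x ξ).1, (e t ht x ξ).2.trans (by gcongr)⟩
    gcongr

lemma sum_abs_coord_le (x : Space n) : ∑ i, |x i| ≤ n * ‖x‖ := by
  calc ∑ i, |x i| ≤ ∑ _i : Fin n, ‖x‖ := sum_le_sum fun i _ => by
        simpa using PiLp.norm_apply_le x i
    _ = n * ‖x‖ := by simp

lemma norm_le_sum_abs_coord (x : Space n) : ‖x‖ ≤ ∑ i, |x i| := by
  rw [EuclideanSpace.norm_eq, sqrt_le_left (sum_nonneg fun i _ => abs_nonneg _)]
  simp only [norm_eq_abs]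
  exact Finset.sum_sq_le_sq_sum_of_nonneg fun i _ => abs_nonneg _

lemma abs_coord_le (x : Space n) (i : Fin n) : |x i| ≤ ‖x‖ := by
  simpa using PiLp.norm_apply_le x i

/-- The gradient `q_ξ`. -/
def gradXi (a : CoeffField n) (t : ℝ) (x ξ : Space n) : Space n :=
  (symbolQ a t x ξ)⁻¹ • WithLp.toLp 2 (fun i => ∑ j, a t x i j * ξ j)

/-- The gradient `q_x`. -/
def gradX (a : CoeffField n) (t : ℝ) (x ξ : Space n) : Space n :=
  (2 * symbolQ a t x ξ)⁻¹ • ∑ i, ∑ j, (ξ i * ξ j) • coeffGrad a t x i j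

namespace CoeffBounds

variable {T K : ℝ} {a : CoeffField n}

lemma pos (h : CoeffBounds T a K) : 0 < K := zero_lt_one.trans_le h.one_le

lemma quadForm_pos (h : CoeffBounds T a K) {t : ℝ} (ht : t ∈ Icc (-T) T) (x : Space n)
    {ξ : Space n} (hξ : ξ ≠ 0) : 0 < quadForm a t x ξ := by
  have h1 := norm_pos_iff.2 hξ
  have := h.pos
  exact lt_of_lt_of_le (by positivity) (h.ell t ht x ξ).1

lemma symbolQ_eq (a : CoeffField n) (t : ℝ) (x ξ : Space n) :
    symbolQ a t x ξ = √(quadForm a t x ξ) := rfl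

lemma symbolQ_pos (h : CoeffBounds T a K) {t : ℝ} (ht : t ∈ Icc (-T) T) (x : Space n)
    {ξ : Space n} (hξ : ξ ≠ 0) : 0 < symbolQ a t x ξ :=
  sqrt_pos.2 (h.quadForm_pos ht x hξ)

lemma sq_symbolQ (h : CoeffBounds T a K) {t : ℝ} (ht : t ∈ Icc (-T) T) (x ξ : Space n) :
    symbolQ a t x ξ ^ 2 = quadForm a t x ξ := by
  rw [symbolQ_eq, sq_sqrt]
  have := h.pos
  exact le_trans (by positivity) (h.ell t ht x ξ).1

lemma le_symbolQ (h : CoeffBounds T a K) {t : ℝ} (ht : t ∈ Icc (-T) T) (x ξ : Space n) :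
    ‖ξ‖ / K ≤ symbolQ a t x ξ := by
  have hK := h.pos
  rw [symbolQ_eq]
  apply le_sqrt_of_sq_le
  refine le_trans ?_ (h.ell t ht x ξ).1
  rw [div_pow]
  have : K ≤ K ^ 2 := by nlinarith [h.one_le]
  gcongr

end CoeffBounds

lemma hasGradientAt_quadForm_right {a : CoeffField n} {t : ℝ} {x : Space n}
    (hs : (a t x).IsSymm) (ξ : Space n) :
    HasGradientAt (fun η => quadForm a t x η)
      ((2 : ℝ) • WithLp.toLp 2 (fun i => ∑ j, a t x i j * ξ j)) ξ := by
  rw [hasGradientAt_iff_hasFDerivAt]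
  have hc : ∀ i : Fin n, HasFDerivAt (fun η : Space n => η i)
      (EuclideanSpace.proj i : Space n →L[ℝ] ℝ) ξ := fun i =>
    (EuclideanSpace.proj i : Space n →L[ℝ] ℝ).hasFDerivAt
  have h := HasFDerivAt.fun_sum (u := Finset.univ) fun i _ => HasFDerivAt.fun_sum (u := Finset.univ)
    fun j _ => ((hc i).const_mul (a t x i j)).mul (hc j)
  refine h.congr_fderiv ?_
  ext v
  simp only [FunLike.coe_sum, Finset.sum_apply, InnerProductSpace.toDual_apply_apply,
    inner_smul_left, PiLp.inner_apply, conj_trivial, two_mul]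
  simp only [add_apply, smul_apply, smul_eq_mul,
    PiLp.proj_apply, sum_add_distrib, RCLike.inner_apply, conj_trivial]
  congr 1
  · rw [sum_comm]
    refine sum_congr rfl fun i _ => ?_
    rw [mul_sum]
    refine sum_congr rfl fun j _ => ?_
    rw [show a t x j i = a t x i j from hs.apply i j]
    ring
  · refine sum_congr rfl fun i _ => ?_
    rw [mul_sum]
    refine sum_congr rfl fun j _ => by ring

lemma gradient_symbolQ_right {T K : ℝ} {a : CoeffField n} (h : CoeffBounds T a K)
    {t : ℝ} (ht : t ∈ Icc (-T) T) {x : Space n} (hs : (a t x).IsSymm) {ξ : Space n} (hξ : ξ ≠ 0) :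
    gradient (fun η => symbolQ a t x η) ξ = gradXi a t x ξ := by
  apply HasGradientAt.gradient
  have h1 := (hasGradientAt_quadForm_right hs ξ)
  rw [hasGradientAt_iff_hasFDerivAt] at h1 ⊢
  refine (h1.sqrt (h.quadForm_pos ht x hξ).ne').congr_fderiv ?_
  rw [gradXi, CoeffBounds.symbolQ_eq, map_smul, map_smul, smul_smul]
  congr 1
  field_simp

lemma gradient_symbolQ_left {T K : ℝ} {a : CoeffField n} (h : CoeffBounds T a K)
    {t : ℝ} (ht : t ∈ Icc (-T) T) {x : Space n}
    (hd : ∀ i j, Differentiable ℝ (fun x => a t x i j)) {ξ : Space n} (hξ : ξ ≠ 0) :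
    gradient (fun y => symbolQ a t y ξ) x = gradX a t x ξ := by
  apply HasGradientAt.gradient
  have hg : HasFDerivAt (fun y => quadForm a t y ξ)
      (InnerProductSpace.toDual ℝ _ (∑ i, ∑ j, (ξ i * ξ j) • coeffGrad a t x i j)) x := by
    have h := HasFDerivAt.fun_sum (u := Finset.univ) fun i _ =>
      HasFDerivAt.fun_sum (u := Finset.univ) fun j _ =>
        (((hd i j x).hasGradientAt.hasFDerivAt.mul_const (ξ i)).mul_const (ξ j))
    refine h.congr_fderiv ?_
    simp only [map_sum, map_smul]
    refine sum_congr rfl fun i _ => sum_congr rfl fun j _ => ?_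
    rw [smul_smul, mul_comm]
    rfl
  rw [hasGradientAt_iff_hasFDerivAt]
  refine (hg.sqrt (h.quadForm_pos ht x hξ).ne').congr_fderiv ?_
  rw [gradX, CoeffBounds.symbolQ_eq, map_smul]
  congr 1
  simp

/-- The phase space points at times in `[-T, T]` with frequency between `R₁` and `R₂`. -/
def phaseAnnulus (n : ℕ) (T R₁ R₂ : ℝ) : Set (ℝ × (Space n × Space n)) :=
  {p | p.1 ∈ Icc (-T) T ∧ R₁ ≤ ‖p.2.2‖ ∧ ‖p.2.2‖ ≤ R₂}

section lip

variable {T K R₁ R₂ : ℝ} {a : CoeffField n}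

lemma CoeffBounds.bddLip_coeff (h : CoeffBounds T a K) (i j : Fin n) :
    BddLip (phaseAnnulus n T R₁ R₂) (fun p => a p.1 p.2.1 i j) := by
  have := h.pos
  refine ⟨2 * K, by positivity, fun p hp => (h.bound _ hp.1 _ _ _).trans (by linarith),
    fun p hp p' hp' => (h.lip _ hp.1 _ hp'.1 _ _ _ _).trans ?_⟩
  have h1 : |p.1 - p'.1| ≤ dist p p' := by rw [← dist_eq]; exact le_max_left _ _
  have h2 : ‖p.2.1 - p'.2.1‖ ≤ dist p p' := by
    rw [← dist_eq_norm]; exact (le_max_left _ _).trans (le_max_right _ _)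
  nlinarith

lemma CoeffBounds.bddLip_coeffGrad (h : CoeffBounds T a K) (i j l : Fin n) :
    BddLip (phaseAnnulus n T R₁ R₂) (fun p => coeffGrad a p.1 p.2.1 i j l) := by
  have := h.pos
  refine ⟨2 * K, by positivity, fun p hp => (abs_coord_le _ _).trans
    ((h.grad_bound _ hp.1 _ _ _).trans (by linarith)),
    fun p hp p' hp' => (abs_coord_le (_ - _) _).trans ((h.grad_lip _ hp.1 _ hp'.1 _ _ _ _).trans ?_)⟩
  have h1 : |p.1 - p'.1| ≤ dist p p' := by rw [← dist_eq]; exact le_max_left _ _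
  have h2 : ‖p.2.1 - p'.2.1‖ ≤ dist p p' := by
    rw [← dist_eq_norm]; exact (le_max_left _ _).trans (le_max_right _ _)
  nlinarith

lemma bddLip_coord (i : Fin n) :
    BddLip (phaseAnnulus n T R₁ R₂) (fun p => p.2.2 i) := by
  refine ⟨1 + |R₂|, by positivity, fun p hp => (abs_coord_le _ _).trans
    (hp.2.2.trans (by linarith [le_abs_self R₂])),
    fun p hp p' hp' => (abs_coord_le (p.2.2 - p'.2.2) _).trans ?_⟩
  have h2 : ‖p.2.2 - p'.2.2‖ ≤ dist p p' := by
    rw [← dist_eq_norm]; exact (le_max_right _ _).trans (le_max_right _ _)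
  nlinarith [abs_nonneg R₂, dist_nonneg (x := p) (y := p')]

lemma CoeffBounds.bddLip_symbolQ (h : CoeffBounds T a K) (hR : 0 < R₁) :
    BddLip (phaseAnnulus n T R₁ R₂) (fun p => symbolQ a p.1 p.2.1 p.2.2) := by
  have := h.pos
  have hq : BddLip (phaseAnnulus n T R₁ R₂) (fun p => quadForm a p.1 p.2.1 p.2.2) :=
    BddLip.sum _ fun i _ => BddLip.sum _ fun j _ =>
      ((h.bddLip_coeff i j).mul (bddLip_coord i)).mul (bddLip_coord j)
  refine hq.sqrt (c := R₁ ^ 2 / K) (by positivity) fun p hp => ?_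
  refine le_trans ?_ (h.ell _ hp.1 _ _).1
  have := hp.2.1
  gcongr

lemma CoeffBounds.bddLip_inv_symbolQ (h : CoeffBounds T a K) (hR : 0 < R₁) :
    BddLip (phaseAnnulus n T R₁ R₂) (fun p => (symbolQ a p.1 p.2.1 p.2.2)⁻¹) := by
  have := h.pos
  refine (h.bddLip_symbolQ hR).inv (c := R₁ / K) (by positivity) fun p hp => ?_
  refine le_trans ?_ (h.le_symbolQ hp.1 _ _)
  have := hp.2.1
  gcongr

lemma CoeffBounds.bddLip_gradXi (h : CoeffBounds T a K) (hR : 0 < R₁) (i : Fin n) :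
    BddLip (phaseAnnulus n T R₁ R₂) (fun p => gradXi a p.1 p.2.1 p.2.2 i) :=
  (h.bddLip_inv_symbolQ hR).mul
    (BddLip.sum Finset.univ (f := fun j (p : ℝ × (Space n × Space n)) => a p.1 p.2.1 i j * p.2.2 j)
      fun j _ => (h.bddLip_coeff i j).mul (bddLip_coord j))

lemma CoeffBounds.bddLip_gradX (h : CoeffBounds T a K) (hR : 0 < R₁) (l : Fin n) :
    BddLip (phaseAnnulus n T R₁ R₂) (fun p => gradX a p.1 p.2.1 p.2.2 l) := by
  have := ((h.bddLip_inv_symbolQ (R₂ := R₂) hR).mul (BddLip.const (1 / 2))).mul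
    (BddLip.sum Finset.univ
      (f := fun i (p : ℝ × (Space n × Space n)) => ∑ j, p.2.2 i * p.2.2 j * coeffGrad a p.1 p.2.1 i j l) fun i _ =>
      BddLip.sum Finset.univ (f := fun j (p : ℝ × (Space n × Space n)) => p.2.2 i * p.2.2 j * coeffGrad a p.1 p.2.1 i j l)
        fun j _ => ((bddLip_coord i).mul (bddLip_coord j)).mul (h.bddLip_coeffGrad i j l))
  convert this using 2 with p
  simp only [gradX, PiLp.smul_apply, WithLp.ofLp_sum, Finset.sum_apply, smul_eq_mul, mul_inv]
  simp
  left; ring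

end lip

lemma CoeffBounds.norm_gradX_le {T K : ℝ} {a : CoeffField n} (h : CoeffBounds T a K) {t : ℝ}
    (ht : t ∈ Icc (-T) T) (x ξ : Space n) : ‖gradX a t x ξ‖ ≤ n ^ 2 * K ^ 2 * ‖ξ‖ := by
  have hK := h.pos
  rcases eq_or_ne ξ 0 with rfl | hξ
  · simp [gradX]
  have hq := h.le_symbolQ ht x ξ
  have hq0 := h.symbolQ_pos ht x hξ
  have hn := norm_pos_iff.2 hξ
  rw [gradX, norm_smul, norm_inv, norm_mul, norm_of_nonneg hq0.le, norm_ofNat,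
    inv_mul_le_iff₀ (by positivity)]
  calc ‖∑ i, ∑ j, (ξ i * ξ j) • coeffGrad a t x i j‖
      ≤ ∑ i, ∑ j, |ξ i| * |ξ j| * K := by
        refine (norm_sum_le _ _).trans (sum_le_sum fun i _ => (norm_sum_le _ _).trans
          (sum_le_sum fun j _ => ?_))
        rw [norm_smul, norm_mul, norm_eq_abs, norm_eq_abs]
        gcongr
        exact h.grad_bound t ht x i j
    _ = (∑ i, |ξ i|) * (∑ j, |ξ j|) * K := by
        rw [Finset.sum_mul_sum, sum_mul]
        simp only [sum_mul]
    _ ≤ (n * ‖ξ‖) * (n * ‖ξ‖) * K := by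
        have := sum_abs_coord_le ξ
        gcongr
    _ = (‖ξ‖ / K) * (n ^ 2 * K ^ 2 * ‖ξ‖) := by field_simp
    _ ≤ symbolQ a t x ξ * (n ^ 2 * K ^ 2 * ‖ξ‖) := by gcongr
    _ ≤ 2 * symbolQ a t x ξ * (n ^ 2 * K ^ 2 * ‖ξ‖) := by
        have : 0 ≤ symbolQ a t x ξ * (n ^ 2 * K ^ 2 * ‖ξ‖) := by positivity
        linarith

/-! ### Bicharacteristics -/

lemma exists_isPicardSolution {E : Type*} [NormedAddCommGroup E] [NormedSpace ℝ E]
    [CompleteSpace E] {T : ℝ} (W : ℝ × E → E) {L : NNReal} (hW : LipschitzWith L W) {M : NNReal}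
    (hM : ∀ p, ‖W p‖ ≤ M) {t' : ℝ} (ht' : t' ∈ Icc (-T) T) (z₀ : E) :
    ∃ z : ℝ → E, z t' = z₀ ∧ ∀ t ∈ Icc (-T) T, HasDerivWithinAt z (W (t, z t)) (Icc (-T) T) t := by
  have hT : 0 ≤ T := by linarith [ht'.1, ht'.2]
  have hp : IsPicardLindelof (fun t z => W (t, z)) (⟨t', ht'⟩ : Icc (-T) T) z₀
      (M * toNNReal (2 * T)) 0 M L := by
    refine ⟨fun t _ => ?_, fun x _ => ?_, fun t _ x _ => hM _, ?_⟩
    · refine (LipschitzWith.of_dist_le_mul fun x y => ?_).lipschitzOnWith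
      refine (hW.dist_le_mul _ _).trans ?_
      rw [Prod.dist_eq]
      simp
    · exact (hW.continuous.comp (by fun_prop : Continuous fun t : ℝ => (t, x))).continuousOn
    · rw [NNReal.coe_mul, coe_toNNReal _ (by positivity), NNReal.coe_zero, sub_zero]
      gcongr
      exact max_le (by linarith [ht'.1]) (by linarith [ht'.2])
  obtain ⟨z, h1, h2⟩ := hp.exists_eq_forall_mem_Icc_hasDerivWithinAt₀
  exact ⟨z, h1, h2⟩

lemma symbolQ_smul (a : CoeffField n) (t : ℝ) (x ξ : Space n) {c : ℝ} (hc : 0 < c) :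
    symbolQ a t x (c • ξ) = c * symbolQ a t x ξ := by
  have : quadForm a t x (c • ξ) = c ^ 2 * quadForm a t x ξ := by
    simp only [quadForm, mul_sum, PiLp.smul_apply, smul_eq_mul]
    exact sum_congr rfl fun i _ => sum_congr rfl fun j _ => by ring
  rw [CoeffBounds.symbolQ_eq, CoeffBounds.symbolQ_eq, this, sqrt_mul (by positivity),
    sqrt_sq hc.le]

lemma gradXi_smul (a : CoeffField n) (t : ℝ) (x ξ : Space n) {c : ℝ} (hc : 0 < c) :
    gradXi a t x (c • ξ) = gradXi a t x ξ := by
  have : (WithLp.toLp 2 (fun i => ∑ j, a t x i j * (c • ξ) j) : Space n) =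
      c • WithLp.toLp 2 (fun i => ∑ j, a t x i j * ξ j) := by
    ext i
    simp only [PiLp.smul_apply, smul_eq_mul, mul_sum]
    exact sum_congr rfl fun j _ => by ring
  rw [gradXi, gradXi, this, symbolQ_smul _ _ _ _ hc, smul_smul, mul_inv]
  congr 1
  field_simp

lemma gradX_smul (a : CoeffField n) (t : ℝ) (x ξ : Space n) {c : ℝ} (hc : 0 < c) :
    gradX a t x (c • ξ) = c • gradX a t x ξ := by
  have : ∑ i, ∑ j, ((c • ξ) i * (c • ξ) j) • coeffGrad a t x i j =
      c ^ 2 • ∑ i, ∑ j, (ξ i * ξ j) • coeffGrad a t x i j := by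
    simp only [Finset.smul_sum, PiLp.smul_apply, smul_eq_mul, smul_smul]
    exact sum_congr rfl fun i _ => sum_congr rfl fun j _ => by congr 1; ring
  rw [gradX, gradX, this, symbolQ_smul _ _ _ _ hc, smul_smul, smul_smul]
  congr 1
  field_simp

/-- The curve `z` solves the Hamilton equations on `[-T, T]`, with the gradients of `q` written
out, and avoids the zero section. -/
structure IsHamCurve (T : ℝ) (a : CoeffField n) (σ : ℝ) (z : ℝ → Space n × Space n) : Prop where
  ne_zero : ∀ t ∈ Icc (-T) T, (z t).2 ≠ 0
  equation : ∀ t ∈ Icc (-T) T, HasDerivWithinAt z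
    (-(σ • gradXi a t (z t).1 (z t).2), σ • gradX a t (z t).1 (z t).2) (Icc (-T) T) t

section curves

variable {T K : ℝ} {a : CoeffField n} {σ : ℝ} {z : ℝ → Space n × Space n}

/-- The growth factor of the frequency along bicharacteristics. -/
def growth (n : ℕ) (T K : ℝ) : ℝ := exp (n ^ 2 * K ^ 2 * (T - -T))

lemma growth_pos (n : ℕ) (T K : ℝ) : 0 < growth n T K := exp_pos _

lemma freq_le_of_deriv (hσ : |σ| ≤ 1) {g : ℝ → Space n}
    (hz : ∀ t ∈ Icc (-T) T, HasDerivWithinAt (fun s => (z s).2) (σ • g t) (Icc (-T) T) t)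
    (hg : ∀ t ∈ Icc (-T) T, ‖g t‖ ≤ n ^ 2 * K ^ 2 * ‖(z t).2‖) {s t : ℝ}
    (hs : s ∈ Icc (-T) T) (ht : t ∈ Icc (-T) T) : ‖(z t).2‖ ≤ growth n T K * ‖(z s).2‖ := by
  refine norm_le_exp_mul_of_norm_deriv_le (d := fun s => (z s).2) (by positivity) hz (fun t ht => ?_)
    hs ht
  rw [norm_smul, norm_eq_abs]
  have := hg t ht
  nlinarith [norm_nonneg (g t)]

lemma hasDerivWithinAt_snd {E F : Type*} [NormedAddCommGroup E] [NormedSpace ℝ E]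
    [NormedAddCommGroup F] [NormedSpace ℝ F] {z : ℝ → E × F} {z' : E × F} {s : Set ℝ} {t : ℝ}
    (h : HasDerivWithinAt z z' s t) : HasDerivWithinAt (fun u => (z u).2) z'.2 s t :=
  ((ContinuousLinearMap.snd ℝ E F).hasFDerivAt.comp_hasDerivWithinAt t h)

lemma hasDerivWithinAt_fst {E F : Type*} [NormedAddCommGroup E] [NormedSpace ℝ E]
    [NormedAddCommGroup F] [NormedSpace ℝ F] {z : ℝ → E × F} {z' : E × F} {s : Set ℝ} {t : ℝ}
    (h : HasDerivWithinAt z z' s t) : HasDerivWithinAt (fun u => (z u).1) z'.1 s t :=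
  ((ContinuousLinearMap.fst ℝ E F).hasFDerivAt.comp_hasDerivWithinAt t h)

lemma IsHamCurve.norm_freq_le (hz : IsHamCurve T a σ z) (h : CoeffBounds T a K) (hσ : |σ| ≤ 1)
    {s t : ℝ} (hs : s ∈ Icc (-T) T) (ht : t ∈ Icc (-T) T) :
    ‖(z t).2‖ ≤ growth n T K * ‖(z s).2‖ :=
  freq_le_of_deriv (g := fun t => gradX a t (z t).1 (z t).2) hσ
    (fun t ht => hasDerivWithinAt_snd (hz.equation t ht))
    (fun _ ht => h.norm_gradX_le ht _ _) hs ht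

lemma symbolQ_zero_right (a : CoeffField n) (t : ℝ) (x : Space n) : symbolQ a t x 0 = 0 := by
  simp [symbolQ]

lemma IsBicharacteristic.isHamCurve (ha : IsC11Coefficient T a) (h : CoeffBounds T a K)
    (hσ : |σ| ≤ 1) {t' : ℝ} (ht' : t' ∈ Icc (-T) T) {x₀ ξ₀ : Space n} (hξ : ξ₀ ≠ 0)
    (hz : IsBicharacteristic T a σ t' x₀ ξ₀ z) : IsHamCurve T a σ z := by
  have h0 : ∀ t ∈ Icc (-T) T, (z t).2 ≠ 0 := by
    intro t ht h0
    have := freq_le_of_deriv (z := z) (K := K) hσ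
      (fun t ht => hasDerivWithinAt_snd (hz.equation t ht))
      (fun t ht => by
        by_cases hh : (z t).2 = 0
        · rw [hh]
          simp [symbolQ_zero_right, gradient]
        · rw [gradient_symbolQ_left h ht (ha.differentiable t ht) hh]
          exact h.norm_gradX_le ht _ _) ht ht'
    rw [h0, hz.initial] at this
    simp at this
    exact hξ this
  refine ⟨h0, fun t ht => ?_⟩
  have := hz.equation t ht
  rwa [gradient_symbolQ_left h ht (ha.differentiable t ht) (h0 t ht),
    gradient_symbolQ_right h ht (ha.symm t ht _) (h0 t ht)] at this

lemma lipschitzWith_toLp_of_coord {α : Type*} [PseudoMetricSpace α] {f : Fin n → α → ℝ}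
    {L : Fin n → NNReal} (h : ∀ i, LipschitzWith (L i) (f i)) :
    LipschitzWith (∑ i, L i) (fun p => (WithLp.toLp 2 (fun i => f i p) : Space n)) := by
  refine LipschitzWith.of_dist_le_mul fun p q => ?_
  rw [dist_eq_norm]
  refine (norm_le_sum_abs_coord _).trans ?_
  rw [NNReal.coe_sum, sum_mul]
  refine sum_le_sum fun i _ => ?_
  have := (h i).dist_le_mul p q
  rwa [dist_eq] at this

lemma exists_isBicharacteristic (ha : IsC11Coefficient T a) (h : CoeffBounds T a K)
    (hσ : |σ| ≤ 1) {t' : ℝ} (ht' : t' ∈ Icc (-T) T) (x₀ : Space n) {ξ₀ : Space n} (hξ : ξ₀ ≠ 0) :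
    ∃ z, IsBicharacteristic T a σ t' x₀ ξ₀ z := by
  have hK := h.pos
  have hn := norm_pos_iff.2 hξ
  -- the solution stays in this annulus because of the linear growth of `q_x` in the frequency
  set κ : ℝ := exp (n * (n ^ 2 * K ^ 2) * (T - -T)) with hκ
  have hκ0 : 0 < κ := exp_pos _
  have hR : 0 < ‖ξ₀‖ / κ := by positivity
  set S := phaseAnnulus n T (‖ξ₀‖ / κ) (κ * ‖ξ₀‖)
  choose B hB hB1 hB2 using fun i => h.bddLip_gradXi (R₂ := κ * ‖ξ₀‖) hR i
  choose f Lf hf hfS hfb _ using fun i => BddLip.exists_extension (M := fun _ => B i)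
    ⟨B i, hB i, hB1 i, hB2 i⟩ (LipschitzWith.const (B i)) (fun _ => hB i) (hB1 i)
  have hM : LipschitzWith (toNNReal (n ^ 2 * K ^ 2))
      (fun p : ℝ × (Space n × Space n) => (n ^ 2 * K ^ 2) * ‖p.2.2‖) := by
    refine LipschitzWith.of_dist_le_mul fun p q => ?_
    rw [coe_toNNReal _ (by positivity), dist_eq, ← mul_sub, abs_mul,
      abs_of_nonneg (by positivity : (0 : ℝ) ≤ n ^ 2 * K ^ 2)]
    gcongr
    refine (abs_norm_sub_norm_le _ _).trans ?_
    rw [← dist_eq_norm]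
    exact (le_max_right _ _).trans (le_max_right _ _)
  choose g Lg hg hgS hgb hgM using fun i =>
    (h.bddLip_gradX (R₂ := κ * ‖ξ₀‖) hR i).exists_extension hM (fun p => by positivity)
      fun p hp => (abs_coord_le _ _).trans (h.norm_gradX_le hp.1 _ _)
  set F : ℝ × (Space n × Space n) → Space n := fun p => WithLp.toLp 2 (fun i => f i p)
  set G : ℝ × (Space n × Space n) → Space n := fun p => WithLp.toLp 2 (fun i => g i p)
  have hF := lipschitzWith_toLp_of_coord hf
  have hG := lipschitzWith_toLp_of_coord hg
  have hσ' : ∀ x y : Space n, ‖(-(σ • x), σ • y)‖ ≤ ‖(x, y)‖ := fun x y => by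
    simp only [Prod.norm_def, norm_neg, norm_smul, norm_eq_abs]
    exact max_le_max (mul_le_of_le_one_left (norm_nonneg _) hσ) (mul_le_of_le_one_left (norm_nonneg _) hσ)
  have hW : LipschitzWith (max (∑ i, Lf i) (∑ i, Lg i))
      (fun p => (-(σ • F p), σ • G p) : ℝ × (Space n × Space n) → Space n × Space n) := by
    refine LipschitzWith.of_dist_le_mul fun p q => le_trans ?_ ((hF.prodMk hG).dist_le_mul p q)
    rw [dist_eq_norm, dist_eq_norm]
    refine le_of_eq_of_le ?_ (hσ' _ _)
    rw [smul_sub, smul_sub, neg_sub', Prod.mk_sub_mk, sub_neg_eq_add]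
  have hWb : ∀ p, ‖((-(σ • F p), σ • G p) : Space n × Space n)‖ ≤
      ((max (∑ i, Lf i) (∑ i, Lg i) : NNReal) : ℝ) := by
    intro p
    refine (hσ' _ _).trans ?_
    rw [Prod.norm_def, NNReal.coe_max, NNReal.coe_sum, NNReal.coe_sum]
    exact max_le_max ((norm_le_sum_abs_coord (F p)).trans (sum_le_sum fun i _ => hfb i p))
      ((norm_le_sum_abs_coord (G p)).trans (sum_le_sum fun i _ => hgb i p))
  obtain ⟨z, hz0, hz⟩ := exists_isPicardSolution _ hW hWb ht' (x₀, ξ₀)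
  have hgrow : ∀ s ∈ Icc (-T) T, ∀ t ∈ Icc (-T) T, ‖(z t).2‖ ≤ κ * ‖(z s).2‖ := by
    intro s hs t ht
    refine norm_le_exp_mul_of_norm_deriv_le (d := fun s => (z s).2)
      (d' := fun t => σ • G (t, z t)) (by positivity)
      (fun t ht => hasDerivWithinAt_snd (hz t ht)) (fun t ht => ?_) hs ht
    rw [norm_smul, norm_eq_abs]
    have h1 := (norm_le_sum_abs_coord (G (t, z t))).trans
      (sum_le_sum fun i _ => hgM i (t, z t))
    simp only [Finset.sum_const, Finset.card_univ, Fintype.card_fin, nsmul_eq_mul] at h1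
    nlinarith [norm_nonneg (G (t, z t))]
  have hmem : ∀ t ∈ Icc (-T) T, (t, z t) ∈ S := by
    intro t ht
    have h1 := hgrow _ ht' _ ht
    have h2 := hgrow _ ht _ ht'
    rw [hz0] at h1 h2
    refine ⟨ht, ?_, h1⟩
    rw [div_le_iff₀' hκ0]
    exact h2
  have hne : ∀ t ∈ Icc (-T) T, (z t).2 ≠ 0 := fun t ht h0 => by
    have := (hmem t ht).2.1
    simp only [h0, norm_zero] at this
    linarith
  refine ⟨z, hz0, fun t ht => ?_⟩
  rw [gradient_symbolQ_left h ht (ha.differentiable t ht) (hne t ht),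
    gradient_symbolQ_right h ht (ha.symm t ht _) (hne t ht)]
  have e1 : F (t, z t) = gradXi a t (z t).1 (z t).2 := by
    ext i; exact hfS i _ (hmem t ht)
  have e2 : G (t, z t) = gradX a t (z t).1 (z t).2 := by
    ext i; exact hgS i _ (hmem t ht)
  rw [← e1, ← e2]
  exact hz t ht

lemma isBicharacteristic_bichar (ha : IsC11Coefficient T a) (hσ : |σ| ≤ 1) {t' : ℝ}
    (ht' : t' ∈ Icc (-T) T) (x₀ : Space n) {ξ₀ : Space n} (hξ : ξ₀ ≠ 0) :
    IsBicharacteristic T a σ t' x₀ ξ₀ (bichar T a σ t' x₀ ξ₀) := by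
  obtain ⟨K, h⟩ := ha.exists_bounds
  exact Classical.epsilon_spec (exists_isBicharacteristic ha h hσ ht' x₀ hξ)

/-- Bounds for the Hamilton field on a fixed annulus. -/
lemma CoeffBounds.exists_field_bound (h : CoeffBounds T a K) {R₁ R₂ : ℝ} (hR : 0 < R₁) :
    ∃ L : ℝ, 0 ≤ L ∧ (∀ p ∈ phaseAnnulus n T R₁ R₂,
      ‖gradXi a p.1 p.2.1 p.2.2‖ ≤ L ∧ ‖gradX a p.1 p.2.1 p.2.2‖ ≤ L) ∧
      ∀ p ∈ phaseAnnulus n T R₁ R₂, ∀ p' ∈ phaseAnnulus n T R₁ R₂,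
        ‖gradXi a p.1 p.2.1 p.2.2 - gradXi a p'.1 p'.2.1 p'.2.2‖ ≤ L * dist p p' ∧
        ‖gradX a p.1 p.2.1 p.2.2 - gradX a p'.1 p'.2.1 p'.2.2‖ ≤ L * dist p p' := by
  choose A hA0 hA1 hA2 using fun i => h.bddLip_gradXi (R₂ := R₂) hR i
  choose B hB0 hB1 hB2 using fun i => h.bddLip_gradX (R₂ := R₂) hR i
  have sA : 0 ≤ ∑ i, A i := sum_nonneg fun i _ => hA0 i
  have sB : 0 ≤ ∑ i, B i := sum_nonneg fun i _ => hB0 i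
  refine ⟨∑ i, A i + ∑ i, B i, by positivity, fun p hp => ⟨?_, ?_⟩, fun p hp p' hp' => ⟨?_, ?_⟩⟩
  · have := (norm_le_sum_abs_coord _).trans (sum_le_sum fun i _ => hA1 i p hp)
    linarith
  · have := (norm_le_sum_abs_coord _).trans (sum_le_sum fun i _ => hB1 i p hp)
    linarith
  · have := (norm_le_sum_abs_coord (gradXi a p.1 p.2.1 p.2.2 - gradXi a p'.1 p'.2.1 p'.2.2)).trans
      (sum_le_sum fun i _ => hA2 i p hp p' hp')
    rw [← sum_mul] at this
    have h2 : 0 ≤ (∑ i, B i) * dist p p' := by positivity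
    linarith
  · have := (norm_le_sum_abs_coord (gradX a p.1 p.2.1 p.2.2 - gradX a p'.1 p'.2.1 p'.2.2)).trans
      (sum_le_sum fun i _ => hB2 i p hp p' hp')
    rw [← sum_mul] at this
    have h2 : 0 ≤ (∑ i, A i) * dist p p' := by positivity
    linarith

/-- The phase space point with the frequency divided by `c`. -/
def rescale (c : ℝ) (z : Space n × Space n) : Space n × Space n := (z.1, c⁻¹ • z.2)

lemma IsHamCurve.rescale {c : ℝ} (hc : 0 < c) (hz : IsHamCurve T a σ z) :
    IsHamCurve T a σ (fun t => rescale c (z t)) := by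
  refine ⟨fun t ht => smul_ne_zero (inv_ne_zero hc.ne') (hz.ne_zero t ht), fun t ht => ?_⟩
  have h1 := hasDerivWithinAt_fst (hz.equation t ht)
  have h2 := (hasDerivWithinAt_snd (hz.equation t ht)).const_smul c⁻¹
  have := h1.prodMk h2
  simp only [_root_.rescale]
  rw [gradXi_smul _ _ _ _ (inv_pos.2 hc), gradX_smul _ _ _ _ (inv_pos.2 hc), smul_comm]
  exact this

/-- Two bicharacteristics separate at most exponentially, in both time directions. -/
lemma CoeffBounds.exists_separation (h : CoeffBounds T a K) {R₁ R₂ : ℝ} (hR : 0 < R₁) :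
    ∃ L : ℝ, 0 < L ∧ ∀ σ : ℝ, |σ| ≤ 1 → ∀ z w : ℝ → Space n × Space n, IsHamCurve T a σ z →
      IsHamCurve T a σ w → (∀ t ∈ Icc (-T) T, (t, z t) ∈ phaseAnnulus n T R₁ R₂) →
      (∀ t ∈ Icc (-T) T, (t, w t) ∈ phaseAnnulus n T R₁ R₂) →
      ∀ s ∈ Icc (-T) T, ∀ t ∈ Icc (-T) T, ‖z t - w t‖ ≤ L * ‖z s - w s‖ := by
  obtain ⟨L, hL, -, h2⟩ := h.exists_field_bound (R₂ := R₂) hR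
  refine ⟨_, exp_pos (L * (T - -T)), fun σ hσ z w hz hw hzS hwS s hs t ht => ?_⟩
  refine norm_le_exp_mul_of_norm_deriv_le (d := fun s => z s - w s) hL
    (fun t ht => (hz.equation t ht).sub (hw.equation t ht)) (fun t ht => ?_) hs ht
  have := h2 _ (hzS t ht) _ (hwS t ht)
  have hd : dist (t, z t) (t, w t) = ‖z t - w t‖ := by
    rw [Prod.dist_eq, dist_self, dist_eq_norm, max_eq_right (norm_nonneg _)]
  rw [hd] at this
  have hσ' : ∀ v : Space n, ‖σ • v‖ ≤ ‖v‖ := fun v => by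
    rw [norm_smul, norm_eq_abs]; nlinarith [norm_nonneg v]
  rw [Prod.norm_def]
  apply max_le
  · simp only [Prod.fst_sub]
    rw [show ∀ u v : Space n, -(σ • u) - -(σ • v) = -(σ • (u - v)) from fun u v => by
      rw [smul_sub]; abel, norm_neg]
    exact (hσ' _).trans this.1
  · simp only [Prod.snd_sub]
    rw [← smul_sub]
    exact (hσ' _).trans this.2

lemma IsHamCurve.hasDerivAt (hz : IsHamCurve T a σ z) {t : ℝ} (ht : t ∈ Ioo (-T) T) :
    HasDerivAt z (-(σ • gradXi a t (z t).1 (z t).2), σ • gradX a t (z t).1 (z t).2) t :=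
  (hz.equation t (Ioo_subset_Icc_self ht)).hasDerivAt (Icc_mem_nhds ht.1 ht.2)

/-- The velocity of a bicharacteristic is Lipschitz in time. -/
lemma CoeffBounds.exists_lipschitz_deriv (h : CoeffBounds T a K) {R₁ R₂ : ℝ} (hR : 0 < R₁) :
    ∃ L : ℝ, 0 < L ∧ ∀ σ : ℝ, |σ| ≤ 1 → ∀ z : ℝ → Space n × Space n, IsHamCurve T a σ z →
      (∀ t ∈ Icc (-T) T, (t, z t) ∈ phaseAnnulus n T R₁ R₂) →
      (∀ t ∈ Ioo (-T) T, ‖deriv z t‖ ≤ L) ∧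
      ∀ s ∈ Ioo (-T) T, ∀ t ∈ Ioo (-T) T, ‖deriv z t - deriv z s‖ ≤ L * |t - s| := by
  obtain ⟨L, hL, h1, h2⟩ := h.exists_field_bound (R₂ := R₂) hR
  refine ⟨1 + L + L * (1 + L), by positivity, fun σ hσ z hz hzS => ?_⟩
  have hσ' : ∀ v : Space n, ‖σ • v‖ ≤ ‖v‖ := fun v => by
    rw [norm_smul, norm_eq_abs]; nlinarith [norm_nonneg v]
  have hb : ∀ t ∈ Icc (-T) T,
      ‖((-(σ • gradXi a t (z t).1 (z t).2), σ • gradX a t (z t).1 (z t).2) :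
        Space n × Space n)‖ ≤ L := by
    intro t ht
    rw [Prod.norm_def]
    apply max_le
    · rw [norm_neg]; exact (hσ' _).trans (h1 _ (hzS t ht)).1
    · exact (hσ' _).trans (h1 _ (hzS t ht)).2
  refine ⟨fun t ht => ?_, fun s hs t ht => ?_⟩
  · rw [(hz.hasDerivAt ht).deriv]
    have := hb t (Ioo_subset_Icc_self ht)
    have : 0 ≤ L * (1 + L) := by positivity
    linarith
  · have hs' := Ioo_subset_Icc_self hs
    have ht' := Ioo_subset_Icc_self ht
    have hlip : ‖z t - z s‖ ≤ L * ‖t - s‖ :=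
      (convex_Icc (-T) T).norm_image_sub_le_of_norm_hasDerivWithin_le
        (fun u hu => hz.equation u hu) hb hs' ht'
    rw [norm_eq_abs] at hlip
    have hd : dist (t, z t) (s, z s) ≤ (1 + L) * |t - s| := by
      rw [Prod.dist_eq]
      apply max_le
      · change dist t s ≤ _
        rw [dist_eq]; nlinarith [abs_nonneg (t - s)]
      · change dist (z t) (z s) ≤ _
        rw [dist_eq_norm]; nlinarith [abs_nonneg (t - s)]
    have h3 := h2 _ (hzS t ht') _ (hzS s hs')
    have h4 : L * dist (t, z t) (s, z s) ≤ (1 + L + L * (1 + L)) * |t - s| := by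
      have := mul_le_mul_of_nonneg_left hd hL
      nlinarith [abs_nonneg (t - s)]
    rw [(hz.hasDerivAt ht).deriv, (hz.hasDerivAt hs).deriv, Prod.norm_def]
    apply max_le
    · simp only [Prod.fst_sub]
      rw [show ∀ u v : Space n, -(σ • u) - -(σ • v) = -(σ • (u - v)) from fun u v => by
        rw [smul_sub]; abel, norm_neg]
      exact (hσ' _).trans (h3.1.trans h4)
    · simp only [Prod.snd_sub]
      rw [← smul_sub]
      exact (hσ' _).trans (h3.2.trans h4)

lemma deriv_lipschitz_ae_differentiableAt {E : Type*} [NormedAddCommGroup E] [NormedSpace ℝ E]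
    [FiniteDimensional ℝ E] {f : ℝ → E} {T L : ℝ}
    (hf : ∀ s ∈ Ioo (-T) T, ∀ t ∈ Ioo (-T) T, ‖f t - f s‖ ≤ L * |t - s|) :
    ∀ᵐ t ∂(volume.restrict (Ioo (-T) T)), DifferentiableAt ℝ f t := by
  have : LipschitzOnWith (toNNReal L) f (Ioo (-T) T) :=
    LipschitzOnWith.of_dist_le_mul fun s hs t ht => by
      rw [dist_eq_norm, dist_eq]
      refine (hf t ht s hs).trans ?_
      gcongr
      exact le_coe_toNNReal L
  filter_upwards [this.ae_differentiableWithinAt_real measurableSet_Ioo,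
    ae_restrict_mem measurableSet_Ioo] with t h1 h2
  exact h1.differentiableAt (Ioo_mem_nhds h2.1 h2.2)

end curves

/-! ### Gaussian sums over separated points -/

lemma integrable_exp_neg_mul_norm_sub_sq {c : ℝ} (hc : 0 < c) (x : Space n) :
    Integrable (fun v : Space n => exp (-(c * ‖x - v‖ ^ 2))) := by
  have h : Integrable (fun v : Space n => exp (-c * ‖v‖ ^ 2)) := by
    have := (GaussianFourier.integrable_cexp_neg_mul_sq_norm_add (V := Space n) (b := (c : ℂ))
      (by simpa using hc) 0 0).norm
    refine this.congr (.of_forall fun v => ?_)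
    simp only [zero_mul, add_zero, Complex.norm_exp]
    norm_cast
  have := h.comp_sub_left x
  refine this.congr (.of_forall fun v => ?_)
  simp only [neg_mul]

lemma integral_exp_neg_mul_norm_sub_sq {c : ℝ} (hc : 0 < c) (x : Space n) :
    ∫ v : Space n, exp (-(c * ‖x - v‖ ^ 2)) = (π / c) ^ ((n : ℝ) / 2) := by
  have := integral_sub_left_eq_self (fun v : Space n => exp (-c * ‖v‖ ^ 2)) volume x
  rw [GaussianFourier.integral_rexp_neg_mul_sq_norm hc] at this
  simp only [neg_mul, finrank_euclideanSpace, Fintype.card_fin] at this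
  exact this

/-- A Gaussian sum over points with mutual distances at least `ρ` is at most the Gaussian integral
in units of `ρ`, up to a constant. -/
lemma exists_sum_exp_separated_le (n : ℕ) : ∃ D : ℝ, 0 < D ∧ ∀ {ι : Type} (S : Finset ι)
    (p : ι → Space n) (c ρ : ℝ), 0 < c → 0 < ρ →
    (∀ i ∈ S, ∀ j ∈ S, i ≠ j → ρ ≤ ‖p i - p j‖) → ∀ x : Space n,
    ∑ i ∈ S, exp (-(c * ‖x - p i‖ ^ 2)) ≤
      D * exp (c * ρ ^ 2 / 2) * ((c * ρ ^ 2) ^ ((n : ℝ) / 2))⁻¹ := by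
  set V : ℝ := volume.real (Metric.ball (0 : Space n) 1) with hV
  have hV0 : 0 < V := by
    rw [hV, measureReal_def]
    exact ENNReal.toReal_pos (Metric.measure_ball_pos _ _ one_pos).ne' measure_ball_lt_top.ne
  refine ⟨(2 * π) ^ ((n : ℝ) / 2) / V * 2 ^ n, by positivity, ?_⟩
  intro ι S p c ρ hc hρ hsep x
  set f : Space n → ℝ := fun v => exp (-(c / 2 * ‖x - v‖ ^ 2)) with hf
  have hfi : Integrable f := integrable_exp_neg_mul_norm_sub_sq (by positivity) x
  have hvol : ∀ i, volume.real (Metric.ball (p i) (ρ / 2)) = (ρ / 2) ^ n * V := by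
    intro i
    rw [measureReal_def, Measure.addHaar_ball_of_pos _ _ (by positivity), ENNReal.toReal_mul,
      ENNReal.toReal_ofReal (by positivity), finrank_euclideanSpace, Fintype.card_fin]
    rfl
  have h1 : ∀ i ∈ S, (ρ / 2) ^ n * V * exp (-(c * ‖x - p i‖ ^ 2)) ≤
      exp (c * ρ ^ 2 / 2) * ∫ v in Metric.ball (p i) (ρ / 2), f v := by
    intro i _
    rw [← hvol i, ← smul_eq_mul, ← setIntegral_const, ← integral_const_mul]
    refine setIntegral_mono_on (integrableOn_const measure_ball_lt_top.ne)
      (hfi.integrableOn.const_mul _) measurableSet_ball fun v hv => ?_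
    rw [hf, ← exp_add]
    apply exp_le_exp.2
    have hv' : ‖p i - v‖ < ρ / 2 := by
      rw [← dist_eq_norm, dist_comm]; exact hv
    have h2 : ‖x - v‖ ≤ ‖x - p i‖ + ‖p i - v‖ := by
      have := norm_add_le (x - p i) (p i - v)
      rwa [sub_add_sub_cancel] at this
    have h3 : ‖x - v‖ ^ 2 ≤ 2 * ‖x - p i‖ ^ 2 + 2 * (ρ / 2) ^ 2 := by
      have h4 : ‖p i - v‖ ^ 2 ≤ (ρ / 2) ^ 2 := by gcongr
      have h5 : ‖x - v‖ ^ 2 ≤ (‖x - p i‖ + ‖p i - v‖) ^ 2 := by gcongr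
      nlinarith [sq_nonneg (‖x - p i‖ - ‖p i - v‖)]
    nlinarith
  have hdisj : Set.Pairwise (S : Set ι) (Function.onFun Disjoint fun i =>
      Metric.ball (p i) (ρ / 2)) := by
    intro i hi j hj hij
    apply Metric.ball_disjoint_ball
    rw [dist_eq_norm]
    linarith [hsep i hi j hj hij]
  have h2 : ∑ i ∈ S, ∫ v in Metric.ball (p i) (ρ / 2), f v ≤ ∫ v, f v := by
    rw [← integral_biUnion_finset S (fun i _ => measurableSet_ball) hdisj
      (fun i _ => hfi.integrableOn)]
    exact setIntegral_le_integral hfi (.of_forall fun v => (exp_pos _).le)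
  have h3 : (ρ / 2) ^ n * V * ∑ i ∈ S, exp (-(c * ‖x - p i‖ ^ 2)) ≤
      exp (c * ρ ^ 2 / 2) * (π / (c / 2)) ^ ((n : ℝ) / 2) := by
    rw [mul_sum]
    refine (sum_le_sum h1).trans ?_
    rw [← mul_sum, ← integral_exp_neg_mul_norm_sub_sq (by positivity) x]
    gcongr
  have e1 : (π / (c / 2)) ^ ((n : ℝ) / 2) =
      (2 * π) ^ ((n : ℝ) / 2) * ((c * ρ ^ 2) ^ ((n : ℝ) / 2))⁻¹ * ρ ^ n := by
    have : π / (c / 2) = (2 * π) * (c * ρ ^ 2)⁻¹ * ρ ^ 2 := by field_simp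
    rw [this, mul_rpow (by positivity) (by positivity),
      mul_rpow (by positivity) (by positivity), inv_rpow (by positivity)]
    congr 1
    rw [← rpow_natCast ρ 2, ← rpow_mul hρ.le, ← rpow_natCast]
    congr 1
    push_cast; ring
  rw [e1] at h3
  have hρn : 0 < (ρ / 2) ^ n * V := by positivity
  rw [← le_div_iff₀' hρn] at h3
  refine h3.trans (le_of_eq ?_)
  rw [div_pow]
  field_simp

/-- The frequencies of one level, seen at the scale `2^{k/2}`, contribute a bounded Gaussian
sum. -/
lemma exists_sum_freq_le (n : ℕ) {c : ℝ} (hc : 0 < c) : ∃ D : ℝ, 0 < D ∧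
    ∀ (Λ : FrequencyLattice n) (k : ℕ) (x : Space n),
      ∑ ζ ∈ Λ.pts k, exp (-(c * ((2 : ℝ) ^ k)⁻¹ * ‖x - ζ‖ ^ 2)) ≤ D := by
  obtain ⟨D, hD, h⟩ := exists_sum_exp_separated_le n
  refine ⟨D * exp (c / 2) * (c ^ ((n : ℝ) / 2))⁻¹, by positivity, fun Λ k x => ?_⟩
  have e : c * ((2 : ℝ) ^ k)⁻¹ * ((2 : ℝ) ^ ((k : ℝ) / 2)) ^ 2 = c := by
    have : ((2 : ℝ) ^ ((k : ℝ) / 2)) ^ 2 = 2 ^ k := by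
      rw [← rpow_mul_natCast (by norm_num), ← rpow_natCast]
      congr 1; push_cast; ring
    rw [this]
    field_simp
  have := h (Λ.pts k) id (c * ((2 : ℝ) ^ k)⁻¹) ((2 : ℝ) ^ ((k : ℝ) / 2)) (by positivity)
    (by positivity) (fun i hi j hj hij => ((Λ.separated k).2 i hi j hj hij).le) x
  rw [e] at this
  exact this

/-- The point `δ α` of the scaled integer lattice. -/
def latticePt (δ : ℝ) (α : Fin n → ℤ) : Space n := WithLp.toLp 2 (fun i => δ * (α i : ℝ))

lemma one_le_norm_latticePt_one {α : Fin n → ℤ} (h : α ≠ 0) : 1 ≤ ‖latticePt 1 α‖ := by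
  obtain ⟨i, hi⟩ := Function.ne_iff.1 h
  refine le_trans ?_ (abs_coord_le (latticePt 1 α) i)
  simp only [latticePt, one_mul]
  exact_mod_cast Int.one_le_abs hi

lemma latticePt_eq_smul (δ : ℝ) (α : Fin n → ℤ) : latticePt δ α = δ • latticePt 1 α := by
  ext i; simp [latticePt]

lemma latticePt_sub (δ : ℝ) (α β : Fin n → ℤ) :
    latticePt δ α - latticePt δ β = latticePt δ (α - β) := by
  ext i; simp [latticePt, mul_sub]

lemma le_norm_latticePt {δ : ℝ} (hδ : 0 < δ) {α : Fin n → ℤ} (h : α ≠ 0) :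
    δ ≤ ‖latticePt δ α‖ := by
  rw [latticePt_eq_smul, norm_smul, norm_of_nonneg hδ.le]
  nlinarith [one_le_norm_latticePt_one h]

lemma exists_sum_lattice_le (n : ℕ) : ∃ D : ℝ, 0 < D ∧
    ∀ (S : Finset (Fin n → ℤ)) (c δ : ℝ), 0 < c → 0 < δ → ∀ x : Space n,
      ∑ α ∈ S, exp (-(c * ‖x - latticePt δ α‖ ^ 2)) ≤
        D * exp (c * δ ^ 2 / 2) * ((c * δ ^ 2) ^ ((n : ℝ) / 2))⁻¹ := by
  obtain ⟨D, hD, h⟩ := exists_sum_exp_separated_le n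
  refine ⟨D, hD, fun S c δ hc hδ x => h S (latticePt δ) c δ hc hδ (fun α _ β _ hαβ => ?_) x⟩
  rw [latticePt_sub]
  exact le_norm_latticePt hδ (sub_ne_zero.2 hαβ)

/-! ### Dyadic sums -/

lemma exists_sum_two_rpow_abs_le {d : ℝ} (hd : 0 < d) : ∃ D : ℝ, 0 < D ∧
    ∀ (S : Finset ℕ) (j : ℤ), ∑ k ∈ S, (2 : ℝ) ^ (-(d * |((k : ℤ) - j : ℝ)|)) ≤ D := by
  set q : ℝ := (2 : ℝ) ^ (-d) with hq
  have hq0 : 0 < q := by positivity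
  have hq1 : q < 1 := by
    rw [hq, rpow_neg (by norm_num)]
    exact inv_lt_one_of_one_lt₀ (one_lt_rpow (by norm_num) hd)
  have hg := (summable_geometric_of_lt_one hq0.le hq1)
  refine ⟨∑' i : ℕ, q ^ i + ∑' i : ℕ, q ^ i, ?_, fun S j => ?_⟩
  · have := hg.tsum_pos (fun i => by positivity) 0 (by positivity)
    positivity
  have e : ∀ k : ℕ, (2 : ℝ) ^ (-(d * |((k : ℤ) - j : ℝ)|)) = q ^ ((k : ℤ) - j).natAbs := by
    intro k
    rw [hq, ← rpow_natCast, ← rpow_mul (by norm_num)]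
    congr 1
    rw [Nat.cast_natAbs]
    push_cast
    ring
  simp only [e]
  rw [← Finset.sum_filter_add_sum_filter_not S (fun k : ℕ => j ≤ (k : ℤ))]
  have key : ∀ S' : Finset ℕ, Set.InjOn (fun k : ℕ => ((k : ℤ) - j).natAbs) S' →
      ∑ k ∈ S', q ^ ((k : ℤ) - j).natAbs ≤ ∑' i : ℕ, q ^ i := by
    intro S' hinj
    have := Finset.sum_image (f := fun i => q ^ i) hinj
    rw [← this]
    exact hg.sum_le_tsum _ (fun i _ => by positivity)
  apply add_le_add
  · refine key _ fun a ha b hb hab => ?_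
    simp only [Finset.coe_filter, Set.mem_ofPred_eq] at ha hb hab
    omega
  · refine key _ fun a ha b hb hab => ?_
    simp only [Finset.coe_filter, Set.mem_ofPred_eq] at ha hb hab
    omega

/-- A sequence with the two-sided decay `min ((w/2^k)^a) ((w/2^k)^{-b})` has bounded sum, whatever
the position of the peak. -/
lemma exists_sum_min_rpow_le {a b : ℝ} (ha : 0 < a) (hb : 0 < b) : ∃ D : ℝ, 0 < D ∧
    ∀ (S : Finset ℕ) (w : ℝ), 0 < w →
      ∑ k ∈ S, min ((w / 2 ^ k) ^ a) ((w / 2 ^ k) ^ (-b)) ≤ D := by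
  have hd : 0 < min a b := lt_min ha hb
  obtain ⟨D, hD, h⟩ := exists_sum_two_rpow_abs_le hd
  refine ⟨2 ^ a * D, by positivity, fun S w hw => ?_⟩
  obtain ⟨j, hj1, hj2⟩ := exists_mem_Ico_zpow hw (by norm_num : (1 : ℝ) < 2)
  calc _ ≤ ∑ k ∈ S, 2 ^ a * (2 : ℝ) ^ (-(min a b * |((k : ℤ) - j : ℝ)|)) := by
        refine sum_le_sum fun k _ => ?_
        have h1 : (2 : ℝ) ^ ((j : ℝ) - k) ≤ w / 2 ^ k := by
          rw [rpow_sub (by norm_num), rpow_intCast, rpow_natCast]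
          gcongr
        have h2 : w / 2 ^ k ≤ (2 : ℝ) ^ ((j : ℝ) + 1 - k) := by
          rw [rpow_sub (by norm_num), rpow_natCast]
          have : (2 : ℝ) ^ ((j : ℝ) + 1) = 2 ^ (j + 1) := by
            rw [← rpow_intCast]; push_cast; rfl
          rw [this]
          gcongr
        rw [← rpow_add (by norm_num)]
        rcases le_total (j : ℝ) k with hjk | hjk
        · refine (min_le_left _ _).trans ?_
          refine (rpow_le_rpow (by positivity) h2 ha.le).trans ?_
          rw [← rpow_mul (by norm_num)]
          apply rpow_le_rpow_of_exponent_le (by norm_num)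
          push_cast
          rw [abs_of_nonneg (by linarith)]
          have := min_le_left a b
          nlinarith
        · refine (min_le_right _ _).trans ?_
          refine (rpow_le_rpow_of_nonpos (by positivity) h1 (by linarith)).trans ?_
          rw [← rpow_mul (by norm_num)]
          apply rpow_le_rpow_of_exponent_le (by norm_num)
          push_cast
          rw [abs_of_nonpos (by linarith)]
          have := min_le_right a b
          nlinarith
    _ ≤ _ := by
        rw [← mul_sum]
        have := h S j
        gcongr

lemma exists_pow_mul_exp_le (N : ℕ) {c : ℝ} (hc : 0 < c) :
    ∃ D : ℝ, 0 < D ∧ ∀ x : ℝ, 0 ≤ x → (1 + x) ^ N * exp (-(c * x)) ≤ D := by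
  refine ⟨N.factorial * exp c * (1 / c) ^ N, by positivity, fun x hx => ?_⟩
  have h1 := pow_div_factorial_le_exp (c * (1 + x)) (by positivity) N
  rw [div_le_iff₀ (by positivity), mul_pow] at h1
  have h2 : (1 + x) ^ N ≤ (1 / c) ^ N * (exp (c * (1 + x)) * N.factorial) := by
    calc (1 + x) ^ N = (1 / c) ^ N * (c ^ N * (1 + x) ^ N) := by
          rw [← mul_assoc, ← mul_pow]; simp [hc.ne']
      _ ≤ _ := by gcongr
  calc (1 + x) ^ N * exp (-(c * x))
      ≤ (1 / c) ^ N * (exp (c * (1 + x)) * N.factorial) * exp (-(c * x)) := by gcongr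
    _ = N.factorial * (1 / c) ^ N * (exp (c * (1 + x)) * exp (-(c * x))) := by ring
    _ = _ := by
        rw [← exp_add]
        ring_nf

/-- The Japanese bracket `(1 + |η|²)^{1/2}`. -/
def bracket (η : Space n) : ℝ := (1 + ‖η‖ ^ 2) ^ (1 / 2 : ℝ)

lemma bracket_eq_sqrt (η : Space n) : bracket η = √(1 + ‖η‖ ^ 2) := by
  rw [bracket, sqrt_eq_rpow]

lemma one_le_bracket (η : Space n) : 1 ≤ bracket η := by
  rw [bracket_eq_sqrt]
  exact one_le_sqrt.2 (by nlinarith [sq_nonneg ‖η‖])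

lemma bracket_pos (η : Space n) : 0 < bracket η := zero_lt_one.trans_le (one_le_bracket η)

lemma bracket_le (η : Space n) : bracket η ≤ 1 + ‖η‖ := by
  rw [bracket_eq_sqrt]
  exact sqrt_le_iff.2 ⟨by positivity, by nlinarith [norm_nonneg η]⟩

lemma norm_le_bracket (η : Space n) : ‖η‖ ≤ bracket η := by
  rw [bracket_eq_sqrt]
  exact le_sqrt_of_sq_le (by linarith)

/-- Frequencies `η` and levels `k` are comparable up to the Gaussian distance. -/
lemma bracket_comparison (η ζ : Space n) (k : ℕ) (h1 : (2 : ℝ) ^ k / 2 ≤ ‖ζ‖)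
    (h2 : ‖ζ‖ < (2 : ℝ) ^ k) :
    bracket η / 2 ^ k ≤ 28 * (1 + ((2 : ℝ) ^ k)⁻¹ * ‖(2 * π) • η - ζ‖ ^ 2) ∧
    (2 : ℝ) ^ k / bracket η ≤ 28 * (1 + ((2 : ℝ) ^ k)⁻¹ * ‖(2 * π) • η - ζ‖ ^ 2) := by
  have hA : (1 : ℝ) ≤ 2 ^ k := one_le_pow₀ (by norm_num)
  set A : ℝ := 2 ^ k
  set d := ‖(2 * π) • η - ζ‖ with hd
  have hd0 : 0 ≤ d := norm_nonneg _
  have hw := one_le_bracket η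
  have hwle := bracket_le η
  have hwn := norm_le_bracket η
  have hp : ‖(2 * π) • η‖ = 2 * π * ‖η‖ := by
    rw [norm_smul, norm_of_nonneg (by positivity)]
  have hpi := pi_gt_three
  have hpi4 := pi_lt_d2
  have t1 : 2 * π * ‖η‖ ≤ ‖ζ‖ + d := by
    rw [← hp]; have := norm_add_le ζ ((2 * π) • η - ζ); rwa [add_sub_cancel] at this
  have t2 : ‖ζ‖ ≤ 2 * π * ‖η‖ + d := by
    rw [← hp, hd, norm_sub_rev]
    have := norm_add_le ((2 * π) • η) (ζ - (2 * π) • η); rwa [add_sub_cancel] at this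
  have hη := norm_nonneg η
  constructor
  · rw [div_le_iff₀ (by positivity)]
    have e : 28 * (1 + A⁻¹ * d ^ 2) * A = 28 * A + 28 * d ^ 2 := by field_simp
    rw [e]
    have : ‖η‖ ≤ A + d := by nlinarith
    nlinarith [sq_nonneg (d - 1)]
  · rw [div_le_iff₀ (by positivity)]
    rcases le_or_gt d (A / 4) with h | h
    · have : A ≤ 28 * bracket η := by nlinarith
      have : 0 ≤ A⁻¹ * d ^ 2 * bracket η := by positivity
      nlinarith
    · have : A / 16 ≤ A⁻¹ * d ^ 2 := by
        rw [inv_mul_eq_div, le_div_iff₀ (by positivity)]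
        nlinarith
      nlinarith

/-- All frequencies of the frame together, weighted by any power of `⟨η⟩ / 2^k`, contribute a
bounded Gaussian sum. -/
lemma exists_sum_all_freq_le (n : ℕ) {c : ℝ} (hc : 0 < c) (s : ℝ) : ∃ D : ℝ, 0 < D ∧
    ∀ (Λ : FrequencyLattice n) (S : Finset ℕ) (η : Space n),
      ∑ k ∈ S, ∑ ζ ∈ Λ.pts k, (bracket η / 2 ^ k) ^ s *
        exp (-(c * ((2 : ℝ) ^ k)⁻¹ * ‖(2 * π) • η - ζ‖ ^ 2)) ≤ D := by
  obtain ⟨D₁, hD₁, h₁⟩ := exists_sum_freq_le n (c := c / 2) (by positivity)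
  obtain ⟨D₂, hD₂, h₂⟩ := exists_sum_min_rpow_le one_pos one_pos
  obtain ⟨N, hN⟩ := exists_nat_ge (|s| + 1)
  obtain ⟨D₃, hD₃, h₃⟩ := exists_pow_mul_exp_le N (c := c / 2) (by positivity)
  refine ⟨28 ^ N * D₃ * D₁ * D₂, by positivity, fun Λ S η => ?_⟩
  have hw := bracket_pos η
  let τ : ℝ → ℝ := fun r => min (r ^ (1 : ℝ)) (r ^ (-1 : ℝ))
  have hτ : ∀ {r}, 0 < r → 0 ≤ τ r := fun h => le_min (by positivity) (by positivity)
  have key : ∀ k ∈ S, ∀ ζ ∈ Λ.pts k, (bracket η / 2 ^ k) ^ s *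
      exp (-(c * ((2 : ℝ) ^ k)⁻¹ * ‖(2 * π) • η - ζ‖ ^ 2)) ≤
      28 ^ N * D₃ * τ (bracket η / 2 ^ k) *
        exp (-(c / 2 * ((2 : ℝ) ^ k)⁻¹ * ‖(2 * π) • η - ζ‖ ^ 2)) := by
    intro k _ ζ hζ
    obtain ⟨r1, r2⟩ := bracket_comparison η ζ k ((Λ.separated k).1 ζ hζ).1
      ((Λ.separated k).1 ζ hζ).2
    set X := ((2 : ℝ) ^ k)⁻¹ * ‖(2 * π) • η - ζ‖ ^ 2 with hX
    have hX0 : 0 ≤ X := by positivity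
    set r := bracket η / 2 ^ k with hr
    have hr0 : 0 < r := by positivity
    have r2' : r⁻¹ ≤ 28 * (1 + X) := by rw [hr, inv_div]; exact r2
    have hbase : (1 : ℝ) ≤ 28 * (1 + X) := by linarith
    -- both `r` and `1/r` are at most `28 (1 + X)`, hence so is every power, up to the exponent
    have pw : ∀ u : ℝ, |u| ≤ N → r ^ u ≤ (28 * (1 + X)) ^ N := by
      intro u hu
      rw [← rpow_natCast]
      rcases le_total 0 u with h0 | h0
      · exact (rpow_le_rpow hr0.le r1 h0).trans
          (rpow_le_rpow_of_exponent_le hbase ((le_abs_self u).trans hu))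
      · have : r ^ u = (r⁻¹) ^ (-u) := by rw [inv_rpow hr0.le, rpow_neg hr0.le, inv_inv]
        rw [this]
        exact (rpow_le_rpow (by positivity) r2' (by linarith)).trans
          (rpow_le_rpow_of_exponent_le hbase ((neg_le_abs u).trans hu))
    have pm : r ^ s ≤ (28 * (1 + X)) ^ N * τ r := by
      simp only [τ]
      rw [mul_min_of_nonneg _ _ (by positivity)]
      apply le_min
      · have := pw (s - 1) ((abs_sub _ _).trans (by simpa using hN))
        calc r ^ s = r ^ (s - 1) * r ^ (1 : ℝ) := by rw [← rpow_add hr0]; ring_nf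
          _ ≤ _ := by gcongr
      · have := pw (s + 1) ((abs_add_le _ _).trans (by simpa using hN))
        calc r ^ s = r ^ (s + 1) * r ^ (-1 : ℝ) := by rw [← rpow_add hr0]; ring_nf
          _ ≤ _ := by gcongr
    have e : exp (-(c * ((2 : ℝ) ^ k)⁻¹ * ‖(2 * π) • η - ζ‖ ^ 2)) =
        exp (-(c / 2 * X)) * exp (-(c / 2 * ((2 : ℝ) ^ k)⁻¹ *
          ‖(2 * π) • η - ζ‖ ^ 2)) := by
      rw [← exp_add, hX]; ring_nf
    rw [e, ← mul_assoc]
    refine mul_le_mul_of_nonneg_right ?_ (exp_pos _).le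
    calc r ^ s * exp (-(c / 2 * X))
        ≤ (28 * (1 + X)) ^ N * τ r * exp (-(c / 2 * X)) := by
          gcongr
      _ = 28 ^ N * ((1 + X) ^ N * exp (-(c / 2 * X))) * τ r := by
          rw [mul_pow]; ring
      _ ≤ _ := by
          have := h₃ X hX0
          have := hτ hr0
          gcongr
  calc _ ≤ ∑ k ∈ S, ∑ ζ ∈ Λ.pts k, 28 ^ N * D₃ * τ (bracket η / 2 ^ k) *
        exp (-(c / 2 * ((2 : ℝ) ^ k)⁻¹ * ‖(2 * π) • η - ζ‖ ^ 2)) :=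
        sum_le_sum fun k hk => sum_le_sum fun ζ hζ => key k hk ζ hζ
    _ ≤ ∑ k ∈ S, 28 ^ N * D₃ * τ (bracket η / 2 ^ k) * D₁ := by
        refine sum_le_sum fun k _ => ?_
        rw [← mul_sum]
        have := hτ (r := bracket η / 2 ^ k) (by positivity)
        have := h₁ Λ k ((2 * π) • η)
        gcongr
    _ = 28 ^ N * D₃ * D₁ * ∑ k ∈ S, τ (bracket η / 2 ^ k) := by
        rw [mul_sum]
        exact sum_congr rfl fun k _ => by ring
    _ ≤ _ := by
        have := h₂ S (bracket η) hw
        gcongr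

/-! ### Parseval's identity for periodizations -/

/-- The half-open unit cube. -/
def unitCube (n : ℕ) : Set (Fin n → ℝ) := {u | ∀ i, u i ∈ Ioc ((0 : Fin n → ℝ) i) ((0 : Fin n → ℝ) i + 1)}

lemma measurableSet_unitCube : MeasurableSet (unitCube n) :=
  MeasurableSet.univ_pi' (fun _ => measurableSet_Ioc)

/-- An integer vector as a real vector. -/
def intVec (β : Fin n → ℤ) : Fin n → ℝ := fun i => (β i : ℝ)

lemma intVec_add (α β : Fin n → ℤ) : intVec (α + β) = intVec α + intVec β := by
  ext i; simp [intVec]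

/-- The integer vectors with entries at most `N`. -/
def intBox (n N : ℕ) : Finset (Fin n → ℤ) := Fintype.piFinset fun _ => Finset.Icc (-(N : ℤ)) N

lemma mem_intBox {N : ℕ} {β : Fin n → ℤ} : β ∈ intBox n N ↔ ∀ i, |β i| ≤ N := by
  simp [intBox, abs_le]

lemma exists_sub_mem_unitCube (v : Fin n → ℝ) : ∃ β : Fin n → ℤ, v - intVec β ∈ unitCube n := by
  refine ⟨fun i => ⌈v i⌉ - 1, fun i => ?_⟩
  simp only [intVec, Pi.sub_apply, Pi.zero_apply, Int.cast_sub, Int.cast_one, mem_Ioc]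
  constructor
  · linarith [Int.ceil_lt_add_one (v i)]
  · linarith [Int.le_ceil (v i)]

lemma eq_of_mem_unitCube {v : Fin n → ℝ} {β β' : Fin n → ℤ} (h : v - intVec β ∈ unitCube n)
    (h' : v - intVec β' ∈ unitCube n) : β = β' := by
  ext i
  have h1 := h i
  have h2 := h' i
  simp only [intVec, Pi.sub_apply, Pi.zero_apply, mem_Ioc] at h1 h2
  have a : (β i : ℝ) < β' i + 1 := by linarith
  have b : (β' i : ℝ) < β i + 1 := by linarith
  have a' : β i < β' i + 1 := by exact_mod_cast a
  have b' : β' i < β i + 1 := by exact_mod_cast b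
  omega

lemma integral_eq_sum_unitCube {F : (Fin n → ℝ) → ℂ} (hF : Integrable F)
    (B : Finset (Fin n → ℤ)) (hB : ∀ u ∈ unitCube n, ∀ β ∉ B, F (u + intVec β) = 0) :
    ∫ v, F v = ∑ β ∈ B, ∫ u in unitCube n, F (u + intVec β) := by
  set C : (Fin n → ℤ) → Set (Fin n → ℝ) := fun β => {v | v - intVec β ∈ unitCube n} with hC
  have hCm : ∀ β, MeasurableSet (C β) := fun β =>
    (measurable_id.sub_const (intVec β)) measurableSet_unitCube
  have h1 : ∫ v, F v = ∫ v in ⋃ β ∈ B, C β, F v := by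
    refine (setIntegral_eq_integral_of_forall_compl_eq_zero fun v hv => ?_).symm
    obtain ⟨β, hβ⟩ := exists_sub_mem_unitCube v
    have hβB : β ∉ B := fun h => hv (Set.mem_biUnion h hβ)
    have := hB _ hβ β hβB
    rwa [sub_add_cancel] at this
  rw [h1, integral_biUnion_finset B (fun β _ => hCm β) (fun β _ β' _ hne => ?_)
    (fun β _ => hF.integrableOn)]
  · refine sum_congr rfl fun β _ => ?_
    have := (measurePreserving_add_right (volume : Measure (Fin n → ℝ))
      (intVec β)).setIntegral_preimage_emb (MeasurableEquiv.addRight (intVec β)).measurableEmbedding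
      F (C β)
    rw [← this]
    congr 2
    ext u
    simp [hC]
  · rw [Function.onFun, Set.disjoint_left]
    intro v hv hv'
    exact hne (eq_of_mem_unitCube hv hv')

/-- The character `v ↦ exp (2 π i α · v)`. -/
def charZ (α : Fin n → ℤ) (v : Fin n → ℝ) : ℂ :=
  Complex.exp (2 * π * I * ((∑ i, (α i : ℝ) * v i : ℝ) : ℂ))

lemma mFourier_coe (α : Fin n → ℤ) (v : Fin n → ℝ) :
    UnitAddTorus.mFourier α (fun i => (v i : UnitAddCircle)) = charZ α v := by
  simp only [UnitAddTorus.mFourier, ContinuousMap.coe_mk, fourier_coe_apply, charZ]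
  rw [← Complex.exp_sum]
  congr 1
  push_cast
  rw [mul_sum]
  exact sum_congr rfl fun i _ => by simp; ring

lemma charZ_add_int (α β : Fin n → ℤ) (v : Fin n → ℝ) :
    charZ α (v + intVec β) = charZ α v := by
  rw [charZ, charZ, Complex.exp_eq_exp_iff_exists_int]
  refine ⟨∑ i, α i * β i, ?_⟩
  simp only [Pi.add_apply, intVec, mul_add, sum_add_distrib]
  push_cast
  ring

lemma continuous_charZ (α : Fin n → ℤ) : Continuous (charZ α) := by
  unfold charZ; fun_prop

/-- The periodization of a function. -/
def periodize (a : (Fin n → ℝ) → ℂ) (v : Fin n → ℝ) : ℂ := ∑' β : Fin n → ℤ, a (v + intVec β)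

lemma periodize_add_int (a : (Fin n → ℝ) → ℂ) (v : Fin n → ℝ) (β : Fin n → ℤ) :
    periodize a (v + intVec β) = periodize a v := by
  rw [periodize, periodize, ← (Equiv.addLeft β).tsum_eq (fun γ => a (v + intVec γ))]
  refine tsum_congr fun γ => ?_
  rw [Equiv.coe_addLeft, intVec_add, add_assoc]

lemma exists_intBox_support {a : (Fin n → ℝ) → ℂ} (ha : HasCompactSupport a) (R : ℕ) :
    ∃ N : ℕ, ∀ v : Fin n → ℝ, ‖v‖ ≤ R → ∀ β ∉ intBox n N, a (v + intVec β) = 0 := by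
  obtain ⟨M, hM⟩ := ha.isCompact.isBounded.subset_closedBall 0
  obtain ⟨N, hN⟩ := exists_nat_ge (M + R)
  refine ⟨N, fun v hv β hβ => ?_⟩
  by_contra h
  apply hβ
  rw [mem_intBox]
  intro i
  have h1 : ‖v + intVec β‖ ≤ M := by
    simpa using hM (subset_tsupport a h)
  have h2 : ‖intVec β‖ ≤ M + R := by
    have := norm_sub_le (v + intVec β) v
    rw [add_sub_cancel_left] at this
    linarith
  have h3 := (norm_le_pi_norm (intVec β) i).trans (h2.trans hN)
  simp only [intVec, norm_eq_abs] at h3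
  exact_mod_cast h3

lemma norm_le_of_mem_unitCube {u : Fin n → ℝ} (hu : u ∈ unitCube n) : ‖u‖ ≤ (1 : ℕ) := by
  rw [pi_norm_le_iff_of_nonneg (by simp)]
  intro i
  have := hu i
  simp only [Pi.zero_apply, zero_add, mem_Ioc] at this
  rw [norm_eq_abs, abs_of_pos this.1]
  simpa using this.2

lemma hasSum_charZ_coeff {a b : (Fin n → ℝ) → ℂ} (ha : Continuous a) (hb : Continuous b)
    (ha' : HasCompactSupport a) (hb' : HasCompactSupport b) :
    HasSum (fun α : Fin n → ℤ => conj (∫ v, charZ (-α) v * a v) *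
      ∫ v, charZ (-α) v * b v) (∫ v, conj (periodize a v) * b v) := by
  let : MeasureSpace UnitAddCircle := ⟨AddCircle.haarAddCircle⟩
  have : IsProbabilityMeasure (volume : Measure UnitAddCircle) :=
    inferInstanceAs (IsProbabilityMeasure AddCircle.haarAddCircle)
  obtain ⟨N₁, hN₁⟩ := exists_intBox_support ha' 1
  obtain ⟨N₂, hN₂⟩ := exists_intBox_support hb' 1
  let pt : UnitAddTorus (Fin n) → Fin n → ℝ := fun t => (UnitAddTorus.measurableEquivPiIoc 0 t).1
  set B := intBox n N₁ ∪ intBox n N₂ with hB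
  have hBa : ∀ u ∈ unitCube n, ∀ β ∉ B, a (u + intVec β) = 0 := fun u hu β hβ =>
    hN₁ u (norm_le_of_mem_unitCube hu) β fun h => hβ (Finset.mem_union_left _ h)
  have hBb : ∀ u ∈ unitCube n, ∀ β ∉ B, b (u + intVec β) = 0 := fun u hu β hβ =>
    hN₂ u (norm_le_of_mem_unitCube hu) β fun h => hβ (Finset.mem_union_right _ h)
  -- the functions on the torus
  have mem : ∀ {f : (Fin n → ℝ) → ℂ}, Continuous f → HasCompactSupport f →
      MemLp (fun t : UnitAddTorus (Fin n) => ∑ β ∈ B,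
        f (pt t + intVec β)) 2 volume := by
    intro f hf hf'
    obtain ⟨M, hM⟩ := hf.bounded_above_of_compact_support hf'
    refine memLp_finsetSum _ fun β _ => MemLp.of_bound (C := M) ?_ (.of_forall
      fun t => hM _)
    refine Measurable.aestronglyMeasurable ?_
    refine hf.measurable.comp (Measurable.add_const ?_ _)
    exact measurable_subtype_coe.comp (MeasurableEquiv.measurable _)
  have rep : ∀ u ∈ unitCube n, pt (fun i => (u i : UnitAddCircle)) = u := fun u hu =>
    congrArg Subtype.val ((UnitAddTorus.measurableEquivPiIoc 0).apply_symm_apply ⟨u, hu⟩)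
  have coeff : ∀ {f : (Fin n → ℝ) → ℂ} (hf : Continuous f) (hf' : HasCompactSupport f),
      (∀ u ∈ unitCube n, ∀ β ∉ B, f (u + intVec β) = 0) → ∀ α : Fin n → ℤ,
      UnitAddTorus.mFourierCoeff ((mem hf hf').toLp _) α = ∫ v, charZ (-α) v * f v := by
    intro f hf hf' hfB α
    have hint : Integrable (fun v => charZ (-α) v * f v) :=
      ((continuous_charZ _).mul hf).integrable_of_hasCompactSupport hf'.mul_left
    rw [integral_eq_sum_unitCube hint B (fun u hu β hβ => by rw [hfB u hu β hβ, mul_zero])]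
    rw [UnitAddTorus.mFourierCoeff]
    rw [integral_congr_ae (g := fun t => UnitAddTorus.mFourier (-α) t • ∑ β ∈ B,
        f (pt t + intVec β))
      (by filter_upwards [(mem hf hf').coeFn_toLp] with t ht; rw [ht])]
    rw [UnitAddTorus.integral_preimage _ (0 : Fin n → ℝ)]
    change ∫ u in unitCube n, _ = _
    rw [setIntegral_congr_fun measurableSet_unitCube (g := fun u => ∑ β ∈ B,
      charZ (-α) (u + intVec β) * f (u + intVec β))]
    · rw [integral_finsetSum]
      intro β _
      exact (hint.comp_add_right (intVec β)).integrableOn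
    · intro u hu
      simp only [rep u hu, mFourier_coe, charZ_add_int, smul_eq_mul, mul_sum]
  have P := UnitAddTorus.hasSum_prod_mFourierCoeff ((mem ha ha').toLp _) ((mem hb hb').toLp _)
  simp only [coeff ha ha' hBa, coeff hb hb' hBb] at P
  convert P using 1
  -- the integral over the torus
  obtain ⟨R, hR⟩ : ∃ R : ℕ, ∀ v, b v ≠ 0 → ‖v‖ ≤ R := by
    obtain ⟨M, hM⟩ := hb'.isCompact.isBounded.subset_closedBall 0
    obtain ⟨R, hR⟩ := exists_nat_ge M
    exact ⟨R, fun v hv => le_trans (by simpa using hM (subset_tsupport b hv)) hR⟩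
  obtain ⟨N₃, hN₃⟩ := exists_intBox_support ha' R
  have hper : ∀ v, conj (periodize a v) * b v =
      conj (∑ β ∈ intBox n N₃, a (v + intVec β)) * b v := by
    intro v
    by_cases hv : b v = 0
    · simp [hv]
    · rw [periodize, tsum_eq_sum (fun β hβ => hN₃ v (hR v hv) β hβ)]
  have hint : Integrable (fun v => conj (periodize a v) * b v) := by
    simp only [hper]
    refine Continuous.integrable_of_hasCompactSupport ?_ hb'.mul_left
    exact (Complex.continuous_conj.comp (by fun_prop)).mul hb
  rw [integral_eq_sum_unitCube hint B (fun u hu β hβ => by rw [hBb u hu β hβ, mul_zero])]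
  rw [integral_congr_ae (g := fun t => conj (∑ β ∈ B,
        a (pt t + intVec β)) * ∑ β ∈ B,
        b (pt t + intVec β))
      (by filter_upwards [(mem ha ha').coeFn_toLp, (mem hb hb').coeFn_toLp] with t h1 h2
          rw [h1, h2])]
  rw [UnitAddTorus.integral_preimage _ (0 : Fin n → ℝ)]
  change _ = ∫ u in unitCube n, _
  rw [setIntegral_congr_fun measurableSet_unitCube (g := fun u => ∑ β ∈ B,
      conj (periodize a (u + intVec β)) * b (u + intVec β))]
  · rw [integral_finsetSum]
    intro β _
    exact (hint.comp_add_right (intVec β)).integrableOn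
  · intro u hu
    simp only [rep u hu, periodize_add_int, ← mul_sum]
    rw [periodize, tsum_eq_sum (fun β hβ => hBa u hu β hβ)]

lemma integral_toLp (F : Space n → ℂ) : ∫ v : Fin n → ℝ, F (WithLp.toLp 2 v) = ∫ η, F η :=
  (PiLp.volume_preserving_toLp (Fin n)).integral_comp
    (MeasurableEquiv.toLp 2 _).measurableEmbedding F

/-- Poisson summation in bilinear form: the Fourier coefficients of `a` and `b` over the lattice
`δ ℤⁿ` correlate like `b` with the translates of `a` by `δ⁻¹ ℤⁿ`. -/
lemma hasSum_lattice_coeff {a b : Space n → ℂ} (ha : Continuous a) (hb : Continuous b)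
    (ha' : HasCompactSupport a) (hb' : HasCompactSupport b) {δ : ℝ} (hδ : 0 < δ) :
    HasSum (fun α : Fin n → ℤ =>
      conj (∫ η, Complex.exp (2 * π * I *
        ((inner ℝ (latticePt δ α) η : ℝ) : ℂ)) * a η) *
      ∫ η, Complex.exp (2 * π * I *
        ((inner ℝ (latticePt δ α) η : ℝ) : ℂ)) * b η)
      (((δ : ℂ) ^ n)⁻¹ * ∫ η, conj (∑' β : Fin n → ℤ, a (η + latticePt δ⁻¹ β)) * b η) := by
  have hδi : δ⁻¹ ≠ 0 := inv_ne_zero hδ.ne'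
  have scale : ∀ F : Space n → ℂ, ∫ v : Fin n → ℝ, F (δ⁻¹ • WithLp.toLp 2 v) =
      (δ : ℂ) ^ n * ∫ η, F η := by
    intro F
    rw [integral_toLp (fun η => F (δ⁻¹ • η)), Measure.integral_comp_smul]
    simp only [finrank_euclideanSpace, Fintype.card_fin, inv_pow, inv_inv]
    rw [abs_of_pos (by positivity)]
    rw [Complex.real_smul]
    push_cast
    rfl
  have hcont : Continuous (fun v : Fin n → ℝ => (δ⁻¹ • WithLp.toLp 2 v : Space n)) :=
    (continuous_const_smul δ⁻¹).comp (PiLp.continuous_toLp 2 _)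
  have hcs : ∀ {f : Space n → ℂ}, HasCompactSupport f →
      HasCompactSupport (fun v : Fin n → ℝ => f (δ⁻¹ • WithLp.toLp 2 v)) := by
    intro f hf
    have := hf.comp_homeomorph (((PiLp.homeomorph 2 (fun _ : Fin n => ℝ)).symm).trans
      (Homeomorph.smulOfNeZero δ⁻¹ hδi))
    exact this
  have H := hasSum_charZ_coeff (ha.comp hcont) (hb.comp hcont) (hcs ha') (hcs hb')
  have coef : ∀ (f : Space n → ℂ) (α : Fin n → ℤ),
      ∫ v : Fin n → ℝ, charZ α v * f (δ⁻¹ • WithLp.toLp 2 v) = (δ : ℂ) ^ n *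
        ∫ η, Complex.exp (2 * π * I *
        ((inner ℝ (latticePt δ α) η : ℝ) : ℂ)) * f η := by
    intro f α
    rw [← scale (fun η => Complex.exp (2 * π * I *
        ((inner ℝ (latticePt δ α) η : ℝ) : ℂ)) * f η)]
    congr 1
    ext v
    congr 2
    rw [latticePt_eq_smul, inner_smul_left, inner_smul_right]
    simp only [conj_trivial]
    rw [← mul_assoc, mul_inv_cancel₀ hδ.ne', one_mul]
    simp only [PiLp.inner_apply, latticePt, one_mul, RCLike.inner_apply, conj_trivial]
    rw [charZ]
    congr 3
    exact sum_congr rfl fun i _ => by ring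
  have per : ∀ v : Fin n → ℝ, periodize (fun v => a (δ⁻¹ • WithLp.toLp 2 v)) v =
      ∑' β : Fin n → ℤ, a (δ⁻¹ • WithLp.toLp 2 v + latticePt δ⁻¹ β) := by
    intro v
    rw [periodize]
    refine tsum_congr fun β => ?_
    congr 1
    rw [latticePt_eq_smul, ← smul_add]
    congr 1
    ext i
    simp [latticePt, intVec]
  simp only [Function.comp_def, per] at H
  rw [scale (fun η => conj (∑' β : Fin n → ℤ, a (η + latticePt δ⁻¹ β)) * b η)] at H
  have H2 := (Equiv.neg (Fin n → ℤ)).hasSum_iff.2 H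
  simp only [Function.comp_def, Equiv.neg_apply, neg_neg, coef, map_mul, map_pow,
    conj_ofReal] at H2
  have hδC : (δ : ℂ) ≠ 0 := by exact_mod_cast hδ.ne'
  have e : ∀ I J : ℂ, ((δ : ℂ) ^ n)⁻¹ * ((δ : ℂ) ^ n)⁻¹ * ((δ : ℂ) ^ n * I * ((δ : ℂ) ^ n * J)) =
      I * J := by
    intro I J
    field_simp
  have H3 := H2.mul_left (((δ : ℂ) ^ n)⁻¹ * ((δ : ℂ) ^ n)⁻¹)
  rw [← mul_assoc, mul_assoc ((δ : ℂ) ^ n)⁻¹, inv_mul_cancel₀ (pow_ne_zero n hδC), mul_one] at H3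
  simpa only [e] using H3

/-! ### Sobolev spaces as weighted `L²` spaces on the Fourier side -/

/-- The Hilbert space `L²(ℝⁿ)`. -/
abbrev L2 (n : ℕ) : Type := Lp ℂ 2 (volume : Measure (Space n))

/-- The complex valued weight `η ↦ (1 + |η|²)^{s/2}`. -/
def weight (s : ℝ) (η : Space n) : ℂ := (((1 + ‖η‖ ^ 2) ^ (s / 2) : ℝ) : ℂ)

lemma weight_eq (s : ℝ) (η : Space n) : weight s η = ((bracket η ^ s : ℝ) : ℂ) := by
  rw [weight, bracket, ← rpow_mul (by positivity)]
  congr 2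
  ring

lemma hasTemperateGrowth_weight (s : ℝ) : (weight s : Space n → ℂ).HasTemperateGrowth := by
  unfold weight
  fun_prop

lemma weight_mul_weight_neg (s : ℝ) (η : Space n) : weight s η * weight (-s) η = 1 := by
  rw [weight_eq, weight_eq, ← ofReal_mul, ← rpow_add (bracket_pos η)]
  simp

/-- The weighted Fourier transform `(1 + |η|²)^{s/2} 𝓕u` of a Schwartz function. -/
def wFourier (s : ℝ) (u : 𝓢(Space n, ℂ)) : 𝓢(Space n, ℂ) :=
  SchwartzMap.smulLeftCLM ℂ (weight s) (𝓕 u)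

lemma wFourier_apply (s : ℝ) (u : 𝓢(Space n, ℂ)) (η : Space n) :
    wFourier s u η = weight s η * (𝓕 u) η := by
  rw [wFourier, SchwartzMap.smulLeftCLM_apply_apply (hasTemperateGrowth_weight s), smul_eq_mul]

/-- The weighted Fourier transform of a Schwartz function as an element of `L²`. -/
def wFourierL2 (s : ℝ) (u : 𝓢(Space n, ℂ)) : L2 n := (wFourier s u).toLp 2

/-- The isomorphism of `L²` with `H^s` given by the weighted inverse Fourier transform. -/
def ofL2 (s : ℝ) : L2 n →L[ℂ] 𝓢'(Space n, ℂ) :=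
  (TemperedDistribution.besselPotential (Space n) ℂ (-s)) ∘L
    (Lp.toTemperedDistributionCLM ℂ volume 2) ∘L (FourierTransform.fourierInvCLM ℂ (L2 n))

lemma ofL2_apply (s : ℝ) (g : L2 n) : ofL2 s g =
    TemperedDistribution.besselPotential (Space n) ℂ (-s) (Lp.toTemperedDistribution (𝓕⁻ g)) := rfl

lemma besselPotential_ofL2 (s : ℝ) (g : L2 n) :
    TemperedDistribution.besselPotential (Space n) ℂ s (ofL2 s g) =
      Lp.toTemperedDistribution (𝓕⁻ g) := by
  rw [ofL2_apply]; simp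

lemma ofL2_mem (s : ℝ) (g : L2 n) : ofL2 s g ∈ Sobolev n s := ⟨_, besselPotential_ofL2 s g⟩

lemma toTemperedDistribution_injective :
    Function.Injective (Lp.toTemperedDistribution : L2 n → 𝓢'(Space n, ℂ)) := by
  have h := Lp.ker_toTemperedDistributionCLM_eq_bot (F := ℂ) (μ := (volume : Measure (Space n)))
    (p := 2)
  exact LinearMap.ker_eq_bot.1 h

lemma ofL2_injective (s : ℝ) : Function.Injective (ofL2 (n := n) s) := by
  intro g g' h
  have := congrArg (TemperedDistribution.besselPotential (Space n) ℂ s) h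
  rw [besselPotential_ofL2, besselPotential_ofL2] at this
  have := congrArg (𝓕 : L2 n → L2 n) (toTemperedDistribution_injective this)
  simpa using this

lemma sobolevNorm_ofL2 (s : ℝ) (g : L2 n) :
    sobolevNorm (⟨ofL2 s g, ofL2_mem s g⟩ : Sobolev n s) = ‖g‖ := by
  have h : TemperedDistribution.MemSobolev s 2 (ofL2 s g) := ofL2_mem s g
  have hc := (besselPotential_ofL2 s g).symm.trans (Classical.choose_spec h)
  have : Classical.choose h = 𝓕⁻ g := (toTemperedDistribution_injective hc).symm
  rw [sobolevNorm]
  change ‖Classical.choose h‖ = _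
  rw [this, ← Lp.norm_fourier_eq]
  simp

lemma exists_ofL2_eq {s : ℝ} (f : Sobolev n s) :
    ∃ g : L2 n, ofL2 s g = (f : 𝓢'(Space n, ℂ)) := by
  obtain ⟨F, hF⟩ := f.2
  refine ⟨𝓕 F, ?_⟩
  rw [ofL2_apply, FourierTransform.fourierInv_fourier_eq]
  exact (TemperedDistribution.besselPotential_neg_apply_eq_iff s _ _).2 hF

/-- `H^s` and `L²` are linearly isomorphic. -/
def sobolevEquiv (n : ℕ) (s : ℝ) : L2 n ≃ₗ[ℂ] Sobolev n s :=
  LinearEquiv.ofBijective ((ofL2 s).toLinearMap.codRestrict (Sobolev n s) (ofL2_mem s)) <| by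
    constructor
    · intro g g' h
      exact ofL2_injective s (congrArg Subtype.val h)
    · intro f
      obtain ⟨g, hg⟩ := exists_ofL2_eq f
      exact ⟨g, Subtype.ext hg⟩

lemma coe_sobolevEquiv (s : ℝ) (g : L2 n) :
    (sobolevEquiv n s g : 𝓢'(Space n, ℂ)) = ofL2 s g := rfl

lemma sobolevNorm_sobolevEquiv (s : ℝ) (g : L2 n) : sobolevNorm (sobolevEquiv n s g) = ‖g‖ :=
  sobolevNorm_ofL2 s g

lemma inner_toLp_left (u : 𝓢(Space n, ℂ)) (g : L2 n) :
    inner ℂ (u.toLp 2 : L2 n) g = ∫ η, conj (u η) * g η := by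
  rw [MeasureTheory.L2.inner_def]
  refine integral_congr_ae ?_
  filter_upwards [u.coeFn_toLp 2 volume] with η h
  rw [h, RCLike.inner_apply, mul_comm]

lemma fourierInv_conj (u : Space n → ℂ) (η : Space n) :
    𝓕⁻ (fun x => conj (u x)) η = conj (𝓕 u η) := by
  rw [fourierInv_eq', fourier_eq', ← integral_conj]
  congr 1
  ext x
  simp only [smul_eq_mul, map_mul, ← Complex.exp_conj, conj_ofReal, Complex.conj_I]
  congr 2
  push_cast
  ring

/-- The pairing of an element of `H^s` with a conjugate Schwartz function. -/
lemma ofL2_apply_conj (s : ℝ) (g : L2 n) (u v : 𝓢(Space n, ℂ))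
    (huv : ∀ x, v x = conj (u x)) :
    ofL2 s g v = inner ℂ (wFourierL2 (-s) u) g := by
  have h1 : ofL2 s g = 𝓕⁻ (TemperedDistribution.smulLeftCLM ℂ (weight (-s))
      (Lp.toTemperedDistribution g)) := by
    rw [ofL2_apply]
    have := TemperedDistribution.fourier_besselPotential_eq_smulLeftCLM_fourier_apply (-s)
      (Lp.toTemperedDistribution (𝓕⁻ g))
    rw [Lp.fourier_toTemperedDistribution_eq, FourierTransform.fourier_fourierInv_eq] at this
    have h2 := congrArg (𝓕⁻ : 𝓢'(Space n, ℂ) → 𝓢'(Space n, ℂ)) this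
    rw [FourierTransform.fourierInv_fourier_eq] at h2
    exact h2
  rw [h1, TemperedDistribution.fourierInv_apply, TemperedDistribution.smulLeftCLM_apply_apply,
    Lp.toTemperedDistribution_apply, wFourierL2, inner_toLp_left]
  congr 1
  ext η
  rw [SchwartzMap.smulLeftCLM_apply_apply (hasTemperateGrowth_weight _), wFourier_apply, map_mul,
    smul_eq_mul, smul_eq_mul]
  have hv : (v : Space n → ℂ) = fun x => conj (u x) := funext huv
  rw [SchwartzMap.fourierInv_coe, SchwartzMap.fourier_coe, hv, fourierInv_conj]
  congr 2
  rw [weight, conj_ofReal]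

lemma toTemperedDistribution_eq_ofL2 (s : ℝ) (u : 𝓢(Space n, ℂ)) :
    SchwartzMap.toTemperedDistributionCLM (Space n) ℂ volume u = ofL2 s (wFourierL2 s u) := by
  have h := TemperedDistribution.fourier_besselPotential_eq_smulLeftCLM_fourier_apply s
      (SchwartzMap.toTemperedDistributionCLM (Space n) ℂ volume u)
  rw [ofL2_apply]
  symm
  rw [TemperedDistribution.besselPotential_neg_apply_eq_iff]
  have h2 := congrArg (𝓕⁻ : 𝓢'(Space n, ℂ) → 𝓢'(Space n, ℂ)) h
  rw [FourierTransform.fourierInv_fourier_eq] at h2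
  rw [h2, ← Lp.fourierInv_toTemperedDistribution_eq, wFourierL2,
    Lp.toTemperedDistribution_toLp_eq]
  congr 1
  rw [TemperedDistribution.fourier_toTemperedDistributionCLM_eq, wFourier]
  ext v
  rw [TemperedDistribution.smulLeftCLM_apply_apply]
  refine (SchwartzMap.toTemperedDistributionCLM_apply_apply volume _ _).trans ?_
  refine Eq.trans ?_ (SchwartzMap.toTemperedDistributionCLM_apply_apply volume _ _).symm
  congr 1
  ext η
  rw [SchwartzMap.smulLeftCLM_apply_apply (hasTemperateGrowth_weight _)]
  erw [SchwartzMap.smulLeftCLM_apply_apply (hasTemperateGrowth_weight _)]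
  simp only [smul_eq_mul, weight]
  ring

lemma wFourier_surjective (s : ℝ) : Function.Surjective (wFourier (n := n) s) := by
  intro u
  refine ⟨𝓕⁻ (SchwartzMap.smulLeftCLM ℂ (weight (-s)) u), ?_⟩
  ext η
  rw [wFourier, FourierTransform.fourier_fourierInv_eq,
    SchwartzMap.smulLeftCLM_apply_apply (hasTemperateGrowth_weight _),
    SchwartzMap.smulLeftCLM_apply_apply (hasTemperateGrowth_weight _), smul_smul,
    weight_mul_weight_neg, one_smul]

lemma denseRange_wFourierL2 (s : ℝ) : DenseRange (wFourierL2 (n := n) s) := by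
  have h : DenseRange (SchwartzMap.toLpCLM ℝ ℂ 2 (volume : Measure (Space n))) :=
    SchwartzMap.denseRange_toLpCLM (by norm_num)
  refine h.mono ?_
  rintro _ ⟨u, rfl⟩
  obtain ⟨v, rfl⟩ := wFourier_surjective s u
  exact ⟨v, rfl⟩

/-- The continuous compactly supported elements of `L²`. -/
lemma dense_continuous_compactSupport :
    Dense {f : L2 n | ∃ g : Space n → ℂ, Continuous g ∧ HasCompactSupport g ∧ f =ᵐ[volume] g} := by
  rw [Metric.dense_iff]
  intro f r hr
  obtain ⟨g, hg, hfg, hgc, hgm⟩ := (Lp.memLp f).exists_hasCompactSupport_eLpNorm_sub_le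
    (by norm_num) (ε := ENNReal.ofReal (r / 2)) (by simpa using hr)
  refine ⟨hgm.toLp g, ?_, g, hgc, hg, hgm.coeFn_toLp⟩
  rw [Metric.mem_ball, dist_comm, dist_eq_norm, Lp.norm_def]
  have h2 : eLpNorm (⇑(f - hgm.toLp g)) 2 volume ≤ ENNReal.ofReal (r / 2) := by
    refine le_trans (le_of_eq (eLpNorm_congr_ae ?_)) hfg
    filter_upwards [Lp.coeFn_sub f (hgm.toLp g), hgm.coeFn_toLp] with x h1 h2
    rw [h1, Pi.sub_apply, Pi.sub_apply, h2]
  calc _ ≤ (ENNReal.ofReal (r / 2)).toReal := ENNReal.toReal_mono ENNReal.ofReal_ne_top h2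
    _ = r / 2 := ENNReal.toReal_ofReal (by positivity)
    _ < r := by linarith

/-! ### The frame functions on the Fourier side -/

/-- The modulus of the Fourier transform of a packet of frequency `ζ`, up to normalization. -/
def gaussHat (ζ η : Space n) : ℝ := exp (-(‖(2 * π) • η - ζ‖ ^ 2 / (4 * ‖ζ‖)))

lemma gaussHat_pos (ζ η : Space n) : 0 < gaussHat ζ η := exp_pos _

lemma gaussHat_le_one (ζ η : Space n) : gaussHat ζ η ≤ 1 := by
  rw [gaussHat, exp_le_one_iff, neg_nonpos]
  positivity

lemma continuous_gaussHat (ζ : Space n) : Continuous (gaussHat ζ) := by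
  unfold gaussHat
  fun_prop

lemma continuous_bracket : Continuous (bracket (n := n)) := by
  unfold bracket
  exact Continuous.rpow_const (by fun_prop) (fun η => Or.inl (by positivity))

/-- The lattice step of level `k`. -/
def levelStep (ε C : ℝ) (k : ℕ) : ℝ := C * (2 : ℝ) ^ (-(k : ℝ) / 2 - ε * (k : ℝ))

lemma levelStep_pos (ε : ℝ) {C : ℝ} (hC : 0 < C) (k : ℕ) : 0 < levelStep ε C k := by
  unfold levelStep; positivity

lemma sq_levelStep_mul_le {ε C : ℝ} (hε : 0 < ε) (k : ℕ) :
    levelStep ε C k ^ 2 * 2 ^ k ≤ C ^ 2 := by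
  have : ((2 : ℝ) ^ (-(k : ℝ) / 2 - ε * (k : ℝ))) ^ 2 * 2 ^ k = 2 ^ (-(2 * (ε * k))) := by
    rw [← rpow_natCast, ← rpow_mul (by norm_num), ← rpow_natCast 2 k,
      ← rpow_add (by norm_num)]
    congr 1
    push_cast
    ring
  rw [levelStep, mul_pow, mul_assoc, this]
  refine mul_le_of_le_one_right (sq_nonneg C) ?_
  exact rpow_le_one_of_one_le_of_nonpos (by norm_num) (by
    have : 0 ≤ ε * k := by positivity
    linarith)

lemma pi_div_cpow_finrank {r : ℝ} (hr : 0 ≤ r) :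
    ((π : ℂ) / r) ^ ((Module.finrank ℝ (Space n) : ℂ) / 2) = (((π / r) ^ ((n : ℝ) / 2) : ℝ) : ℂ) := by
  rw [Complex.ofReal_cpow (by positivity), finrank_euclideanSpace, Fintype.card_fin]
  push_cast
  rfl

lemma fourier_packet {δ : ℝ} (hδ : 0 < δ) (x₀ : Space n) {ζ : Space n} (hζ : ζ ≠ 0)
    (η : Space n) :
    𝓕 (packet δ x₀ ζ) η = (((δ / 2) ^ ((n : ℝ) / 2) * gaussHat ζ η : ℝ) : ℂ) *
      Complex.exp (-(2 * π * I * ((inner ℝ x₀ η : ℝ) : ℂ))) := by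
  have hr : 0 < ‖ζ‖ := norm_pos_iff.2 hζ
  set r := ‖ζ‖ with hrdef
  rw [fourier_eq', ← integral_add_right_eq_self _ x₀]
  have h := fourier_gaussian_innerProductSpace' (b := (r : ℂ)) (V := Space n)
    (by simpa using hr) ((2 * π)⁻¹ • ζ) η
  rw [fourier_eq'] at h
  have e : ∀ v : Space n, Complex.exp (((-2 * π * inner ℝ (v + x₀) η : ℝ) : ℂ) * I) •
      packet δ x₀ ζ (v + x₀) = ((((r * δ / (2 * π)) ^ ((n : ℝ) / 2) : ℝ) : ℂ) *
        Complex.exp (-(2 * π * I * ((inner ℝ x₀ η : ℝ) : ℂ)))) *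
      (Complex.exp (((-2 * π * inner ℝ v η : ℝ) : ℂ) * I) •
        Complex.exp (-(r : ℂ) * (‖v‖ : ℂ) ^ 2 + 2 * π * I *
          ((inner ℝ ((2 * π)⁻¹ • ζ) v : ℝ) : ℂ))) := by
    intro v
    rw [packet, add_sub_cancel_right, smul_eq_mul, smul_eq_mul, inner_add_left, inner_smul_left,
      ← hrdef]
    have : ∀ a b c d e : ℂ, a * (b * c) = (b * d) * e ↔ b * (a * c) = b * (d * e) := by
      intros; constructor <;> intro h <;> linear_combination h
    rw [this, ← Complex.exp_add, ← Complex.exp_add, ← Complex.exp_add]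
    congr 2
    have hp : (π : ℂ) ≠ 0 := by exact_mod_cast pi_ne_zero
    simp only [conj_trivial]
    push_cast
    field_simp
    ring
  simp only [e]
  rw [integral_const_mul, h]
  have hn : ‖(2 * π)⁻¹ • ζ - η‖ ^ 2 = (2 * π)⁻¹ ^ 2 * ‖(2 * π) • η - ζ‖ ^ 2 := by
    rw [← norm_neg, neg_sub, show η - (2 * π)⁻¹ • ζ =
      (2 * π)⁻¹ • ((2 * π) • η - ζ) by
        rw [smul_sub, smul_smul, inv_mul_cancel₀ (by positivity), one_smul], norm_smul, mul_pow,
      norm_of_nonneg (by positivity)]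
  have h1 : Complex.exp (-(π : ℂ) ^ 2 * (‖(2 * π)⁻¹ • ζ - η‖ : ℂ) ^ 2 / r) =
      ((gaussHat ζ η : ℝ) : ℂ) := by
    rw [gaussHat, Complex.ofReal_exp]
    congr 1
    have hp : (π : ℂ) ≠ 0 := by exact_mod_cast pi_ne_zero
    have hrc : (r : ℂ) ≠ 0 := by exact_mod_cast hr.ne'
    have := congrArg (fun x : ℝ => (x : ℂ)) hn
    push_cast at this ⊢
    rw [this, ← hrdef]
    field_simp
    ring
  rw [h1, pi_div_cpow_finrank hr.le]
  have h3 : (r * δ / (2 * π)) ^ ((n : ℝ) / 2) * (π / r) ^ ((n : ℝ) / 2) =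
      (δ / 2) ^ ((n : ℝ) / 2) := by
    rw [← mul_rpow (by positivity) (by positivity)]
    congr 1
    field_simp
  rw [← h3]
  push_cast
  ring

/-- The weight `(1 + |η|²)^{s/2}` in units of the dyadic level `k`. -/
def levelWeight (k : ℕ) (s : ℝ) (η : Space n) : ℝ := (bracket η / 2 ^ k) ^ s

lemma levelWeight_pos (k : ℕ) (s : ℝ) (η : Space n) : 0 < levelWeight k s η :=
  rpow_pos_of_pos (div_pos (bracket_pos η) (by positivity)) _

lemma continuous_levelWeight (k : ℕ) (s : ℝ) : Continuous (levelWeight (n := n) k s) := by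
  unfold levelWeight
  exact Continuous.rpow_const (continuous_bracket.div_const _)
    (fun η => Or.inl (div_pos (bracket_pos η) (by positivity)).ne')

lemma bracket_rpow_eq (k : ℕ) (s : ℝ) (η : Space n) :
    bracket η ^ s = ((2 : ℝ) ^ k) ^ s * levelWeight k s η := by
  rw [levelWeight, ← mul_rpow (by positivity) (div_pos (bracket_pos η) (by positivity)).le,
    mul_div_cancel₀ _ (by positivity)]

/-- The lattice Fourier coefficients of `levelWeight k s * gaussHat ζ * g`. -/
def latticeCoeff (ε C : ℝ) (k : ℕ) (s : ℝ) (ζ : Space n) (g : Space n → ℂ) (α : Fin n → ℤ) : ℂ :=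
  ∫ η, Complex.exp (2 * π * I *
    ((inner ℝ (latticePt (levelStep ε C k) α) η : ℝ) : ℂ)) *
    (((levelWeight k s η * gaussHat ζ η : ℝ) : ℂ) * g η)

variable {Λ : FrequencyLattice n}

lemma FrameIndex.norm_freq_mem (γ : FrameIndex Λ) :
    (2 : ℝ) ^ γ.k / 2 ≤ ‖γ.freq‖ ∧ ‖γ.freq‖ < 2 ^ γ.k := (Λ.separated γ.k).1 _ γ.mem

/-- The frame functions as elements of the weighted `L²` space on the Fourier side. -/
def frameVec (ε C s : ℝ) (γ : FrameIndex Λ) : L2 n := wFourierL2 s (γ.frameFun ε C)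

lemma inner_frameVec (ε : ℝ) {C : ℝ} (hC : 0 < C) (s : ℝ) (γ : FrameIndex Λ) (g : L2 n)
    {g' : Space n → ℂ} (hg : g =ᵐ[volume] g') :
    inner ℂ (frameVec ε C s γ) g = (((((2 : ℝ) ^ γ.k) ^ s *
      (levelStep ε C γ.k / 2) ^ ((n : ℝ) / 2) : ℝ)) : ℂ) *
      latticeCoeff ε C γ.k s γ.freq g' γ.pos := by
  rw [frameVec, wFourierL2, inner_toLp_left, latticeCoeff, ← integral_const_mul]
  refine integral_congr_ae ?_
  filter_upwards [hg] with η h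
  rw [h, wFourier_apply, SchwartzMap.fourier_coe]
  have := fourier_packet (levelStep_pos ε hC γ.k) (γ.centre ε C) γ.freq_ne_zero η
  have e : ⇑(γ.frameFun ε C) = packet (levelStep ε C γ.k) (γ.centre ε C) γ.freq := rfl
  rw [e, this, weight_eq, bracket_rpow_eq γ.k]
  simp only [map_mul, conj_ofReal, ← Complex.exp_conj, map_neg, Complex.conj_I,
    map_ofNat]
  have e2 : γ.centre ε C = latticePt (levelStep ε C γ.k) γ.pos := rfl
  rw [e2]
  push_cast
  ring_nf

/-! ### Cross terms of the Poisson summation -/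

lemma gaussHat_translate_le {ζ : Space n} (hζ : ζ ≠ 0) (η L : Space n) :
    gaussHat ζ (η + L) * gaussHat ζ η ≤ exp (-(‖(2 * π) • L‖ ^ 2 / (16 * ‖ζ‖))) *
      (gaussHat ζ (η + L) ^ (1 / 2 : ℝ) * gaussHat ζ η ^ (1 / 2 : ℝ)) := by
  have hr : 0 < ‖ζ‖ := norm_pos_iff.2 hζ
  unfold gaussHat
  rw [← exp_mul, ← exp_mul, ← exp_add, ← exp_add, ← exp_add,
    exp_le_exp]
  set u := (2 * π) • (η + L) - ζ with hu
  set v := (2 * π) • η - ζ with hv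
  have huv : (2 * π) • L = u - v := by rw [hu, hv]; module
  have h1 : ‖u - v‖ ^ 2 ≤ 2 * (‖u‖ ^ 2 + ‖v‖ ^ 2) := by
    have := norm_sub_le u v
    nlinarith [sq_nonneg (‖u‖ - ‖v‖), norm_nonneg (u - v), norm_nonneg u, norm_nonneg v]
  rw [huv]
  have h2 : ‖u - v‖ ^ 2 / (16 * ‖ζ‖) ≤ 2 * (‖u‖ ^ 2 + ‖v‖ ^ 2) / (16 * ‖ζ‖) := by gcongr
  have h3 : 2 * (‖u‖ ^ 2 + ‖v‖ ^ 2) / (16 * ‖ζ‖) =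
    ‖u‖ ^ 2 / (4 * ‖ζ‖) * (1 / 2) + ‖v‖ ^ 2 / (4 * ‖ζ‖) * (1 / 2) := by field_simp; ring
  linarith

/-- The energy of `g` near the frequency `ζ`. -/
def localEnergy (k : ℕ) (s : ℝ) (ζ : Space n) (g : Space n → ℂ) : ℝ :=
  ∫ η, levelWeight k (2 * s) η * gaussHat ζ η * ‖g η‖ ^ 2

lemma hasCompactSupport_mul_normSq {g : Space n → ℂ} (hg : HasCompactSupport g)
    (f : Space n → ℝ) : HasCompactSupport (fun η => f η * ‖g η‖ ^ 2) := by
  refine HasCompactSupport.mul_left (f := f) ?_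
  exact hg.comp_left (g := fun z : ℂ => ‖z‖ ^ 2) (by simp)

lemma integrable_localEnergy (k : ℕ) (s : ℝ) (ζ : Space n) {g : Space n → ℂ} (hg : Continuous g)
    (hg' : HasCompactSupport g) :
    Integrable (fun η => levelWeight k (2 * s) η * gaussHat ζ η * ‖g η‖ ^ 2) := by
  refine Continuous.integrable_of_hasCompactSupport ?_ (hasCompactSupport_mul_normSq hg' _)
  exact ((continuous_levelWeight k _).mul (continuous_gaussHat ζ)).mul (hg.norm.pow 2)

lemma norm_integral_cross_le (k : ℕ) (s s' : ℝ) {ζ : Space n} (hζ : ζ ≠ 0) {g h : Space n → ℂ}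
    (hg : Continuous g) (hg' : HasCompactSupport g) (hh : Continuous h) (hh' : HasCompactSupport h)
    (L : Space n) :
    ‖∫ η, conj (((levelWeight k s (η + L) * gaussHat ζ (η + L) : ℝ) : ℂ) * h (η + L)) *
      (((levelWeight k s' η * gaussHat ζ η : ℝ) : ℂ) * g η)‖ ≤
      exp (-(‖(2 * π) • L‖ ^ 2 / (16 * ‖ζ‖))) *
        ((localEnergy k s ζ h + localEnergy k s' ζ g) / 2) := by
  set E := exp (-(‖(2 * π) • L‖ ^ 2 / (16 * ‖ζ‖))) with hE
  set fh : Space n → ℝ := fun η => levelWeight k (2 * s) η * gaussHat ζ η * ‖h η‖ ^ 2 with hfh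
  set fg : Space n → ℝ := fun η => levelWeight k (2 * s') η * gaussHat ζ η * ‖g η‖ ^ 2 with hfg
  have ih : Integrable fh := integrable_localEnergy k s ζ hh hh'
  have ig : Integrable fg := integrable_localEnergy k s' ζ hg hg'
  have ih' : Integrable (fun η => fh (η + L)) := ih.comp_add_right L
  have sq : ∀ (t : ℝ) (η : Space n) (z : ℂ), (levelWeight k t η * gaussHat ζ η ^ (1 / 2 : ℝ) *
      ‖z‖) ^ 2 = levelWeight k (2 * t) η * gaussHat ζ η * ‖z‖ ^ 2 := by
    intro t η z
    rw [mul_pow, mul_pow, levelWeight, levelWeight, ← rpow_mul_natCast (gaussHat_pos _ _).le,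
      ← rpow_mul_natCast (div_pos (bracket_pos η) (by positivity)).le]
    norm_num
    rw [mul_comm t 2]
    simp
  calc _ ≤ ∫ η, E * ((fh (η + L) + fg η) / 2) := by
        refine norm_integral_le_of_norm_le (((ih'.add ig).div_const 2).const_mul E)
          (.of_forall fun η => ?_)
        rw [norm_mul, RCLike.norm_conj, norm_mul, norm_mul, norm_real, norm_real,
          norm_of_nonneg (mul_pos (levelWeight_pos _ _ _) (gaussHat_pos _ _)).le,
          norm_of_nonneg (mul_pos (levelWeight_pos _ _ _) (gaussHat_pos _ _)).le]
        have h1 := gaussHat_translate_le hζ η L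
        have h2 : fh (η + L) = _ := (sq s (η + L) (h (η + L))).symm
        have h3 : fg η = _ := (sq s' η (g η)).symm
        have hW : 0 ≤ levelWeight k s (η + L) * ‖h (η + L)‖ * (levelWeight k s' η * ‖g η‖) := by
          have := (levelWeight_pos k s (η + L)).le
          have := (levelWeight_pos k s' η).le
          positivity
        rw [h2, h3]
        set a := gaussHat ζ (η + L) ^ (1 / 2 : ℝ)
        set b := gaussHat ζ η ^ (1 / 2 : ℝ)
        calc _ = levelWeight k s (η + L) * ‖h (η + L)‖ * (levelWeight k s' η * ‖g η‖) *
              (gaussHat ζ (η + L) * gaussHat ζ η) := by ring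
          _ ≤ levelWeight k s (η + L) * ‖h (η + L)‖ * (levelWeight k s' η * ‖g η‖) *
              (E * (a * b)) := mul_le_mul_of_nonneg_left h1 hW
          _ = E * ((levelWeight k s (η + L) * a * ‖h (η + L)‖) *
              (levelWeight k s' η * b * ‖g η‖)) := by ring
          _ ≤ _ := by
            refine mul_le_mul_of_nonneg_left ?_ (exp_pos _).le
            nlinarith [sq_nonneg (levelWeight k s (η + L) * a * ‖h (η + L)‖ -
              levelWeight k s' η * b * ‖g η‖)]
    _ = _ := by
        rw [integral_const_mul, integral_div, integral_add ih' ig, integral_add_right_eq_self fh L]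
        rfl

lemma exists_finset_integral_conj_tsum {a b : Space n → ℂ} (ha : Continuous a) (hb : Continuous b)
    (ha' : HasCompactSupport a) (hb' : HasCompactSupport b) {ρ : ℝ} (hρ : 0 < ρ) :
    ∃ B : Finset (Fin n → ℤ), 0 ∈ B ∧
      ∫ η, conj (∑' β : Fin n → ℤ, a (η + latticePt ρ β)) * b η =
        ∑ β ∈ B, ∫ η, conj (a (η + latticePt ρ β)) * b η := by
  obtain ⟨R₁, h₁⟩ := ha'.isCompact.isBounded.exists_norm_le
  obtain ⟨R₂, h₂⟩ := hb'.isCompact.isBounded.exists_norm_le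
  obtain ⟨N, hN⟩ := exists_nat_ge ((R₁ + R₂) / ρ)
  have hz : ∀ β ∉ intBox n N, ∀ η, b η ≠ 0 → a (η + latticePt ρ β) = 0 := by
    intro β hβ η hη
    by_contra hne
    apply hβ
    rw [mem_intBox]
    intro i
    have e1 := h₁ _ (subset_tsupport _ hne)
    have e2 := h₂ _ (subset_tsupport _ hη)
    have e3 : ‖latticePt ρ β‖ ≤ R₁ + R₂ := by
      calc _ = ‖(η + latticePt ρ β) - η‖ := by rw [add_sub_cancel_left]
        _ ≤ _ := (norm_sub_le _ _).trans (add_le_add e1 e2)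
    rw [latticePt_eq_smul, norm_smul, norm_of_nonneg hρ.le] at e3
    have e4 := abs_coord_le (latticePt 1 β) i
    have e6 : (latticePt 1 β) i = β i := by simp [latticePt]
    rw [e6] at e4
    have e5 : ‖latticePt 1 β‖ ≤ (R₁ + R₂) / ρ := by
      rw [le_div_iff₀ hρ]; linarith
    have : |(β i : ℝ)| ≤ N := e4.trans (e5.trans hN)
    exact_mod_cast this
  refine ⟨intBox n N, by simp [mem_intBox], ?_⟩
  rw [← integral_finsetSum]
  · congr 1
    ext η
    by_cases hη : b η = 0
    · simp [hη]
    · rw [tsum_eq_sum (fun β hβ => hz β hβ η hη), map_sum, sum_mul]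
  · intro β _
    refine Continuous.integrable_of_hasCompactSupport ?_ hb'.mul_left
    exact (Complex.continuous_conj.comp (by fun_prop)).mul hb

lemma exists_sum_dual_lattice_le (n : ℕ) : ∃ D : ℝ, 0 < D ∧ ∀ (B : Finset (Fin n → ℤ)) (C δ r : ℝ),
    0 < C → C ≤ 1 → 0 < δ → 0 < r → δ ^ 2 * r ≤ C ^ 2 →
      ∑ β ∈ B.erase 0, exp (-(‖(2 * π) • latticePt δ⁻¹ β‖ ^ 2 / (16 * r))) ≤ D * C ^ 2 := by
  obtain ⟨D, hD, h⟩ := exists_sum_lattice_le n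
  refine ⟨D * exp (1 * 1 ^ 2 / 2) * (((1 : ℝ) * 1 ^ 2) ^ ((n : ℝ) / 2))⁻¹, by positivity,
    fun B C δ r hC hC1 hδ hr hδr => ?_⟩
  have key : ∀ β ∈ B.erase 0,
      exp (-(‖(2 * π) • latticePt δ⁻¹ β‖ ^ 2 / (16 * r))) ≤
        C ^ 2 * exp (-(1 * ‖0 - latticePt 1 β‖ ^ 2)) := by
    intro β hβ
    have hb := one_le_norm_latticePt_one (Finset.ne_of_mem_erase hβ)
    have h1 : 1 / C ^ 2 + ‖latticePt 1 β‖ ^ 2 ≤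
        ‖(2 * π) • latticePt δ⁻¹ β‖ ^ 2 / (16 * r) := by
      rw [latticePt_eq_smul δ⁻¹, norm_smul, norm_smul, norm_of_nonneg (by positivity),
        norm_of_nonneg (by positivity)]
      have e : (2 * π * (δ⁻¹ * ‖latticePt 1 β‖)) ^ 2 / (16 * r) =
        π ^ 2 / 4 * ‖latticePt 1 β‖ ^ 2 * (1 / (δ ^ 2 * r)) := by field_simp; ring
      have e2 : 1 / C ^ 2 ≤ 1 / (δ ^ 2 * r) := one_div_le_one_div_of_le (by positivity) hδr
      have e3 : 1 ≤ 1 / C ^ 2 := by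
        rw [le_div_iff₀ (by positivity)]; nlinarith
      have e4 : 2 ≤ π ^ 2 / 4 := by nlinarith [pi_gt_three]
      rw [e]
      set B2 := ‖latticePt 1 β‖ ^ 2 with hB2
      have hB1 : 1 ≤ B2 := by rw [hB2]; nlinarith
      set X := 1 / C ^ 2
      set Y := 1 / (δ ^ 2 * r)
      have : 2 * B2 * X ≤ π ^ 2 / 4 * B2 * Y := by gcongr
      nlinarith
    rw [one_mul, zero_sub, norm_neg]
    calc _ ≤ exp (-(1 / C ^ 2 + ‖latticePt 1 β‖ ^ 2)) := exp_le_exp.2 (by linarith)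
      _ = exp (-(1 / C ^ 2)) * exp (-‖latticePt 1 β‖ ^ 2) := by
          rw [neg_add, exp_add]
      _ ≤ _ := by
          gcongr
          rw [exp_neg]
          have := add_one_le_exp (1 / C ^ 2)
          have h3 : 1 / C ^ 2 ≤ exp (1 / C ^ 2) := by linarith
          calc (exp (1 / C ^ 2))⁻¹ ≤ (1 / C ^ 2)⁻¹ := inv_anti₀ (by positivity) h3
            _ = C ^ 2 := by simp
  calc _ ≤ ∑ β ∈ B.erase 0, C ^ 2 * exp (-(1 * ‖0 - latticePt 1 β‖ ^ 2)) :=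
        sum_le_sum key
    _ = C ^ 2 * ∑ β ∈ B.erase 0, exp (-(1 * ‖0 - latticePt 1 β‖ ^ 2)) := by
        rw [← mul_sum]
    _ ≤ _ := by
        rw [mul_comm]
        exact mul_le_mul_of_nonneg_right (h (B.erase 0) 1 1 one_pos one_pos 0) (by positivity)

lemma localEnergy_nonneg (k : ℕ) (s : ℝ) (ζ : Space n) (g : Space n → ℂ) :
    0 ≤ localEnergy k s ζ g :=
  integral_nonneg fun η => mul_nonneg
    (mul_pos (levelWeight_pos _ _ _) (gaussHat_pos _ _)).le (sq_nonneg _)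

/-- The correlation of the lattice coefficients of two functions is diagonal on the Fourier side
up to an error which is small for a fine lattice. -/
lemma exists_lattice_correlation (n : ℕ) : ∃ D : ℝ, 0 < D ∧
    ∀ (ε C : ℝ), 0 < ε → 0 < C → C ≤ 1 → ∀ (k : ℕ) (ζ : Space n), ζ ≠ 0 → ‖ζ‖ < 2 ^ k →
    ∀ (s s' : ℝ) (g h : Space n → ℂ), Continuous g → HasCompactSupport g → Continuous h →
      HasCompactSupport h →
    ∃ V : ℂ, HasSum (fun α => (((levelStep ε C k / 2) ^ ((n : ℝ) / 2) : ℝ) : ℂ) ^ 2 *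
        (conj (latticeCoeff ε C k s ζ h α) * latticeCoeff ε C k s' ζ g α)) V ∧
      ‖V - ((2 : ℂ) ^ n)⁻¹ * ∫ η, ((levelWeight k s η * levelWeight k s' η * gaussHat ζ η ^ 2 : ℝ) : ℂ)
        * (conj (h η) * g η)‖ ≤
      D * C ^ 2 * ((localEnergy k s ζ h + localEnergy k s' ζ g) / 2) := by
  obtain ⟨D, hD, hsum⟩ := exists_sum_dual_lattice_le n
  refine ⟨D, hD, ?_⟩
  intro ε C hε hC hC1 k ζ hζ hζk s s' g h hg hg' hh hh'
  have hr : 0 < ‖ζ‖ := norm_pos_iff.2 hζ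
  set δ := levelStep ε C k with hδdef
  have hδ : 0 < δ := levelStep_pos ε hC k
  have cont : ∀ t {f : Space n → ℂ}, Continuous f →
      Continuous (fun η => ((levelWeight k t η * gaussHat ζ η : ℝ) : ℂ) * f η) := fun t _ hf =>
    (continuous_ofReal.comp ((continuous_levelWeight k t).mul (continuous_gaussHat ζ))).mul hf
  have H := hasSum_lattice_coeff (cont s hh) (cont s' hg) hh'.mul_left hg'.mul_left hδ
  obtain ⟨B, hB0, hB⟩ := exists_finset_integral_conj_tsum (cont s hh) (cont s' hg)
    hh'.mul_left hg'.mul_left (inv_pos.2 hδ)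
  rw [hB] at H
  have hδ2 : (((δ / 2) ^ ((n : ℝ) / 2) : ℝ) : ℂ) ^ 2 = (δ : ℂ) ^ n * ((2 : ℂ) ^ n)⁻¹ := by
    rw [← Complex.ofReal_pow, ← rpow_mul_natCast (by positivity)]
    rw [show (n : ℝ) / 2 * (2 : ℕ) = n by push_cast; ring, rpow_natCast, div_pow]
    push_cast
    rw [div_eq_mul_inv]
  refine ⟨_, H.mul_left _, ?_⟩
  have hδC : (δ : ℂ) ^ n ≠ 0 := pow_ne_zero _ (by exact_mod_cast hδ.ne')
  rw [hδ2, ← mul_assoc, mul_right_comm ((δ : ℂ) ^ n), mul_inv_cancel₀ hδC, one_mul, ← mul_sub]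
  -- the term `β = 0` is the diagonal part, the other terms are the error
  rw [← Finset.add_sum_erase B _ hB0]
  have h0 : latticePt (n := n) δ⁻¹ 0 = 0 := by ext i; simp [latticePt]
  have hz : ∫ η, conj (((levelWeight k s (η + latticePt δ⁻¹ 0) *
      gaussHat ζ (η + latticePt δ⁻¹ 0) : ℝ) : ℂ) * h (η + latticePt δ⁻¹ 0)) *
      (((levelWeight k s' η * gaussHat ζ η : ℝ) : ℂ) * g η) =
      ∫ η, ((levelWeight k s η * levelWeight k s' η * gaussHat ζ η ^ 2 : ℝ) : ℂ)
        * (conj (h η) * g η) := by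
    congr 1
    ext η
    rw [h0, add_zero, map_mul, conj_ofReal]
    push_cast
    ring
  rw [hz, add_sub_cancel_left, norm_mul]
  have h2n : ‖((2 : ℂ) ^ n)⁻¹‖ ≤ 1 := by
    rw [norm_inv, norm_pow, Complex.norm_ofNat]
    exact inv_le_one_of_one_le₀ (one_le_pow₀ (by norm_num))
  have hE : 0 ≤ (localEnergy k s ζ h + localEnergy k s' ζ g) / 2 := by
    have := localEnergy_nonneg k s ζ h
    have := localEnergy_nonneg k s' ζ g
    positivity
  calc _ ≤ 1 * ∑ β ∈ B.erase 0, exp (-(‖(2 * π) • latticePt δ⁻¹ β‖ ^ 2 / (16 * ‖ζ‖))) *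
        ((localEnergy k s ζ h + localEnergy k s' ζ g) / 2) := by
        refine mul_le_mul h2n ((norm_sum_le _ _).trans (sum_le_sum fun β _ => ?_))
          (norm_nonneg _) zero_le_one
        exact norm_integral_cross_le k s s' hζ hg hg' hh hh' _
    _ ≤ _ := by
        rw [one_mul, ← sum_mul]
        refine mul_le_mul_of_nonneg_right ?_ hE
        refine hsum B C δ ‖ζ‖ hC hC1 hδ hr (le_trans ?_ (sq_levelStep_mul_le (C := C) hε k))
        gcongr

/-! ### The frame property -/

lemma forall_of_dense {X : Type*} [TopologicalSpace X] {s : Set X} (hs : Dense s) {P : X → Prop}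
    (hP : IsClosed {x | P x}) (h : ∀ x ∈ s, P x) (x : X) : P x :=
  hP.closure_subset_iff.2 h (hs x)

lemma norm_sq_L2_eq (g : L2 n) {g' : Space n → ℂ} (hg : g =ᵐ[volume] g') :
    ‖g‖ ^ 2 = ∫ η, ‖g' η‖ ^ 2 := by
  have h := inner_self_eq_norm_sq_to_K (𝕜 := ℂ) g
  rw [MeasureTheory.L2.inner_def] at h
  have e : ∫ η, inner ℂ (g η) (g η) = ((∫ η, ‖g' η‖ ^ 2 : ℝ) : ℂ) := by
    rw [← integral_complex_ofReal]
    refine integral_congr_ae ?_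
    filter_upwards [hg] with η h
    rw [h]
    have := inner_self_eq_norm_sq_to_K (𝕜 := ℂ) (g' η)
    rw [this]
    push_cast
    rfl
  rw [e] at h
  refine Complex.ofReal_injective (Eq.trans ?_ h.symm)
  push_cast
  rfl

lemma inner_L2_eq (h g : L2 n) {h' g' : Space n → ℂ} (hh : h =ᵐ[volume] h')
    (hg : g =ᵐ[volume] g') : inner ℂ h g = ∫ η, conj (h' η) * g' η := by
  rw [MeasureTheory.L2.inner_def]
  refine integral_congr_ae ?_
  filter_upwards [hh, hg] with η h1 h2
  rw [h1, h2, RCLike.inner_apply, mul_comm]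

section Hilbert

variable {H ι : Type*} [NormedAddCommGroup H] [InnerProductSpace ℂ H]

/-- The synthesis bound dual to a weighted Bessel inequality. -/
lemma norm_sum_smul_sq_le {e : ι → H} {w : ι → ℝ} (hw : ∀ i, 0 < w i) {K : ℝ} (hK : 0 ≤ K)
    {S : Finset ι} (hB : ∀ g : H, ∑ i ∈ S, ((w i)⁻¹ * ‖inner ℂ (e i) g‖) ^ 2 ≤ K * ‖g‖ ^ 2)
    (c : ι → ℂ) : ‖∑ i ∈ S, c i • e i‖ ^ 2 ≤ K * ∑ i ∈ S, (w i * ‖c i‖) ^ 2 := by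
  set v := ∑ i ∈ S, c i • e i with hv
  have hA : 0 ≤ ∑ i ∈ S, (w i * ‖c i‖) ^ 2 := sum_nonneg fun i _ => sq_nonneg _
  have h1 : ‖v‖ ^ 2 ≤ ∑ i ∈ S, (w i * ‖c i‖) * ((w i)⁻¹ * ‖inner ℂ (e i) v‖) := by
    have : ‖v‖ ^ 2 = ‖inner ℂ v v‖ := by
      rw [inner_self_eq_norm_sq_to_K, norm_pow, RCLike.norm_ofReal, abs_of_nonneg (norm_nonneg _)]
    rw [this]
    conv_lhs => rw [hv, sum_inner]
    refine (norm_sum_le _ _).trans (sum_le_sum fun i _ => ?_)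
    rw [inner_smul_left, norm_mul, RCLike.norm_conj]
    have := (hw i).ne'
    rw [← hv]
    exact le_of_eq (by field_simp)
  have h2 := Finset.sum_mul_sq_le_sq_mul_sq S (fun i => w i * ‖c i‖)
    (fun i => (w i)⁻¹ * ‖inner ℂ (e i) v‖)
  have h3 : (‖v‖ ^ 2) ^ 2 ≤ (∑ i ∈ S, (w i * ‖c i‖) ^ 2) * (K * ‖v‖ ^ 2) :=
    (pow_le_pow_left₀ (sq_nonneg _) h1 2).trans (h2.trans (mul_le_mul_of_nonneg_left (hB v) hA))
  by_cases h0 : ‖v‖ ^ 2 = 0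
  · rw [h0]; positivity
  · have : 0 < ‖v‖ ^ 2 := lt_of_le_of_ne (sq_nonneg _) (Ne.symm h0)
    nlinarith

/-- A synthesis bound gives convergence for square summable coefficients. -/
lemma summable_smul_of_sq [CompleteSpace H] {e : ι → H} {w : ι → ℝ} {K : ℝ} (hK : 0 ≤ K)
    {c : ι → ℂ} (hB : ∀ S : Finset ι, ‖∑ i ∈ S, c i • e i‖ ^ 2 ≤ K * ∑ i ∈ S, (w i * ‖c i‖) ^ 2)
    (hc : Summable fun i => (w i * ‖c i‖) ^ 2) : Summable fun i => c i • e i := by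
  rw [summable_iff_vanishing_norm] at hc ⊢
  intro ε hε
  obtain ⟨s, hs⟩ := hc (ε ^ 2 / (K + 1)) (by positivity)
  refine ⟨s, fun t ht => ?_⟩
  have h1 := hs t ht
  rw [norm_of_nonneg (sum_nonneg fun i _ => sq_nonneg _), lt_div_iff₀ (by positivity)]
    at h1
  have h2 := hB t
  have h3 : 0 ≤ ∑ i ∈ t, (w i * ‖c i‖) ^ 2 := sum_nonneg fun i _ => sq_nonneg _
  refine lt_of_pow_lt_pow_left₀ 2 hε.le ?_
  nlinarith

lemma norm_tsum_smul_sq_le {e : ι → H} {w : ι → ℝ} {K : ℝ} (hK : 0 ≤ K)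
    {c : ι → ℂ} (hB : ∀ S : Finset ι, ‖∑ i ∈ S, c i • e i‖ ^ 2 ≤ K * ∑ i ∈ S, (w i * ‖c i‖) ^ 2)
    {M : ℝ} (hM : ∀ S : Finset ι, ∑ i ∈ S, (w i * ‖c i‖) ^ 2 ≤ M) {v : H}
    (hv : HasSum (fun i => c i • e i) v) : ‖v‖ ^ 2 ≤ K * M := by
  have h1 : Filter.Tendsto (fun S : Finset ι => ‖∑ i ∈ S, c i • e i‖ ^ 2) Filter.atTop
      (nhds (‖v‖ ^ 2)) := (Filter.Tendsto.norm hv).pow 2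
  exact le_of_tendsto h1 (.of_forall fun S =>
    (hB S).trans (mul_le_mul_of_nonneg_left (hM S) hK))

/-- An operator close to a positive multiple of the identity is invertible. -/
lemma bijective_of_norm_sub_le [CompleteSpace H] (A : H →L[ℂ] H) {c κ : ℝ}
    (hκc : κ < c) (hκ : 0 ≤ κ) (h : ∀ g, ‖(c : ℂ) • g - A g‖ ≤ κ * ‖g‖) :
    Function.Bijective A ∧ ∀ g, (c - κ) * ‖g‖ ≤ ‖A g‖ := by
  have hc : 0 < c := hκ.trans_lt hκc
  have hcC : (c : ℂ) ≠ 0 := by exact_mod_cast hc.ne'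
  constructor
  · set x : H →L[ℂ] H := 1 - (c : ℂ)⁻¹ • A with hx
    have hxn : ‖x‖ < 1 := by
      have : ‖x‖ ≤ κ / c := by
        refine ContinuousLinearMap.opNorm_le_bound _ (by positivity) fun g => ?_
        have e : x g = (c : ℂ)⁻¹ • ((c : ℂ) • g - A g) := by
          rw [smul_sub, smul_smul, inv_mul_cancel₀ hcC, one_smul]; rfl
        rw [e, norm_smul, norm_inv, norm_real, norm_of_nonneg hc.le, div_mul_eq_mul_div,
          inv_mul_eq_div]
        gcongr
        exact h g
      exact this.trans_lt ((div_lt_one hc).2 hκc)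
    have hu := isUnit_one_sub_of_norm_lt_one hxn
    have e : A = (c : ℂ) • (1 - x) := by
      rw [hx, sub_sub_cancel, smul_smul, mul_inv_cancel₀ hcC, one_smul]
    have hb := (ContinuousLinearMap.isUnit_iff_bijective).1 hu
    rw [e]
    exact (MulAction.bijective₀ hcC).comp hb
  · intro g
    have h1 := h g
    have h2 := norm_sub_norm_le ((c : ℂ) • g) (A g)
    rw [norm_smul, norm_real, norm_of_nonneg hc.le] at h2
    linarith

end Hilbert

lemma levelWeight_zero (k : ℕ) (η : Space n) : levelWeight k 0 η = 1 := by simp [levelWeight]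

lemma gaussHat_le (η : Space n) {ζ : Space n} {k : ℕ} (hζ : ζ ≠ 0) (h : ‖ζ‖ < 2 ^ k) :
    gaussHat ζ η ≤ exp (-(1 / 4 * ((2 : ℝ) ^ k)⁻¹ * ‖(2 * π) • η - ζ‖ ^ 2)) := by
  have hr : 0 < ‖ζ‖ := norm_pos_iff.2 hζ
  rw [gaussHat, exp_le_exp, neg_le_neg_iff]
  calc _ = ‖(2 * π) • η - ζ‖ ^ 2 / (4 * 2 ^ k) := by field_simp
    _ ≤ _ := by gcongr

lemma levelWeight_le {s M : ℝ} (hs : |s| ≤ M) (k : ℕ) (η : Space n) :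
    levelWeight k s η ≤ levelWeight k M η + levelWeight k (-M) η := by
  have hx : 0 < bracket η / 2 ^ k := div_pos (bracket_pos η) (by positivity)
  have h := abs_le.1 hs
  unfold levelWeight
  rcases le_total 1 (bracket η / 2 ^ k) with h1 | h1
  · have := rpow_le_rpow_of_exponent_le h1 h.2
    have := rpow_nonneg hx.le (-M)
    linarith
  · have := rpow_le_rpow_of_exponent_ge hx h1 h.1
    have := rpow_nonneg hx.le M
    linarith

lemma exists_sum_levelWeight_le (n : ℕ) (M : ℝ) : ∃ D : ℝ, 0 < D ∧
    ∀ (Λ : FrequencyLattice n) (s : ℝ), |s| ≤ M → ∀ (S : Finset ℕ) (η : Space n),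
      ∑ k ∈ S, ∑ ζ ∈ Λ.pts k, levelWeight k s η * gaussHat ζ η ≤ D := by
  obtain ⟨D₁, hD₁, h₁⟩ := exists_sum_all_freq_le n (c := 1 / 4) (by norm_num) M
  obtain ⟨D₂, hD₂, h₂⟩ := exists_sum_all_freq_le n (c := 1 / 4) (by norm_num) (-M)
  refine ⟨D₁ + D₂, by positivity, fun Λ s hs S η => ?_⟩
  refine le_trans ?_ (add_le_add (h₁ Λ S η) (h₂ Λ S η))
  rw [← sum_add_distrib]
  refine sum_le_sum fun k _ => ?_
  rw [← sum_add_distrib]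
  refine sum_le_sum fun ζ hζ => ?_
  have hm := (Λ.separated k).1 ζ hζ
  have h0 : ζ ≠ 0 := norm_pos_iff.1 (lt_of_lt_of_le (by positivity) hm.1)
  rw [← add_mul]
  exact mul_le_mul (levelWeight_le hs k η) (gaussHat_le η h0 hm.2) (gaussHat_pos _ _).le
    (add_pos (levelWeight_pos _ _ _) (levelWeight_pos _ _ _)).le

lemma FrequencyLattice.ne_zero (Λ : FrequencyLattice n) {k : ℕ} {ζ : Space n} (h : ζ ∈ Λ.pts k) :
    ζ ≠ 0 :=
  norm_pos_iff.1 (lt_of_lt_of_le (by positivity) ((Λ.separated k).1 ζ h).1)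

lemma integrable_normSq {g : Space n → ℂ} (hg : Continuous g) (hg' : HasCompactSupport g) :
    Integrable (fun η => ‖g η‖ ^ 2) :=
  Continuous.integrable_of_hasCompactSupport (hg.norm.pow 2)
    (by simpa using hasCompactSupport_mul_normSq hg' (fun _ => 1))

lemma exists_sum_localEnergy_le (n : ℕ) (M : ℝ) : ∃ D : ℝ, 0 < D ∧
    ∀ (Λ : FrequencyLattice n) (s : ℝ), |s| ≤ M → ∀ (S : Finset ℕ) (g : Space n → ℂ),
      Continuous g → HasCompactSupport g →
      ∑ k ∈ S, ∑ ζ ∈ Λ.pts k, localEnergy k s ζ g ≤ D * ∫ η, ‖g η‖ ^ 2 := by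
  obtain ⟨D, hD, h⟩ := exists_sum_levelWeight_le n (2 * M)
  refine ⟨D, hD, fun Λ s hs S g hg hg' => ?_⟩
  have hi := fun k ζ => integrable_localEnergy (n := n) k s ζ hg hg'
  have e : ∑ k ∈ S, ∑ ζ ∈ Λ.pts k, localEnergy k s ζ g = ∫ η, ∑ k ∈ S, ∑ ζ ∈ Λ.pts k,
      levelWeight k (2 * s) η * gaussHat ζ η * ‖g η‖ ^ 2 := by
    rw [integral_finsetSum _ (fun k _ => integrable_finsetSum _ fun ζ _ => hi k ζ)]
    refine sum_congr rfl fun k _ => ?_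
    rw [integral_finsetSum _ (fun ζ _ => hi k ζ)]
    rfl
  rw [e, ← integral_const_mul]
  refine integral_mono (integrable_finsetSum _ fun k _ => integrable_finsetSum _ fun ζ _ => hi k ζ)
    ((integrable_normSq hg hg').const_mul D) fun η => ?_
  simp only [← sum_mul]
  refine mul_le_mul_of_nonneg_right (h Λ (2 * s) ?_ S η) (sq_nonneg _)
  rw [abs_mul, abs_two]
  linarith

variable {Λ : FrequencyLattice n}

/-- The frame indices, sorted by level, frequency and position. -/
def frameIndexEquiv (Λ : FrequencyLattice n) :
    FrameIndex Λ ≃ (Σ k : ℕ, {ζ // ζ ∈ Λ.pts k} × (Fin n → ℤ)) where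
  toFun γ := ⟨γ.k, ⟨γ.freq, γ.mem⟩, γ.pos⟩
  invFun p := ⟨p.1, p.2.1.1, p.2.1.2, p.2.2⟩
  left_inv _ := rfl
  right_inv _ := rfl

lemma sum_frame_le (S : Finset (FrameIndex Λ)) : ∃ (K : Finset ℕ) (A : Finset (Fin n → ℤ)),
    (∀ γ ∈ S, γ.k ∈ K) ∧ ∀ F : ℕ → Space n → (Fin n → ℤ) → ℝ, (∀ k ζ α, 0 ≤ F k ζ α) →
      ∑ γ ∈ S, F γ.k γ.freq γ.pos ≤ ∑ k ∈ K, ∑ ζ ∈ Λ.pts k, ∑ α ∈ A, F k ζ α := by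
  classical
  refine ⟨S.image FrameIndex.k, S.image FrameIndex.pos,
    fun γ hγ => Finset.mem_image_of_mem _ hγ, fun F hF => ?_⟩
  have hinj : Set.InjOn (fun γ : FrameIndex Λ => (⟨γ.k, γ.freq, γ.pos⟩ :
      Σ _ : ℕ, Space n × (Fin n → ℤ))) S := by
    rintro ⟨k, ζ, h, α⟩ _ ⟨k', ζ', h', α'⟩ _ heq
    simp only [Sigma.mk.injEq, heq_eq_eq, Prod.mk.injEq] at heq
    obtain ⟨rfl, rfl, rfl⟩ := heq
    rfl
  calc _ = ∑ p ∈ S.image (fun γ : FrameIndex Λ => (⟨γ.k, γ.freq, γ.pos⟩ :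
      Σ _ : ℕ, Space n × (Fin n → ℤ))), F p.1 p.2.1 p.2.2 := by
        rw [Finset.sum_image hinj]
    _ ≤ ∑ p ∈ (S.image FrameIndex.k).sigma (fun k => Λ.pts k ×ˢ S.image FrameIndex.pos),
        F p.1 p.2.1 p.2.2 := by
        refine Finset.sum_le_sum_of_subset_of_nonneg ?_ (fun p _ _ => hF _ _ _)
        intro p hp
        obtain ⟨γ, hγ, rfl⟩ := Finset.mem_image.1 hp
        simp only [Finset.mem_sigma, Finset.mem_product]
        exact ⟨Finset.mem_image_of_mem _ hγ, γ.mem, Finset.mem_image_of_mem _ hγ⟩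
    _ = _ := by
        rw [Finset.sum_sigma]
        refine sum_congr rfl fun k _ => ?_
        rw [Finset.sum_product]

/-- The weighted Bessel inequality for the frame. -/
lemma exists_bessel (n : ℕ) (M : ℝ) : ∃ K : ℝ, 0 < K ∧ ∀ (Λ : FrequencyLattice n) (ε C : ℝ), 0 < ε →
    0 < C → C ≤ 1 → ∀ s : ℝ, |s| ≤ M → ∀ (S : Finset (FrameIndex Λ)) (g : L2 n),
      ∑ γ ∈ S, ((((2 : ℝ) ^ γ.k) ^ s)⁻¹ * ‖inner ℂ (frameVec ε C s γ) g‖) ^ 2 ≤ K * ‖g‖ ^ 2 := by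
  obtain ⟨D₁, hD₁, h₁⟩ := exists_lattice_correlation n
  obtain ⟨D₂, hD₂, h₂⟩ := exists_sum_localEnergy_le n M
  refine ⟨(1 + D₁) * D₂, by positivity, fun Λ ε C hε hC hC1 s hs S => ?_⟩
  refine forall_of_dense dense_continuous_compactSupport ?_ ?_
  · refine isClosed_le (continuous_finsetSum _ fun γ _ => ?_) (by fun_prop)
    fun_prop
  rintro g ⟨g', hg, hg', hgg⟩
  obtain ⟨K, A, -, hKA⟩ := sum_frame_le S
  have level : ∀ k, ∀ ζ ∈ Λ.pts k, ∑ α ∈ A, ((levelStep ε C k / 2) ^ ((n : ℝ) / 2) *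
      ‖latticeCoeff ε C k s ζ g' α‖) ^ 2 ≤ (1 + D₁) * localEnergy k s ζ g' := by
    intro k ζ hζ
    have hm := (Λ.separated k).1 ζ hζ
    obtain ⟨V, hV, hVle⟩ := h₁ ε C hε hC hC1 k ζ (Λ.ne_zero hζ) hm.2 s s g' g' hg hg' hg hg'
    have hterm : ∀ α, (((levelStep ε C k / 2) ^ ((n : ℝ) / 2) : ℝ) : ℂ) ^ 2 *
        (conj (latticeCoeff ε C k s ζ g' α) * latticeCoeff ε C k s ζ g' α) =
        ((((levelStep ε C k / 2) ^ ((n : ℝ) / 2) * ‖latticeCoeff ε C k s ζ g' α‖) ^ 2 : ℝ) : ℂ) := by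
      intro α
      rw [Complex.conj_mul']
      push_cast
      ring
    simp only [hterm] at hV
    have hre := Complex.hasSum_re hV
    simp only [Complex.ofReal_re] at hre
    refine (sum_le_hasSum A (fun α _ => sq_nonneg _) hre).trans ((Complex.re_le_norm V).trans ?_)
    set I := ((2 : ℂ) ^ n)⁻¹ * ∫ η, ((levelWeight k s η * levelWeight k s η * gaussHat ζ η ^ 2 : ℝ) : ℂ)
        * (conj (g' η) * g' η) with hI
    -- the diagonal part of the correlation
    have hIle : ‖I‖ ≤ localEnergy k s ζ g' := by
      rw [hI, norm_mul, norm_inv, norm_pow, Complex.norm_ofNat]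
      have h2n : ((2 : ℝ) ^ n)⁻¹ ≤ 1 := inv_le_one_of_one_le₀ (one_le_pow₀ (by norm_num))
      refine (mul_le_of_le_one_left (norm_nonneg _) h2n).trans ?_
      refine norm_integral_le_of_norm_le (integrable_localEnergy k s ζ hg hg')
        (.of_forall fun η => ?_)
      have hw := levelWeight_pos k s η
      have hG := gaussHat_pos ζ η
      rw [norm_mul, norm_real, norm_of_nonneg (by positivity), norm_mul,
        RCLike.norm_conj]
      have e : levelWeight k (2 * s) η = levelWeight k s η * levelWeight k s η := by
        rw [two_mul]
        exact rpow_add (div_pos (bracket_pos η) (by positivity)) _ _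
      rw [e]
      have hGG : gaussHat ζ η ^ 2 ≤ gaussHat ζ η := by
        nlinarith [gaussHat_le_one ζ η]
      calc _ = levelWeight k s η * levelWeight k s η * gaussHat ζ η ^ 2 * ‖g' η‖ ^ 2 := by ring
        _ ≤ _ := by gcongr
    have hL := localEnergy_nonneg k s ζ g'
    have hC2 : D₁ * C ^ 2 ≤ D₁ := mul_le_of_le_one_right hD₁.le (by nlinarith)
    calc ‖V‖ ≤ ‖V - I‖ + ‖I‖ := by
          simpa using norm_add_le (V - I) I
      _ ≤ D₁ * C ^ 2 * ((localEnergy k s ζ g' + localEnergy k s ζ g') / 2) + localEnergy k s ζ g' :=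
          add_le_add hVle hIle
      _ ≤ _ := by nlinarith
  calc _ = ∑ γ ∈ S, ((levelStep ε C γ.k / 2) ^ ((n : ℝ) / 2) *
      ‖latticeCoeff ε C γ.k s γ.freq g' γ.pos‖) ^ 2 := by
        refine sum_congr rfl fun γ _ => ?_
        have hst := levelStep_pos ε hC γ.k
        rw [inner_frameVec ε hC s γ g hgg, norm_mul, norm_real,
          norm_of_nonneg (by positivity), ← mul_assoc, ← mul_assoc, inv_mul_cancel₀, one_mul]
        exact (by positivity : (0 : ℝ) < ((2 : ℝ) ^ γ.k) ^ s).ne'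
    _ ≤ _ := hKA (fun k ζ α => ((levelStep ε C k / 2) ^ ((n : ℝ) / 2) *
      ‖latticeCoeff ε C k s ζ g' α‖) ^ 2) (fun _ _ _ => sq_nonneg _)
    _ ≤ ∑ k ∈ K, ∑ ζ ∈ Λ.pts k, (1 + D₁) * localEnergy k s ζ g' :=
        sum_le_sum fun k _ => sum_le_sum fun ζ hζ => level k ζ hζ
    _ = (1 + D₁) * ∑ k ∈ K, ∑ ζ ∈ Λ.pts k, localEnergy k s ζ g' := by
        simp only [mul_sum]
    _ ≤ _ := by
        rw [norm_sq_L2_eq g hgg, mul_assoc]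
        exact mul_le_mul_of_nonneg_left (h₂ Λ s hs K g' hg hg') (by positivity)

/-- Since the frequency sets are maximal, every frequency is near one of them. -/
lemma exists_near_freq (hn : 1 ≤ n) (Λ : FrequencyLattice n) (η : Space n) :
    ∃ k, ∃ ζ ∈ Λ.pts k, (k : ℝ) ≤ 1 + logb 2 (1 + ‖η‖) ∧
      exp (-(9 / 4)) ≤ gaussHat ζ ((2 * π)⁻¹ • η) ^ 2 := by
  classical
  have cover : ∀ (k : ℕ) (v : Space n), (2 : ℝ) ^ k / 2 ≤ ‖v‖ → ‖v‖ < 2 ^ k →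
      ∃ ζ ∈ Λ.pts k, ‖v - ζ‖ ≤ (2 : ℝ) ^ ((k : ℝ) / 2) := by
    intro k v hv1 hv2
    by_contra hno
    push Not at hno
    have hvn : v ∉ Λ.pts k := by
      intro h
      have := hno v h
      rw [sub_self, norm_zero] at this
      exact absurd this (not_lt.2 (by positivity))
    have hsep : IsSeparatedInAnnulus k (insert v (Λ.pts k)) := by
      refine ⟨?_, ?_⟩
      · intro ξ hξ
        rcases Finset.mem_insert.1 hξ with rfl | h
        · exact ⟨hv1, hv2⟩
        · exact (Λ.separated k).1 ξ h
      · intro ξ hξ ξ' hξ' hne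
        rcases Finset.mem_insert.1 hξ with rfl | h <;> rcases Finset.mem_insert.1 hξ' with rfl | h'
        · exact absurd rfl hne
        · exact hno ξ' h'
        · rw [norm_sub_rev]; exact hno ξ h
        · exact (Λ.separated k).2 ξ h ξ' h' hne
    have := Λ.maximal k _ hsep
    rw [Finset.card_insert_of_notMem hvn] at this
    omega
  have hG : ∀ ζ : Space n, gaussHat ζ ((2 * π)⁻¹ • η) ^ 2 =
      exp (-(‖η - ζ‖ ^ 2 / (2 * ‖ζ‖))) := by
    intro ζ
    rw [gaussHat, smul_smul, mul_inv_cancel₀ (by positivity), one_smul, ← exp_nat_mul]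
    congr 1
    by_cases h : ‖ζ‖ = 0
    · simp [h]
    · field_simp
      push_cast
      ring
  have hlog0 : 0 ≤ logb 2 (1 + ‖η‖) :=
    logb_nonneg (by norm_num) (by linarith [norm_nonneg η])
  -- the annuli leave out the ball of radius `1 / 2`; there a frequency of level `0` is near
  by_cases hη : ‖η‖ < 1 / 2
  · obtain ⟨ζ, hζ, -⟩ := cover 0 (EuclideanSpace.single ⟨0, hn⟩ (1 / 2 : ℝ))
      (by simp) (by simp; norm_num)
    refine ⟨0, ζ, hζ, by push_cast; linarith, ?_⟩
    have hm := (Λ.separated 0).1 ζ hζ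
    simp only [pow_zero] at hm
    rw [hG, exp_le_exp, neg_le_neg_iff, div_le_iff₀ (by linarith)]
    have := norm_sub_le η ζ
    nlinarith [norm_nonneg (η - ζ)]
  · push Not at hη
    obtain ⟨j, hj1, hj2⟩ := exists_nat_pow_near (x := 2 * ‖η‖) (y := 2) (by linarith) (by norm_num)
    have h1 : (2 : ℝ) ^ j / 2 ≤ ‖η‖ := by linarith
    have h2 : ‖η‖ < 2 ^ j := by rw [pow_succ] at hj2; linarith
    obtain ⟨ζ, hζ, hd⟩ := cover j η h1 h2
    refine ⟨j, ζ, hζ, ?_, ?_⟩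
    · have : (j : ℝ) - 1 ≤ logb 2 (1 + ‖η‖) := by
        rw [le_logb_iff_rpow_le (by norm_num) (by linarith [norm_nonneg η]),
          rpow_sub (by norm_num), rpow_natCast, rpow_one]
        linarith
      linarith
    · have hm := (Λ.separated j).1 ζ hζ
      have hp : (0 : ℝ) < 2 ^ j := by positivity
      rw [hG, exp_le_exp, neg_le_neg_iff, div_le_iff₀ (by linarith)]
      have e : ((2 : ℝ) ^ ((j : ℝ) / 2)) ^ 2 = 2 ^ j := by
        rw [← rpow_mul_natCast (by norm_num), ← rpow_natCast]
        congr 1; push_cast; ring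
      have : ‖η - ζ‖ ^ 2 ≤ 2 ^ j := by rw [← e]; gcongr
      linarith

section frameOperator

variable {Λ : FrequencyLattice n}

lemma two_pow_rpow_pos (k : ℕ) (s : ℝ) : 0 < ((2 : ℝ) ^ k) ^ s := by positivity

/-- Synthesis: square summable coefficients, with the weight of `H^s`, give an element of the
weighted `L²` space. -/
lemma exists_synthesis (n : ℕ) (M : ℝ) : ∃ K : ℝ, 0 < K ∧ ∀ (Λ : FrequencyLattice n) (ε C : ℝ),
    0 < ε → 0 < C → C ≤ 1 → ∀ s : ℝ, |s| ≤ M →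
    (∀ (S : Finset (FrameIndex Λ)) (g : L2 n),
      ∑ γ ∈ S, ((((2 : ℝ) ^ γ.k) ^ (-s)) * ‖inner ℂ (frameVec ε C s γ) g‖) ^ 2 ≤ K * ‖g‖ ^ 2) ∧
    (∀ (S : Finset (FrameIndex Λ)) (c : FrameIndex Λ → ℂ),
      ‖∑ γ ∈ S, c γ • frameVec ε C s γ‖ ^ 2 ≤ K * ∑ γ ∈ S, (((2 : ℝ) ^ γ.k) ^ s * ‖c γ‖) ^ 2) := by
  obtain ⟨K, hK, h⟩ := exists_bessel n M
  refine ⟨K, hK, fun Λ ε C hε hC hC1 s hs => ⟨fun S g => ?_, fun S c => ?_⟩⟩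
  · refine le_trans (le_of_eq ?_) (h Λ ε C hε hC hC1 s hs S g)
    refine sum_congr rfl fun γ _ => ?_
    rw [rpow_neg (by positivity)]
  · exact norm_sum_smul_sq_le (e := frameVec ε C s) (w := fun γ : FrameIndex Λ => ((2 : ℝ) ^ γ.k) ^ s)
      (fun γ => two_pow_rpow_pos _ _) hK.le (h Λ ε C hε hC hC1 s hs S) c

/-- The frame operator on the weighted `L²` space, the conjugate of `Π⁰` on `H^s`. -/
lemma exists_frameOp (n : ℕ) (M : ℝ) : ∃ K : ℝ, 0 < K ∧ ∀ (Λ : FrequencyLattice n) (ε C : ℝ),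
    0 < ε → 0 < C → C ≤ 1 → ∀ s : ℝ, |s| ≤ M → ∃ P : L2 n →L[ℂ] L2 n, ‖P‖ ≤ K ∧
      ∀ f, HasSum (fun γ : FrameIndex Λ => inner ℂ (frameVec ε C (-s) γ) f • frameVec ε C s γ) (P f) := by
  obtain ⟨K, hK, h⟩ := exists_synthesis n M
  refine ⟨K, hK, fun Λ ε C hε hC hC1 s hs => ?_⟩
  have hb := fun f S => (h Λ ε C hε hC hC1 (-s) (by rwa [abs_neg])).1 S f
  simp only [neg_neg] at hb
  have hs2 := (h Λ ε C hε hC hC1 s hs).2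
  have hsum : ∀ f : L2 n, Summable
      (fun γ : FrameIndex Λ => inner ℂ (frameVec ε C (-s) γ) f • frameVec ε C s γ) := fun f =>
    summable_smul_of_sq hK.le (fun S => hs2 S _)
      (summable_of_sum_le (fun γ => sq_nonneg _) (hb f))
  let P : L2 n →ₗ[ℂ] L2 n :=
    { toFun := fun f => ∑' γ : FrameIndex Λ, inner ℂ (frameVec ε C (-s) γ) f • frameVec ε C s γ
      map_add' := fun f g => by
        rw [← (hsum f).tsum_add (hsum g)]
        simp only [inner_add_right, add_smul]
      map_smul' := fun c f => by
        rw [RingHom.id_apply, ← (hsum f).tsum_const_smul]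
        simp only [inner_smul_right, mul_smul] }
  have hP : ∀ f, ‖P f‖ ≤ K * ‖f‖ := by
    intro f
    have h1 := norm_tsum_smul_sq_le hK.le (fun S => hs2 S _) (hb f) (hsum f).hasSum
    have h2 : ‖P f‖ ^ 2 ≤ (K * ‖f‖) ^ 2 := by
      refine le_trans h1 (le_of_eq ?_); ring
    exact le_of_sq_le_sq h2 (by positivity)
  exact ⟨P.mkContinuous K hP, P.mkContinuous_norm_le hK.le hP, fun f => (hsum f).hasSum⟩

lemma exists_finset_multiplier_ge (hn : 1 ≤ n) (Λ : FrequencyLattice n) (R : ℝ) :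
    ∃ S₀ : Finset ℕ, ∀ S, S₀ ⊆ S → ∀ η : Space n, ‖η‖ ≤ R →
      exp (-(9 / 4)) ≤ ∑ k ∈ S, ∑ ζ ∈ Λ.pts k, gaussHat ζ η ^ 2 := by
  obtain ⟨N, hN⟩ := exists_nat_ge (1 + logb 2 (1 + 2 * π * |R|))
  refine ⟨Finset.range (N + 1), fun S hS η hη => ?_⟩
  obtain ⟨k, ζ, hζ, hk, hG⟩ := exists_near_freq hn Λ ((2 * π) • η)
  rw [smul_smul, inv_mul_cancel₀ (by positivity), one_smul] at hG
  have hkN : k ∈ S := by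
    apply hS
    rw [Finset.mem_range, Nat.lt_succ_iff]
    have : (k : ℝ) ≤ N := by
      refine hk.trans (le_trans ?_ hN)
      have h1 : ‖(2 * π) • η‖ ≤ 2 * π * |R| := by
        rw [norm_smul, norm_of_nonneg (by positivity)]
        have := hη.trans (le_abs_self R)
        gcongr
      have := logb_le_logb_of_le (b := 2) (by norm_num)
        (by positivity) (add_le_add_right h1 1)
      linarith
    exact_mod_cast this
  calc _ ≤ gaussHat ζ η ^ 2 := hG
    _ ≤ ∑ ζ ∈ Λ.pts k, gaussHat ζ η ^ 2 :=
        single_le_sum (f := fun ζ => gaussHat ζ η ^ 2) (fun _ _ => sq_nonneg _) hζ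
    _ ≤ _ := single_le_sum (f := fun k => ∑ ζ ∈ Λ.pts k, gaussHat ζ η ^ 2)
        (fun _ _ => sum_nonneg fun _ _ => sq_nonneg _) hkN

set_option maxHeartbeats 1000000 in
/-- For a fine lattice the frame operator is close to a multiple of the identity in the sense of
quadratic forms. -/
lemma exists_frameOp_form_bound (n : ℕ) (hn : 1 ≤ n) (M : ℝ) : ∃ C₀ c κ : ℝ, 0 < C₀ ∧ C₀ ≤ 1 ∧
    0 ≤ κ ∧ κ < c ∧ ∀ (Λ : FrequencyLattice n) (ε C : ℝ), 0 < ε → 0 < C → C ≤ C₀ →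
    ∀ s : ℝ, |s| ≤ M → ∀ P : L2 n →L[ℂ] L2 n,
      (∀ f, HasSum (fun γ : FrameIndex Λ => inner ℂ (frameVec ε C (-s) γ) f • frameVec ε C s γ) (P f)) →
      ∀ g h : L2 n, ‖(c : ℂ) * inner ℂ h g - inner ℂ h (P g)‖ ≤ κ * ((‖h‖ ^ 2 + ‖g‖ ^ 2) / 2) := by
  obtain ⟨D₁, hD₁, h₁⟩ := exists_lattice_correlation n
  obtain ⟨D₂, hD₂, h₂⟩ := exists_sum_localEnergy_le n M
  obtain ⟨D₃, hD₃, h₃⟩ := exists_sum_levelWeight_le n 0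
  -- the multiplier of the diagonal part lies between `c₁` and `c`
  set c₁ : ℝ := ((2 : ℝ) ^ n)⁻¹ * exp (-(9 / 4)) with hc₁
  have hc₁0 : 0 < c₁ := by positivity
  set c : ℝ := ((2 : ℝ) ^ n)⁻¹ * D₃ + c₁ with hc
  have hcpos : 0 < c := by positivity
  set C₀ : ℝ := min 1 (c₁ / (2 * (D₁ * D₂))) with hC₀
  have hC₀0 : 0 < C₀ := lt_min one_pos (by positivity)
  refine ⟨C₀, c, c - c₁ / 2, hC₀0, min_le_left _ _, ?_, by linarith, ?_⟩
  · have : 0 ≤ ((2 : ℝ) ^ n)⁻¹ * D₃ := by positivity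
    linarith
  intro Λ ε C hε hC hCC₀ s hs P hP
  have hC1 : C ≤ 1 := hCC₀.trans (min_le_left _ _)
  have hCe : D₁ * C ^ 2 * D₂ ≤ c₁ / 2 := by
    have e1 : C ≤ c₁ / (2 * (D₁ * D₂)) := hCC₀.trans (min_le_right _ _)
    rw [le_div_iff₀ (by positivity)] at e1
    have : C ^ 2 ≤ C := by nlinarith
    have : D₁ * D₂ * C ^ 2 ≤ D₁ * D₂ * C := by gcongr
    linarith
  -- by density both functions may be continuous and compactly supported
  intro g
  refine forall_of_dense dense_continuous_compactSupport ?_ ?_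
  · exact isClosed_le (by fun_prop) (by fun_prop)
  rintro h ⟨h', hh, hh', hhh⟩
  revert g
  refine forall_of_dense dense_continuous_compactSupport ?_ ?_
  · exact isClosed_le (by fun_prop) (by fun_prop)
  rintro g ⟨g', hg, hg', hgg⟩
  let w : Space n → ℂ := fun η => conj (h' η) * g' η
  let J : Space n → ℂ := fun ζ => ((2 : ℂ) ^ n)⁻¹ * ∫ η, ((gaussHat ζ η ^ 2 : ℝ) : ℂ) * w η
  let lw : ℕ → ℂ := fun k => (((levelStep ε C k / 2) ^ ((n : ℝ) / 2) : ℝ) : ℂ)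
  have lev : ∀ k, ∀ ζ : {ζ // ζ ∈ Λ.pts k}, ∃ V : ℂ,
      HasSum (fun α => lw k ^ 2 *
        (conj (latticeCoeff ε C k s ζ h' α) * latticeCoeff ε C k (-s) ζ g' α)) V ∧
      ‖V - J ζ‖ ≤ D₁ * C ^ 2 * ((localEnergy k s ζ h' + localEnergy k (-s) ζ g') / 2) := by
    intro k ζ
    have hm := (Λ.separated k).1 ζ ζ.2
    obtain ⟨V, hV, hV'⟩ := h₁ ε C hε hC hC1 k ζ (Λ.ne_zero ζ.2) hm.2 s (-s) g' h' hg hg' hh hh'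
    refine ⟨V, hV, ?_⟩
    change ‖V - _ * ∫ η, _ * (_ * _)‖ ≤ _
    have e : ∀ η : Space n, levelWeight k s η * levelWeight k (-s) η = 1 := by
      intro η
      rw [levelWeight, levelWeight, ← rpow_add (div_pos (bracket_pos η) (by positivity))]
      simp
    simpa only [e, one_mul] using hV'
  choose V hV hVle using lev
  set F : FrameIndex Λ → ℂ := fun γ =>
    inner ℂ (frameVec ε C (-s) γ) g * inner ℂ h (frameVec ε C s γ) with hF
  have hFsum : HasSum F (inner ℂ h (P g)) := by
    have := (innerSL ℂ h).hasSum (hP g)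
    simpa only [Function.comp_def, innerSL_apply_apply, inner_smul_right] using this
  have hFeq : ∀ k (p : {ζ // ζ ∈ Λ.pts k} × (Fin n → ℤ)), F ((frameIndexEquiv Λ).symm ⟨k, p⟩) =
      lw k ^ 2 *
        (conj (latticeCoeff ε C k s p.1 h' p.2) * latticeCoeff ε C k (-s) p.1 g' p.2) := by
    intro k p
    simp only [hF]
    rw [← inner_conj_symm h, inner_frameVec ε hC s _ h hhh, inner_frameVec ε hC (-s) _ g hgg]
    simp only [map_mul, conj_ofReal]
    have e : ((((2 : ℝ) ^ k) ^ s : ℝ) : ℂ) * ((((2 : ℝ) ^ k) ^ (-s) : ℝ) : ℂ) = 1 := by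
      rw [← ofReal_mul, ← rpow_add (by positivity)]
      simp
    change (((((2 : ℝ) ^ k) ^ (-s) * (levelStep ε C k / 2) ^ ((n : ℝ) / 2) : ℝ)) : ℂ) *
      latticeCoeff ε C k (-s) p.1 g' p.2 * ((((((2 : ℝ) ^ k) ^ s * (levelStep ε C k / 2) ^ ((n : ℝ) / 2) : ℝ)) : ℂ) *
      conj (latticeCoeff ε C k s p.1 h' p.2)) = _
    rw [ofReal_mul, ofReal_mul]
    linear_combination lw k ^ 2 *
      latticeCoeff ε C k (-s) p.1 g' p.2 * conj (latticeCoeff ε C k s p.1 h' p.2) * e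
  have hG : HasSum (fun q : Σ k : ℕ, {ζ // ζ ∈ Λ.pts k} × (Fin n → ℤ) =>
      F ((frameIndexEquiv Λ).symm q)) (inner ℂ h (P g)) :=
    (frameIndexEquiv Λ).symm.hasSum_iff.2 hFsum
  have hlevel : ∀ k, HasSum (fun p : {ζ // ζ ∈ Λ.pts k} × (Fin n → ℤ) =>
      F ((frameIndexEquiv Λ).symm ⟨k, p⟩)) (∑ ζ, V k ζ) := by
    intro k
    have h1 : Summable (fun p : {ζ // ζ ∈ Λ.pts k} × (Fin n → ℤ) =>
      F ((frameIndexEquiv Λ).symm ⟨k, p⟩)) :=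
      hG.summable.comp_injective sigma_mk_injective
    have h2 : HasSum (V k) _ := h1.hasSum.prod_fiberwise (fun ζ => by
      simp only [hFeq]
      exact hV k ζ)
    have h3 := h2.unique (hasSum_fintype (V k))
    have h4 := h1.hasSum
    rwa [h3] at h4
  have hK : HasSum (fun k => ∑ ζ, V k ζ) (inner ℂ h (P g)) := hG.sigma hlevel
  obtain ⟨R, hR⟩ := hh'.isCompact.isBounded.exists_norm_le
  obtain ⟨S₀, hS₀⟩ := exists_finset_multiplier_ge hn Λ R
  have hlim : Filter.Tendsto (fun S : Finset ℕ => ‖(c : ℂ) * inner ℂ h g - ∑ k ∈ S, ∑ ζ, V k ζ‖)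
      Filter.atTop (nhds ‖(c : ℂ) * inner ℂ h g - inner ℂ h (P g)‖) :=
    (tendsto_const_nhds.sub hK).norm
  refine le_of_tendsto hlim ?_
  filter_upwards [Filter.eventually_ge_atTop S₀] with S hS
  have hin := inner_L2_eq h g hhh hgg
  have wc : Continuous w := (Complex.continuous_conj.comp hh).mul hg
  have iw : ∀ {m : Space n → ℝ}, Continuous m → Integrable (fun η => (m η : ℂ) * w η) := fun hm =>
    ((continuous_ofReal.comp hm).mul wc).integrable_of_hasCompactSupport hg'.mul_left.mul_left
  have gc : ∀ ζ : Space n, Continuous fun η => gaussHat ζ η ^ 2 := fun ζ => (continuous_gaussHat ζ).pow 2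
  set m : Space n → ℝ := fun η => ((2 : ℝ) ^ n)⁻¹ * ∑ k ∈ S, ∑ ζ ∈ Λ.pts k, gaussHat ζ η ^ 2 with hm
  have main : ∑ k ∈ S, ∑ ζ : {ζ // ζ ∈ Λ.pts k}, J ζ = ∫ η, (m η : ℂ) * w η := by
    have e2 : ∀ η, (m η : ℂ) * w η = ((2 : ℂ) ^ n)⁻¹ *
        ∑ k ∈ S, ∑ ζ ∈ Λ.pts k, ((gaussHat ζ η ^ 2 : ℝ) : ℂ) * w η := by
      intro η
      simp only [← sum_mul]
      rw [hm]
      push_cast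
      ring
    simp only [Finset.sum_coe_sort _ J, J, ← mul_sum, e2]
    rw [integral_const_mul, integral_finsetSum _ fun k _ => integrable_finsetSum _ fun ζ _ => iw (gc ζ)]
    congr 1
    exact sum_congr rfl fun k _ => (integral_finsetSum _ fun ζ _ => iw (gc ζ)).symm
  have hsplit : (c : ℂ) * inner ℂ h g - ∑ k ∈ S, ∑ ζ, V k ζ =
      (∫ η, ((c - m η : ℝ) : ℂ) * w η) - ∑ k ∈ S, ∑ ζ : {ζ // ζ ∈ Λ.pts k}, (V k ζ - J ζ) := by
    have mc : Continuous m := continuous_const.mul (continuous_finsetSum S fun k _ =>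
      continuous_finsetSum (Λ.pts k) fun ζ _ => gc ζ)
    simp only [sum_sub_distrib, Complex.ofReal_sub, sub_mul]
    rw [main, hin, integral_sub (iw (m := fun _ => c) continuous_const) (iw mc), integral_const_mul]
    ring
  have nh := norm_sq_L2_eq h hhh
  have ng := norm_sq_L2_eq g hgg
  have ih := integrable_normSq hh hh'
  have ig := integrable_normSq hg hg'
  -- the diagonal part: a multiplication operator on the Fourier side
  have B1 : ‖∫ η, ((c - m η : ℝ) : ℂ) * w η‖ ≤
      (c - c₁) * ((‖h‖ ^ 2 + ‖g‖ ^ 2) / 2) := by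
    have : (c - c₁) * ((‖h‖ ^ 2 + ‖g‖ ^ 2) / 2) =
        ∫ η, (c - c₁) * ((‖h' η‖ ^ 2 + ‖g' η‖ ^ 2) / 2) := by
      rw [integral_const_mul, integral_div, integral_add ih ig, nh, ng]
    rw [this]
    refine norm_integral_le_of_norm_le (((ih.add ig).div_const 2).const_mul _)
      (.of_forall fun η => ?_)
    rw [norm_mul, norm_mul, RCLike.norm_conj, norm_real]
    by_cases hz : h' η = 0
    · rw [hz, norm_zero, zero_mul, mul_zero]
      have : 0 ≤ c - c₁ := by rw [hc, add_sub_cancel_right]; positivity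
      positivity
    · have hle : c₁ ≤ m η := by
        rw [hc₁, hm]
        exact mul_le_mul_of_nonneg_left (hS₀ S hS η (hR η (subset_tsupport _ hz))) (by positivity)
      have hge : m η ≤ c := by
        have : m η ≤ ((2 : ℝ) ^ n)⁻¹ * D₃ := by
          rw [hm]
          refine mul_le_mul_of_nonneg_left (le_trans ?_ (h₃ Λ 0 (by simp) S η)) (by positivity)
          refine sum_le_sum fun k _ => sum_le_sum fun ζ _ => ?_
          rw [levelWeight_zero, one_mul]
          nlinarith [gaussHat_pos ζ η, gaussHat_le_one ζ η]
        linarith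
      rw [norm_of_nonneg (by linarith)]
      refine mul_le_mul (by linarith) ?_ (by positivity) (by linarith)
      nlinarith [sq_nonneg (‖h' η‖ - ‖g' η‖)]
  -- the rest is of size `C ^ 2`
  have B2 : ‖∑ k ∈ S, ∑ ζ : {ζ // ζ ∈ Λ.pts k}, (V k ζ - J ζ)‖ ≤
      c₁ / 2 * ((‖h‖ ^ 2 + ‖g‖ ^ 2) / 2) := by
    calc _ ≤ ∑ k ∈ S, ∑ ζ : {ζ // ζ ∈ Λ.pts k},
          D₁ * C ^ 2 * ((localEnergy k s ζ h' + localEnergy k (-s) ζ g') / 2) := by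
          refine (norm_sum_le _ _).trans (sum_le_sum fun k _ => ?_)
          exact (norm_sum_le _ _).trans (sum_le_sum fun ζ _ => hVle k ζ)
      _ = ∑ k ∈ S, ∑ ζ ∈ Λ.pts k,
          D₁ * C ^ 2 * ((localEnergy k s ζ h' + localEnergy k (-s) ζ g') / 2) := by
          refine sum_congr rfl fun k _ => ?_
          exact Finset.sum_coe_sort (Λ.pts k) (fun ζ =>
            D₁ * C ^ 2 * ((localEnergy k s ζ h' + localEnergy k (-s) ζ g') / 2))
      _ = D₁ * C ^ 2 * ((∑ k ∈ S, ∑ ζ ∈ Λ.pts k, localEnergy k s ζ h' +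
          ∑ k ∈ S, ∑ ζ ∈ Λ.pts k, localEnergy k (-s) ζ g') / 2) := by
          simp only [← mul_sum, ← Finset.sum_div, sum_add_distrib]
      _ ≤ D₁ * C ^ 2 * ((D₂ * ‖h‖ ^ 2 + D₂ * ‖g‖ ^ 2) / 2) := by
          rw [nh, ng]
          gcongr
          · exact h₂ Λ s hs S h' hh hh'
          · exact h₂ Λ (-s) (by rwa [abs_neg]) S g' hg hg'
      _ = D₁ * C ^ 2 * D₂ * ((‖h‖ ^ 2 + ‖g‖ ^ 2) / 2) := by ring
      _ ≤ _ := by gcongr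
  rw [hsplit]
  refine (norm_sub_le _ _).trans ((add_le_add B1 B2).trans (le_of_eq ?_))
  ring

/-- The frame operator is invertible for a fine lattice. -/
lemma exists_frame_inverse (n : ℕ) (hn : 1 ≤ n) (M : ℝ) : ∃ C₀ K : ℝ, 0 < C₀ ∧ C₀ ≤ 1 ∧ 0 < K ∧
    ∀ (Λ : FrequencyLattice n) (ε C : ℝ), 0 < ε → 0 < C → C ≤ C₀ → ∀ s : ℝ, |s| ≤ M →
      ∃ P : L2 n ≃ₗ[ℂ] L2 n,
      (∀ f, HasSum (fun γ : FrameIndex Λ =>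
        inner ℂ (frameVec ε C (-s) γ) f • frameVec ε C s γ) (P f)) ∧
      ∀ f, ‖P.symm f‖ ≤ K * ‖f‖ := by
  obtain ⟨C₀, c, κ, hC₀, hC₁, hκ, hκc, H⟩ := exists_frameOp_form_bound n hn M
  obtain ⟨K, hK, hop⟩ := exists_frameOp n M
  have hcκ : 0 < c - κ := by linarith
  refine ⟨C₀, (c - κ)⁻¹, hC₀, hC₁, by positivity, fun Λ ε C hε hC hCC s hs => ?_⟩
  obtain ⟨P, -, hP⟩ := hop Λ ε C hε hC (hCC.trans hC₁) s hs
  have form := H Λ ε C hε hC hCC s hs P hP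
  have hclose : ∀ g, ‖(c : ℂ) • g - P g‖ ≤ κ * ‖g‖ := by
    intro g
    set v := (c : ℂ) • g - P g with hv
    have hform : ∀ h, ‖inner ℂ h v‖ ≤ κ * ((‖h‖ ^ 2 + ‖g‖ ^ 2) / 2) := by
      intro h
      have := form g h
      rwa [hv, inner_sub_right, inner_smul_right]
    by_cases hv0 : ‖v‖ = 0
    · rw [hv0]; positivity
    have hvpos : 0 < ‖v‖ := lt_of_le_of_ne (norm_nonneg _) (Ne.symm hv0)
    by_cases hg0 : ‖g‖ = 0
    · have : g = 0 := norm_eq_zero.1 hg0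
      rw [hv, this]; simp
    have hgpos : 0 < ‖g‖ := lt_of_le_of_ne (norm_nonneg _) (Ne.symm hg0)
    -- the test vector has the direction of `v` and the length of `g`
    have h1 := hform (((‖g‖ / ‖v‖ : ℝ) : ℂ) • v)
    rw [inner_smul_left, norm_mul, RCLike.norm_conj, norm_smul, norm_real,
      norm_of_nonneg (by positivity), inner_self_eq_norm_sq_to_K, norm_pow,
      RCLike.norm_ofReal, abs_of_nonneg (norm_nonneg _)] at h1
    have e1 : ‖g‖ / ‖v‖ * ‖v‖ = ‖g‖ := by field_simp
    have e2 : ‖g‖ / ‖v‖ * ‖v‖ ^ 2 = ‖g‖ * ‖v‖ := by field_simp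
    rw [e1, e2] at h1
    have : ‖g‖ * ‖v‖ ≤ ‖g‖ * (κ * ‖g‖) := by nlinarith
    exact le_of_mul_le_mul_left this hgpos
  obtain ⟨hbij, hlow⟩ := bijective_of_norm_sub_le P hκc hκ hclose
  refine ⟨LinearEquiv.ofBijective P.toLinearMap hbij, fun f => hP f, fun f => ?_⟩
  set E := LinearEquiv.ofBijective P.toLinearMap hbij
  have h1 := hlow (E.symm f)
  have h2 : P (E.symm f) = f := E.apply_symm_apply f
  rw [h2] at h1
  rwa [inv_mul_eq_div, le_div_iff₀ hcκ, mul_comm]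

end frameOperator

/-! ### Gram matrices of Gaussian packets -/

lemma norm_packet (δ : ℝ) (X Ξ x : Space n) (hδ : 0 < δ) : ‖packet δ X Ξ x‖ =
    (‖Ξ‖ * δ / (2 * π)) ^ ((n : ℝ) / 2) * exp (-(‖Ξ‖ * ‖x - X‖ ^ 2)) := by
  rw [packet, norm_mul, norm_real, norm_of_nonneg (by positivity), Complex.norm_exp]
  congr 2
  simp only [Complex.sub_re, Complex.mul_re, Complex.I_re, Complex.ofReal_re, Complex.I_im,
    Complex.ofReal_im]
  ring

lemma continuous_packet (δ : ℝ) (X Ξ : Space n) : Continuous (packet δ X Ξ) := by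
  unfold packet
  refine continuous_const.mul (Complex.continuous_exp.comp ?_)
  refine (continuous_const.mul (continuous_ofReal.comp ?_)).sub
    (continuous_ofReal.comp ?_)
  · fun_prop
  · fun_prop

lemma sq_add_sq_ge {μ r : ℝ} (hμ : 0 < μ) (hr : 0 < r) (m z X : Space n) :
    μ * r / (μ + r) * ‖X - z‖ ^ 2 ≤ μ * ‖m - z‖ ^ 2 + r * ‖m - X‖ ^ 2 := by
  have h1 : ‖X - z‖ ≤ ‖m - z‖ + ‖m - X‖ := by
    have := norm_sub_le (m - z) (m - X)
    rwa [sub_sub_sub_cancel_left] at this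
  have h2 : ‖X - z‖ ^ 2 ≤ (‖m - z‖ + ‖m - X‖) ^ 2 := pow_le_pow_left₀ (norm_nonneg _) h1 2
  rw [div_mul_eq_mul_div, div_le_iff₀ (by positivity)]
  have h3 : μ * r * ‖X - z‖ ^ 2 ≤ μ * r * (‖m - z‖ + ‖m - X‖) ^ 2 := by gcongr
  nlinarith [sq_nonneg (μ * ‖m - z‖ - r * ‖m - X‖)]

/-- The localized Gram matrix of Gaussian packets decays in position and frequency. -/
lemma norm_gram_le {δ δ' μ : ℝ} (hδ : 0 < δ) (hδ' : 0 < δ') (hμ : 0 < μ) (z X X' Ξ Ξ' : Space n)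
    (hΞ : Ξ ≠ 0) (hΞ' : Ξ' ≠ 0) :
    ‖∫ x, (exp (-(μ * ‖x - z‖ ^ 2)) : ℂ) * (packet δ X Ξ x *
      conj (packet δ' X' Ξ' x))‖ ≤
    (‖Ξ‖ * δ / (2 * π)) ^ ((n : ℝ) / 2) * (‖Ξ'‖ * δ' / (2 * π)) ^ ((n : ℝ) / 2) *
      (π / (μ + ‖Ξ‖ + ‖Ξ'‖)) ^ ((n : ℝ) / 2) *
      exp (-(‖Ξ - Ξ'‖ ^ 2 / (4 * (μ + ‖Ξ‖ + ‖Ξ'‖)))) *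
      exp (-(1 / 2 * (μ * ‖Ξ‖ / (μ + ‖Ξ‖) * ‖X - z‖ ^ 2 +
        μ * ‖Ξ'‖ / (μ + ‖Ξ'‖) * ‖X' - z‖ ^ 2))) := by
  have hr : 0 < ‖Ξ‖ := norm_pos_iff.2 hΞ
  have hr' : 0 < ‖Ξ'‖ := norm_pos_iff.2 hΞ'
  set r := ‖Ξ‖ with hrd
  set r' := ‖Ξ'‖ with hrd'
  set s := μ + r + r' with hs
  have hs0 : 0 < s := by positivity
  set m : Space n := s⁻¹ • (μ • z + r • X + r' • X') with hm
  set Q := μ * ‖m - z‖ ^ 2 + r * ‖m - X‖ ^ 2 + r' * ‖m - X'‖ ^ 2 with hQ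
  set N := (r * δ / (2 * π)) ^ ((n : ℝ) / 2) with hN
  set N' := (r' * δ' / (2 * π)) ^ ((n : ℝ) / 2) with hN'
  have hbal : μ • (m - z) + r • (m - X) + r' • (m - X') = 0 := by
    have : s • m = μ • z + r • X + r' • X' := by
      rw [hm, smul_smul, mul_inv_cancel₀ hs0.ne', one_smul]
    have e : μ • (m - z) + r • (m - X) + r' • (m - X') = s • m - (μ • z + r • X + r' • X') := by
      rw [hs]; module
    rw [e, this, sub_self]
  have hquad : ∀ v : Space n, μ * ‖v + m - z‖ ^ 2 + r * ‖v + m - X‖ ^ 2 + r' * ‖v + m - X'‖ ^ 2 =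
      s * ‖v‖ ^ 2 + Q := by
    intro v
    have e : ∀ w : Space n, ‖v + m - w‖ ^ 2 = ‖v‖ ^ 2 + 2 * inner ℝ v (m - w) + ‖m - w‖ ^ 2 := by
      intro w
      rw [add_sub_assoc, norm_add_sq_real]
    have h0 : inner ℝ v (μ • (m - z) + r • (m - X) + r' • (m - X')) = 0 := by
      rw [hbal, inner_zero_right]
    simp only [inner_add_right, inner_smul_right] at h0
    rw [e, e, e, hQ, hs]
    linear_combination 2 * h0
  set c₀ : ℂ := (N : ℂ) * N' * Complex.exp (-(Q : ℂ) + I * ((inner ℝ Ξ (m - X) : ℝ) : ℂ)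
    - I * ((inner ℝ Ξ' (m - X') : ℝ) : ℂ)) with hc₀
  have hint : ∀ v : Space n, (exp (-(μ * ‖v + m - z‖ ^ 2)) : ℂ) * (packet δ X Ξ (v + m) *
      conj (packet δ' X' Ξ' (v + m))) =
      c₀ * Complex.exp (-(s : ℂ) * (‖v‖ : ℂ) ^ 2 + I * ((inner ℝ (Ξ - Ξ') v : ℝ) : ℂ)) := by
    intro v
    rw [packet, packet, map_mul, conj_ofReal, ← Complex.exp_conj, hc₀]
    simp only [map_sub, map_mul, conj_ofReal, Complex.conj_I]
    rw [← hrd, ← hrd', ← hN, ← hN', Complex.ofReal_exp]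
    have hq := congrArg (fun t : ℝ => (t : ℂ)) (hquad v)
    have e : ∀ a b c d f g h : ℂ, a * (b * c * (d * f)) = b * d * g * h ↔
        b * d * (a * c * f) = b * d * (g * h) := by
      intros; constructor <;> intro h <;> linear_combination h
    rw [e, ← Complex.exp_add, ← Complex.exp_add, ← Complex.exp_add]
    congr 2
    have e1 : inner ℝ Ξ (v + m - X) = inner ℝ Ξ v + inner ℝ Ξ (m - X) := by
      rw [add_sub_assoc, inner_add_right]
    have e2 : inner ℝ Ξ' (v + m - X') = inner ℝ Ξ' v + inner ℝ Ξ' (m - X') := by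
      rw [add_sub_assoc, inner_add_right]
    rw [e1, e2, inner_sub_left]
    push_cast at hq ⊢
    linear_combination -hq
  have hG := GaussianFourier.integral_cexp_neg_mul_sq_norm_add (V := Space n) (b := (s : ℂ))
    (by simpa using hs0) I (Ξ - Ξ')
  rw [← integral_add_right_eq_self _ m]
  simp only [hint]
  rw [integral_const_mul, hG, norm_mul c₀, norm_mul (_ ^ _)]
  have n1 : ‖c₀‖ = N * N' * exp (-Q) := by
    rw [hc₀, norm_mul, norm_mul, norm_real, norm_real, Complex.norm_exp,
      norm_of_nonneg (by positivity), norm_of_nonneg (by positivity)]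
    congr 2
    simp
  have n2 : ‖((π : ℂ) / s) ^ ((Module.finrank ℝ (Space n) : ℂ) / 2)‖ =
      (π / s) ^ ((n : ℝ) / 2) := by
    rw [pi_div_cpow_finrank hs0.le, norm_real, norm_of_nonneg (by positivity)]
  have n3 : ‖Complex.exp (I ^ 2 * (‖Ξ - Ξ'‖ : ℂ) ^ 2 / (4 * s))‖ =
      exp (-(‖Ξ - Ξ'‖ ^ 2 / (4 * s))) := by
    have : I ^ 2 * (‖Ξ - Ξ'‖ : ℂ) ^ 2 / (4 * s) =
        ((-(‖Ξ - Ξ'‖ ^ 2 / (4 * s)) : ℝ) : ℂ) := by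
      rw [Complex.I_sq]; push_cast; ring
    rw [this, Complex.norm_exp, Complex.ofReal_re]
  rw [n1, n2, n3]
  have hQge : 1 / 2 * (μ * r / (μ + r) * ‖X - z‖ ^ 2 + μ * r' / (μ + r') * ‖X' - z‖ ^ 2) ≤ Q := by
    have h1 := sq_add_sq_ge hμ hr m z X
    have h2 := sq_add_sq_ge hμ hr' m z X'
    have h3 : 0 ≤ r * ‖m - X‖ ^ 2 := by positivity
    have h4 : 0 ≤ r' * ‖m - X'‖ ^ 2 := by positivity
    rw [hQ]
    linarith
  calc _ = N * N' * (π / s) ^ ((n : ℝ) / 2) * exp (-(‖Ξ - Ξ'‖ ^ 2 / (4 * s))) *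
      exp (-Q) := by ring
    _ ≤ _ := by gcongr

/-! ### Systems of packets -/

/-- The square root of `2^k`, the inverse of the spatial width of a packet of level `k`. -/
def scl (k : ℕ) : ℝ := sqrt (2 ^ k)

lemma sq_scl (k : ℕ) : scl k ^ 2 = 2 ^ k := sq_sqrt (by positivity)

lemma scl_pos (k : ℕ) : 0 < scl k := sqrt_pos.2 (by positivity)

lemma one_le_scl (k : ℕ) : 1 ≤ scl k := one_le_sqrt.2 (one_le_pow₀ (by norm_num))

/-- A family of packets with parameter `θ`, whose members of level `k` have frequency of size `2^k`
and fill phase space with bounded density. -/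
structure PacketSystem (n : ℕ) (Θ ι : Type) where
  /-- the dyadic level -/
  lev : ι → ℕ
  /-- the lattice step, which enters the normalization -/
  step : ι → ℝ
  /-- the centre -/
  X : Θ → ι → Space n
  /-- the frequency -/
  Ξ : Θ → ι → Space n
  /-- the bound for the frequencies -/
  R : ℝ
  one_le_R : 1 ≤ R
  step_pos : ∀ γ, 0 < step γ
  step_eq : ∀ γ γ', lev γ = lev γ' → step γ = step γ'
  le_norm : ∀ θ γ, 2 ^ lev γ / R ≤ ‖Ξ θ γ‖
  norm_le : ∀ θ γ, ‖Ξ θ γ‖ ≤ R * 2 ^ lev γ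
  count : ∀ c > (0 : ℝ), ∃ K : ℝ, ∀ θ (z : Space n) γ' (S : Finset ι), (∀ γ ∈ S, lev γ = lev γ') →
    ∑ γ ∈ S, (step γ * scl (lev γ)) ^ n * exp (-(c * (2 ^ lev γ * ‖z - X θ γ‖ ^ 2 +
      ((2 : ℝ) ^ lev γ)⁻¹ * ‖Ξ θ γ - Ξ θ γ'‖ ^ 2))) ≤ K

namespace PacketSystem

variable {Θ ι : Type} (Y : PacketSystem n Θ ι)

/-- The packet with index `γ`. -/
def pk (θ : Θ) (γ : ι) (x : Space n) : ℂ := packet (Y.step γ) (Y.X θ γ) (Y.Ξ θ γ) x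

lemma R_pos : 0 < Y.R := zero_lt_one.trans_le Y.one_le_R

lemma norm_pos (θ : Θ) (γ : ι) : 0 < ‖Y.Ξ θ γ‖ :=
  lt_of_lt_of_le (div_pos (by positivity) Y.R_pos) (Y.le_norm θ γ)

lemma ne_zero (θ : Θ) (γ : ι) : Y.Ξ θ γ ≠ 0 := norm_pos_iff.1 (Y.norm_pos θ γ)

/-- The Gram matrix at one level. -/
lemma exists_gram_le {ν : ℝ} (hν : 0 < ν) : ∃ c K : ℝ, 0 < c ∧ 0 < K ∧ ∀ θ (z : Space n) γ γ',
    Y.lev γ = Y.lev γ' →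
    ‖∫ x, (exp (-(ν * 2 ^ Y.lev γ * ‖x - z‖ ^ 2)) : ℂ) * (Y.pk θ γ x *
      conj (Y.pk θ γ' x))‖ ≤
      K * (Y.step γ * scl (Y.lev γ)) ^ n * exp (-(c * (2 ^ Y.lev γ * ‖z - Y.X θ γ‖ ^ 2 +
        2 ^ Y.lev γ * ‖z - Y.X θ γ'‖ ^ 2 +
        ((2 : ℝ) ^ Y.lev γ)⁻¹ * ‖Y.Ξ θ γ - Y.Ξ θ γ'‖ ^ 2))) := by
  have hR := Y.R_pos
  set c₁ := 1 / (4 * (ν + Y.R + Y.R)) with hc₁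
  set c₂ := 1 / 2 * (ν * (1 / Y.R) / (ν + Y.R)) with hc₂
  have hc₁0 : 0 < c₁ := by positivity
  have hc₂0 : 0 < c₂ := by positivity
  refine ⟨min c₁ c₂, ((Y.R / (2 * π)) ^ ((n : ℝ) / 2)) ^ 2 * (π / ν) ^ ((n : ℝ) / 2),
    lt_min hc₁0 hc₂0, by positivity, fun θ z γ γ' hl => ?_⟩
  have hA : (0 : ℝ) < 2 ^ Y.lev γ := by positivity
  set A : ℝ := 2 ^ Y.lev γ with hAd
  have hst := Y.step_pos γ
  have hst' : Y.step γ' = Y.step γ := (Y.step_eq γ γ' hl).symm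
  have l1 := Y.le_norm θ γ
  have u1 := Y.norm_le θ γ
  have l2 := Y.le_norm θ γ'
  have u2 := Y.norm_le θ γ'
  rw [← hl, ← hAd] at l2 u2
  rw [← hAd] at l1 u1
  have p1 := Y.norm_pos θ γ
  have p2 := Y.norm_pos θ γ'
  have h := norm_gram_le hst (Y.step_pos γ') (μ := ν * A) (by positivity) z (Y.X θ γ) (Y.X θ γ')
    (Y.Ξ θ γ) (Y.Ξ θ γ') (Y.ne_zero θ γ) (Y.ne_zero θ γ')
  rw [hst'] at h
  have hsc : (Y.step γ * scl (Y.lev γ)) ^ n = (A * Y.step γ) ^ ((n : ℝ) / 2) *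
      (A * Y.step γ) ^ ((n : ℝ) / 2) * (1 / A) ^ ((n : ℝ) / 2) := by
    rw [← mul_rpow (by positivity) (by positivity), ← mul_rpow (by positivity) (by positivity)]
    have e : A * Y.step γ * (A * Y.step γ) * (1 / A) = (Y.step γ * scl (Y.lev γ)) ^ (2 : ℝ) := by
      rw [rpow_two, mul_pow, sq_scl, ← hAd]; field_simp
    rw [e, ← rpow_mul (mul_pos hst (scl_pos _)).le, ← rpow_natCast]
    congr 1; ring
  have spat : ∀ (ξ v : Space n), A / Y.R ≤ ‖ξ‖ → ‖ξ‖ ≤ Y.R * A →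
      c₂ * (A * ‖v‖ ^ 2) ≤ 1 / 2 * (ν * A * ‖ξ‖ / (ν * A + ‖ξ‖) * ‖v‖ ^ 2) := by
    intro ξ v h1 h2
    have h0 : 0 < ‖ξ‖ := lt_of_lt_of_le (by positivity) h1
    have : ν * (1 / Y.R) / (ν + Y.R) * A ≤ ν * A * ‖ξ‖ / (ν * A + ‖ξ‖) := by
      calc ν * (1 / Y.R) / (ν + Y.R) * A = ν * A * (A / Y.R) / (ν * A + Y.R * A) := by field_simp
        _ ≤ _ := by gcongr
    calc _ = 1 / 2 * (ν * (1 / Y.R) / (ν + Y.R) * A * ‖v‖ ^ 2) := by rw [hc₂]; ring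
      _ ≤ _ := by gcongr
  have freq : c₁ * (A⁻¹ * ‖Y.Ξ θ γ - Y.Ξ θ γ'‖ ^ 2) ≤
      ‖Y.Ξ θ γ - Y.Ξ θ γ'‖ ^ 2 / (4 * (ν * A + ‖Y.Ξ θ γ‖ + ‖Y.Ξ θ γ'‖)) := by
    calc _ = ‖Y.Ξ θ γ - Y.Ξ θ γ'‖ ^ 2 / (4 * (ν * A + Y.R * A + Y.R * A)) := by
          rw [hc₁]; field_simp
      _ ≤ _ := by gcongr
  have hpk : Y.pk θ γ' = packet (Y.step γ) (Y.X θ γ') (Y.Ξ θ γ') := by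
    funext x
    rw [pk, hst']
  rw [hpk]
  refine le_trans h ?_
  rw [mul_assoc _ (exp _) (exp _), ← exp_add]
  refine mul_le_mul ?_ (exp_le_exp.2 ?_) (exp_pos _).le (by have := scl_pos (Y.lev γ); positivity)
  · rw [hsc]
    calc _ ≤ (Y.R * A * Y.step γ / (2 * π)) ^ ((n : ℝ) / 2) *
          (Y.R * A * Y.step γ / (2 * π)) ^ ((n : ℝ) / 2) *
          (π / (ν * A)) ^ ((n : ℝ) / 2) := by
          gcongr
          linarith
      _ = _ := by
          rw [show Y.R * A * Y.step γ / (2 * π) = Y.R / (2 * π) * (A * Y.step γ) by ring,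
            show π / (ν * A) = π / ν * (1 / A) by field_simp,
            mul_rpow (x := Y.R / (2 * π)) (by positivity) (by positivity),
            mul_rpow (x := π / ν) (by positivity) (by positivity)]
          ring
  · have s1 := spat (Y.Ξ θ γ) (Y.X θ γ - z) l1 u1
    have s2 := spat (Y.Ξ θ γ') (Y.X θ γ' - z) l2 u2
    rw [norm_sub_rev z, norm_sub_rev z]
    have m1 := mul_le_mul_of_nonneg_right (min_le_right c₁ c₂)
      (show 0 ≤ A * ‖Y.X θ γ - z‖ ^ 2 by positivity)
    have m2 := mul_le_mul_of_nonneg_right (min_le_right c₁ c₂)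
      (show 0 ≤ A * ‖Y.X θ γ' - z‖ ^ 2 by positivity)
    have m3 := mul_le_mul_of_nonneg_right (min_le_left c₁ c₂)
      (show 0 ≤ A⁻¹ * ‖Y.Ξ θ γ - Y.Ξ θ γ'‖ ^ 2 by positivity)
    linarith

end PacketSystem

/-! ### Functions with Gaussian decay -/

/-- Continuous functions with Gaussian decay. -/
def Decays (f : Space n → ℂ) : Prop :=
  Continuous f ∧ ∃ K c : ℝ, 0 < c ∧ ∀ x, ‖f x‖ ≤ K * exp (-(c * ‖x‖ ^ 2))

/-- Continuous functions of polynomial growth. -/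
def PolyGrowth (f : Space n → ℂ) : Prop :=
  Continuous f ∧ ∃ (K : ℝ) (N : ℕ), ∀ x, ‖f x‖ ≤ K * (1 + ‖x‖) ^ N

namespace Decays

variable {f g : Space n → ℂ}

lemma continuous (hf : Decays f) : Continuous f := hf.1

lemma zero : Decays (fun _ : Space n => (0 : ℂ)) :=
  ⟨continuous_const, 0, 1, one_pos, fun x => by simp⟩

lemma add (hf : Decays f) (hg : Decays g) : Decays (fun x => f x + g x) := by
  obtain ⟨hf, K, c, hc, h⟩ := hf
  obtain ⟨hg, K', c', hc', h'⟩ := hg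
  refine ⟨hf.add hg, |K| + |K'|, min c c', lt_min hc hc', fun x => ?_⟩
  rw [add_mul]
  refine (norm_add_le _ _).trans (add_le_add ((h x).trans ?_) ((h' x).trans ?_)) <;> gcongr
  exacts [le_abs_self K, min_le_left _ _, le_abs_self K', min_le_right _ _]

lemma sum {ι : Type*} {S : Finset ι} {f : ι → Space n → ℂ} (hf : ∀ i ∈ S, Decays (f i)) :
    Decays (fun x => ∑ i ∈ S, f i x) := by
  classical
  induction S using Finset.induction_on with
  | empty => simpa using zero
  | insert i S hi ih =>
    simp only [sum_insert hi]
    exact (hf i (mem_insert_self _ _)).add (ih fun j hj => hf j (mem_insert_of_mem hj))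

lemma poly_mul (hf : PolyGrowth f) (hg : Decays g) :
    Decays (fun x => f x * g x) := by
  obtain ⟨hf, K, N, h⟩ := hf
  obtain ⟨hg, K', c, hc, h'⟩ := hg
  have hK : 0 ≤ K := by simpa using (norm_nonneg _).trans (h 0)
  have hK' : 0 ≤ K' := by simpa using (norm_nonneg _).trans (h' 0)
  refine ⟨hf.mul hg, K * K' * (N.factorial * exp (1 + 1 / (4 * (c / 2)))), c / 2, by positivity,
    fun x => ?_⟩
  have e : exp (-(c * ‖x‖ ^ 2)) = exp (-(c / 2 * ‖x‖ ^ 2)) * exp (-(c / 2 * ‖x‖ ^ 2)) := by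
    rw [← exp_add]; ring_nf
  rw [norm_mul]
  calc ‖f x‖ * ‖g x‖ ≤ K * (1 + ‖x‖) ^ N * (K' * exp (-(c * ‖x‖ ^ 2))) :=
        mul_le_mul (h x) (h' x) (norm_nonneg _) (by positivity)
    _ = K * K' * ((1 + ‖x‖) ^ N * exp (-(c / 2 * ‖x‖ ^ 2))) * exp (-(c / 2 * ‖x‖ ^ 2)) := by
        rw [e]; ring
    _ ≤ _ := by
        have := one_add_pow_mul_exp_le (c / 2) (by positivity) N ‖x‖ (norm_nonneg x)
        gcongr

lemma integrable (hf : Decays f) : Integrable f := by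
  obtain ⟨hf, K, c, hc, h⟩ := hf
  have := (integrable_exp_neg_mul_norm_sub_sq hc (0 : Space n)).const_mul K
  simp only [zero_sub, norm_neg] at this
  exact this.mono' hf.aestronglyMeasurable (.of_forall h)

end Decays

lemma PolyGrowth.of_bounded {f : Space n → ℂ} (hf : Continuous f) {K : ℝ} (h : ∀ x, ‖f x‖ ≤ K) :
    PolyGrowth f := ⟨hf, K, 0, by simpa using h⟩

lemma PolyGrowth.const (c : ℂ) : PolyGrowth (fun _ : Space n => c) :=
  .of_bounded continuous_const (K := ‖c‖) fun _ => le_rfl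

namespace Decays

variable {f g : Space n → ℂ}

lemma polyGrowth (hf : Decays f) : PolyGrowth f := by
  obtain ⟨hf, K, c, hc, h⟩ := hf
  have hK : 0 ≤ K := by simpa using (norm_nonneg _).trans (h 0)
  refine PolyGrowth.of_bounded hf (K := K) fun x => (h x).trans ?_
  refine mul_le_of_le_one_right hK (exp_le_one_iff.2 ?_)
  exact neg_nonpos.2 (by positivity)

lemma mul (hf : Decays f) (hg : Decays g) : Decays (fun x => f x * g x) :=
  poly_mul hf.polyGrowth hg

lemma const_mul (hf : Decays f) (c : ℂ) : Decays (fun x => c * f x) :=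
  poly_mul (PolyGrowth.const c) hf

lemma conjugate (hf : Decays f) : Decays (fun x => conj (f x)) := by
  obtain ⟨hf, K, c, hc, h⟩ := hf
  exact ⟨Complex.continuous_conj.comp hf, K, c, hc, fun x => by rw [RCLike.norm_conj]; exact h x⟩

lemma integrable_normSq (hf : Decays f) : Integrable (fun x => ‖f x‖ ^ 2) := by
  have := (hf.conjugate.mul hf).integrable.norm
  refine this.congr (.of_forall fun x => ?_)
  simp only [norm_mul, RCLike.norm_conj]
  ring

end Decays

lemma exp_shift_le {r : ℝ} (hr : 0 < r) (X x : Space n) :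
    exp (-(r * ‖x - X‖ ^ 2)) ≤ exp (r * ‖X‖ ^ 2) * exp (-(r / 2 * ‖x‖ ^ 2)) := by
  rw [← exp_add, exp_le_exp]
  have h1 : ‖x‖ ≤ ‖x - X‖ + ‖X‖ := by simpa using norm_add_le (x - X) X
  have h2 : ‖x‖ ^ 2 ≤ (‖x - X‖ + ‖X‖) ^ 2 := pow_le_pow_left₀ (norm_nonneg _) h1 2
  have h3 : ‖x‖ ^ 2 ≤ 2 * ‖x - X‖ ^ 2 + 2 * ‖X‖ ^ 2 := by nlinarith [sq_nonneg (‖x - X‖ - ‖X‖)]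
  nlinarith

lemma decays_packet {δ : ℝ} (hδ : 0 < δ) (X : Space n) {Ξ : Space n} (hΞ : Ξ ≠ 0) :
    Decays (packet δ X Ξ) := by
  have hr : 0 < ‖Ξ‖ := norm_pos_iff.2 hΞ
  refine ⟨continuous_packet _ _ _, (‖Ξ‖ * δ / (2 * π)) ^ ((n : ℝ) / 2) *
    exp (‖Ξ‖ * ‖X‖ ^ 2), ‖Ξ‖ / 2, by positivity, fun x => ?_⟩
  rw [norm_packet _ _ _ _ hδ, mul_assoc]
  gcongr
  exact exp_shift_le hr X x

/-! ### Packet sums at one level -/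

/-- Schur's test for the Gram matrix of functions, in a weighted `L²` space. -/
lemma integral_mul_normSq_sum_le {κ : Type*} {S : Finset κ} {f : κ → Space n → ℂ} {w : Space n → ℝ}
    {T : κ → κ → ℝ} {A : κ → ℝ} (hi : ∀ i j, Integrable fun x => (w x : ℂ) * (f i x * conj (f j x)))
    (h : ∀ i ∈ S, ∀ j ∈ S, ‖∫ x, (w x : ℂ) * (f i x * conj (f j x))‖ ≤ T i j / 2 + T j i / 2)
    (hT : ∀ i ∈ S, ∑ j ∈ S, T i j ≤ A i) : ∫ x, w x * ‖∑ i ∈ S, f i x‖ ^ 2 ≤ ∑ i ∈ S, A i := by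
  have e1 : ((∫ x, w x * ‖∑ i ∈ S, f i x‖ ^ 2 : ℝ) : ℂ) =
      ∑ i ∈ S, ∑ j ∈ S, ∫ x, (w x : ℂ) * (f i x * conj (f j x)) := by
    have hp : ∀ x, ((w x * ‖∑ i ∈ S, f i x‖ ^ 2 : ℝ) : ℂ) =
        ∑ i ∈ S, ∑ j ∈ S, (w x : ℂ) * (f i x * conj (f j x)) := fun x => by
      rw [ofReal_mul, Complex.ofReal_pow, ← Complex.mul_conj', map_sum, Finset.sum_mul_sum]
      simp only [mul_sum]
    rw [← integral_complex_ofReal]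
    simp only [hp]
    rw [integral_finsetSum _ fun i _ => integrable_finsetSum _ fun j _ => hi i j]
    exact sum_congr rfl fun i _ => integral_finsetSum _ fun j _ => hi i j
  have hA := le_abs_self (∫ x, w x * ‖∑ i ∈ S, f i x‖ ^ 2)
  rw [← norm_eq_abs, ← norm_real, e1] at hA
  refine hA.trans ((norm_sum_le _ _).trans ((sum_le_sum fun i hi => (norm_sum_le _ _).trans
    (sum_le_sum fun j hj => h i hi j hj)).trans (le_trans (le_of_eq ?_) (sum_le_sum hT))))
  simp only [sum_add_distrib]
  rw [sum_comm (f := fun i j => T j i / 2)]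
  simp only [← Finset.sum_div, add_halves]

namespace PacketSystem

variable {Θ ι : Type} (Y : PacketSystem n Θ ι)

lemma decays_pk (θ : Θ) (γ : ι) : Decays (Y.pk θ γ) :=
  decays_packet (Y.step_pos γ) _ (Y.ne_zero θ γ)

/-- Packet sums of one level, localized near `z`. -/
lemma exists_local_bound {ν : ℝ} (hν : 0 < ν) : ∃ c K : ℝ, 0 < c ∧ 0 ≤ K ∧ ∀ θ (z : Space n) (k : ℕ)
    (S : Finset ι), (∀ γ ∈ S, Y.lev γ = k) → ∀ d : ι → ℂ,
    ∫ x, exp (-(ν * 2 ^ k * ‖x - z‖ ^ 2)) * ‖∑ γ ∈ S, d γ * Y.pk θ γ x‖ ^ 2 ≤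
      K * ∑ γ ∈ S, ‖d γ‖ ^ 2 * exp (-(c * (2 ^ k * ‖z - Y.X θ γ‖ ^ 2))) := by
  obtain ⟨c, K₁, hc, hK₁, hgram⟩ := Y.exists_gram_le hν
  obtain ⟨K₂, hcount⟩ := Y.count c hc
  refine ⟨c, K₁ * |K₂|, hc, by positivity, fun θ z k S hS d => ?_⟩
  set w : Space n → ℝ := fun x => exp (-(ν * 2 ^ k * ‖x - z‖ ^ 2)) with hw
  have hwP : PolyGrowth (fun x => (w x : ℂ)) := by
    refine PolyGrowth.of_bounded (K := 1) ?_ fun x => ?_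
    · exact continuous_ofReal.comp (by rw [hw]; fun_prop)
    · rw [norm_real, norm_of_nonneg (exp_pos _).le, exp_le_one_iff]
      exact neg_nonpos.2 (by positivity)
  set J : ι → ι → ℂ := fun γ γ' => ∫ x, (w x : ℂ) * (Y.pk θ γ x * conj (Y.pk θ γ' x)) with hJ
  set a : ι → ℝ := fun γ => exp (-(c * (2 ^ k * ‖z - Y.X θ γ‖ ^ 2))) with ha
  set T : ι → ι → ℝ := fun γ γ' => (Y.step γ' * scl (Y.lev γ')) ^ n *
    exp (-(c * (2 ^ Y.lev γ' * ‖z - Y.X θ γ'‖ ^ 2 +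
      ((2 : ℝ) ^ Y.lev γ')⁻¹ * ‖Y.Ξ θ γ' - Y.Ξ θ γ‖ ^ 2))) with hT
  have hTsum : ∀ γ ∈ S, ∑ γ' ∈ S, T γ γ' ≤ |K₂| := fun γ hγ =>
    (hcount θ z γ S fun γ' hγ' => (hS γ' hγ').trans (hS γ hγ).symm).trans (le_abs_self _)
  have hI : ∀ γ ∈ S, ∀ γ' ∈ S,
      ‖J γ γ'‖ ≤ K₁ * (a γ * T γ γ') ∧ ‖J γ γ'‖ ≤ K₁ * (a γ' * T γ' γ) := by
    intro γ hγ γ' hγ'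
    have hl : Y.lev γ = Y.lev γ' := (hS γ hγ).trans (hS γ' hγ').symm
    have h := hgram θ z γ γ' hl
    have hst := Y.step_eq γ γ' hl
    rw [hS γ hγ] at h
    refine ⟨h.trans (le_of_eq ?_), h.trans (le_of_eq ?_)⟩
    · simp only [ha, hT]
      rw [hS γ' hγ', ← hst, mul_left_comm (exp _), ← exp_add, mul_assoc, norm_sub_rev (Y.Ξ θ γ)]
      congr 3
      ring
    · simp only [ha, hT]
      rw [hS γ hγ, mul_left_comm (exp _), ← exp_add, mul_assoc]
      congr 3
      ring
  have hd : ∀ γ, Decays (fun x => d γ * Y.pk θ γ x) := fun γ => (Y.decays_pk θ γ).const_mul _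
  refine (integral_mul_normSq_sum_le (T := fun γ γ' => K₁ * (‖d γ‖ ^ 2 * a γ * T γ γ'))
    (A := fun γ => K₁ * (‖d γ‖ ^ 2 * a γ * |K₂|))
    (fun γ γ' => (Decays.poly_mul hwP ((hd γ).mul (hd γ').conjugate)).integrable)
    (fun γ hγ γ' hγ' => ?_) fun γ hγ => ?_).trans (le_of_eq ?_)
  · have e : ∀ x, (w x : ℂ) * (d γ * Y.pk θ γ x * conj (d γ' * Y.pk θ γ' x)) =
        d γ * conj (d γ') * ((w x : ℂ) * (Y.pk θ γ x * conj (Y.pk θ γ' x))) := fun x => by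
      rw [map_mul]; ring
    simp only [e]
    rw [integral_const_mul, norm_mul, norm_mul, RCLike.norm_conj]
    obtain ⟨h1, h2⟩ := hI γ hγ γ' hγ'
    calc ‖d γ‖ * ‖d γ'‖ * ‖J γ γ'‖ ≤ (‖d γ‖ ^ 2 + ‖d γ'‖ ^ 2) / 2 * ‖J γ γ'‖ := by
          gcongr
          nlinarith [sq_nonneg (‖d γ‖ - ‖d γ'‖)]
      _ = ‖d γ‖ ^ 2 / 2 * ‖J γ γ'‖ + ‖d γ'‖ ^ 2 / 2 * ‖J γ γ'‖ := by ring
      _ ≤ ‖d γ‖ ^ 2 / 2 * (K₁ * (a γ * T γ γ')) + ‖d γ'‖ ^ 2 / 2 * (K₁ * (a γ' * T γ' γ)) := by gcongr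
      _ = _ := by ring
  · rw [← mul_sum, ← mul_sum]
    gcongr
    exact hTsum γ hγ
  · rw [← mul_sum, ← sum_mul]; ring

/-- Coefficient families which near every point `z`, on the scale of the packets, are finite sums of
products of a function of `x` and a function of the index, both of polynomial growth. Polynomials
in the scaled distance to the centre are the basic example; the point of the definition is that it
also covers Taylor remainders of the coefficients of the equation, which are not smooth. -/
def Tame (p : Θ → ι → Space n → ℂ) : Prop :=
  (∀ θ γ, Continuous (p θ γ)) ∧ ∃ (J : Type) (_ : Fintype J) (N : ℕ) (K : ℝ), ∀ θ k (z : Space n),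
    ∃ (A : J → Space n → ℂ) (B : J → ι → ℂ),
      (∀ γ, Y.lev γ = k → ∀ x, p θ γ x = ∑ l, A l x * B l γ) ∧
      (∀ l x, ‖A l x‖ ≤ K * (1 + scl k * ‖x - z‖) ^ N) ∧
      (∀ l γ, Y.lev γ = k → ‖B l γ‖ ≤ K * (1 + scl k * ‖z - Y.X θ γ‖) ^ N)

lemma scl_mul_norm_nonneg (k : ℕ) (v : Space n) : 0 ≤ scl k * ‖v‖ :=
  mul_nonneg (scl_pos k).le (norm_nonneg _)

variable {Y} {p q : Θ → ι → Space n → ℂ}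

namespace Tame

lemma add (hp : Y.Tame p) (hq : Y.Tame q) :
    Y.Tame (fun θ γ x => p θ γ x + q θ γ x) := by
  obtain ⟨cp, J, _, N, K, h⟩ := hp
  obtain ⟨cq, J', _, N', K', h'⟩ := hq
  refine ⟨fun θ γ => (cp θ γ).add (cq θ γ), J ⊕ J', inferInstance, max N N', max |K| |K'|,
    fun θ k z => ?_⟩
  obtain ⟨A, B, e, hA, hB⟩ := h θ k z
  obtain ⟨A', B', e', hA', hB'⟩ := h' θ k z
  have mono : ∀ {K₁ : ℝ} {N₁ : ℕ}, |K₁| ≤ max |K| |K'| → N₁ ≤ max N N' → ∀ {u : ℂ} {v : Space n},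
      ‖u‖ ≤ K₁ * (1 + scl k * ‖v‖) ^ N₁ → ‖u‖ ≤ max |K| |K'| * (1 + scl k * ‖v‖) ^ max N N' := by
    intro K₁ N₁ h1 h2 u v h3
    have := scl_mul_norm_nonneg k v
    have h4 := (le_abs_self _).trans h1
    have h5 : 1 ≤ 1 + scl k * ‖v‖ := by linarith
    have h6 := (abs_nonneg _).trans h1
    exact h3.trans (by gcongr)
  have m1 := @mono K N (le_max_left _ _) (le_max_left _ _)
  have m2 := @mono K' N' (le_max_right _ _) (le_max_right _ _)
  refine ⟨Sum.elim A A', Sum.elim B B', fun γ hγ x => ?_, ?_, ?_⟩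
  · beta_reduce
    rw [Fintype.sum_sum_type, e γ hγ x, e' γ hγ x]
    rfl
  · rintro (l | l) x
    exacts [m1 (hA l x), m2 (hA' l x)]
  · rintro (l | l) γ hγ
    exacts [m1 (hB l γ hγ), m2 (hB' l γ hγ)]

lemma mul (hp : Y.Tame p) (hq : Y.Tame q) :
    Y.Tame (fun θ γ x => p θ γ x * q θ γ x) := by
  obtain ⟨cp, J, _, N, K, h⟩ := hp
  obtain ⟨cq, J', _, N', K', h'⟩ := hq
  refine ⟨fun θ γ => (cp θ γ).mul (cq θ γ), J × J', inferInstance, N + N', |K| * |K'|,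
    fun θ k z => ?_⟩
  obtain ⟨A, B, e, hA, hB⟩ := h θ k z
  obtain ⟨A', B', e', hA', hB'⟩ := h' θ k z
  have key : ∀ (u v : ℂ) (r : ℝ), 0 ≤ r → ‖u‖ ≤ K * (1 + r) ^ N → ‖v‖ ≤ K' * (1 + r) ^ N' →
      ‖u * v‖ ≤ |K| * |K'| * (1 + r) ^ (N + N') := by
    intro u v r hr hu hv
    have hu' : ‖u‖ ≤ |K| * (1 + r) ^ N := hu.trans (by gcongr; exact le_abs_self K)
    have hv' : ‖v‖ ≤ |K'| * (1 + r) ^ N' := hv.trans (by gcongr; exact le_abs_self K')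
    rw [norm_mul, pow_add]
    calc _ ≤ |K| * (1 + r) ^ N * (|K'| * (1 + r) ^ N') := by gcongr
      _ = _ := by ring
  refine ⟨fun l x => A l.1 x * A' l.2 x, fun l γ => B l.1 γ * B' l.2 γ, fun γ hγ x => ?_,
    fun l x => ?_, fun l γ hγ => ?_⟩
  · beta_reduce
    rw [e γ hγ x, e' γ hγ x, Finset.sum_mul_sum, Fintype.sum_prod_type]
    refine sum_congr rfl fun i _ => sum_congr rfl fun j _ => ?_
    ring
  · exact key _ _ _ (scl_mul_norm_nonneg k _) (hA l.1 x) (hA' l.2 x)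
  · exact key _ _ _ (scl_mul_norm_nonneg k _) (hB l.1 γ hγ) (hB' l.2 γ hγ)

lemma const {b : Θ → ι → ℂ} {K : ℝ} (hb : ∀ θ γ, ‖b θ γ‖ ≤ K) : Y.Tame (fun θ γ _ => b θ γ) := by
  refine ⟨fun _ _ => continuous_const, Unit, inferInstance, 0, max 1 K, fun θ k z =>
    ⟨fun _ _ => 1, fun _ γ => b θ γ, fun γ _ x => by simp, fun _ x => by simp, fun _ γ _ => ?_⟩⟩
  simpa using Or.inr (hb θ γ)

/-- The scaled coordinates of the distance to the centre are tame. -/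
lemma coord (j : Fin n) :
    Y.Tame (fun θ γ x => ((scl (Y.lev γ) * (x j - Y.X θ γ j) : ℝ) : ℂ)) := by
  refine ⟨fun θ γ => continuous_ofReal.comp (by fun_prop), Bool, inferInstance, 1, 1,
    fun θ k z => ⟨fun l x => if l then ((scl k * (x j - z j) : ℝ) : ℂ) else 1,
      fun l γ => if l then 1 else ((scl k * (z j - Y.X θ γ j) : ℝ) : ℂ), fun γ hγ x => ?_, ?_, ?_⟩⟩
  · beta_reduce
    rw [Fintype.sum_bool, hγ]
    simp only [if_true, Bool.false_eq_true, if_false]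
    push_cast
    ring
  · rintro (_ | _) x
    · simpa using scl_mul_norm_nonneg k (x - z)
    · have h2 := mul_le_mul_of_nonneg_left (abs_coord_le (x - z) j) (scl_pos k).le
      simp only [if_true, norm_real, norm_eq_abs, abs_mul, abs_of_pos (scl_pos k), pow_one,
        one_mul]
      simp only [PiLp.sub_apply] at h2
      linarith
  · rintro (_ | _) γ hγ
    · have h2 := mul_le_mul_of_nonneg_left (abs_coord_le (z - Y.X θ γ) j) (scl_pos k).le
      simp only [Bool.false_eq_true, if_false, norm_real, norm_eq_abs, abs_mul,
        abs_of_pos (scl_pos k), pow_one, one_mul]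
      simp only [PiLp.sub_apply] at h2
      linarith
    · simpa using scl_mul_norm_nonneg k (z - Y.X θ γ)

lemma polyGrowth (hp : Y.Tame p) (θ : Θ) (γ : ι) : PolyGrowth (p θ γ) := by
  obtain ⟨cp, J, _, N, K, h⟩ := hp
  obtain ⟨A, B, e, hA, hB⟩ := h θ (Y.lev γ) 0
  refine ⟨cp θ γ, ∑ l, |K| * scl (Y.lev γ) ^ N * ‖B l γ‖, N, fun x => ?_⟩
  rw [e γ rfl x, sum_mul]
  refine (norm_sum_le _ _).trans (sum_le_sum fun l _ => ?_)
  rw [norm_mul]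
  have h1 : 1 + scl (Y.lev γ) * ‖x - 0‖ ≤ scl (Y.lev γ) * (1 + ‖x‖) := by
    rw [sub_zero]; nlinarith [one_le_scl (Y.lev γ)]
  have h0 : 0 ≤ 1 + scl (Y.lev γ) * ‖x - 0‖ := by
    linarith [scl_mul_norm_nonneg (Y.lev γ) (x - 0)]
  calc _ ≤ |K| * (1 + scl (Y.lev γ) * ‖x - 0‖) ^ N * ‖B l γ‖ := by
        gcongr
        exact (hA l x).trans (mul_le_mul_of_nonneg_right (le_abs_self K) (by positivity))
    _ ≤ |K| * (scl (Y.lev γ) * (1 + ‖x‖)) ^ N * ‖B l γ‖ := by gcongr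
    _ = _ := by rw [mul_pow]; ring

lemma decays (hp : Y.Tame p) (θ : Θ) (γ : ι) :
    Decays (fun x => p θ γ x * Y.pk θ γ x) := Decays.poly_mul (hp.polyGrowth θ γ) (Y.decays_pk θ γ)

lemma decays_sum (hp : Y.Tame p) (θ : Θ) (S : Finset ι) (c : ι → ℂ) :
    Decays (fun x => ∑ γ ∈ S, c γ * (p θ γ x * Y.pk θ γ x)) :=
  Decays.sum fun γ _ => (hp.decays θ γ).const_mul (c γ)

end Tame

lemma integrable_exp_mul {ν : ℝ} (hν : 0 < ν) (z : Space n) {f : Space n → ℂ} (hf : Decays f) :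
    Integrable (fun x => exp (-(ν * ‖x - z‖ ^ 2)) * ‖f x‖ ^ 2) := by
  refine Integrable.mono' hf.integrable_normSq ?_ (.of_forall fun x => ?_)
  · have := hf.continuous
    exact Continuous.aestronglyMeasurable (by fun_prop)
  · rw [norm_of_nonneg (by positivity)]
    exact mul_le_of_le_one_left (by positivity) (exp_le_one_iff.2 (neg_nonpos.2 (by positivity)))

/-- A Gaussian absorbs polynomial growth on its own scale. -/
lemma exp_mul_norm_sq_le {c K : ℝ} (hc : 0 < c) {N k : ℕ} {u : ℂ} {v : Space n}
    (h : ‖u‖ ≤ K * (1 + scl k * ‖v‖) ^ N) : exp (-(c * (2 ^ k * ‖v‖ ^ 2))) * ‖u‖ ^ 2 ≤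
      K ^ 2 * ((2 * N).factorial * exp (1 + 1 / (4 * (c / 2)))) *
        exp (-(c / 2 * (2 ^ k * ‖v‖ ^ 2))) := by
  have h1 := one_add_pow_mul_exp_le (c / 2) (by positivity) (2 * N) _ (scl_mul_norm_nonneg k v)
  rw [mul_pow, sq_scl] at h1
  have h2 : ‖u‖ ^ 2 ≤ K ^ 2 * (1 + scl k * ‖v‖) ^ (2 * N) := by
    refine (pow_le_pow_left₀ (norm_nonneg _) h 2).trans (le_of_eq ?_)
    rw [mul_pow, ← pow_mul, mul_comm N]
  have e : exp (-(c * (2 ^ k * ‖v‖ ^ 2))) = exp (-(c / 2 * (2 ^ k * ‖v‖ ^ 2))) ^ 2 := by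
    rw [← exp_nat_mul]; ring_nf
  set E := exp (-(c / 2 * (2 ^ k * ‖v‖ ^ 2)))
  have hE : 0 < E := exp_pos _
  rw [e]
  calc _ ≤ E ^ 2 * (K ^ 2 * (1 + scl k * ‖v‖) ^ (2 * N)) := by gcongr
    _ = K ^ 2 * ((1 + scl k * ‖v‖) ^ (2 * N) * E) * E := by ring
    _ ≤ _ := by gcongr

/-- Tame packet sums of one level, localized near `z`. -/
lemma Tame.exists_local_bound (hp : Y.Tame p) : ∃ c K : ℝ, 0 < c ∧ 0 ≤ K ∧
    ∀ θ (z : Space n) (k : ℕ) (S : Finset ι), (∀ γ ∈ S, Y.lev γ = k) → ∀ d : ι → ℂ,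
    ∫ x, exp (-(2 ^ k * ‖x - z‖ ^ 2)) * ‖∑ γ ∈ S, d γ * (p θ γ x * Y.pk θ γ x)‖ ^ 2 ≤
      K * ∑ γ ∈ S, ‖d γ‖ ^ 2 * exp (-(c * (2 ^ k * ‖z - Y.X θ γ‖ ^ 2))) := by
  have hp' := hp
  obtain ⟨cp, J, _, N, K, h⟩ := hp
  obtain ⟨c, K', hc, hK', hloc⟩ := Y.exists_local_bound (ν := 1 / 2) (by norm_num)
  set D₁ : ℝ := (2 * N).factorial * exp (1 + 1 / (4 * (1 / 2))) with hD₁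
  set D₂ : ℝ := (2 * N).factorial * exp (1 + 1 / (4 * (c / 2))) with hD₂
  refine ⟨c / 2, Fintype.card J * (Fintype.card J * (K ^ 2 * D₁ * (K' * (K ^ 2 * D₂)))), by positivity,
    by positivity, fun θ z k S hS d => ?_⟩
  obtain ⟨A, B, e, hA, hB⟩ := h θ k z
  have hA2 : ∀ l x, exp (-(2 ^ k * ‖x - z‖ ^ 2)) * ‖A l x‖ ^ 2 ≤
      K ^ 2 * D₁ * exp (-(1 / 2 * 2 ^ k * ‖x - z‖ ^ 2)) := fun l x => by
    simpa only [hD₁, one_mul, mul_assoc] using exp_mul_norm_sq_le one_pos (hA l x)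
  have hB2 : ∀ l, ∀ γ ∈ S, ‖d γ * B l γ‖ ^ 2 * exp (-(c * (2 ^ k * ‖z - Y.X θ γ‖ ^ 2))) ≤
      K ^ 2 * D₂ * (‖d γ‖ ^ 2 * exp (-(c / 2 * (2 ^ k * ‖z - Y.X θ γ‖ ^ 2)))) := fun l γ hγ => by
    rw [norm_mul, mul_pow, mul_assoc, mul_left_comm (K ^ 2 * D₂), mul_comm (‖B l γ‖ ^ 2)]
    exact mul_le_mul_of_nonneg_left (exp_mul_norm_sq_le hc (hB l γ (hS γ hγ))) (by positivity)
  set F : J → Space n → ℂ := fun l x => ∑ γ ∈ S, (d γ * B l γ) * Y.pk θ γ x with hF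
  have hpk : ∀ l, Decays (F l) := fun l =>
    Decays.sum fun γ _ => (Y.decays_pk θ γ).const_mul _
  have hpt : ∀ x, exp (-(2 ^ k * ‖x - z‖ ^ 2)) * ‖∑ γ ∈ S, d γ * (p θ γ x * Y.pk θ γ x)‖ ^ 2 ≤
      Fintype.card J * ∑ l, K ^ 2 * D₁ * (exp (-(1 / 2 * 2 ^ k * ‖x - z‖ ^ 2)) * ‖F l x‖ ^ 2) := by
    intro x
    have e3 : ∑ γ ∈ S, d γ * (p θ γ x * Y.pk θ γ x) =
        ∑ l, A l x * F l x := by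
      simp only [hF, mul_sum]
      rw [sum_comm]
      refine sum_congr rfl fun γ hγ => ?_
      rw [e γ (hS γ hγ) x, sum_mul, mul_sum]
      refine sum_congr rfl fun l _ => ?_
      ring
    rw [e3]
    calc _ ≤ exp (-(2 ^ k * ‖x - z‖ ^ 2)) * (Fintype.card J * ∑ l, ‖A l x * F l x‖ ^ 2) := by
          gcongr
          exact (pow_le_pow_left₀ (norm_nonneg _) (norm_sum_le _ _) 2).trans
            sq_sum_le_card_mul_sum_sq
      _ = Fintype.card J * ∑ l, exp (-(2 ^ k * ‖x - z‖ ^ 2)) * ‖A l x‖ ^ 2 * ‖F l x‖ ^ 2 := by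
          rw [mul_left_comm, mul_sum]
          congr 1
          refine sum_congr rfl fun l _ => ?_
          rw [norm_mul]
          ring
      _ ≤ _ := by
          refine mul_le_mul_of_nonneg_left (sum_le_sum fun l _ => ?_) (by positivity)
          rw [← mul_assoc]
          exact mul_le_mul_of_nonneg_right (hA2 l x) (by positivity)
  have hi : ∀ l, Integrable (fun x => K ^ 2 * D₁ * (exp (-(1 / 2 * 2 ^ k * ‖x - z‖ ^ 2)) * ‖F l x‖ ^ 2)) := fun l =>
    (integrable_exp_mul (by positivity) z (hpk l)).const_mul _
  calc _ ≤ ∫ x, Fintype.card J * ∑ l, K ^ 2 * D₁ * (exp (-(1 / 2 * 2 ^ k * ‖x - z‖ ^ 2)) * ‖F l x‖ ^ 2) :=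
        integral_mono (integrable_exp_mul (by positivity) z (hp'.decays_sum θ S d))
          ((integrable_finsetSum _ fun l _ => hi l).const_mul _) hpt
    _ = Fintype.card J * ∑ l, K ^ 2 * D₁ * ∫ x, exp (-(1 / 2 * 2 ^ k * ‖x - z‖ ^ 2)) * ‖F l x‖ ^ 2 := by
        rw [integral_const_mul, integral_finsetSum _ fun l _ => hi l]
        simp only [integral_const_mul]
    _ ≤ Fintype.card J * ∑ _l : J, K ^ 2 * D₁ * (K' * ∑ γ ∈ S,
        K ^ 2 * D₂ * (‖d γ‖ ^ 2 * exp (-(c / 2 * (2 ^ k * ‖z - Y.X θ γ‖ ^ 2))))) := by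
        gcongr with l
        refine (hloc θ z k S hS fun γ => d γ * B l γ).trans ?_
        exact mul_le_mul_of_nonneg_left (sum_le_sum fun γ hγ => hB2 l γ hγ) hK'
    _ = _ := by
        rw [Finset.sum_const, Finset.card_univ, nsmul_eq_mul, ← mul_sum]
        ring

/-- The average of localized `L²` norms is the `L²` norm. -/
lemma integral_local_eq {μ : ℝ} (hμ : 0 < μ) {f : Space n → ℂ} (hf : Decays f) :
    ∫ z, ∫ x, exp (-(μ * ‖x - z‖ ^ 2)) * ‖f x‖ ^ 2 =
      (π / μ) ^ ((n : ℝ) / 2) * ∫ x, ‖f x‖ ^ 2 ∧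
    Integrable (fun z => ∫ x, exp (-(μ * ‖x - z‖ ^ 2)) * ‖f x‖ ^ 2) := by
  have hcont : Continuous (fun q : Space n × Space n =>
      exp (-(μ * ‖q.1 - q.2‖ ^ 2)) * ‖f q.1‖ ^ 2) := by
    have := hf.continuous
    fun_prop
  have hz : ∀ x, ∫ z, exp (-(μ * ‖x - z‖ ^ 2)) * ‖f x‖ ^ 2 =
      (π / μ) ^ ((n : ℝ) / 2) * ‖f x‖ ^ 2 := by
    intro x
    rw [integral_mul_const, integral_exp_neg_mul_norm_sub_sq hμ]
  have hprod : Integrable (fun q : Space n × Space n =>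
      exp (-(μ * ‖q.1 - q.2‖ ^ 2)) * ‖f q.1‖ ^ 2) (volume.prod volume) := by
    rw [integrable_prod_iff hcont.aestronglyMeasurable]
    refine ⟨Filter.Eventually.of_forall fun x =>
      (integrable_exp_neg_mul_norm_sub_sq hμ x).mul_const (‖f x‖ ^ 2), ?_⟩
    have : ∀ x : Space n, ∫ z : Space n, ‖exp (-(μ * ‖x - z‖ ^ 2)) * ‖f x‖ ^ 2‖ =
        (π / μ) ^ ((n : ℝ) / 2) * ‖f x‖ ^ 2 := by
      intro x
      rw [← hz x]
      congr 1
      ext z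
      rw [norm_of_nonneg (by positivity)]
    simp only [this]
    exact hf.integrable_normSq.const_mul _
  constructor
  · rw [integral_integral_swap (f := fun z x => exp (-(μ * ‖x - z‖ ^ 2)) * ‖f x‖ ^ 2) hprod.swap]
    simp only [hz]
    rw [integral_const_mul]
  · exact hprod.swap.integral_prod_left

/-- Tame packet sums of one level are bounded in `L²` by the coefficients. -/
lemma Tame.exists_level_bound (hp : Y.Tame p) : ∃ K : ℝ, 0 ≤ K ∧
    ∀ θ (k : ℕ) (S : Finset ι), (∀ γ ∈ S, Y.lev γ = k) → ∀ d : ι → ℂ,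
    ∫ x, ‖∑ γ ∈ S, d γ * (p θ γ x * Y.pk θ γ x)‖ ^ 2 ≤ K * ∑ γ ∈ S, ‖d γ‖ ^ 2 := by
  obtain ⟨c, K, hc, hK, h⟩ := hp.exists_local_bound
  refine ⟨K * (1 / c) ^ ((n : ℝ) / 2), by positivity, fun θ k S hS d => ?_⟩
  have hA : (0 : ℝ) < 2 ^ k := by positivity
  have hf := hp.decays_sum θ S d
  obtain ⟨h1, h2⟩ := integral_local_eq hA hf
  have hg : ∀ γ, Integrable (fun z : Space n => ‖d γ‖ ^ 2 * exp (-(c * (2 ^ k * ‖z - Y.X θ γ‖ ^ 2)))) := by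
    intro γ
    have := (integrable_exp_neg_mul_norm_sub_sq (c := c * 2 ^ k) (by positivity) (Y.X θ γ)).const_mul
      (‖d γ‖ ^ 2)
    simpa only [norm_sub_rev (Y.X θ γ), mul_assoc] using this
  have h3 : ∫ z, ∫ x, exp (-(2 ^ k * ‖x - z‖ ^ 2)) * ‖∑ γ ∈ S, d γ * (p θ γ x * Y.pk θ γ x)‖ ^ 2 ≤
      ∫ z, K * ∑ γ ∈ S, ‖d γ‖ ^ 2 * exp (-(c * (2 ^ k * ‖z - Y.X θ γ‖ ^ 2))) :=
    integral_mono h2 ((integrable_finsetSum _ fun γ _ => hg γ).const_mul _)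
      (fun z => h θ z k S hS d)
  rw [h1, integral_const_mul, integral_finsetSum _ fun γ _ => hg γ] at h3
  have h4 : ∀ γ, ∫ z : Space n, ‖d γ‖ ^ 2 * exp (-(c * (2 ^ k * ‖z - Y.X θ γ‖ ^ 2))) =
      (1 / c) ^ ((n : ℝ) / 2) * (π / 2 ^ k) ^ ((n : ℝ) / 2) * ‖d γ‖ ^ 2 := by
    intro γ
    rw [integral_const_mul]
    have := integral_exp_neg_mul_norm_sub_sq (c := c * 2 ^ k) (by positivity) (Y.X θ γ)
    simp only [norm_sub_rev (Y.X θ γ), mul_assoc] at this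
    rw [this, ← mul_rpow (by positivity) (by positivity), mul_comm]
    congr 2
    field_simp
  simp only [h4] at h3
  rw [← mul_sum] at h3
  have hpos : (0 : ℝ) < (π / 2 ^ k) ^ ((n : ℝ) / 2) := by positivity
  refine le_of_mul_le_mul_left (h3.trans (le_of_eq ?_)) hpos
  ring

end PacketSystem

/-! ### Partial derivatives -/

/-- `f'` is the partial derivative of `f` in the direction `j`. -/
def HasPartial (j : Fin n) (f f' : Space n → ℂ) : Prop :=
  ∀ x, HasLineDerivAt ℝ f (f' x) x (EuclideanSpace.single j 1)

namespace HasPartial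

variable {j : Fin n} {f f' g g' : Space n → ℂ}

lemma congr (h : HasPartial j f f') (e : ∀ x, g x = f x) (e' : ∀ x, g' x = f' x) :
    HasPartial j g g' := by
  rw [funext e, funext e']
  exact h

lemma const (c : ℂ) : HasPartial j (fun _ => c) (fun _ => 0) := fun _ => hasDerivAt_const _ _

lemma add (hf : HasPartial j f f') (hg : HasPartial j g g') :
    HasPartial j (fun x => f x + g x) (fun x => f' x + g' x) := fun x =>
  HasDerivAt.add (hf x) (hg x)

lemma sum {ι : Type*} {S : Finset ι} {f f' : ι → Space n → ℂ}
    (h : ∀ i ∈ S, HasPartial j (f i) (f' i)) :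
    HasPartial j (fun x => ∑ i ∈ S, f i x) (fun x => ∑ i ∈ S, f' i x) := fun x =>
  HasDerivAt.fun_sum fun i hi => h i hi x

lemma mul (hf : HasPartial j f f') (hg : HasPartial j g g') :
    HasPartial j (fun x => f x * g x) (fun x => f' x * g x + f x * g' x) := fun x =>
  (HasDerivAt.mul (hf x) (hg x)).congr_deriv (by simp)

lemma const_mul (hf : HasPartial j f f') (c : ℂ) :
    HasPartial j (fun x => c * f x) (fun x => c * f' x) := fun x =>
  HasDerivAt.const_mul c (hf x)

lemma conjugate (hf : HasPartial j f f') :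
    HasPartial j (fun x => conj (f x)) (fun x => conj (f' x)) := fun x => by
  have h : HasDerivAt _ _ _ := hf x
  exact h.star

lemma ofReal {f f' : Space n → ℝ}
    (hf : ∀ x, HasLineDerivAt ℝ f (f' x) x (EuclideanSpace.single j 1)) :
    HasPartial j (fun x => (f x : ℂ)) (fun x => (f' x : ℂ)) := fun x =>
  HasDerivAt.ofReal_comp (hf x)

lemma coord (l : Fin n) (X : Space n) :
    HasPartial j (fun x => ((x l - X l : ℝ) : ℂ)) (fun _ => if l = j then 1 else 0) := by
  have h : ∀ x, HasLineDerivAt ℝ (fun x : Space n => x l - X l) (if l = j then 1 else 0) x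
      (EuclideanSpace.single j 1) := by
    intro x
    have h1 : HasDerivAt (fun t : ℝ => x l + t * (if l = j then 1 else 0) - X l)
        (if l = j then 1 else 0) 0 := by
      simpa using (((hasDerivAt_id (0 : ℝ)).mul_const (if l = j then (1 : ℝ) else 0)).const_add
        (x l)).sub_const (X l)
    refine h1.congr_of_eventuallyEq (.of_forall fun t => ?_)
    simp
  refine (ofReal h).congr (fun _ => rfl) fun x => ?_
  split_ifs <;> simp

lemma integral_mul_eq_neg (hf : HasPartial j f f') (hg : HasPartial j g g')
    (i1 : Integrable (fun x => f' x * g x)) (i2 : Integrable (fun x => f x * g' x))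
    (i3 : Integrable (fun x => f x * g x)) : ∫ x, f x * g' x = -∫ x, f' x * g x :=
  integral_bilinear_hasLineDerivAt_right_eq_neg_left_of_integrable
    (B := ContinuousLinearMap.mul ℝ ℂ) i1 i2 i3 (fun x _ => hf x) (fun x _ => hg x)

end HasPartial

lemma hasPartial_packet (δ : ℝ) (X Ξ : Space n) (j : Fin n) :
    HasPartial j (packet δ X Ξ) (fun x =>
      (I * (Ξ j : ℂ) - 2 * (‖Ξ‖ : ℂ) * ((x j - X j : ℝ) : ℂ)) * packet δ X Ξ x) := by
  intro x
  have e1 : ∀ t : ℝ, inner ℝ Ξ (x + t • EuclideanSpace.single j (1 : ℝ) - X) =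
      inner ℝ Ξ (x - X) + t * Ξ j := by
    intro t
    rw [add_sub_right_comm, inner_add_right, inner_smul_right, EuclideanSpace.inner_single_right]
    simp
  have e2 : ∀ t : ℝ, ‖x + t • EuclideanSpace.single j (1 : ℝ) - X‖ ^ 2 =
      ‖x - X‖ ^ 2 + 2 * t * (x j - X j) + t ^ 2 := by
    intro t
    rw [add_sub_right_comm, norm_add_sq_real, inner_smul_right, EuclideanSpace.inner_single_right,
      norm_smul, PiLp.norm_single]
    simp
    ring
  have h1 : HasDerivAt (fun t : ℝ => I * ((inner ℝ Ξ (x - X) + t * Ξ j : ℝ) : ℂ) -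
      ((‖Ξ‖ * (‖x - X‖ ^ 2 + 2 * t * (x j - X j) + t ^ 2) : ℝ) : ℂ))
      (I * (Ξ j : ℂ) - ((‖Ξ‖ * (2 * (x j - X j)) : ℝ) : ℂ)) 0 := by
    have a1 : HasDerivAt (fun t : ℝ => inner ℝ Ξ (x - X) + t * Ξ j) (Ξ j) 0 := by
      simpa using ((hasDerivAt_id (0 : ℝ)).mul_const (Ξ j)).const_add (inner ℝ Ξ (x - X))
    have a2 : HasDerivAt (fun t : ℝ => ‖Ξ‖ * (‖x - X‖ ^ 2 + 2 * t * (x j - X j) + t ^ 2))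
        (‖Ξ‖ * (2 * (x j - X j))) 0 := by
      have := (((((hasDerivAt_id (0 : ℝ)).const_mul 2).mul_const (x j - X j)).const_add
        (‖x - X‖ ^ 2)).add ((hasDerivAt_id (0 : ℝ)).pow 2)).const_mul ‖Ξ‖
      simpa using this
    exact (a1.ofReal_comp.const_mul I).sub a2.ofReal_comp
  have h2 := (h1.cexp).const_mul (((‖Ξ‖ * δ / (2 * π)) ^ ((n : ℝ) / 2) : ℝ) : ℂ)
  refine (h2.congr_of_eventuallyEq (.of_forall fun t => ?_)).congr_deriv ?_
  · simp only [packet, e1, e2]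
  · simp only [packet]
    push_cast
    ring_nf

/-! ### The `L²` seminorm of functions -/

/-- Continuous square integrable functions. -/
def SqInt (f : Space n → ℂ) : Prop := Continuous f ∧ Integrable (fun x => ‖f x‖ ^ 2)

/-- The `L²` norm of a function. -/
def nrm (f : Space n → ℂ) : ℝ := sqrt (∫ x, ‖f x‖ ^ 2)

lemma nrm_nonneg (f : Space n → ℂ) : 0 ≤ nrm f := sqrt_nonneg _

lemma nrm_sq (f : Space n → ℂ) : nrm f ^ 2 = ∫ x, ‖f x‖ ^ 2 :=
  sq_sqrt (integral_nonneg fun _ => by positivity)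

lemma Decays.sqInt {f : Space n → ℂ} (hf : Decays f) : SqInt f := ⟨hf.continuous, hf.integrable_normSq⟩

namespace SqInt

variable {f g : Space n → ℂ}

lemma conjugate (hf : SqInt f) : SqInt (fun x => conj (f x)) :=
  ⟨Complex.continuous_conj.comp hf.1, by simpa only [RCLike.norm_conj] using hf.2⟩

lemma bounded_mul (hf : SqInt f) {b : Space n → ℂ} (hb : Continuous b) {B : ℝ}
    (h : ∀ x, ‖b x‖ ≤ B) : SqInt (fun x => b x * f x) := by
  refine ⟨hb.mul hf.1, (hf.2.const_mul (B ^ 2)).mono' ?_ (.of_forall fun x => ?_)⟩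
  · exact ((hb.mul hf.1).norm.pow 2).aestronglyMeasurable
  · rw [norm_mul, mul_pow, norm_of_nonneg (by positivity)]
    have := h x
    gcongr

lemma memLp (hf : SqInt f) : MemLp f 2 volume :=
  (memLp_two_iff_integrable_sq_norm hf.1.aestronglyMeasurable).2 hf.2

lemma integrable_mul (hf : SqInt f) (hg : SqInt g) : Integrable (fun x => f x * g x) :=
  hf.memLp.integrable_mul hg.memLp

lemma norm_integral_mul_le (hf : SqInt f) (hg : SqInt g) :
    ‖∫ x, f x * g x‖ ≤ nrm f * nrm g := by
  have h := integral_mul_le_Lp_mul_Lq_of_nonneg (μ := (volume : Measure (Space n)))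
    (p := 2) (q := 2) Real.HolderConjugate.two_two
    (f := fun x => ‖f x‖) (g := fun x => ‖g x‖)
    (.of_forall fun _ => norm_nonneg _)
    (.of_forall fun _ => norm_nonneg _)
    (by simpa using hf.memLp.norm) (by simpa using hg.memLp.norm)
  refine (norm_integral_le_integral_norm _).trans ?_
  simp only [norm_mul]
  refine h.trans (le_of_eq ?_)
  simp only [nrm, sqrt_eq_rpow, rpow_two]

end SqInt

lemma nrm_le_of_sq_le {f : Space n → ℂ} {A : ℝ} (hA : 0 ≤ A) (h : ∫ x, ‖f x‖ ^ 2 ≤ A ^ 2) :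
    nrm f ≤ A := (sqrt_le_sqrt h).trans (le_of_eq (sqrt_sq hA))

/-! ### Symbols with an order -/

namespace PacketSystem

variable {Θ ι : Type} {Y : PacketSystem n Θ ι} {α β κ : ℤ} {p q : Θ → ι → Space n → ℂ}

lemma scl_zpow_pos (k : ℕ) (α : ℤ) : 0 < scl k ^ α := zpow_pos (scl_pos k) α

variable (Y) in
/-- Tame families of order `α`: `scl ^ α` times a tame family. -/
def TameO (α : ℤ) (p : Θ → ι → Space n → ℂ) : Prop :=
  Y.Tame (fun θ γ x => ((scl (Y.lev γ) ^ (-α) : ℝ) : ℂ) * p θ γ x)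

namespace TameO

lemma const {b : Θ → ι → ℂ} {K : ℝ} (hb : ∀ θ γ, ‖b θ γ‖ ≤ K * scl (Y.lev γ) ^ α) :
    Y.TameO α (fun θ γ _ => b θ γ) := by
  refine Tame.const (K := K) fun θ γ => ?_
  rw [norm_mul, norm_real, norm_of_nonneg (scl_zpow_pos _ _).le, zpow_neg, ← div_eq_inv_mul,
    div_le_iff₀ (scl_zpow_pos _ _)]
  exact hb θ γ

lemma add (hp : Y.TameO α p) (hq : Y.TameO α q) : Y.TameO α (fun θ γ x => p θ γ x + q θ γ x) := by
  simpa only [TameO, mul_add] using Tame.add hp hq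

lemma mul (hp : Y.TameO α p) (hq : Y.TameO β q) (h : α + β ≤ κ := by omega) :
    Y.TameO κ (fun θ γ x => p θ γ x * q θ γ x) := by
  have h1 : Y.Tame (fun _ γ _ => ((scl (Y.lev γ) ^ (α + β - κ) : ℝ) : ℂ)) :=
    Tame.const (K := 1) fun θ γ => by
      rw [norm_real, norm_of_nonneg (scl_zpow_pos _ _).le]
      exact zpow_le_one_of_nonpos₀ (one_le_scl _) (by omega)
  have h2 := h1.mul (Tame.mul hp hq)
  unfold TameO
  convert h2 using 4 with θ γ x
  have hs := (scl_pos (Y.lev γ)).ne'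
  have e : scl (Y.lev γ) ^ (-κ) = scl (Y.lev γ) ^ (α + β - κ) *
      (scl (Y.lev γ) ^ (-α) * scl (Y.lev γ) ^ (-β)) := by
    rw [← zpow_add₀ hs, ← zpow_add₀ hs]; congr 1; ring
  rw [e]
  push_cast
  ring

lemma mono (hp : Y.TameO α p) (h : α ≤ β := by omega) : Y.TameO β p := by
  have h1 : Y.TameO 0 (fun _ _ _ => (1 : ℂ)) := const (K := 1) fun _ _ => by simp
  simpa using hp.mul h1 (κ := β)

lemma coord (j : Fin n) : Y.TameO (-1) (fun θ γ x => ((x j - Y.X θ γ j : ℝ) : ℂ)) := by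
  simpa [TameO] using Tame.coord (Y := Y) j

lemma sum {J : Type*} {S : Finset J} {p : J → Θ → ι → Space n → ℂ} (h : ∀ j ∈ S, Y.TameO α (p j)) :
    Y.TameO α (fun θ γ x => ∑ j ∈ S, p j θ γ x) := by
  convert Finset.sum_induction p (Y.TameO α) (fun _ _ => add)
    (const (b := fun _ _ => 0) (K := 0) (by simp)) h using 4
  simp only [Finset.sum_apply]

lemma polyGrowth (hp : Y.TameO α p) (θ : Θ) (γ : ι) : PolyGrowth (p θ γ) := by
  obtain ⟨h1, K, N, h2⟩ := Tame.polyGrowth hp θ γ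
  have hs := scl_zpow_pos (Y.lev γ) α
  have e : ∀ x, p θ γ x = ((scl (Y.lev γ) ^ α : ℝ) : ℂ) *
      (((scl (Y.lev γ) ^ (-α) : ℝ) : ℂ) * p θ γ x) := by
    intro x
    rw [← mul_assoc, ← ofReal_mul, zpow_neg, mul_inv_cancel₀ hs.ne', Complex.ofReal_one, one_mul]
  refine ⟨?_, scl (Y.lev γ) ^ α * K, N, fun x => ?_⟩
  · rw [funext e]
    exact continuous_const.mul h1
  · rw [e x, norm_mul, norm_real, norm_of_nonneg hs.le, mul_assoc]
    exact mul_le_mul_of_nonneg_left (h2 x) hs.le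

lemma decays (hp : Y.TameO α p) (θ : Θ) (γ : ι) : Decays (fun x => p θ γ x * Y.pk θ γ x) :=
  Decays.poly_mul (hp.polyGrowth θ γ) (Y.decays_pk θ γ)

lemma decays_sum (hp : Y.TameO α p) (θ : Θ) (S : Finset ι) (c : ι → ℂ) :
    Decays (fun x => ∑ γ ∈ S, c γ * (p θ γ x * Y.pk θ γ x)) :=
  Decays.sum fun γ _ => (hp.decays θ γ).const_mul (c γ)

lemma exists_level_bound (hp : Y.TameO α p) : ∃ K : ℝ, 0 ≤ K ∧
    ∀ θ (k : ℕ) (S : Finset ι), (∀ γ ∈ S, Y.lev γ = k) → ∀ d : ι → ℂ,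
    ∫ x, ‖∑ γ ∈ S, d γ * (p θ γ x * Y.pk θ γ x)‖ ^ 2 ≤
      K * ∑ γ ∈ S, (scl (Y.lev γ) ^ α * ‖d γ‖) ^ 2 := by
  obtain ⟨K, hK, h⟩ := Tame.exists_level_bound hp
  refine ⟨K, hK, fun θ k S hS d => ?_⟩
  have h1 := h θ k S hS fun γ => ((scl (Y.lev γ) ^ α : ℝ) : ℂ) * d γ
  have e : ∀ γ x, ((scl (Y.lev γ) ^ α : ℝ) : ℂ) * d γ *
      (((scl (Y.lev γ) ^ (-α) : ℝ) : ℂ) * p θ γ x * Y.pk θ γ x) = d γ * (p θ γ x * Y.pk θ γ x) := by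
    intro γ x
    have : ((scl (Y.lev γ) ^ α : ℝ) : ℂ) * ((scl (Y.lev γ) ^ (-α) : ℝ) : ℂ) = 1 := by
      rw [← ofReal_mul, zpow_neg, mul_inv_cancel₀ (scl_zpow_pos _ _).ne', Complex.ofReal_one]
    linear_combination (d γ * p θ γ x * Y.pk θ γ x) * this
  simp only [e, norm_mul, norm_real, norm_of_nonneg (scl_zpow_pos _ _).le] at h1
  exact h1

end TameO

variable (Y) in
/-- Tame families of order `α` whose partial derivatives are tame of order `α + 1`. -/
def TameD (α : ℤ) (p : Θ → ι → Space n → ℂ) : Prop :=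
  Y.TameO α p ∧ ∃ p' : Fin n → Θ → ι → Space n → ℂ, (∀ j, Y.TameO (α + 1) (p' j)) ∧
    ∀ j θ γ, HasPartial j (p θ γ) (p' j θ γ)

namespace TameD

lemma const {b : Θ → ι → ℂ} {K : ℝ} (hb : ∀ θ γ, ‖b θ γ‖ ≤ K * scl (Y.lev γ) ^ α) :
    Y.TameD α (fun θ γ _ => b θ γ) :=
  ⟨TameO.const hb, fun _ _ _ _ => 0, fun _ => TameO.const (b := fun _ _ => 0) (K := 0) (by simp),
    fun _ _ _ => HasPartial.const _⟩

lemma add (hp : Y.TameD α p) (hq : Y.TameD α q) : Y.TameD α (fun θ γ x => p θ γ x + q θ γ x) := by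
  obtain ⟨tp, p', tp', hp'⟩ := hp
  obtain ⟨tq, q', tq', hq'⟩ := hq
  exact ⟨tp.add tq, fun j θ γ x => p' j θ γ x + q' j θ γ x, fun j => (tp' j).add (tq' j),
    fun j θ γ => (hp' j θ γ).add (hq' j θ γ)⟩

lemma mul (hp : Y.TameD α p) (hq : Y.TameD β q) (h : α + β ≤ κ := by omega) :
    Y.TameD κ (fun θ γ x => p θ γ x * q θ γ x) := by
  obtain ⟨tp, p', tp', hp'⟩ := hp
  obtain ⟨tq, q', tq', hq'⟩ := hq
  exact ⟨tp.mul tq h, fun j θ γ x => p' j θ γ x * q θ γ x + p θ γ x * q' j θ γ x,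
    fun j => ((tp' j).mul tq).add (tp.mul (tq' j)),
    fun j θ γ => (hp' j θ γ).mul (hq' j θ γ)⟩

lemma sum {J : Type*} {S : Finset J} {p : J → Θ → ι → Space n → ℂ} (h : ∀ j ∈ S, Y.TameD α (p j)) :
    Y.TameD α (fun θ γ x => ∑ j ∈ S, p j θ γ x) := by
  convert Finset.sum_induction p (Y.TameD α) (fun _ _ => add)
    (const (b := fun _ _ => 0) (K := 0) (by simp)) h using 4
  simp only [Finset.sum_apply]

end TameD

variable (Y) in
/-- Symbols of order `α`: polynomials in the distance to the centre (each factor counts `-1`) whose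
coefficients depend on the index only. -/
inductive Sym : ℤ → (Θ → ι → Space n → ℂ) → Prop
  | const {α : ℤ} (b : Θ → ι → ℂ) (K : ℝ) (hb : ∀ θ γ, ‖b θ γ‖ ≤ K * scl (Y.lev γ) ^ α) :
      Sym α (fun θ γ _ => b θ γ)
  | coord (j : Fin n) : Sym (-1) (fun θ γ x => ((x j - Y.X θ γ j : ℝ) : ℂ))
  | add {α : ℤ} {p q : Θ → ι → Space n → ℂ} (hp : Sym α p) (hq : Sym α q) :
      Sym α (fun θ γ x => p θ γ x + q θ γ x)
  | mul {α β κ : ℤ} {p q : Θ → ι → Space n → ℂ} (hp : Sym α p) (hq : Sym β q)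
      (h : α + β ≤ κ := by omega) :
      Sym κ (fun θ γ x => p θ γ x * q θ γ x)

namespace Sym

lemma congr (hp : Y.Sym α p) (h : ∀ θ γ x, q θ γ x = p θ γ x) : Y.Sym α q := by
  have : q = p := by funext θ γ x; exact h θ γ x
  rwa [this]

lemma tameO (hp : Y.Sym α p) : Y.TameO α p := by
  induction hp with
  | const b K hb => exact TameO.const hb
  | coord j => exact TameO.coord j
  | add _ _ h1 h2 => exact h1.add h2
  | mul _ _ h h1 h2 => exact h1.mul h2 h

lemma num (c : ℂ) : Y.Sym 0 (fun _ _ _ => c) := const (fun _ _ => c) ‖c‖ fun _ _ => by simp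

lemma mono (hp : Y.Sym α p) (h : α ≤ β := by omega) : Y.Sym β p :=
  (hp.mul (num 1) (κ := β)).congr fun _ _ _ => by simp

lemma neg (hp : Y.Sym α p) : Y.Sym α (fun θ γ x => -p θ γ x) :=
  ((num (-1)).mul hp (κ := α)).congr fun _ _ _ => by ring

lemma sub (hp : Y.Sym α p) (hq : Y.Sym α q) : Y.Sym α (fun θ γ x => p θ γ x - q θ γ x) :=
  (hp.add hq.neg).congr fun _ _ _ => by ring

lemma sum {J : Type*} {S : Finset J} {p : J → Θ → ι → Space n → ℂ} (h : ∀ j ∈ S, Y.Sym α (p j)) :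
    Y.Sym α (fun θ γ x => ∑ j ∈ S, p j θ γ x) := by
  convert Finset.sum_induction p (Y.Sym α) (fun _ _ => add) (const (fun _ _ => 0) 0 (by simp)) h using 4
  simp only [Finset.sum_apply]

/-- Each derivative raises the order by one. -/
lemma exists_partial (hp : Y.Sym α p) : ∃ p' : Fin n → Θ → ι → Space n → ℂ,
    (∀ j, Y.Sym (α + 1) (p' j)) ∧ ∀ j θ γ, HasPartial j (p θ γ) (p' j θ γ) := by
  induction hp with
  | const b K hb =>
    exact ⟨fun _ _ _ _ => 0, fun _ => const (fun _ _ => 0) 0 (by simp), fun _ _ _ => HasPartial.const _⟩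
  | coord j =>
    exact ⟨fun l _ _ _ => if j = l then 1 else 0, fun l => const (fun _ _ => if j = l then 1 else 0) 1
      (by intro θ γ; split_ifs <;> simp), fun l θ γ => HasPartial.coord j (Y.X θ γ)⟩
  | add _ _ h1 h2 =>
    obtain ⟨p', tp', hp'⟩ := h1
    obtain ⟨q', tq', hq'⟩ := h2
    exact ⟨fun j θ γ x => p' j θ γ x + q' j θ γ x, fun j => (tp' j).add (tq' j),
      fun j θ γ => (hp' j θ γ).add (hq' j θ γ)⟩
  | @mul _ _ _ p q sp sq h h1 h2 =>
    obtain ⟨p', tp', hp'⟩ := h1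
    obtain ⟨q', tq', hq'⟩ := h2
    exact ⟨fun j θ γ x => p' j θ γ x * q θ γ x + p θ γ x * q' j θ γ x,
      fun j => ((tp' j).mul sq).add (sp.mul (tq' j)),
      fun j θ γ => (hp' j θ γ).mul (hq' j θ γ)⟩

lemma tameD (hp : Y.Sym α p) : Y.TameD α p := by
  obtain ⟨p', h1, h2⟩ := hp.exists_partial
  exact ⟨hp.tameO, p', fun j => (h1 j).tameO, h2⟩

end Sym

variable (Y) in
/-- The logarithmic derivative of a packet in the direction `j`. -/
def logD (j : Fin n) (θ : Θ) (γ : ι) (x : Space n) : ℂ :=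
  I * (Y.Ξ θ γ j : ℂ) - 2 * (‖Y.Ξ θ γ‖ : ℂ) * ((x j - Y.X θ γ j : ℝ) : ℂ)

lemma hasPartial_pk (j : Fin n) (θ : Θ) (γ : ι) :
    HasPartial j (Y.pk θ γ) (fun x => Y.logD j θ γ x * Y.pk θ γ x) := hasPartial_packet _ _ _ j

lemma abs_freq_le (j : Fin n) (θ : Θ) (γ : ι) : ‖(Y.Ξ θ γ j : ℂ)‖ ≤ Y.R * scl (Y.lev γ) ^ (2 : ℤ) := by
  rw [norm_real]
  have := sq_scl (Y.lev γ)
  rw [zpow_ofNat, this]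
  exact (abs_coord_le _ j).trans (Y.norm_le θ γ)

lemma sym_freq (j : Fin n) : Y.Sym 2 (fun θ γ _ => (Y.Ξ θ γ j : ℂ)) :=
  Sym.const _ Y.R (abs_freq_le j)

lemma sym_norm_freq : Y.Sym 2 (fun θ γ _ => (‖Y.Ξ θ γ‖ : ℂ)) :=
  Sym.const _ Y.R fun θ γ => by
    rw [norm_real, norm_norm, zpow_ofNat, sq_scl]
    exact Y.norm_le θ γ

lemma sym_inv_norm_freq : Y.Sym (-2) (fun θ γ _ => (‖Y.Ξ θ γ‖ : ℂ)⁻¹) :=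
  Sym.const _ Y.R fun θ γ => by
    rw [norm_inv, norm_real, norm_norm, zpow_neg, zpow_ofNat, sq_scl]
    have h := Y.le_norm θ γ
    have hR := Y.R_pos
    rw [inv_le_comm₀ (Y.norm_pos θ γ) (by positivity), mul_inv, inv_inv]
    rwa [mul_comm, ← div_eq_mul_inv]

lemma sym_logD (j : Fin n) : Y.Sym 2 (Y.logD j) :=
  (((Sym.num I).mul (sym_freq j) (κ := 2)).sub
    (((Sym.num 2).mul sym_norm_freq (κ := 2)).mul (Sym.coord j) (κ := 2))).congr
    fun _ _ _ => rfl

/-- Derivatives of a symbol times a packet. -/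
lemma Sym.exists_partial_mul_pk (hp : Y.Sym α p) (j : Fin n) :
    ∃ p', Y.Sym (α + 2) p' ∧ ∀ θ γ, HasPartial j (fun x => p θ γ x * Y.pk θ γ x)
      (fun x => p' θ γ x * Y.pk θ γ x) := by
  obtain ⟨p', h1, h2⟩ := hp.exists_partial
  refine ⟨fun θ γ x => p' j θ γ x + p θ γ x * Y.logD j θ γ x,
    ((h1 j).mono).add (hp.mul (sym_logD j) le_rfl), fun θ γ => ?_⟩
  refine ((h2 j θ γ).mul (hasPartial_pk j θ γ)).congr (fun _ => rfl) fun x => ?_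
  ring

end PacketSystem

/-! ### Packet sums over all levels -/

/-- Cotlar's principle: functions `F k` whose inner products decay exponentially off the diagonal
are almost orthogonal. -/
lemma exists_almost_orthogonal : ∃ D : ℝ, 0 < D ∧ ∀ (L : Finset ℕ) (F : ℕ → Space n → ℂ) (σ : ℕ → ℝ)
    (K : ℝ), 0 ≤ K → (∀ k, SqInt (F k)) →
    (∀ k l, l ≤ k → ‖∫ x, F k x * conj (F l x)‖ ≤ K * (scl l / scl k * (σ k * σ l))) →
    ∫ x, ‖∑ k ∈ L, F k x‖ ^ 2 ≤ K * D * ∑ k ∈ L, σ k ^ 2 := by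
  obtain ⟨D, hD, hsum⟩ := exists_sum_two_rpow_abs_le (d := 1 / 2) (by norm_num)
  refine ⟨D, hD, fun L F σ K hK hF h => ?_⟩
  set w : ℕ → ℕ → ℝ := fun k l => (2 : ℝ) ^ (-(1 / 2 * |((k : ℤ) - (l : ℤ) : ℝ)|)) with hw
  have hsc : ∀ k : ℕ, scl k = (2 : ℝ) ^ (1 / 2 * (k : ℝ)) := by
    intro k
    rw [scl, sqrt_eq_rpow, ← rpow_natCast, ← rpow_mul (by norm_num)]
    congr 1; ring
  have hw1 : ∀ k l : ℕ, l ≤ k → scl l / scl k = w k l := by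
    intro k l hl
    have : (0 : ℝ) ≤ (k : ℝ) - l := by rw [sub_nonneg]; exact_mod_cast hl
    simp only [hw, Int.cast_natCast]
    rw [abs_of_nonneg this, hsc, hsc, ← rpow_sub (by norm_num)]
    congr 1; ring
  have hws : ∀ k l : ℕ, w k l = w l k := fun k l => by
    simp only [hw]
    rw [abs_sub_comm]
  have hw0 : ∀ k l, 0 ≤ w k l := fun k l => by positivity
  have hI : ∀ k l, ‖∫ x, F k x * conj (F l x)‖ ≤ K * (w k l * (σ k * σ l)) := by
    intro k l
    rcases le_total l k with hl | hl
    · rw [← hw1 k l hl]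
      exact h k l hl
    · have h1 := h l k hl
      rw [hw1 l k hl, hws] at h1
      have e : ∫ x, F k x * conj (F l x) =
          conj (∫ x, F l x * conj (F k x)) := by
        rw [← integral_conj]
        congr 1
        ext x
        rw [map_mul, Complex.conj_conj, mul_comm]
      rw [e, RCLike.norm_conj, mul_comm (σ k)]
      exact h1
  have := integral_mul_normSq_sum_le (S := L) (f := F) (w := fun _ => 1)
    (T := fun k l => K * (σ k ^ 2 * w l k)) (A := fun k => K * (σ k ^ 2 * D))
    (by simpa using fun k l => (hF k).integrable_mul (hF l).conjugate) (fun k _ l _ => ?_) fun k _ => ?_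
  · simp only [one_mul] at this
    exact this.trans (le_of_eq (by rw [← mul_sum, ← sum_mul]; ring))
  · simp only [Complex.ofReal_one, one_mul]
    refine (hI k l).trans ?_
    rw [hws l k]
    have := mul_nonneg hK (hw0 k l)
    nlinarith [sq_nonneg (σ k - σ l)]
  · rw [← mul_sum, ← mul_sum]
    have := hsum L k
    gcongr

namespace PacketSystem

variable {Θ ι : Type} {Y : PacketSystem n Θ ι} {α β : ℤ} {p : Θ → ι → Space n → ℂ}

lemma TameO.exists_level_nrm (hp : Y.TameO β p) (α : ℤ) :
    ∃ K : ℝ, 0 ≤ K ∧ ∀ θ (k : ℕ) (S : Finset ι), (∀ γ ∈ S, Y.lev γ = k) → ∀ d : ι → ℂ,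
    nrm (fun x => ∑ γ ∈ S, d γ * (p θ γ x * Y.pk θ γ x)) ≤
      K * (scl k ^ (β - α) * sqrt (∑ γ ∈ S, (scl (Y.lev γ) ^ α * ‖d γ‖) ^ 2)) := by
  obtain ⟨K, hK, h⟩ := hp.exists_level_bound
  refine ⟨sqrt K, sqrt_nonneg _, fun θ k S hS d => ?_⟩
  have hs := scl_zpow_pos k (β - α)
  refine nrm_le_of_sq_le (by positivity) ((h θ k S hS d).trans (le_of_eq ?_))
  have e : ∀ A : ℝ, 0 ≤ A → (sqrt K * (scl k ^ (β - α) * sqrt A)) ^ 2 =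
      K * ((scl k ^ (β - α)) ^ 2 * A) := by
    intro A hA
    rw [mul_pow, mul_pow, sq_sqrt hK, sq_sqrt hA]
  rw [e _ (sum_nonneg fun _ _ => by positivity), mul_sum _ _ ((scl k ^ (β - α)) ^ 2)]
  refine congrArg (K * ·) (sum_congr rfl fun γ hγ => ?_)
  rw [hS γ hγ, ← mul_pow, ← mul_assoc, ← zpow_add₀ (scl_pos k).ne', sub_add_cancel]

variable (Y) in
/-- The vector field `-i ξ / |ξ|²`: its product with the gradient of a packet is the packet, up to
terms of lower order. -/
def radial (j : Fin n) (θ : Θ) (γ : ι) : ℂ :=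
  -I * (Y.Ξ θ γ j : ℂ) * ((‖Y.Ξ θ γ‖ : ℂ)⁻¹ * (‖Y.Ξ θ γ‖ : ℂ)⁻¹)

lemma sym_radial (j : Fin n) : Y.Sym (-2) (fun θ γ _ => Y.radial j θ γ) :=
  (((Sym.num (-I)).mul (sym_freq j) (κ := 2)).mul
    (sym_inv_norm_freq.mul sym_inv_norm_freq (κ := -4)))

variable (Y) in
/-- The lower order term in the identity for `radial`. -/
def radialRest (θ : Θ) (γ : ι) (x : Space n) : ℂ :=
  ∑ j, 2 * I * (Y.Ξ θ γ j : ℂ) * (‖Y.Ξ θ γ‖ : ℂ)⁻¹ * ((x j - Y.X θ γ j : ℝ) : ℂ)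

lemma sym_radialRest : Y.Sym (-1) Y.radialRest :=
  Sym.sum fun j _ => ((((Sym.num (2 * I)).mul (sym_freq j) (κ := 2)).mul
    sym_inv_norm_freq (κ := 0)).mul (Sym.coord j))

lemma sum_radial_mul_logD (θ : Θ) (γ : ι) (x : Space n) :
    ∑ j, Y.radial j θ γ * Y.logD j θ γ x = 1 + Y.radialRest θ γ x := by
  have hr : (‖Y.Ξ θ γ‖ : ℂ) ≠ 0 := by exact_mod_cast (Y.norm_pos θ γ).ne'
  have h1 : ∑ j, (Y.Ξ θ γ j : ℂ) * (Y.Ξ θ γ j : ℂ) = (‖Y.Ξ θ γ‖ : ℂ) ^ 2 := by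
    have := EuclideanSpace.real_norm_sq_eq (Y.Ξ θ γ)
    rw [← Complex.ofReal_pow, this]
    push_cast
    exact sum_congr rfl fun j _ => by ring
  have h2 : (1 : ℂ) = ∑ j, (Y.Ξ θ γ j : ℂ) * (Y.Ξ θ γ j : ℂ) * ((‖Y.Ξ θ γ‖ : ℂ)⁻¹ * (‖Y.Ξ θ γ‖ : ℂ)⁻¹) := by
    rw [← sum_mul, h1]
    field_simp
  rw [h2, radialRest, ← sum_add_distrib]
  refine sum_congr rfl fun j _ => ?_
  simp only [radial, logD]
  have h3 : (‖Y.Ξ θ γ‖ : ℂ)⁻¹ * (‖Y.Ξ θ γ‖ : ℂ) = 1 := inv_mul_cancel₀ hr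
  linear_combination (-(Y.Ξ θ γ j : ℂ) * (Y.Ξ θ γ j : ℂ) * ((‖Y.Ξ θ γ‖ : ℂ)⁻¹ * (‖Y.Ξ θ γ‖ : ℂ)⁻¹)) *
    Complex.I_sq + (2 * I * (Y.Ξ θ γ j : ℂ) * (‖Y.Ξ θ γ‖ : ℂ)⁻¹ *
      ((x j - Y.X θ γ j : ℝ) : ℂ)) * h3

lemma divergence_identity {p : Space n → ℂ} {θ : Θ} {γ : ι} (x : Space n) (q : Fin n → ℂ) :
    p x = (∑ j, (Y.radial j θ γ * q j + Y.radial j θ γ * p x * Y.logD j θ γ x)) +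
      -(∑ j, Y.radial j θ γ * q j + p x * Y.radialRest θ γ x) := by
  have h := sum_radial_mul_logD (Y := Y) θ γ x
  have e : ∑ j, Y.radial j θ γ * p x * Y.logD j θ γ x = p x * ∑ j, Y.radial j θ γ * Y.logD j θ γ x := by
    rw [mul_sum]
    exact sum_congr rfl fun j _ => by ring
  rw [sum_add_distrib, e, h]
  ring

lemma hasPartial_radial {p p' : Space n → ℂ} {θ : Θ} {γ : ι} {j : Fin n} (h : HasPartial j p p') :
    HasPartial j (fun x => Y.radial j θ γ * p x * Y.pk θ γ x) (fun x =>
      (Y.radial j θ γ * p' x + Y.radial j θ γ * p x * Y.logD j θ γ x) * Y.pk θ γ x) :=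
  ((h.const_mul (Y.radial j θ γ)).mul (hasPartial_pk j θ γ)).congr (fun _ => rfl) fun x => by ring

/-- A symbol times a packet is a divergence, up to a term of lower order. -/
lemma Sym.exists_divergence (hp : Y.Sym α p) :
    ∃ (v g : Fin n → Θ → ι → Space n → ℂ) (w : Θ → ι → Space n → ℂ), (∀ j, Y.Sym (α - 2) (v j)) ∧
      (∀ j, Y.Sym α (g j)) ∧ Y.Sym (α - 1) w ∧
      (∀ j θ γ, HasPartial j (fun x => v j θ γ x * Y.pk θ γ x) (fun x => g j θ γ x * Y.pk θ γ x)) ∧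
      ∀ θ γ x, p θ γ x = ∑ j, g j θ γ x + w θ γ x := by
  obtain ⟨p', h1, h2⟩ := hp.exists_partial
  have h3 : ∀ j, Y.Sym (α - 2) (fun θ γ x => Y.radial j θ γ * p θ γ x) :=
    fun j => (sym_radial j).mul hp
  have h4 : ∀ j, Y.Sym (α - 1) (fun θ γ x => Y.radial j θ γ * p' j θ γ x) :=
    fun j => (sym_radial j).mul (h1 j)
  exact ⟨fun j θ γ x => Y.radial j θ γ * p θ γ x,
    fun j θ γ x => Y.radial j θ γ * p' j θ γ x + Y.radial j θ γ * p θ γ x * Y.logD j θ γ x,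
    fun θ γ x => -(∑ j, Y.radial j θ γ * p' j θ γ x + p θ γ x * Y.radialRest θ γ x), h3,
    fun j => ((h4 j).mono).add ((h3 j).mul (sym_logD j)),
    ((Sym.sum fun j _ => h4 j).add (hp.mul sym_radialRest)).neg,
    fun j θ γ => hasPartial_radial (h2 j θ γ), fun θ γ x =>
      divergence_identity (p := p θ γ) x fun j => p' j θ γ x⟩

/-- Packet sums whose coefficients are differentiable tame families are bounded in `L²`. -/
lemma TameD.exists_bound (hp : Y.TameD α p) :
    ∃ K : ℝ, 0 ≤ K ∧ ∀ θ (S : Finset ι) (d : ι → ℂ),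
    ∫ x, ‖∑ γ ∈ S, d γ * (p θ γ x * Y.pk θ γ x)‖ ^ 2 ≤
      K * ∑ γ ∈ S, (scl (Y.lev γ) ^ α * ‖d γ‖) ^ 2 := by
  classical
  obtain ⟨tp, p', tp', hp'⟩ := hp
  have tD : ∀ j, Y.TameO 2 (Y.logD j) := fun j => (sym_logD j).tameO
  have tr : ∀ j, Y.TameO (-2) (fun θ γ _ => Y.radial j θ γ) := fun j => (sym_radial j).tameO
  -- the families in the identity `p Φ = ∑ ∂_j (v_j Φ) + w Φ`
  set v : Fin n → Θ → ι → Space n → ℂ := fun j θ γ x => Y.radial j θ γ * p θ γ x with hv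
  set g : Fin n → Θ → ι → Space n → ℂ := fun j θ γ x =>
    Y.radial j θ γ * p' j θ γ x + Y.radial j θ γ * p θ γ x * Y.logD j θ γ x with hg
  set w : Θ → ι → Space n → ℂ := fun θ γ x =>
    (-1 : ℂ) * (∑ j, Y.radial j θ γ * p' j θ γ x + p θ γ x * Y.radialRest θ γ x) with hw
  set e : Fin n → Θ → ι → Space n → ℂ := fun j θ γ x => p' j θ γ x + p θ γ x * Y.logD j θ γ x with he
  have tv : ∀ j, Y.TameO (α - 2) (v j) := fun j => (tr j).mul tp
  have tg : ∀ j, Y.TameO α (g j) := fun j =>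
    ((tr j).mul (tp' j)).add ((tv j).mul (tD j))
  have tw : Y.TameO (α - 1) w :=
    (TameO.const (Y := Y) (α := 0) (b := fun _ _ => (-1 : ℂ)) (K := 1) (by simp)).mul
      ((TameO.sum fun j _ => (tr j).mul (tp' j) (κ := α - 1)).add
        (tp.mul sym_radialRest.tameO))
  have te : ∀ j, Y.TameO (α + 2) (e j) := fun j =>
    ((tp' j).mono).add (tp.mul (tD j))
  have hvg : ∀ j θ γ, HasPartial j (fun x => v j θ γ x * Y.pk θ γ x) (fun x => g j θ γ x * Y.pk θ γ x) :=
    fun j θ γ => hasPartial_radial (hp' j θ γ)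
  have hpe : ∀ j θ γ, HasPartial j (fun x => p θ γ x * Y.pk θ γ x) (fun x => e j θ γ x * Y.pk θ γ x) :=
    fun j θ γ => ((hp' j θ γ).mul (hasPartial_pk j θ γ)).congr (fun _ => rfl) fun x => by
      simp only [he]; ring
  have hpgw : ∀ θ γ x, p θ γ x = ∑ j, g j θ γ x + w θ γ x := fun θ γ x => by
    simp only [hw, neg_one_mul]
    exact divergence_identity (p := p θ γ) x fun j => p' j θ γ x
  choose Kv hKv hbv using fun j => (tv j).exists_level_nrm α
  choose Ke hKe hbe using fun j => (te j).exists_level_nrm α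
  obtain ⟨Kw, hKw, hbw⟩ := tw.exists_level_nrm α
  obtain ⟨Kp, hKp, hbp⟩ := tp.exists_level_nrm α
  obtain ⟨D, hD, hcotlar⟩ := exists_almost_orthogonal (n := n)
  set K : ℝ := ∑ j, Kv j * Ke j + Kw * Kp with hK
  have hK0 : 0 ≤ K := add_nonneg (sum_nonneg fun j _ => mul_nonneg (hKv j) (hKe j))
    (mul_nonneg hKw hKp)
  refine ⟨K * D, by positivity, fun θ S d => ?_⟩
  set Sk : ℕ → Finset ι := fun k => S.filter fun γ => Y.lev γ = k with hSk
  have hlev : ∀ k, ∀ γ ∈ Sk k, Y.lev γ = k := fun k γ hγ => (Finset.mem_filter.1 hγ).2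
  set σ : ℕ → ℝ := fun k => sqrt (∑ γ ∈ Sk k, (scl (Y.lev γ) ^ α * ‖d γ‖) ^ 2) with hσ
  have hσ0 : ∀ k, 0 ≤ σ k := fun k => sqrt_nonneg _
  set F : ℕ → Space n → ℂ := fun k x => ∑ γ ∈ Sk k, d γ * (p θ γ x * Y.pk θ γ x) with hF
  -- moving a derivative from the higher level `k` to the lower level `l` gains `(scl l / scl k)²`
  have hcross : ∀ k l, l ≤ k → ‖∫ x, F k x * conj (F l x)‖ ≤
      K * (scl l / scl k * (σ k * σ l)) := by
    intro k l hl
    set V : Fin n → Space n → ℂ := fun j x => ∑ γ ∈ Sk k, d γ * (v j θ γ x * Y.pk θ γ x)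
    set G : Fin n → Space n → ℂ := fun j x => ∑ γ ∈ Sk k, d γ * (g j θ γ x * Y.pk θ γ x)
    set W : Space n → ℂ := fun x => ∑ γ ∈ Sk k, d γ * (w θ γ x * Y.pk θ γ x)
    set E : Fin n → Space n → ℂ := fun j x => ∑ γ ∈ Sk l, d γ * (e j θ γ x * Y.pk θ γ x)
    have dV : ∀ j, Decays (V j) := fun j => (tv j).decays_sum θ _ d
    have dG : ∀ j, Decays (G j) := fun j => (tg j).decays_sum θ _ d
    have dW : Decays W := tw.decays_sum θ _ d
    have dE : ∀ j, Decays (E j) := fun j => (te j).decays_sum θ _ d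
    have dF : Decays (F l) := tp.decays_sum θ _ d
    have e1 : ∀ x, F k x * conj (F l x) = ∑ j, G j x * conj (F l x) + W x * conj (F l x) := fun x => by
      rw [← sum_mul, ← add_mul]
      congr 1
      simp only [F, G, W]
      rw [sum_comm, ← sum_add_distrib]
      refine sum_congr rfl fun γ _ => ?_
      rw [hpgw θ γ x, ← mul_sum, ← sum_mul]
      ring
    have hVG : ∀ j, HasPartial j (V j) (G j) := fun j =>
      HasPartial.sum fun γ _ => (hvg j θ γ).const_mul (d γ)
    have hFE : ∀ j, HasPartial j (F l) (E j) := fun j =>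
      HasPartial.sum fun γ _ => (hpe j θ γ).const_mul (d γ)
    have e2 : ∀ j, ∫ x, G j x * conj (F l x) = -∫ x, V j x * conj (E j x) := by
      intro j
      rw [(hVG j).integral_mul_eq_neg (hFE j).conjugate ((dG j).mul dF.conjugate).integrable
        ((dV j).mul (dE j).conjugate).integrable ((dV j).mul dF.conjugate).integrable, neg_neg]
    have nconj : ∀ f : Space n → ℂ, nrm (fun x => conj (f x)) = nrm f := fun f => by
      simp only [nrm, RCLike.norm_conj]
    have sk := scl_pos k
    have sl := scl_pos l
    have b1 : ∀ j, ‖∫ x, G j x * conj (F l x)‖ ≤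
        Kv j * Ke j * (scl l / scl k * (σ k * σ l)) := by
      intro j
      rw [e2, norm_neg]
      refine ((dV j).sqInt.norm_integral_mul_le (dE j).sqInt.conjugate).trans ?_
      rw [nconj]
      have h1 := hbv j θ k (Sk k) (hlev k) d
      have h2 := hbe j θ l (Sk l) (hlev l) d
      rw [show α - 2 - α = -2 by ring] at h1
      rw [add_sub_cancel_left] at h2
      calc _ ≤ Kv j * (scl k ^ (-2 : ℤ) * σ k) * (Ke j * (scl l ^ (2 : ℤ) * σ l)) :=
            mul_le_mul h1 h2 (nrm_nonneg _) (by have := hKv j; have := hσ0 k; positivity)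
        _ = Kv j * Ke j * ((scl l / scl k) ^ 2 * (σ k * σ l)) := by
            rw [zpow_neg, zpow_ofNat, zpow_ofNat]
            field_simp
        _ ≤ _ := by
            have hq : scl l / scl k ≤ 1 := by
              rw [div_le_one sk]
              exact sqrt_le_sqrt (pow_le_pow_right₀ (by norm_num) hl)
            have hq0 : 0 ≤ scl l / scl k := by positivity
            refine mul_le_mul_of_nonneg_left ?_ (mul_nonneg (hKv j) (hKe j))
            refine mul_le_mul_of_nonneg_right ?_ (mul_nonneg (hσ0 k) (hσ0 l))
            nlinarith
    have b2 : ‖∫ x, W x * conj (F l x)‖ ≤ Kw * Kp * (scl l / scl k * (σ k * σ l)) := by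
      refine (dW.sqInt.norm_integral_mul_le dF.sqInt.conjugate).trans ?_
      rw [nconj]
      have h1 := hbw θ k (Sk k) (hlev k) d
      have h2 := hbp θ l (Sk l) (hlev l) d
      rw [show α - 1 - α = -1 by ring] at h1
      rw [sub_self, zpow_zero, one_mul] at h2
      have := hσ0 k
      have := hσ0 l
      calc _ ≤ Kw * (scl k ^ (-1 : ℤ) * σ k) * (Kp * σ l) :=
            mul_le_mul h1 h2 (nrm_nonneg _) (by positivity)
        _ = Kw * Kp * (1 / scl k * (σ k * σ l)) := by rw [zpow_neg, zpow_one]; field_simp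
        _ ≤ _ := by gcongr; exact one_le_scl l
    have hi : ∀ j, Integrable (fun x => G j x * conj (F l x)) := fun j =>
      ((dG j).mul dF.conjugate).integrable
    simp only [e1]
    rw [integral_add (integrable_finsetSum _ fun j _ => hi j) (dW.mul dF.conjugate).integrable,
      integral_finsetSum _ fun j _ => hi j, hK, add_mul, sum_mul]
    exact (norm_add_le _ _).trans (add_le_add ((norm_sum_le _ _).trans
      (sum_le_sum fun j _ => b1 j)) b2)
  have h := hcotlar (S.image Y.lev) F σ K hK0 (fun k => (tp.decays_sum θ _ d).sqInt) hcross
  have e3 : ∀ x, ∑ k ∈ S.image Y.lev, F k x = ∑ γ ∈ S, d γ * (p θ γ x * Y.pk θ γ x) := fun x =>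
    Finset.sum_fiberwise_of_maps_to (fun γ hγ => Finset.mem_image_of_mem _ hγ) _
  have e4 : ∑ k ∈ S.image Y.lev, σ k ^ 2 = ∑ γ ∈ S, (scl (Y.lev γ) ^ α * ‖d γ‖) ^ 2 := by
    rw [← Finset.sum_fiberwise_of_maps_to (g := Y.lev)
      (fun γ hγ => Finset.mem_image_of_mem Y.lev hγ) fun γ => (scl (Y.lev γ) ^ α * ‖d γ‖) ^ 2]
    exact sum_congr rfl fun k _ => sq_sqrt (sum_nonneg fun _ _ => by positivity)
  simp only [e3, e4] at h
  exact h

/-- The bound of packet sums, for the `L²` norm and coefficients weighted to the order. -/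
lemma TameD.exists_nrm_bound (hp : Y.TameD α p) :
    ∃ K : ℝ, 0 ≤ K ∧ ∀ θ (S : Finset ι) (d : ι → ℂ),
    nrm (fun x => ∑ γ ∈ S, d γ * (p θ γ x * Y.pk θ γ x)) ≤
      K * sqrt (∑ γ ∈ S, (scl (Y.lev γ) ^ α * ‖d γ‖) ^ 2) := by
  obtain ⟨K, hK, h⟩ := hp.exists_bound
  refine ⟨sqrt K, sqrt_nonneg _, fun θ S d => nrm_le_of_sq_le (by positivity)
    ((h θ S d).trans (le_of_eq ?_))⟩
  rw [mul_pow, sq_sqrt hK, sq_sqrt (sum_nonneg fun _ _ => by positivity)]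

end PacketSystem

/-! ### Integration by parts against Lipschitz coefficients -/

lemma SqInt.add {f g : Space n → ℂ} (hf : SqInt f) (hg : SqInt g) : SqInt (fun x => f x + g x) := by
  have hc := hf.1.add hg.1
  exact ⟨hc, (memLp_two_iff_integrable_sq_norm hc.aestronglyMeasurable).1 (hf.memLp.add hg.memLp)⟩

lemma SqInt.sub {f g : Space n → ℂ} (hf : SqInt f) (hg : SqInt g) : SqInt (fun x => f x - g x) := by
  have hc := hf.1.sub hg.1
  exact ⟨hc, (memLp_two_iff_integrable_sq_norm hc.aestronglyMeasurable).1 (hf.memLp.sub hg.memLp)⟩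

lemma nrm_bounded_mul_le {f b : Space n → ℂ} (hf : SqInt f) (hb : Continuous b) {B : ℝ}
    (h : ∀ x, ‖b x‖ ≤ B) : nrm (fun x => b x * f x) ≤ B * nrm f := by
  have hB : 0 ≤ B := (norm_nonneg _).trans (h 0)
  refine nrm_le_of_sq_le (mul_nonneg hB (nrm_nonneg f)) ?_
  rw [mul_pow, nrm_sq, ← integral_const_mul]
  refine integral_mono (hf.bounded_mul hb h).2 (hf.2.const_mul _) fun x => ?_
  beta_reduce
  rw [norm_mul, mul_pow]
  have := h x
  gcongr

lemma HasPartial.integral_mul_eq {j : Fin n} {f f' g g' : Space n → ℂ} (hf : HasPartial j f f')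
    (hg : HasPartial j g g') (sf : SqInt f) (sf' : SqInt f') (sg : SqInt g) (sg' : SqInt g') :
    ∫ x, f x * g' x = -∫ x, f' x * g x :=
  hf.integral_mul_eq_neg hg (sf'.integrable_mul sg) (sf.integrable_mul sg') (sf.integrable_mul sg)

/-- A Lipschitz function is a uniform limit of functions with bounded partial derivative, the
averages over short segments. -/
lemma exists_steklov (j : Fin n) {b : Space n → ℝ} {B K h : ℝ} (hh : 0 < h) (hB : ∀ x, |b x| ≤ B)
    (hK : ∀ x y, |b x - b y| ≤ K * ‖x - y‖) :
    ∃ g g' : Space n → ℝ, Continuous g ∧ Continuous g' ∧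
      HasPartial j (fun x => (g x : ℂ)) (fun x => (g' x : ℂ)) ∧
      (∀ x, |g x| ≤ B) ∧ (∀ x, |g' x| ≤ K) ∧ ∀ x, |b x - g x| ≤ K * h := by
  set e : Space n := EuclideanSpace.single j 1 with he
  have hne : ‖e‖ = 1 := by simp [he]
  have hK0 : 0 ≤ K := by
    have h1 := (abs_nonneg _).trans (hK e 0)
    rwa [sub_zero, hne, mul_one] at h1
  have hcont : Continuous b := by
    refine (LipschitzWith.of_dist_le_mul (K := toNNReal K) fun x y => ?_).continuous
    rw [dist_eq, dist_eq_norm, coe_toNNReal _ hK0]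
    exact hK x y
  have hc1 : ∀ x, Continuous fun s : ℝ => b (x + s • e) := fun x => hcont.comp (by fun_prop)
  refine ⟨fun x => h⁻¹ * ∫ s in (0 : ℝ)..h, b (x + s • e), fun x => h⁻¹ * (b (x + h • e) - b x),
    ?_, ?_, ?_, fun x => ?_, fun x => ?_, fun x => ?_⟩
  · refine continuous_const.mul
      (intervalIntegral.continuous_parametric_intervalIntegral_of_continuous' ?_ _ _)
    exact hcont.comp (by fun_prop)
  · exact continuous_const.mul ((hcont.comp (by fun_prop)).sub hcont)
  · refine HasPartial.ofReal fun x => ?_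
    have h1 : ∀ t : ℝ, ∫ s in (0 : ℝ)..h, b (x + t • e + s • e) =
        (∫ s in (0 : ℝ)..(t + h), b (x + s • e)) - ∫ s in (0 : ℝ)..t, b (x + s • e) := by
      intro t
      rw [intervalIntegral.integral_interval_sub_left ((hc1 x).intervalIntegrable _ _)
        ((hc1 x).intervalIntegrable _ _)]
      have := intervalIntegral.integral_comp_add_left (a := 0) (b := h) (fun s => b (x + s • e)) t
      rw [add_zero] at this
      rw [← this]
      refine intervalIntegral.integral_congr fun s _ => ?_
      beta_reduce
      rw [add_assoc, ← add_smul]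
    have h2 : HasDerivAt (fun t : ℝ => h⁻¹ * ((∫ s in (0 : ℝ)..(t + h), b (x + s • e)) -
        ∫ s in (0 : ℝ)..t, b (x + s • e))) (h⁻¹ * (b (x + h • e) - b x)) 0 := by
      have d1 : HasDerivAt (fun t : ℝ => ∫ s in (0 : ℝ)..(t + h), b (x + s • e)) (b (x + h • e)) 0 := by
        have := (intervalIntegral.integral_hasDerivAt_right ((hc1 x).intervalIntegrable 0 (0 + h))
          ((hc1 x).stronglyMeasurableAtFilter _ _) (hc1 x).continuousAt).comp_add_const 0 h
        simpa using this
      have d2 : HasDerivAt (fun t : ℝ => ∫ s in (0 : ℝ)..t, b (x + s • e)) (b x) 0 := by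
        have := intervalIntegral.integral_hasDerivAt_right ((hc1 x).intervalIntegrable 0 0)
          ((hc1 x).stronglyMeasurableAtFilter _ _) (hc1 x).continuousAt
        simpa using this
      exact (d1.sub d2).const_mul _
    refine h2.congr_of_eventuallyEq (.of_forall fun t => ?_)
    beta_reduce
    rw [h1]
  · have := intervalIntegral.norm_integral_le_of_norm_le_const (a := 0) (b := h) (C := B)
      (f := fun s => b (x + s • e)) fun s _ => hB _
    rw [sub_zero, abs_of_pos hh, norm_eq_abs] at this
    rw [abs_mul, abs_of_pos (inv_pos.2 hh), inv_mul_le_iff₀ hh, mul_comm h]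
    exact this
  · have := hK (x + h • e) x
    rw [add_sub_cancel_left, norm_smul, hne, mul_one, norm_of_nonneg hh.le] at this
    rw [abs_mul, abs_of_pos (inv_pos.2 hh), inv_mul_le_iff₀ hh, mul_comm h]
    exact this
  · have h3 : b x - h⁻¹ * ∫ s in (0 : ℝ)..h, b (x + s • e) =
        h⁻¹ * ∫ s in (0 : ℝ)..h, (b x - b (x + s • e)) := by
      rw [intervalIntegral.integral_sub (continuous_const.intervalIntegrable _ _)
        ((hc1 x).intervalIntegrable _ _), intervalIntegral.integral_const, sub_zero, smul_eq_mul]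
      field_simp
    have := intervalIntegral.norm_integral_le_of_norm_le_const (a := 0) (b := h) (C := K * h)
      (f := fun s => b x - b (x + s • e)) fun s hs => by
        rw [uIoc_of_le hh.le] at hs
        refine (hK _ _).trans ?_
        rw [sub_add_cancel_left, norm_neg, norm_smul, hne, mul_one, norm_of_nonneg hs.1.le]
        exact mul_le_mul_of_nonneg_left hs.2 hK0
    rw [sub_zero, abs_of_pos hh, norm_eq_abs] at this
    rw [h3, abs_mul, abs_of_pos (inv_pos.2 hh), inv_mul_le_iff₀ hh, mul_comm h]
    exact this

/-- Integration by parts against a Lipschitz coefficient, as an estimate. -/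
lemma norm_integral_lipschitz_mul_le {j : Fin n} {b : Space n → ℝ} {B K : ℝ} (hB : ∀ x, |b x| ≤ B)
    (hK : ∀ x y, |b x - b y| ≤ K * ‖x - y‖) (hb : Continuous b) {S S' ψ ψ' : Space n → ℂ}
    (hS : HasPartial j S S') (hψ : HasPartial j ψ ψ') (sS : SqInt S) (sS' : SqInt S') (sψ : SqInt ψ)
    (sψ' : SqInt ψ') :
    ‖∫ x, (b x : ℂ) * (S' x * ψ x)‖ ≤ nrm S * (K * nrm ψ + B * nrm ψ') := by
  refine le_of_forall_pos_le_add fun δ hδ => ?_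
  have hK0 : 0 ≤ K := by
    have h1 := (abs_nonneg _).trans (hK (EuclideanSpace.single j 1) 0)
    simpa using h1
  -- with averages over segments of length `h`, the error of the approximation is at most `δ`
  obtain ⟨h, hh, hhδ⟩ : ∃ h > 0, K * h * (nrm S' * nrm ψ) ≤ δ := by
    have hN : 0 ≤ K * (nrm S' * nrm ψ) :=
      mul_nonneg hK0 (mul_nonneg (nrm_nonneg _) (nrm_nonneg _))
    refine ⟨δ / (K * (nrm S' * nrm ψ) + 1), by positivity, ?_⟩
    rw [mul_right_comm, mul_div_assoc', div_le_iff₀ (by positivity)]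
    nlinarith
  obtain ⟨g, g', cg, cg', hg, bg, bg', hbg⟩ := exists_steklov j hh hB hK
  have cgC : Continuous (fun x => (g x : ℂ)) := continuous_ofReal.comp cg
  have cgC' : Continuous (fun x => (g' x : ℂ)) := continuous_ofReal.comp cg'
  have cd : Continuous (fun x => ((b x - g x : ℝ) : ℂ)) := continuous_ofReal.comp (hb.sub cg)
  have nb : ∀ x, ‖(g x : ℂ)‖ ≤ B := fun x => by rw [norm_real]; exact bg x
  have nb' : ∀ x, ‖(g' x : ℂ)‖ ≤ K := fun x => by rw [norm_real]; exact bg' x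
  have nd : ∀ x, ‖((b x - g x : ℝ) : ℂ)‖ ≤ K * h := fun x => by rw [norm_real]; exact hbg x
  have s1 : SqInt (fun x => (g' x : ℂ) * ψ x) := sψ.bounded_mul cgC' nb'
  have s2 : SqInt (fun x => (g x : ℂ) * ψ' x) := sψ'.bounded_mul cgC nb
  have s3 : SqInt (fun x => (g x : ℂ) * ψ x) := sψ.bounded_mul cgC nb
  have s4 : SqInt (fun x => ((b x - g x : ℝ) : ℂ) * ψ x) := sψ.bounded_mul cd nd
  have e1 : ∫ x, (b x : ℂ) * (S' x * ψ x) = (∫ x, S' x * ((g x : ℂ) * ψ x)) +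
      ∫ x, S' x * (((b x - g x : ℝ) : ℂ) * ψ x) := by
    rw [← integral_add (sS'.integrable_mul s3) (sS'.integrable_mul s4)]
    congr 1
    ext x
    push_cast
    ring
  have e2 : ∫ x, S' x * ((g x : ℂ) * ψ x) = -((∫ x, S x * ((g' x : ℂ) * ψ x)) +
      ∫ x, S x * ((g x : ℂ) * ψ' x)) := by
    have := hS.integral_mul_eq (hg.mul hψ) sS sS' s3 (s1.add s2)
    rw [← integral_add (sS.integrable_mul s1) (sS.integrable_mul s2)]
    simp only [← mul_add]
    rw [this, neg_neg]
  have i1 := (sS.norm_integral_mul_le s1).trans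
    (mul_le_mul_of_nonneg_left (nrm_bounded_mul_le sψ cgC' nb') (nrm_nonneg S))
  have i2 := (sS.norm_integral_mul_le s2).trans
    (mul_le_mul_of_nonneg_left (nrm_bounded_mul_le sψ' cgC nb) (nrm_nonneg S))
  have i3 := (sS'.norm_integral_mul_le s4).trans
    (mul_le_mul_of_nonneg_left (nrm_bounded_mul_le sψ cd nd) (nrm_nonneg S'))
  rw [e1, e2]
  refine (norm_add_le _ _).trans (add_le_add ?_ (i3.trans (le_trans (le_of_eq (by ring)) hhδ)))
  rw [norm_neg]
  refine (norm_add_le _ _).trans ((add_le_add i1 i2).trans (le_of_eq (by ring)))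

/-! ### Taylor remainders of the coefficients -/

/-- A bounded family of functions whose gradients are bounded and Lipschitz. -/
structure C11Family {Θ : Type} (f : Θ → Space n → ℝ) (df : Θ → Space n → Space n) (K : ℝ) : Prop where
  nonneg : 0 ≤ K
  bound : ∀ θ x, |f θ x| ≤ K
  grad : ∀ θ x, HasGradientAt (f θ) (df θ x) x
  grad_bound : ∀ θ x, ‖df θ x‖ ≤ K
  grad_lip : ∀ θ x y, ‖df θ x - df θ y‖ ≤ K * ‖x - y‖

namespace C11Family

variable {Θ : Type} {f : Θ → Space n → ℝ} {df : Θ → Space n → Space n} {K : ℝ}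

lemma taylor (h : C11Family f df K) (θ : Θ) (x y : Space n) :
    |f θ x - f θ y - inner ℝ (df θ y) (x - y)| ≤ K * ‖x - y‖ ^ 2 := by
  have := (convex_closedBall y ‖x - y‖).norm_image_sub_le_of_norm_hasFDerivWithin_le' (𝕜 := ℝ)
    (f := f θ) (φ := InnerProductSpace.toDual ℝ _ (df θ y))
    (f' := fun z => InnerProductSpace.toDual ℝ _ (df θ z)) (C := K * ‖x - y‖)
    (fun z _ => (h.grad θ z).hasFDerivAt.hasFDerivWithinAt)
    (fun z hz => by
      rw [← map_sub, LinearIsometryEquiv.norm_map]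
      refine (h.grad_lip θ z y).trans (mul_le_mul_of_nonneg_left ?_ h.nonneg)
      rwa [Metric.mem_closedBall, dist_eq_norm] at hz)
    (Metric.mem_closedBall_self (norm_nonneg _))
    (show x ∈ Metric.closedBall y ‖x - y‖ by rw [Metric.mem_closedBall, dist_eq_norm])
  rw [norm_eq_abs] at this
  refine this.trans (le_of_eq (by ring))

lemma continuous (h : C11Family f df K) (θ : Θ) : Continuous (f θ) :=
  continuous_iff_continuousAt.2 fun x => (h.grad θ x).hasFDerivAt.continuousAt

lemma abs_grad_coord_sub_le (h : C11Family f df K) (θ : Θ) (l : Fin n) (x y : Space n) :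
    |df θ x l - df θ y l| ≤ K * ‖x - y‖ := by
  have := abs_coord_le (df θ x - df θ y) l
  rw [PiLp.sub_apply] at this
  exact this.trans (h.grad_lip θ x y)

lemma abs_grad_coord_le (h : C11Family f df K) (θ : Θ) (l : Fin n) (x : Space n) :
    |df θ x l| ≤ K := (abs_coord_le _ _).trans (h.grad_bound θ x)

lemma continuous_grad (h : C11Family f df K) (θ : Θ) : Continuous (df θ) := by
  refine (LipschitzWith.of_dist_le_mul (K := toNNReal K) fun x y => ?_).continuous
  rw [dist_eq_norm, dist_eq_norm, coe_toNNReal _ h.nonneg]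
  exact h.grad_lip θ x y

lemma continuous_grad_coord (h : C11Family f df K) (θ : Θ) (l : Fin n) :
    Continuous (fun x => df θ x l) := by
  have := h.continuous_grad θ
  fun_prop

end C11Family

namespace PacketSystem

variable {Θ ι : Type} {Y : PacketSystem n Θ ι} {f : Θ → Space n → ℝ} {df : Θ → Space n → Space n} {K : ℝ}

variable (Y f df) in
/-- The second order Taylor remainder of `f` at the centre of the packet. -/
def rem (θ : Θ) (γ : ι) (x : Space n) : ℂ :=
  ((f θ x - f θ (Y.X θ γ) - inner ℝ (df θ (Y.X θ γ)) (x - Y.X θ γ) : ℝ) : ℂ)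

lemma hasPartial_rem (h : C11Family f df K) (l : Fin n) (θ : Θ) (γ : ι) :
    HasPartial l (Y.rem f df θ γ) (fun x => ((df θ x l - df θ (Y.X θ γ) l : ℝ) : ℂ)) := by
  refine HasPartial.ofReal fun x => ?_
  have h1 : HasFDerivAt (fun x => inner ℝ (df θ (Y.X θ γ)) (x - Y.X θ γ))
      (innerSL ℝ (df θ (Y.X θ γ))) x := by
    simp only [inner_sub_right]
    exact (innerSL ℝ (df θ (Y.X θ γ))).hasFDerivAt.sub_const _
  have h2 := (((h.grad θ x).hasFDerivAt.sub_const (f θ (Y.X θ γ))).sub h1).hasLineDerivAt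
    (EuclideanSpace.single l 1)
  have e : ∀ v : Space n, inner ℝ v (EuclideanSpace.single l (1 : ℝ)) = v l := fun v => by
    rw [EuclideanSpace.inner_single_right]; simp
  exact HasDerivAt.congr_deriv h2 (by simp [e])

lemma one_le_max_mul (K : ℝ) (k N : ℕ) (v : Space n) : 1 ≤ max 1 K * (1 + scl k * ‖v‖) ^ N :=
  one_le_mul_of_one_le_of_one_le (le_max_left _ _)
    (one_le_pow₀ (le_add_of_nonneg_right (scl_mul_norm_nonneg k v)))

lemma tameO_grad_sub (h : C11Family f df K) (l : Fin n) :
    Y.TameO (-1) (fun θ γ x => ((df θ x l - df θ (Y.X θ γ) l : ℝ) : ℂ)) := by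
  have hK := h.nonneg
  have aux : ∀ (θ : Θ) (k : ℕ) (x y : Space n),
      ‖((scl k * (df θ x l - df θ y l) : ℝ) : ℂ)‖ ≤ max 1 K * (1 + scl k * ‖x - y‖) ^ 1 := by
    intro θ k x y
    have h1 := h.abs_grad_coord_sub_le θ l x y
    have hs := scl_pos k
    rw [norm_real, norm_eq_abs, abs_mul, abs_of_pos hs, pow_one]
    calc _ ≤ scl k * (K * ‖x - y‖) := by gcongr
      _ = K * (0 + scl k * ‖x - y‖) := by ring
      _ ≤ _ := by gcongr; exacts [le_max_right _ _, zero_le_one]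
  refine ⟨fun θ γ => continuous_const.mul (continuous_ofReal.comp
    ((h.continuous_grad_coord θ l).sub continuous_const)), Bool, inferInstance, 1, max 1 K,
    fun θ k z => ⟨fun m x => if m then ((scl k * (df θ x l - df θ z l) : ℝ) : ℂ) else 1,
      fun m γ => if m then 1 else ((scl k * (df θ z l - df θ (Y.X θ γ) l) : ℝ) : ℂ),
      fun γ hγ x => ?_, ?_, ?_⟩⟩
  · beta_reduce
    rw [Fintype.sum_bool, hγ]
    simp only [if_true, Bool.false_eq_true, if_false, neg_neg, zpow_one]
    push_cast
    ring
  · rintro (_ | _) x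
    exacts [by simpa using one_le_max_mul K k 1 (x - z), aux θ k x z]
  · rintro (_ | _) γ hγ
    exacts [aux θ k z _, by simpa using one_le_max_mul K k 1 (z - Y.X θ γ)]

/-- Expanding about an arbitrary point `z` shows that the Taylor remainder is tame. -/
lemma tameO_rem (h : C11Family f df K) : Y.TameO (-2) (Y.rem f df) := by
  have hK := h.nonneg
  have aux : ∀ (θ : Θ) (k : ℕ) (x y : Space n),
      ‖((scl k ^ 2 * (f θ x - f θ y - inner ℝ (df θ y) (x - y)) : ℝ) : ℂ)‖ ≤
        max 1 K * (1 + scl k * ‖x - y‖) ^ 2 := by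
    intro θ k x y
    have h1 := h.taylor θ x y
    have hs := scl_pos k
    rw [norm_real, norm_eq_abs, abs_mul, abs_of_pos (by positivity)]
    calc _ ≤ scl k ^ 2 * (K * ‖x - y‖ ^ 2) := by gcongr
      _ = K * (0 + scl k * ‖x - y‖) ^ 2 := by ring
      _ ≤ _ := by gcongr; exacts [le_max_right _ _, zero_le_one]
  have aux2 : ∀ (k : ℕ) (x y : Space n) (u : ℂ), ‖u‖ ≤ max 1 K * (scl k * ‖x - y‖) →
      ‖u‖ ≤ max 1 K * (1 + scl k * ‖x - y‖) ^ 2 := by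
    intro k x y u hu
    refine hu.trans (mul_le_mul_of_nonneg_left ?_ (le_trans zero_le_one (le_max_left _ _)))
    nlinarith [scl_mul_norm_nonneg k (x - y)]
  have hm : (1 : ℝ) ≤ max 1 K := le_max_left _ _
  -- `rem` is the remainder at `x` about `z`, plus the remainder at `z` about the centre, plus the
  -- product of `x - z` with the difference of the gradients
  refine ⟨fun θ γ => continuous_const.mul (continuous_ofReal.comp ?_), Bool ⊕ Fin n,
    inferInstance, 2, max 1 K, fun θ k z =>
    ⟨Sum.elim (fun m x => if m then ((scl k ^ 2 * (f θ x - f θ z - inner ℝ (df θ z) (x - z)) : ℝ) : ℂ)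
        else 1) (fun l x => ((scl k * (x l - z l) : ℝ) : ℂ)),
      Sum.elim (fun m γ => if m then 1 else
        ((scl k ^ 2 * (f θ z - f θ (Y.X θ γ) - inner ℝ (df θ (Y.X θ γ)) (z - Y.X θ γ)) : ℝ) : ℂ))
        (fun l γ => ((scl k * (df θ z l - df θ (Y.X θ γ) l) : ℝ) : ℂ)), fun γ hγ x => ?_, ?_, ?_⟩⟩
  · have := h.continuous θ
    fun_prop
  · beta_reduce
    rw [Fintype.sum_sum_type, Fintype.sum_bool, hγ]
    simp only [Sum.elim_inl, Sum.elim_inr, if_true, Bool.false_eq_true, if_false, rem, neg_neg]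
    have e1 : ∑ l, (scl k * (x l - z l)) * (scl k * (df θ z l - df θ (Y.X θ γ) l)) =
        scl k ^ 2 * inner ℝ (df θ z - df θ (Y.X θ γ)) (x - z) := by
      rw [PiLp.inner_apply, mul_sum]
      refine sum_congr rfl fun l _ => ?_
      simp only [PiLp.sub_apply, RCLike.inner_apply, conj_trivial]
      ring
    have e2 : inner ℝ (df θ (Y.X θ γ)) (x - Y.X θ γ) = inner ℝ (df θ (Y.X θ γ)) (x - z) +
        inner ℝ (df θ (Y.X θ γ)) (z - Y.X θ γ) := by
      rw [← inner_add_right, sub_add_sub_cancel]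
    have e3 : ∑ l, ((scl k * (x l - z l) : ℝ) : ℂ) * ((scl k * (df θ z l - df θ (Y.X θ γ) l) : ℝ) : ℂ) =
        ((scl k ^ 2 * inner ℝ (df θ z - df θ (Y.X θ γ)) (x - z) : ℝ) : ℂ) := by
      rw [← e1]; push_cast; rfl
    rw [e3, inner_sub_left, e2, zpow_ofNat]
    push_cast
    ring
  · rintro ((_ | _) | l) x
    · simpa using one_le_max_mul K k 2 (x - z)
    · exact aux θ k x z
    · refine aux2 k x z _ ?_
      have h1 := abs_coord_le (x - z) l
      rw [PiLp.sub_apply] at h1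
      have hs := scl_pos k
      simp only [Sum.elim_inr]
      rw [norm_real, norm_eq_abs, abs_mul, abs_of_pos hs]
      calc _ ≤ 1 * (scl k * ‖x - z‖) := by rw [one_mul]; gcongr
        _ ≤ _ := by gcongr
  · rintro ((_ | _) | l) γ hγ
    · exact aux θ k z _
    · simpa using one_le_max_mul K k 2 (z - Y.X θ γ)
    · refine aux2 k z _ _ ?_
      have h1 := h.abs_grad_coord_sub_le θ l z (Y.X θ γ)
      have hs := scl_pos k
      simp only [Sum.elim_inr]
      rw [norm_real, norm_eq_abs, abs_mul, abs_of_pos hs]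
      calc _ ≤ scl k * (K * ‖z - Y.X θ γ‖) := by gcongr
        _ = K * (scl k * ‖z - Y.X θ γ‖) := by ring
        _ ≤ _ := by gcongr; exact le_max_right _ _

lemma tameD_rem (h : C11Family f df K) : Y.TameD (-2) (Y.rem f df) :=
  ⟨tameO_rem h, fun l θ γ x => ((df θ x l - df θ (Y.X θ γ) l : ℝ) : ℂ), fun l => tameO_grad_sub h l,
    fun l θ γ => hasPartial_rem h l θ γ⟩

end PacketSystem

/-! ### Weak estimates for packet sums -/

namespace PacketSystem

variable {Θ ι : Type} {Y : PacketSystem n Θ ι} {α β : ℤ} {p q p' q' : Θ → ι → Space n → ℂ}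

variable (Y) in
/-- The packet sum with coefficients `d` and amplitudes `p`. -/
def psum (p : Θ → ι → Space n → ℂ) (θ : Θ) (S : Finset ι) (d : ι → ℂ) (x : Space n) : ℂ :=
  ∑ γ ∈ S, d γ * (p θ γ x * Y.pk θ γ x)

variable (Y) in
/-- The `ℓ²` norm of the coefficients, with the weight `scl ^ α`. -/
def wn (α : ℤ) (S : Finset ι) (d : ι → ℂ) : ℝ :=
  sqrt (∑ γ ∈ S, (scl (Y.lev γ) ^ α * ‖d γ‖) ^ 2)

lemma wn_nonneg (α : ℤ) (S : Finset ι) (d : ι → ℂ) : 0 ≤ Y.wn α S d := sqrt_nonneg _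

lemma wn_mono (h : α ≤ β) (S : Finset ι) (d : ι → ℂ) : Y.wn α S d ≤ Y.wn β S d := by
  refine sqrt_le_sqrt (sum_le_sum fun γ _ => ?_)
  have := scl_zpow_pos (Y.lev γ) α
  have := zpow_le_zpow_right₀ (one_le_scl (Y.lev γ)) h
  gcongr

lemma TameD.exists_nrm_psum_le (hp : Y.TameD α p) :
    ∃ K : ℝ, 0 ≤ K ∧ ∀ θ S d, nrm (Y.psum p θ S d) ≤ K * Y.wn α S d := hp.exists_nrm_bound

lemma TameO.sqInt_psum (hp : Y.TameO α p) (θ : Θ) (S : Finset ι)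
    (d : ι → ℂ) : SqInt (Y.psum p θ S d) := (hp.decays_sum θ S d).sqInt

lemma hasPartial_psum {j : Fin n} {θ : Θ}
    (h : ∀ γ, HasPartial j (fun x => p θ γ x * Y.pk θ γ x) (fun x => p' θ γ x * Y.pk θ γ x))
    (S : Finset ι) (d : ι → ℂ) : HasPartial j (Y.psum p θ S d) (Y.psum p' θ S d) :=
  HasPartial.sum fun γ _ => (h γ).const_mul (d γ)

lemma psum_add (p q : Θ → ι → Space n → ℂ) (θ : Θ) (S : Finset ι) (d : ι → ℂ) (x : Space n) :
    Y.psum (fun θ γ x => p θ γ x + q θ γ x) θ S d x = Y.psum p θ S d x + Y.psum q θ S d x := by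
  simp only [psum, ← sum_add_distrib]
  exact sum_congr rfl fun γ _ => by ring

lemma psum_sub (p q : Θ → ι → Space n → ℂ) (θ : Θ) (S : Finset ι) (d : ι → ℂ) (x : Space n) :
    Y.psum (fun θ γ x => p θ γ x - q θ γ x) θ S d x = Y.psum p θ S d x - Y.psum q θ S d x := by
  simp only [psum, ← sum_sub_distrib]
  exact sum_congr rfl fun γ _ => by ring

lemma psum_sum {J : Type*} (s : Finset J) (p : J → Θ → ι → Space n → ℂ) (θ : Θ) (S : Finset ι)
    (d : ι → ℂ) (x : Space n) :
    Y.psum (fun θ γ x => ∑ j ∈ s, p j θ γ x) θ S d x = ∑ j ∈ s, Y.psum (p j) θ S d x := by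
  simp only [psum]
  rw [sum_comm]
  refine sum_congr rfl fun γ _ => ?_
  rw [← mul_sum, sum_mul]

/-- Factors which do not depend on the index can be taken out of the sum. -/
lemma psum_mul_left (b : Θ → Space n → ℂ) (p : Θ → ι → Space n → ℂ) (θ : Θ) (S : Finset ι)
    (d : ι → ℂ) (x : Space n) :
    Y.psum (fun θ γ x => b θ x * p θ γ x) θ S d x = b θ x * Y.psum p θ S d x := by
  simp only [psum, mul_sum]
  exact sum_congr rfl fun γ _ => by ring

variable (Y) in
/-- Packet sums with amplitude `p` are functionals of the test functions with one derivative in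
`L²`, bounded by the unweighted norm of the coefficients. -/
def WeakBound (p : Θ → ι → Space n → ℂ) : Prop := ∃ K : ℝ, 0 ≤ K ∧
  ∀ θ S d (ψ : Space n → ℂ) (ψ' : Fin n → Space n → ℂ), SqInt ψ → (∀ j, SqInt (ψ' j)) →
    (∀ j, HasPartial j ψ (ψ' j)) →
    ‖∫ x, Y.psum p θ S d x * ψ x‖ ≤ K * (Y.wn 0 S d * (nrm ψ + ∑ j, nrm (ψ' j)))

lemma Sym.weakBound_zero (hp : Y.Sym 0 p) : Y.WeakBound p := by
  obtain ⟨K, hK, h⟩ := hp.tameD.exists_nrm_psum_le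
  refine ⟨K, hK, fun θ S d ψ ψ' sψ _ _ => ((hp.tameO.sqInt_psum θ S d).norm_integral_mul_le sψ).trans ?_⟩
  rw [← mul_assoc]
  exact mul_le_mul (h θ S d) (le_add_of_nonneg_right (sum_nonneg fun j _ => nrm_nonneg _))
    (nrm_nonneg _) ((nrm_nonneg _).trans (h θ S d))

/-- Write the symbol as a divergence and integrate by parts. -/
lemma Sym.weakBound_of_lower (hp : Y.Sym α p) (hα : α ≤ 2)
    (hw : ∀ w, Y.Sym (α - 1) w → Y.WeakBound w) : Y.WeakBound p := by
  obtain ⟨v, g, w, sv, sg, sw, hvg, hpgw⟩ := hp.exists_divergence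
  have sv' : ∀ j, Y.Sym 0 (v j) := fun j => (sv j).mono
  choose A hA bA using fun j => (sv' j).tameD.exists_nrm_psum_le
  obtain ⟨D, hD, bD⟩ := hw w sw
  refine ⟨∑ j, A j + D, add_nonneg (sum_nonneg fun j _ => hA j) hD, fun θ S d ψ ψ' sψ sψ' hψ => ?_⟩
  have e : ∀ x, Y.psum p θ S d x * ψ x = ∑ j, Y.psum (g j) θ S d x * ψ x + Y.psum w θ S d x * ψ x := by
    intro x
    have : p = fun θ γ x => ∑ j, g j θ γ x + w θ γ x := by
      funext θ γ x
      rw [hpgw]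
    rw [this, psum_add, psum_sum, add_mul, sum_mul]
  have i1 : ∀ j, Integrable (fun x => Y.psum (g j) θ S d x * ψ x) := fun j =>
    ((sg j).tameO.sqInt_psum θ S d).integrable_mul sψ
  simp only [e]
  rw [integral_add (integrable_finsetSum _ fun j _ => i1 j)
    ((sw.tameO.sqInt_psum θ S d).integrable_mul sψ), integral_finsetSum _ fun j _ => i1 j, add_mul,
    sum_mul]
  refine (norm_add_le _ _).trans (add_le_add ((norm_sum_le _ _).trans (sum_le_sum fun j _ => ?_))
    (bD θ S d ψ ψ' sψ sψ' hψ))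
  have q := (sv j).tameO.sqInt_psum θ S d
  rw [← neg_neg (∫ x, _), ← (hasPartial_psum (hvg j θ) S d).integral_mul_eq (hψ j) q
    ((sg j).tameO.sqInt_psum θ S d) sψ (sψ' j), norm_neg, ← mul_assoc]
  exact (q.norm_integral_mul_le (sψ' j)).trans (mul_le_mul (bA j θ S d)
    ((single_le_sum (fun j _ => nrm_nonneg (ψ' j)) (Finset.mem_univ j)).trans
      (le_add_of_nonneg_left (nrm_nonneg ψ))) (nrm_nonneg _) ((nrm_nonneg _).trans (bA j θ S d)))

/-- A symbol of order two loses one derivative of the test function only: write it as a divergence,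
twice. -/
lemma Sym.weakBound (hp : Y.Sym 2 p) : Y.WeakBound p :=
  hp.weakBound_of_lower le_rfl fun _ hw => hw.weakBound_of_lower (by norm_num) fun _ hw' =>
    Sym.weakBound_zero hw'.mono

variable (Y) in
/-- Packet sums with amplitude `p` are functionals of the second derivative `∂_l² χ` which are
bounded by the `L²` norm of `χ` and the norm of the coefficients with weight `scl ^ α`. -/
def WeakBoundTwo (l : Fin n) (α : ℤ) (p : Θ → ι → Space n → ℂ) : Prop := ∃ K : ℝ, 0 ≤ K ∧
  ∀ θ S d (χ χ' χ'' : Space n → ℂ), SqInt χ → SqInt χ' → SqInt χ'' →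
    HasPartial l χ χ' → HasPartial l χ' χ'' →
    ‖∫ x, Y.psum p θ S d x * χ'' x‖ ≤ K * (Y.wn α S d * nrm χ)

/-- Two derivatives of the test function are moved to a packet sum. -/
lemma Sym.weakBoundTwo (hp : Y.Sym α p) (l : Fin n) : Y.WeakBoundTwo l (α + 4) p := by
  obtain ⟨p', sp', hp'⟩ := hp.exists_partial_mul_pk l
  obtain ⟨p'', sp'', hp''⟩ := sp'.exists_partial_mul_pk l
  obtain ⟨K, hK, hb⟩ := sp''.tameD.exists_nrm_psum_le
  refine ⟨K, hK, fun θ S d χ χ' χ'' sχ sχ' sχ'' h1 h2 => ?_⟩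
  have q := hp.tameO.sqInt_psum θ S d
  have q' := sp'.tameO.sqInt_psum θ S d
  have q'' := sp''.tameO.sqInt_psum θ S d
  rw [(hasPartial_psum (hp' θ) S d).integral_mul_eq h2 q q' sχ' sχ'',
    (hasPartial_psum (hp'' θ) S d).integral_mul_eq h1 q' q'' sχ sχ', neg_neg]
  refine (q''.norm_integral_mul_le sχ).trans ?_
  have := hb θ S d
  rw [add_assoc] at this
  norm_num at this
  rw [← mul_assoc]
  exact mul_le_mul_of_nonneg_right this (nrm_nonneg _)

section rem

variable {f : Θ → Space n → ℝ} {df : Θ → Space n → Space n} {M : ℝ}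

/-- The derivative of a sum with Taylor remainders. -/
lemma hasPartial_psum_rem (h : C11Family f df M) {l : Fin n} {θ : Θ}
    (hq : ∀ γ, HasPartial l (fun x => q θ γ x * Y.pk θ γ x) (fun x => q' θ γ x * Y.pk θ γ x))
    (S : Finset ι) (d : ι → ℂ) :
    HasPartial l (Y.psum (fun θ γ x => Y.rem f df θ γ x * q θ γ x) θ S d)
      (fun x => (df θ x l : ℂ) * Y.psum q θ S d x -
        Y.psum (fun θ γ x => (df θ (Y.X θ γ) l : ℂ) * q θ γ x) θ S d x +
        Y.psum (fun θ γ x => Y.rem f df θ γ x * q' θ γ x) θ S d x) := by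
  have h1 : ∀ γ, HasPartial l (fun x => Y.rem f df θ γ x * q θ γ x * Y.pk θ γ x) (fun x =>
      (((df θ x l : ℂ) * q θ γ x - (df θ (Y.X θ γ) l : ℂ) * q θ γ x) +
        Y.rem f df θ γ x * q' θ γ x) * Y.pk θ γ x) := fun γ =>
    ((hasPartial_rem h l θ γ).mul (hq γ)).congr (fun x => by ring) fun x => by push_cast; ring
  refine (hasPartial_psum (p' := fun θ γ x => ((df θ x l : ℂ) * q θ γ x -
    (df θ (Y.X θ γ) l : ℂ) * q θ γ x) + Y.rem f df θ γ x * q' θ γ x) h1 S d).congr (fun _ => rfl)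
    fun x => ?_
  rw [psum_add, psum_sub, psum_mul_left (fun θ x => (df θ x l : ℂ))]

lemma sym_grad_centre (h : C11Family f df M) (l : Fin n) :
    Y.Sym 0 (fun θ γ _ => (df θ (Y.X θ γ) l : ℂ)) :=
  Sym.const _ M fun θ γ => by
    rw [norm_real, zpow_zero, mul_one]
    exact h.abs_grad_coord_le θ l _

lemma sqInt_grad_mul (h : C11Family f df M) (θ : Θ) (l : Fin n) {g : Space n → ℂ} (hg : SqInt g) :
    SqInt (fun x => (df θ x l : ℂ) * g x) :=
  hg.bounded_mul (continuous_ofReal.comp (h.continuous_grad_coord θ l)) (B := M) fun x => by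
    rw [norm_real]; exact h.abs_grad_coord_le θ l x

lemma nrm_grad_mul_le (h : C11Family f df M) (θ : Θ) (l : Fin n) {g : Space n → ℂ} (hg : SqInt g) :
    nrm (fun x => (df θ x l : ℂ) * g x) ≤ M * nrm g :=
  nrm_bounded_mul_le (b := fun x => (df θ x l : ℂ)) hg
    (continuous_ofReal.comp (h.continuous_grad_coord θ l)) fun x => by
    rw [norm_real]; exact h.abs_grad_coord_le θ l x

lemma integral_sub_add_mul {a b c φ : Space n → ℂ} (ha : SqInt a) (hb : SqInt b) (hc : SqInt c)
    (hφ : SqInt φ) : ∫ x, (a x - b x + c x) * φ x =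
      (∫ x, a x * φ x) - (∫ x, b x * φ x) + ∫ x, c x * φ x := by
  have hab : Integrable (fun x => a x * φ x - b x * φ x) :=
    (ha.integrable_mul hφ).sub (hb.integrable_mul hφ)
  rw [← integral_sub (ha.integrable_mul hφ) (hb.integrable_mul hφ),
    ← integral_add hab (hc.integrable_mul hφ)]
  simp only [add_mul, sub_mul]

/-- Weak bound for Taylor remainders times second derivatives of packets. One derivative is moved to
the test function; where it falls on the remainder, it leaves the gradient of the coefficient, and
the remaining derivative of the packets is moved by `norm_integral_lipschitz_mul_le`. -/
lemma weakBound_rem (h : C11Family f df M) {u q' : Θ → ι → Space n → ℂ} {i j : Fin n}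
    (su : Y.Sym 2 u) (sq' : Y.Sym 4 q')
    (hu : ∀ θ γ, HasPartial j (Y.pk θ γ) (fun x => u θ γ x * Y.pk θ γ x))
    (hq : ∀ θ γ, HasPartial i (fun x => u θ γ x * Y.pk θ γ x) (fun x => q' θ γ x * Y.pk θ γ x)) :
    Y.WeakBound (fun θ γ x => Y.rem f df θ γ x * q' θ γ x) := by
  have hM := h.nonneg
  have tu : Y.TameD 0 (fun θ γ x => Y.rem f df θ γ x * u θ γ x) := (tameD_rem h).mul su.tameD
  have tq : Y.TameO 2 (fun θ γ x => Y.rem f df θ γ x * q' θ γ x) := (tameO_rem h).mul sq'.tameO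
  have sc : Y.Sym 2 (fun θ γ x => (df θ (Y.X θ γ) i : ℂ) * u θ γ x) := (sym_grad_centre h i).mul su
  obtain ⟨A, hA, bA⟩ := tu.exists_nrm_psum_le
  obtain ⟨B, hB, bB⟩ := (Sym.num (Y := Y) 1).tameD.exists_nrm_psum_le
  obtain ⟨D, hD, bD⟩ := sc.weakBound
  refine ⟨A + B * M + D, by positivity, fun θ S d ψ ψ' sψ sψ' hψ => ?_⟩
  have hNj : ∀ j, nrm (ψ' j) ≤ ∑ j, nrm (ψ' j) := fun j =>
    single_le_sum (fun j _ => nrm_nonneg (ψ' j)) (Finset.mem_univ j)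
  have hNd := bD θ S d ψ ψ' sψ sψ' hψ
  set N := nrm ψ + ∑ j, nrm (ψ' j) with hN
  have qu := tu.1.sqInt_psum θ S d
  have qq := tq.sqInt_psum θ S d
  have qc := sc.tameO.sqInt_psum θ S d
  have q1 := su.tameO.sqInt_psum θ S d
  have q0 := (Sym.num (Y := Y) 1).tameO.sqInt_psum θ S d
  have qg := sqInt_grad_mul h θ i q1
  have e := (hasPartial_psum_rem h (hq θ) S d).integral_mul_eq (hψ i) qu ((qg.sub qc).add qq) sψ (sψ' i)
  rw [integral_sub_add_mul qg qc qq sψ] at e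
  -- the first derivatives of the packets are derivatives of the packet sum with amplitude one
  have hSu : HasPartial j (Y.psum (fun _ _ _ => 1) θ S d) (Y.psum u θ S d) :=
    hasPartial_psum (fun γ => by simpa using hu θ γ) S d
  have bA' := bA θ S d
  have bB' := bB θ S d
  have l1 := norm_integral_lipschitz_mul_le (h.abs_grad_coord_le θ i)
    (fun x y => h.abs_grad_coord_sub_le θ i x y) (h.continuous_grad_coord θ i) hSu (hψ j) q0 q1 sψ (sψ' j)
  simp only [← mul_assoc] at l1
  have l1' := l1.trans (mul_le_mul bB' (show _ ≤ M * N by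
    rw [← mul_add]
    exact mul_le_mul_of_nonneg_left (add_le_add le_rfl (hNj j)) hM)
    (add_nonneg (mul_nonneg hM (nrm_nonneg _)) (mul_nonneg hM (nrm_nonneg _)))
    ((nrm_nonneg _).trans bB'))
  have l2 := (qu.norm_integral_mul_le (sψ' i)).trans
    (mul_le_mul bA' ((hNj i).trans (le_add_of_nonneg_left (nrm_nonneg ψ))) (nrm_nonneg _)
      ((nrm_nonneg _).trans bA'))
  -- the integral to be bounded is the last term of `e`
  have solve : ∀ {a b c d : ℂ}, d = -(a - b + c) → c = -d - a + b := fun h => by linear_combination h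
  rw [solve e]
  refine (norm_add_le _ _).trans ((add_le_add ((norm_sub_le _ _).trans
    (add_le_add ((norm_neg _).trans_le l2) l1')) hNd).trans (le_of_eq (by ring)))

/-- Weak bound for remainder times a symbol, against two derivatives of the test function. A
derivative of the remainder leaves the gradient of the coefficient, which is only Lipschitz; there
the second derivative is moved by `norm_integral_lipschitz_mul_le`. -/
lemma weakBoundTwo_rem (h : C11Family f df M) (sq : Y.Sym α q) (l : Fin n) :
    Y.WeakBoundTwo l (α + 2) (fun θ γ x => Y.rem f df θ γ x * q θ γ x) := by
  have hM := h.nonneg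
  obtain ⟨q', sq', hq'⟩ := sq.exists_partial_mul_pk l
  obtain ⟨q'', sq'', hq''⟩ := sq'.exists_partial_mul_pk l
  have t0 : Y.TameO α (fun θ γ x => Y.rem f df θ γ x * q θ γ x) :=
    (tameO_rem h).mul sq.tameO
  have t1 : Y.TameO α (fun θ γ x => Y.rem f df θ γ x * q' θ γ x) :=
    (tameO_rem h).mul sq'.tameO
  have t2 : Y.TameD (α + 2) (fun θ γ x => Y.rem f df θ γ x * q'' θ γ x) :=
    (tameD_rem h).mul sq''.tameD
  have c0 : Y.Sym α (fun θ γ x => (df θ (Y.X θ γ) l : ℂ) * q θ γ x) :=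
    (sym_grad_centre h l).mul sq
  have c1 : Y.Sym (α + 2) (fun θ γ x => (df θ (Y.X θ γ) l : ℂ) * q' θ γ x) :=
    (sym_grad_centre h l).mul sq'
  obtain ⟨A, hA, bA⟩ := sq.tameD.exists_nrm_psum_le
  obtain ⟨A', hA', bA'⟩ := sq'.tameD.exists_nrm_psum_le
  obtain ⟨B, hB, bB⟩ := t2.exists_nrm_psum_le
  obtain ⟨D, hD, bD⟩ := c1.tameD.exists_nrm_psum_le
  refine ⟨M * A + M * A' + D + M * A' + D + B, by positivity,
    fun θ S d χ χ' χ'' sχ sχ' sχ'' h1 h2 => ?_⟩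
  have s0 := sq.tameO.sqInt_psum θ S d
  have s1 := sq'.tameO.sqInt_psum θ S d
  have r0 := t0.sqInt_psum θ S d
  have r1 := t1.sqInt_psum θ S d
  have r2 := t2.1.sqInt_psum θ S d
  have d0 := c0.tameO.sqInt_psum θ S d
  have d1 := c1.tameO.sqInt_psum θ S d
  have g0 := sqInt_grad_mul h θ l s0
  have g1 := sqInt_grad_mul h θ l s1
  have hcq : ∀ γ, HasPartial l (fun x => (df θ (Y.X θ γ) l : ℂ) * q θ γ x * Y.pk θ γ x)
      (fun x => (df θ (Y.X θ γ) l : ℂ) * q' θ γ x * Y.pk θ γ x) := fun γ =>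
    ((hq' θ γ).const_mul (df θ (Y.X θ γ) l : ℂ)).congr (fun x => by ring) fun x => by ring
  have p0 := (hasPartial_psum_rem h (hq' θ) S d).integral_mul_eq h2 r0 ((g0.sub d0).add r1) sχ' sχ''
  have p1 := (hasPartial_psum_rem h (hq'' θ) S d).integral_mul_eq h1 r1 ((g1.sub d1).add r2) sχ sχ'
  have p2 := (hasPartial_psum (p := fun θ γ x => (df θ (Y.X θ γ) l : ℂ) * q θ γ x)
    (p' := fun θ γ x => (df θ (Y.X θ γ) l : ℂ) * q' θ γ x) hcq S d).integral_mul_eq h1 d0 d1 sχ sχ'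
  rw [integral_sub_add_mul g0 d0 r1 sχ'] at p0
  rw [integral_sub_add_mul g1 d1 r2 sχ] at p1
  have l0 : ‖∫ x, (df θ x l : ℂ) * Y.psum q θ S d x * χ' x‖ ≤
      nrm χ * (M * nrm (Y.psum q θ S d) + M * nrm (Y.psum q' θ S d)) := by
    have := norm_integral_lipschitz_mul_le (h.abs_grad_coord_le θ l)
      (fun x y => h.abs_grad_coord_sub_le θ l x y) (h.continuous_grad_coord θ l) h1
      (hasPartial_psum (hq' θ) S d) sχ sχ' s0 s1
    refine le_of_eq_of_le ?_ this
    congr 2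
    ext x
    ring
  have w0 : nrm (Y.psum q θ S d) ≤ A * Y.wn (α + 2) S d := (bA θ S d).trans
    (mul_le_mul_of_nonneg_left (wn_mono (by omega) S d) hA)
  have w1 := bA' θ S d
  have w2 := bB θ S d
  have w3 := bD θ S d
  have l1 := (g1.norm_integral_mul_le sχ).trans
    (mul_le_mul_of_nonneg_right (nrm_grad_mul_le h θ l s1) (nrm_nonneg χ))
  have l2 := d1.norm_integral_mul_le sχ
  have l3 := r2.norm_integral_mul_le sχ
  have hχ := nrm_nonneg χ
  rw [p0, p1, p2, norm_neg]
  calc _ ≤ _ := (norm_add_le _ _).trans (add_le_add ((norm_sub_le _ _).trans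
        (add_le_add l0 ((norm_neg _).trans_le l2))) ((norm_neg _).trans_le ((norm_add_le _ _).trans
        (add_le_add ((norm_sub_le _ _).trans (add_le_add l1 l2)) l3))))
    _ ≤ nrm χ * (M * (A * Y.wn (α + 2) S d) + M * (A' * Y.wn (α + 2) S d)) +
        D * Y.wn (α + 2) S d * nrm χ + (M * (A' * Y.wn (α + 2) S d) * nrm χ +
        D * Y.wn (α + 2) S d * nrm χ + B * Y.wn (α + 2) S d * nrm χ) := by gcongr
    _ = _ := by ring

end rem

variable (Y) in
/-- The symbol of the second derivatives: `∂_i ∂_j Φ = hessD i j Φ`. -/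
def hessD (i j : Fin n) (θ : Θ) (γ : ι) (x : Space n) : ℂ :=
  Y.logD i θ γ x * Y.logD j θ γ x - if i = j then 2 * (‖Y.Ξ θ γ‖ : ℂ) else 0

lemma sym_hessD (i j : Fin n) : Y.Sym 4 (Y.hessD i j) := by
  refine ((sym_logD i).mul (sym_logD j) (κ := 4)).sub ?_
  split_ifs
  · exact (Sym.num 2).mul sym_norm_freq
  · exact (Sym.num 0).mono

lemma hasPartial_logD_mul_pk (i j : Fin n) (θ : Θ) (γ : ι) :
    HasPartial i (fun x => Y.logD j θ γ x * Y.pk θ γ x) (fun x => Y.hessD i j θ γ x * Y.pk θ γ x) := by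
  have h1 : HasPartial i (Y.logD j θ γ) (fun _ => -(2 * (‖Y.Ξ θ γ‖ : ℂ)) * if j = i then 1 else 0) :=
    ((HasPartial.const (I * (Y.Ξ θ γ j : ℂ))).add
      ((HasPartial.coord j (Y.X θ γ)).const_mul (-(2 * (‖Y.Ξ θ γ‖ : ℂ))))).congr
      (fun x => by simp only [logD]; ring) fun x => by ring
  refine (h1.mul (hasPartial_pk i θ γ)).congr (fun _ => rfl) fun x => ?_
  simp only [hessD, eq_comm (a := i)]
  split_ifs <;> ring

end PacketSystem

/-! ### Time derivatives of moving packets -/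

/-- The logarithmic time derivative of a moving packet. The position is `y` relative to the centre,
`ξ`, `v`, `η` are the frequency and the velocities of centre and frequency, `r = |ξ|` and `ρ = r'`. -/
def timeL (y ξ v η : Fin n → ℂ) (r ρ : ℂ) : ℂ :=
  n / 2 * (ρ * r⁻¹) + (I * (∑ j, η j * y j - ∑ j, ξ j * v j) -
    (ρ * ∑ j, y j * y j - 2 * r * ∑ j, y j * v j))

/-- The time derivative of `timeL`; here `v'`, `η'`, `ρ'` are the accelerations. -/
def timeL' (y ξ v η v' η' : Fin n → ℂ) (r ρ ρ' : ℂ) : ℂ :=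
  n / 2 * (ρ' * r⁻¹ - ρ * ρ * (r⁻¹ * r⁻¹)) +
    (I * (∑ j, η' j * y j - 2 * ∑ j, η j * v j - ∑ j, ξ j * v' j) -
    (ρ' * ∑ j, y j * y j - 4 * ρ * ∑ j, y j * v j + 2 * r * ∑ j, v j * v j -
      2 * r * ∑ j, y j * v' j))

/-- The complexified coordinates of a vector. -/
def cvec (v : Space n) (j : Fin n) : ℂ := (v j : ℂ)

lemma ofReal_inner (u v : Space n) : ((inner ℝ u v : ℝ) : ℂ) = ∑ j, cvec u j * cvec v j := by
  rw [PiLp.inner_apply]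
  push_cast
  refine sum_congr rfl fun j _ => ?_
  simp only [cvec, RCLike.inner_apply, conj_trivial]
  push_cast
  ring

lemma ofReal_norm_sq (v : Space n) : ((‖v‖ ^ 2 : ℝ) : ℂ) = ∑ j, cvec v j * cvec v j := by
  rw [← ofReal_inner, real_inner_self_eq_norm_sq]

lemma packet_eq_exp {δ : ℝ} (hδ : 0 < δ) (X Ξ x : Space n) (hΞ : Ξ ≠ 0) : packet δ X Ξ x =
    Complex.exp (((n / 2 * log (‖Ξ‖ * δ / (2 * π)) : ℝ) : ℂ) +
      (I * ((inner ℝ Ξ (x - X) : ℝ) : ℂ) - ((‖Ξ‖ * ‖x - X‖ ^ 2 : ℝ) : ℂ))) := by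
  have hr : 0 < ‖Ξ‖ * δ / (2 * π) := by have := norm_pos_iff.2 hΞ; positivity
  rw [packet, Complex.exp_add, rpow_def_of_pos hr, Complex.ofReal_exp, mul_comm (log _)]

lemma hasDerivAt_norm {Ξ : ℝ → Space n} {Ξ' : Space n} {t : ℝ} (h : HasDerivAt Ξ Ξ' t) (h0 : Ξ t ≠ 0) :
    HasDerivAt (fun s => ‖Ξ s‖) (inner ℝ (Ξ t) Ξ' * ‖Ξ t‖⁻¹) t := by
  have h1 := (h.norm_sq).sqrt (pow_ne_zero 2 (norm_ne_zero_iff.2 h0))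
  simp only [sqrt_sq (norm_nonneg _)] at h1
  refine h1.congr_deriv ?_
  have := norm_ne_zero_iff.2 h0
  field_simp

lemma hasDerivAt_packet {δ : ℝ} (hδ : 0 < δ) {X Ξ : ℝ → Space n} {X' Ξ' : Space n} {t : ℝ}
    (hX : HasDerivAt X X' t) (hΞ : HasDerivAt Ξ Ξ' t) (h0 : Ξ t ≠ 0) (x : Space n) :
    HasDerivAt (fun s => packet δ (X s) (Ξ s) x)
      (timeL (cvec (x - X t)) (cvec (Ξ t)) (cvec X') (cvec Ξ') ‖Ξ t‖
        ((inner ℝ (Ξ t) Ξ' * ‖Ξ t‖⁻¹ : ℝ) : ℂ) * packet δ (X t) (Ξ t) x) t := by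
  have hr := norm_pos_iff.2 h0
  have hn := hasDerivAt_norm hΞ h0
  have hy : HasDerivAt (fun s => x - X s) (-X') t := hX.const_sub x
  have h1 : HasDerivAt (fun s => n / 2 * log (‖Ξ s‖ * δ / (2 * π)))
      (n / 2 * (inner ℝ (Ξ t) Ξ' * ‖Ξ t‖⁻¹ * ‖Ξ t‖⁻¹)) t := by
    refine ((((hn.mul_const δ).div_const (2 * π)).log (by positivity)).const_mul
      ((n : ℝ) / 2)).congr_deriv ?_
    field_simp
  have h2 : HasDerivAt (fun s => inner ℝ (Ξ s) (x - X s)) (inner ℝ (Ξ t) (-X') + inner ℝ Ξ' (x - X t)) t :=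
    hΞ.inner ℝ hy
  have h3 : HasDerivAt (fun s => ‖Ξ s‖ * ‖x - X s‖ ^ 2) (inner ℝ (Ξ t) Ξ' * ‖Ξ t‖⁻¹ * ‖x - X t‖ ^ 2 +
      ‖Ξ t‖ * (2 * inner ℝ (x - X t) (-X'))) t := hn.mul hy.norm_sq
  have h4 := (h1.ofReal_comp.add ((h2.ofReal_comp.const_mul I).sub h3.ofReal_comp)).cexp
  have hev : ∀ᶠ s in nhds t, Ξ s ≠ 0 := hΞ.continuousAt.eventually_ne h0
  refine (h4.congr_of_eventuallyEq ?_).congr_deriv ?_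
  · filter_upwards [hev] with s hs
    exact packet_eq_exp hδ _ _ _ hs
  · simp only [Pi.add_apply, Pi.sub_apply]
    rw [← packet_eq_exp hδ _ _ _ h0, mul_comm]
    congr 1
    rw [timeL, inner_neg_right, inner_neg_right]
    simp only [← ofReal_inner, real_inner_self_eq_norm_sq]
    push_cast
    ring

/-- The second time derivative of a packet moving along a curve which is twice differentiable at
`t`. -/
lemma deriv_deriv_packet {δ : ℝ} (hδ : 0 < δ) {X Ξ X₁ Ξ₁ : ℝ → Space n} {X₂ Ξ₂ : Space n} {t : ℝ}
    (hX : ∀ᶠ s in nhds t, HasDerivAt X (X₁ s) s) (hΞ : ∀ᶠ s in nhds t, HasDerivAt Ξ (Ξ₁ s) s)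
    (hX₁ : HasDerivAt X₁ X₂ t) (hΞ₁ : HasDerivAt Ξ₁ Ξ₂ t) (h0 : Ξ t ≠ 0) (x : Space n) {r ρ ρ' : ℝ}
    (hr : r = ‖Ξ t‖) (hρ : ρ = inner ℝ (Ξ t) (Ξ₁ t) * r⁻¹)
    (hρ' : ρ' = (inner ℝ (Ξ₁ t) (Ξ₁ t) + inner ℝ (Ξ t) Ξ₂) * r⁻¹ - ρ * ρ * r⁻¹) :
    HasDerivAt (fun τ => deriv (fun s => packet δ (X s) (Ξ s) x) τ)
      ((timeL (cvec (x - X t)) (cvec (Ξ t)) (cvec (X₁ t)) (cvec (Ξ₁ t)) r ρ ^ 2 +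
        timeL' (cvec (x - X t)) (cvec (Ξ t)) (cvec (X₁ t)) (cvec (Ξ₁ t)) (cvec X₂) (cvec Ξ₂) r ρ ρ') *
        packet δ (X t) (Ξ t) x) t := by
  have hXt := hX.self_of_nhds
  have hΞt := hΞ.self_of_nhds
  have hev : ∀ᶠ s in nhds t, Ξ s ≠ 0 := hΞt.continuousAt.eventually_ne h0
  have hr0 : 0 < ‖Ξ t‖ := norm_pos_iff.2 h0
  have hn := hasDerivAt_norm hΞt h0
  have hy : HasDerivAt (fun s => x - X s) (-X₁ t) t := hXt.const_sub x
  set P : ℝ → ℝ := fun s => inner ℝ (Ξ s) (Ξ₁ s) * ‖Ξ s‖⁻¹ with hP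
  have hPt : P t = ρ := by rw [hP, hρ, hr]
  have dP : HasDerivAt P ρ' t := by
    refine ((hΞt.inner ℝ hΞ₁).mul (hn.inv hr0.ne')).congr_deriv ?_
    simp only [Pi.inv_apply]
    rw [hρ', hρ, hr]
    field_simp
    ring
  have d1 : HasDerivAt (fun s => (n : ℝ) / 2 * (P s * ‖Ξ s‖⁻¹))
      (n / 2 * (ρ' * r⁻¹ - ρ * ρ * (r⁻¹ * r⁻¹))) t := by
    refine ((dP.mul (hn.inv hr0.ne')).const_mul ((n : ℝ) / 2)).congr_deriv ?_
    simp only [Pi.inv_apply]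
    rw [hPt, hρ, hr]
    field_simp
    ring
  have d2 : HasDerivAt (fun s => inner ℝ (Ξ₁ s) (x - X s) - inner ℝ (Ξ s) (X₁ s))
      (inner ℝ Ξ₂ (x - X t) - 2 * inner ℝ (Ξ₁ t) (X₁ t) - inner ℝ (Ξ t) X₂) t := by
    refine ((hΞ₁.inner ℝ hy).sub (hΞt.inner ℝ hX₁)).congr_deriv ?_
    rw [inner_neg_right]
    ring
  have d3 : HasDerivAt (fun s => P s * ‖x - X s‖ ^ 2 - 2 * ‖Ξ s‖ * inner ℝ (x - X s) (X₁ s))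
      (ρ' * ‖x - X t‖ ^ 2 - 4 * ρ * inner ℝ (x - X t) (X₁ t) + 2 * r * ‖X₁ t‖ ^ 2 -
        2 * r * inner ℝ (x - X t) X₂) t := by
    refine ((dP.mul hy.norm_sq).sub ((hn.const_mul 2).mul (hy.inner ℝ hX₁))).congr_deriv ?_
    rw [hPt, inner_neg_right, inner_neg_left, real_inner_self_eq_norm_sq, ← hr, ← hρ]
    ring
  have dL : HasDerivAt (fun s => timeL (cvec (x - X s)) (cvec (Ξ s)) (cvec (X₁ s)) (cvec (Ξ₁ s)) ‖Ξ s‖ (P s))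
      (timeL' (cvec (x - X t)) (cvec (Ξ t)) (cvec (X₁ t)) (cvec (Ξ₁ t)) (cvec X₂) (cvec Ξ₂) r ρ ρ') t := by
    refine ((d1.ofReal_comp.add ((d2.ofReal_comp.const_mul I).sub d3.ofReal_comp)).congr_of_eventuallyEq
      (.of_forall fun s => ?_)).congr_deriv ?_
    · simp only [timeL, ← ofReal_inner, real_inner_self_eq_norm_sq, Pi.add_apply, Pi.sub_apply]
      push_cast
      ring
    · simp only [timeL', ← ofReal_inner, real_inner_self_eq_norm_sq]
      push_cast
      ring
  have hd : HasDerivAt (fun s => packet δ (X s) (Ξ s) x)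
      (timeL (cvec (x - X t)) (cvec (Ξ t)) (cvec (X₁ t)) (cvec (Ξ₁ t)) ‖Ξ t‖ (P t) *
        packet δ (X t) (Ξ t) x) t := hasDerivAt_packet hδ hXt hΞt h0 x
  refine ((dL.mul hd).congr_of_eventuallyEq ?_).congr_deriv ?_
  · filter_upwards [hX, hΞ, hev] with s h1 h2 h3
    exact (hasDerivAt_packet hδ h1 h2 h3 x).deriv
  · rw [hPt, ← hr]
    ring

/-! ### The wave operator on packets -/

/-- The Hamilton equations cancel the terms of highest order: this is the eikonal equation, up to
second order in `y`. -/
lemma eikonal_identity {f : Fin n → Fin n → ℂ} {df : Fin n → Fin n → Fin n → ℂ} {y ξ v η : Fin n → ℂ}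
    {q σ r : ℂ} (hsymm : ∀ i j, f i j = f j i) (hq : q ≠ 0) (hσ : σ ^ 2 = 1)
    (hq2 : q ^ 2 = ∑ i, ∑ j, f i j * ξ i * ξ j)
    (hv : ∀ i, v i = -(σ * (q⁻¹ * ∑ j, f i j * ξ j)))
    (hη : ∀ l, η l = σ * ((2 * q)⁻¹ * ∑ i, ∑ j, ξ i * ξ j * df i j l)) :
    (-I * ∑ j, ξ j * v j) ^ 2 + 2 * (-I * ∑ j, ξ j * v j) *
        ∑ j, (I * η j + 2 * r * v j) * y j =
      ∑ i, ∑ j, (f i j + ∑ l, df i j l * y l) *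
        ((I * ξ i - 2 * r * y i) * (I * ξ j - 2 * r * y j)) -
      (4 * r ^ 2 * ∑ i, ∑ j, f i j * y i * y j -
        2 * I * r * ∑ i, ∑ j, (∑ l, df i j l * y l) * (ξ i * y j + ξ j * y i) +
        4 * r ^ 2 * ∑ i, ∑ j, (∑ l, df i j l * y l) * y i * y j) := by
  have e0 : ∑ j, ξ j * v j = -(σ * q) := by
    have : ∑ j, ξ j * v j = -(σ * (q⁻¹ * ∑ i, ∑ j, f i j * ξ i * ξ j)) := by
      rw [mul_sum, mul_sum, ← sum_neg_distrib]
      refine sum_congr rfl fun i _ => ?_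
      rw [hv, mul_sum, mul_sum, ← sum_neg_distrib, mul_sum, mul_sum,
        mul_sum, ← sum_neg_distrib]
      exact sum_congr rfl fun j _ => by ring
    rw [this, ← hq2, sq, inv_mul_cancel_left₀ hq]
  have e1 : ∑ l, η l * y l = σ * (2 * q)⁻¹ * ∑ i, ∑ j, (∑ l, df i j l * y l) * (ξ i * ξ j) := by
    have : ∀ l, η l * y l = ∑ i, ∑ j, σ * (2 * q)⁻¹ * (df i j l * y l * (ξ i * ξ j)) := by
      intro l
      rw [hη, mul_sum, mul_sum, sum_mul]
      refine sum_congr rfl fun i _ => ?_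
      rw [mul_sum, mul_sum, sum_mul]
      exact sum_congr rfl fun j _ => by ring
    simp only [this]
    rw [sum_comm, mul_sum]
    refine sum_congr rfl fun i _ => ?_
    rw [sum_comm, mul_sum]
    refine sum_congr rfl fun j _ => ?_
    rw [sum_mul, mul_sum]
  have e2 : ∑ j, v j * y j = -(σ * q⁻¹) * ∑ i, ∑ j, f i j * (ξ j * y i) := by
    rw [mul_sum]
    refine sum_congr rfl fun i _ => ?_
    rw [hv, mul_sum, mul_sum, ← sum_neg_distrib, sum_mul, mul_sum]
    exact sum_congr rfl fun j _ => by ring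
  have e3 : ∑ i, ∑ j, f i j * (ξ i * y j) = ∑ i, ∑ j, f i j * (ξ j * y i) := by
    rw [sum_comm]
    exact sum_congr rfl fun i _ => sum_congr rfl fun j _ => by rw [hsymm]
  have e4 : ∑ j, (I * η j + 2 * r * v j) * y j =
      I * ∑ j, η j * y j + 2 * r * ∑ j, v j * y j := by
    rw [mul_sum, mul_sum, ← sum_add_distrib]
    exact sum_congr rfl fun j _ => by ring
  have e5 : ∑ i, ∑ j, (f i j + ∑ l, df i j l * y l) *
        ((I * ξ i - 2 * r * y i) * (I * ξ j - 2 * r * y j)) =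
      -(∑ i, ∑ j, f i j * ξ i * ξ j) - (∑ i, ∑ j, (∑ l, df i j l * y l) * (ξ i * ξ j)) -
      2 * I * r * (∑ i, ∑ j, f i j * (ξ i * y j)) -
      2 * I * r * (∑ i, ∑ j, f i j * (ξ j * y i)) +
      (4 * r ^ 2 * ∑ i, ∑ j, f i j * y i * y j -
        2 * I * r * ∑ i, ∑ j, (∑ l, df i j l * y l) * (ξ i * y j + ξ j * y i) +
        4 * r ^ 2 * ∑ i, ∑ j, (∑ l, df i j l * y l) * y i * y j) := by
    simp only [mul_sum (s := Finset.univ (α := Fin n)) (a := 2 * I * r),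
      mul_sum (s := Finset.univ (α := Fin n)) (a := 4 * r ^ 2), ← sum_neg_distrib,
      ← sum_sub_distrib, ← sum_add_distrib]
    refine sum_congr rfl fun i _ => sum_congr rfl fun j _ => ?_
    linear_combination ((f i j + ∑ l, df i j l * y l) * ξ i * ξ j) * Complex.I_sq
  rw [e4, e5, e0, e1, e2, e3, ← hq2]
  generalize ∑ i, ∑ j, (∑ l, df i j l * y l) * (ξ i * ξ j) = D
  generalize ∑ i, ∑ j, f i j * (ξ j * y i) = E
  field_simp
  linear_combination (q ^ 2 * σ ^ 2 + D * σ ^ 2) * Complex.I_sq +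
    (-q ^ 2 - D - 4 * I * r * E) * hσ

/-- Packets which move along the bicharacteristics of a wave operator, at a fixed time: besides the
positions and frequencies there are the velocities `X₁`, `Ξ₁` and accelerations `X₂`, `Ξ₂`, and the
coefficients `f` of the operator with their gradients `df`. -/
structure WavePackets (n : ℕ) (Θ ι : Type) extends PacketSystem n Θ ι where
  /-- the coefficients -/
  f : Fin n → Fin n → Θ → Space n → ℝ
  /-- the gradients of the coefficients -/
  df : Fin n → Fin n → Θ → Space n → Space n
  /-- the bound for the coefficients -/
  M : ℝ
  c11 : ∀ i j, C11Family (f i j) (df i j) M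
  symm : ∀ i j θ x, f i j θ x = f j i θ x
  /-- the sign of the half wave -/
  σ : Θ → ℝ
  sq_σ : ∀ θ, σ θ ^ 2 = 1
  /-- the symbol -/
  q : Θ → ι → ℝ
  q_ne_zero : ∀ θ γ, q θ γ ≠ 0
  sq_q : ∀ θ γ, q θ γ ^ 2 = ∑ i, ∑ j, f i j θ (X θ γ) * Ξ θ γ i * Ξ θ γ j
  /-- the velocity of the centre -/
  X₁ : Θ → ι → Space n
  /-- the acceleration of the centre -/
  X₂ : Θ → ι → Space n
  /-- the velocity of the frequency -/
  Ξ₁ : Θ → ι → Space n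
  /-- the acceleration of the frequency -/
  Ξ₂ : Θ → ι → Space n
  /-- the bound for velocities and accelerations -/
  B : ℝ
  norm_X₁ : ∀ θ γ, ‖X₁ θ γ‖ ≤ B
  norm_X₂ : ∀ θ γ, ‖X₂ θ γ‖ ≤ B
  norm_Ξ₁ : ∀ θ γ, ‖Ξ₁ θ γ‖ ≤ B * 2 ^ lev γ
  norm_Ξ₂ : ∀ θ γ, ‖Ξ₂ θ γ‖ ≤ B * 2 ^ lev γ
  eq_X₁ : ∀ θ γ i, X₁ θ γ i = -(σ θ * ((q θ γ)⁻¹ * ∑ j, f i j θ (X θ γ) * Ξ θ γ j))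
  eq_Ξ₁ : ∀ θ γ l, Ξ₁ θ γ l = σ θ * ((2 * q θ γ)⁻¹ * ∑ i, ∑ j, Ξ θ γ i * Ξ θ γ j * df i j θ (X θ γ) l)

namespace WavePackets

open PacketSystem

variable {Θ ι : Type} (Y : WavePackets n Θ ι)

/-- The derivative of `|Ξ|` along the curve. -/
def ρ (θ : Θ) (γ : ι) : ℝ := inner ℝ (Y.Ξ θ γ) (Y.Ξ₁ θ γ) * ‖Y.Ξ θ γ‖⁻¹

/-- The second derivative of `|Ξ|` along the curve. -/
def ρ' (θ : Θ) (γ : ι) : ℝ := (inner ℝ (Y.Ξ₁ θ γ) (Y.Ξ₁ θ γ) + inner ℝ (Y.Ξ θ γ) (Y.Ξ₂ θ γ)) *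
  ‖Y.Ξ θ γ‖⁻¹ - Y.ρ θ γ * Y.ρ θ γ * ‖Y.Ξ θ γ‖⁻¹

/-- The amplitude of the first time derivative. -/
def ampL (θ : Θ) (γ : ι) (x : Space n) : ℂ :=
  timeL (cvec (x - Y.X θ γ)) (cvec (Y.Ξ θ γ)) (cvec (Y.X₁ θ γ)) (cvec (Y.Ξ₁ θ γ)) ‖Y.Ξ θ γ‖ (Y.ρ θ γ)

/-- The time derivative of `ampL`. -/
def ampL' (θ : Θ) (γ : ι) (x : Space n) : ℂ :=
  timeL' (cvec (x - Y.X θ γ)) (cvec (Y.Ξ θ γ)) (cvec (Y.X₁ θ γ)) (cvec (Y.Ξ₁ θ γ)) (cvec (Y.X₂ θ γ))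
    (cvec (Y.Ξ₂ θ γ)) ‖Y.Ξ θ γ‖ (Y.ρ θ γ) (Y.ρ' θ γ)

/-- The amplitude of the wave operator, applied to a packet. -/
def amp (θ : Θ) (γ : ι) (x : Space n) : ℂ :=
  Y.ampL θ γ x ^ 2 + Y.ampL' θ γ x - ∑ i, ∑ j, (Y.f i j θ x : ℂ) * Y.hessD i j θ γ x

variable {Y}

lemma sym_vec {V : Θ → ι → Space n} {B : ℝ} {α : ℤ} (h : ∀ θ γ, ‖V θ γ‖ ≤ B * scl (Y.lev γ) ^ α)
    (j : Fin n) : Y.Sym α (fun θ γ _ => cvec (V θ γ) j) :=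
  Sym.const _ B fun θ γ => by
    rw [cvec, norm_real]
    exact (abs_coord_le _ j).trans (h θ γ)

lemma sym_X₁ (j : Fin n) : Y.Sym 0 (fun θ γ _ => cvec (Y.X₁ θ γ) j) :=
  sym_vec (B := Y.B) (fun θ γ => by rw [zpow_zero, mul_one]; exact Y.norm_X₁ θ γ) j

lemma sym_X₂ (j : Fin n) : Y.Sym 0 (fun θ γ _ => cvec (Y.X₂ θ γ) j) :=
  sym_vec (B := Y.B) (fun θ γ => by rw [zpow_zero, mul_one]; exact Y.norm_X₂ θ γ) j

lemma sym_Ξ (j : Fin n) : Y.Sym 2 (fun θ γ _ => cvec (Y.Ξ θ γ) j) :=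
  sym_vec (B := Y.R) (fun θ γ => by rw [zpow_ofNat, sq_scl]; exact Y.norm_le θ γ) j

lemma sym_Ξ₁ (j : Fin n) : Y.Sym 2 (fun θ γ _ => cvec (Y.Ξ₁ θ γ) j) :=
  sym_vec (B := Y.B) (fun θ γ => by rw [zpow_ofNat, sq_scl]; exact Y.norm_Ξ₁ θ γ) j

lemma sym_Ξ₂ (j : Fin n) : Y.Sym 2 (fun θ γ _ => cvec (Y.Ξ₂ θ γ) j) :=
  sym_vec (B := Y.B) (fun θ γ => by rw [zpow_ofNat, sq_scl]; exact Y.norm_Ξ₂ θ γ) j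

lemma sym_y (j : Fin n) : Y.Sym (-1) (fun θ γ x => cvec (x - Y.X θ γ) j) :=
  (Sym.coord j).congr fun θ γ x => by simp only [cvec, PiLp.sub_apply]

lemma sym_r : Y.Sym 2 (fun θ γ _ => (‖Y.Ξ θ γ‖ : ℂ)) := sym_norm_freq

lemma sym_r_inv : Y.Sym (-2) (fun θ γ _ => (‖Y.Ξ θ γ‖ : ℂ)⁻¹) := sym_inv_norm_freq

lemma sym_dot {α β κ : ℤ} {u v : Θ → ι → Space n → Fin n → ℂ}
    (hu : ∀ j, Y.Sym α (fun θ γ x => u θ γ x j)) (hv : ∀ j, Y.Sym β (fun θ γ x => v θ γ x j))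
    (h : α + β ≤ κ := by omega) : Y.Sym κ (fun θ γ x => ∑ j, u θ γ x j * v θ γ x j) :=
  Sym.sum fun j _ => (hu j).mul (hv j) h

lemma sym_ρ : Y.Sym 2 (fun θ γ _ => (Y.ρ θ γ : ℂ)) :=
  ((sym_dot (fun j => sym_Ξ j) (fun j => sym_Ξ₁ j) (κ := 4)).mul sym_r_inv).congr fun θ γ x => by
    rw [ρ, ofReal_mul, Complex.ofReal_inv, ofReal_inner]

lemma sym_ρ' : Y.Sym 2 (fun θ γ _ => (Y.ρ' θ γ : ℂ)) :=
  ((((sym_dot (fun j => sym_Ξ₁ j) (fun j => sym_Ξ₁ j) (κ := 4)).add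
    (sym_dot (fun j => sym_Ξ j) (fun j => sym_Ξ₂ j) (κ := 4))).mul sym_r_inv
    (κ := 2)).sub ((sym_ρ.mul sym_ρ (κ := 4)).mul sym_r_inv (κ := 2))).congr fun θ γ x => by
    rw [ρ', Complex.ofReal_sub, ofReal_mul, ofReal_mul, Complex.ofReal_inv,
      Complex.ofReal_add, ofReal_inner, ofReal_inner, ofReal_mul]

lemma sym_ampL' : Y.Sym 2 Y.ampL' := by
  have a1 : Y.Sym 2 (fun θ γ _ => (n : ℂ) / 2 * ((Y.ρ' θ γ : ℂ) * (‖Y.Ξ θ γ‖ : ℂ)⁻¹ -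
      (Y.ρ θ γ : ℂ) * (Y.ρ θ γ : ℂ) * ((‖Y.Ξ θ γ‖ : ℂ)⁻¹ * (‖Y.Ξ θ γ‖ : ℂ)⁻¹))) :=
    (Sym.num _).mul ((sym_ρ'.mul sym_r_inv (κ := 2)).sub
      ((sym_ρ.mul sym_ρ (κ := 4)).mul (sym_r_inv.mul sym_r_inv (κ := -2))
        (by norm_num)))
  have a2 := (Sym.num (Y := Y.toPacketSystem) I).mul
    (((sym_dot (fun j => sym_Ξ₂ j) (fun j => sym_y j) (κ := 2)).sub
    ((Sym.num 2).mul (sym_dot (fun j => sym_Ξ₁ j) (fun j => sym_X₁ j) (κ := 2)) (κ := 2))).sub (sym_dot (fun j => sym_Ξ (Y := Y) j) (fun j => sym_X₂ j) (κ := 2)))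
      (κ := 2)
  have a3 := sym_ρ'.mul (sym_dot (fun j => sym_y (Y := Y) j) (fun j => sym_y j) (κ := 0))
    (κ := 2)
  have a4 := ((Sym.num 4).mul sym_ρ (κ := 2)).mul
    (sym_dot (fun j => sym_y (Y := Y) j) (fun j => sym_X₁ j) (κ := 0)) (κ := 2)
  have a5 := ((Sym.num 2).mul sym_r (κ := 2)).mul
    (sym_dot (fun j => sym_X₁ (Y := Y) j) (fun j => sym_X₁ j) (κ := 0)) (κ := 2)
  have a6 := ((Sym.num 2).mul sym_r (κ := 2)).mul
    (sym_dot (fun j => sym_y (Y := Y) j) (fun j => sym_X₂ j) (κ := 0)) (κ := 2)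
  exact (a1.add (a2.sub (((a3.sub a4).add a5).sub a6))).congr fun θ γ x => by
    simp only [ampL', timeL']

/-- The part of order two of `ampL`. -/
def L₀ (Y : WavePackets n Θ ι) (θ : Θ) (γ : ι) (_ : Space n) : ℂ :=
  -I * ∑ j, cvec (Y.Ξ θ γ) j * cvec (Y.X₁ θ γ) j

/-- The part of order one of `ampL`. -/
def L₁ (Y : WavePackets n Θ ι) (θ : Θ) (γ : ι) (x : Space n) : ℂ :=
  ∑ j, (I * cvec (Y.Ξ₁ θ γ) j + 2 * (‖Y.Ξ θ γ‖ : ℂ) * cvec (Y.X₁ θ γ) j) *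
    cvec (x - Y.X θ γ) j

/-- The part of order zero of `ampL`. -/
def L₂ (Y : WavePackets n Θ ι) (θ : Θ) (γ : ι) (x : Space n) : ℂ :=
  n / 2 * ((Y.ρ θ γ : ℂ) * (‖Y.Ξ θ γ‖ : ℂ)⁻¹) -
    (Y.ρ θ γ : ℂ) * ∑ j, cvec (x - Y.X θ γ) j * cvec (x - Y.X θ γ) j

lemma ampL_eq (θ : Θ) (γ : ι) (x : Space n) :
    Y.ampL θ γ x = Y.L₀ θ γ x + Y.L₁ θ γ x + Y.L₂ θ γ x := by
  have e : Y.L₁ θ γ x = I * ∑ j, cvec (Y.Ξ₁ θ γ) j * cvec (x - Y.X θ γ) j +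
      2 * (‖Y.Ξ θ γ‖ : ℂ) * ∑ j, cvec (x - Y.X θ γ) j * cvec (Y.X₁ θ γ) j := by
    rw [L₁, mul_sum, mul_sum, ← sum_add_distrib]
    exact sum_congr rfl fun j _ => by ring
  rw [e, ampL, timeL, L₀, L₂]
  ring

lemma sym_L₀ : Y.Sym 2 Y.L₀ :=
  (Sym.num _).mul (sym_dot (fun j => sym_Ξ j) (fun j => sym_X₁ j) (κ := 2))

lemma sym_L₁ : Y.Sym 1 Y.L₁ :=
  sym_dot (α := 2) (β := -1)
    (fun j => ((Sym.num _).mul (sym_Ξ₁ j) (κ := 2)).add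
      (((Sym.num 2).mul sym_r (κ := 2)).mul (sym_X₁ j)))
    (fun j => sym_y j)

lemma sym_L₂ : Y.Sym 0 Y.L₂ :=
  ((Sym.num _).mul (sym_ρ.mul sym_r_inv (κ := 0)) (κ := 0)).sub
    (sym_ρ.mul (sym_dot (fun j => sym_y j) (fun j => sym_y j) (κ := -2)))

/-- The coefficient `f i j` at the centre. -/
def fc (Y : WavePackets n Θ ι) (i j : Fin n) (θ : Θ) (γ : ι) (_ : Space n) : ℂ := (Y.f i j θ (Y.X θ γ) : ℂ)

/-- The linear part of the Taylor polynomial of `f i j` at the centre. -/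
def fl (Y : WavePackets n Θ ι) (i j : Fin n) (θ : Θ) (γ : ι) (x : Space n) : ℂ :=
  ∑ l, cvec (Y.df i j θ (Y.X θ γ)) l * cvec (x - Y.X θ γ) l

lemma sym_fc (i j : Fin n) : Y.Sym 0 (Y.fc i j) :=
  Sym.const (fun θ γ => (Y.f i j θ (Y.X θ γ) : ℂ)) Y.M fun θ γ => by
    rw [norm_real, zpow_zero, mul_one]
    exact (Y.c11 i j).bound θ _

lemma sym_fl (i j : Fin n) : Y.Sym (-1) (Y.fl i j) :=
  sym_dot (α := 0) (β := -1) (fun l => sym_vec (B := Y.M) (fun θ γ => by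
    rw [zpow_zero, mul_one]; exact (Y.c11 i j).grad_bound θ _) l) (fun l => sym_y l)

lemma coeff_eq (i j : Fin n) (θ : Θ) (γ : ι) (x : Space n) :
    (Y.f i j θ x : ℂ) = Y.rem (Y.f i j) (Y.df i j) θ γ x + (Y.fc i j θ γ x + Y.fl i j θ γ x) := by
  rw [rem, fc, fl, ← ofReal_inner]
  push_cast
  ring

/-- The wave operator has order one on packets moving along bicharacteristics: its amplitude is a
symbol of order two (that is, `2^k`), up to Taylor remainders. -/
lemma exists_amp_eq : ∃ P, Y.Sym 2 P ∧ ∀ θ γ x, Y.amp θ γ x =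
    P θ γ x - ∑ i, ∑ j, Y.rem (Y.f i j) (Y.df i j) θ γ x * Y.hessD i j θ γ x := by
  -- the lower order terms of the eikonal identity
  have b1 := ((Sym.num 4).mul (sym_r.mul sym_r (κ := 4)) (κ := 4)).mul
    (Sym.sum (S := Finset.univ) fun i _ => Sym.sum (S := Finset.univ) fun j _ =>
      ((sym_fc (Y := Y) i j).mul (sym_y i) (κ := -1)).mul (sym_y j) (κ := -2))
    (κ := 2)
  have b2 := ((Sym.num (2 * I)).mul sym_r (κ := 2)).mul
    (Sym.sum (S := Finset.univ) fun i _ => Sym.sum (S := Finset.univ) fun j _ =>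
      (sym_fl (Y := Y) i j).mul (((sym_Ξ i).mul (sym_y j) (κ := 1)).add
        ((sym_Ξ j).mul (sym_y i))) (κ := 0))
    (κ := 2)
  have b3 := ((Sym.num 4).mul (sym_r.mul sym_r (κ := 4)) (κ := 4)).mul
    (Sym.sum (S := Finset.univ) fun i _ => Sym.sum (S := Finset.univ) fun j _ =>
      ((sym_fl (Y := Y) i j).mul (sym_y i) (κ := -2)).mul (sym_y j) (κ := -2))
    (κ := 2)
  have b4 : Y.Sym 2 (fun θ γ x => ∑ i, ∑ j, (Y.fc i j θ γ x + Y.fl i j θ γ x) *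
      (if i = j then 2 * (‖Y.Ξ θ γ‖ : ℂ) else 0)) :=
    Sym.sum fun i _ => Sym.sum fun j _ => ((sym_fc i j).add ((sym_fl i j).mono)).mul
      (β := 2) (by
        split_ifs
        · exact (Sym.num 2).mul sym_r
        · exact (Sym.num 0).mono)
  have c := ((((sym_ampL' (Y := Y)).add (sym_L₁.mul sym_L₁)).add
    ((Sym.num 2).mul (sym_L₀.mul sym_L₂ (κ := 2)))).add
    ((Sym.num 2).mul (sym_L₁.mul sym_L₂ (κ := 2)))).add
    (sym_L₂.mul sym_L₂)
  refine ⟨_, (c.sub ((b1.sub b2).add b3)).add b4, fun θ γ x => ?_⟩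
  have hq : (Y.q θ γ : ℂ) ≠ 0 := by exact_mod_cast Y.q_ne_zero θ γ
  have eik := eikonal_identity (f := fun i j => Y.fc i j θ γ x)
    (df := fun i j l => cvec (Y.df i j θ (Y.X θ γ)) l) (y := cvec (x - Y.X θ γ)) (ξ := cvec (Y.Ξ θ γ))
    (v := cvec (Y.X₁ θ γ)) (η := cvec (Y.Ξ₁ θ γ)) (q := (Y.q θ γ : ℂ)) (σ := (Y.σ θ : ℂ))
    (r := (‖Y.Ξ θ γ‖ : ℂ)) (fun i j => by simp only [fc, Y.symm i j]) hq
    (by exact_mod_cast Y.sq_σ θ)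
    (by simp only [fc, cvec]; exact_mod_cast Y.sq_q θ γ)
    (fun i => by simp only [fc, cvec]; exact_mod_cast Y.eq_X₁ θ γ i)
    (fun l => by simp only [cvec]; exact_mod_cast Y.eq_Ξ₁ θ γ l)
  have hD : ∀ i j, Y.hessD i j θ γ x =
      (I * cvec (Y.Ξ θ γ) i - 2 * (‖Y.Ξ θ γ‖ : ℂ) * cvec (x - Y.X θ γ) i) *
      (I * cvec (Y.Ξ θ γ) j - 2 * (‖Y.Ξ θ γ‖ : ℂ) * cvec (x - Y.X θ γ) j) -
      (if i = j then 2 * (‖Y.Ξ θ γ‖ : ℂ) else 0) := fun i j => by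
    simp only [hessD, logD, cvec, PiLp.sub_apply]
  have e1 : ∑ i, ∑ j, (Y.f i j θ x : ℂ) * Y.hessD i j θ γ x =
      ∑ i, ∑ j, Y.rem (Y.f i j) (Y.df i j) θ γ x * Y.hessD i j θ γ x +
      (∑ i, ∑ j, (Y.fc i j θ γ x + Y.fl i j θ γ x) *
        ((I * cvec (Y.Ξ θ γ) i - 2 * (‖Y.Ξ θ γ‖ : ℂ) * cvec (x - Y.X θ γ) i) *
        (I * cvec (Y.Ξ θ γ) j - 2 * (‖Y.Ξ θ γ‖ : ℂ) * cvec (x - Y.X θ γ) j)) -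
      ∑ i, ∑ j, (Y.fc i j θ γ x + Y.fl i j θ γ x) * (if i = j then 2 * (‖Y.Ξ θ γ‖ : ℂ) else 0)) := by
    simp only [← sum_sub_distrib, ← sum_add_distrib]
    refine sum_congr rfl fun i _ => sum_congr rfl fun j _ => ?_
    rw [coeff_eq i j θ γ x, hD i j]
    ring
  have eik' : Y.L₀ θ γ x ^ 2 + 2 * Y.L₀ θ γ x * Y.L₁ θ γ x = _ := eik
  have hfl : ∀ i j, ∑ l, cvec (Y.df i j θ (Y.X θ γ)) l * cvec (x - Y.X θ γ) l = Y.fl i j θ γ x :=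
    fun i j => rfl
  simp only [hfl] at eik'
  rw [amp, e1, ampL_eq]
  linear_combination eik'

/-- By `exists_amp_eq`, weak bounds for symbols and for Taylor remainders give weak bounds for the wave
operator on packet sums. -/
lemma exists_norm_integral_psum_amp_le : ∃ P, Y.Sym 2 P ∧ ∀ θ S d (ψ : Space n → ℂ), SqInt ψ →
    ∀ (A N : ℝ) (C : Fin n → Fin n → ℝ), ‖∫ x, Y.psum P θ S d x * ψ x‖ ≤ A * N →
    (∀ i j, ‖∫ x, Y.psum (fun θ γ x => Y.rem (Y.f i j) (Y.df i j) θ γ x * Y.hessD i j θ γ x) θ S d x *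
      ψ x‖ ≤ C i j * N) → ‖∫ x, Y.psum Y.amp θ S d x * ψ x‖ ≤ (A + ∑ i, ∑ j, C i j) * N := by
  obtain ⟨P, sP, hP⟩ := Y.exists_amp_eq
  refine ⟨P, sP, fun θ S d ψ sψ A N C hA hC => ?_⟩
  set R : Fin n → Fin n → Θ → ι → Space n → ℂ := fun i j θ γ x =>
    Y.rem (Y.f i j) (Y.df i j) θ γ x * Y.hessD i j θ γ x
  have t : ∀ i j, Y.TameO 2 (R i j) := fun i j => (tameO_rem (Y.c11 i j)).mul (sym_hessD i j).tameO
  have i1 : ∀ i j, Integrable (fun x => Y.psum (R i j) θ S d x * ψ x) := fun i j =>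
    ((t i j).sqInt_psum θ S d).integrable_mul sψ
  have e : ∀ x, Y.psum Y.amp θ S d x * ψ x =
      Y.psum P θ S d x * ψ x - ∑ i, ∑ j, Y.psum (R i j) θ S d x * ψ x := by
    intro x
    have : Y.amp = fun θ γ x => P θ γ x - ∑ i, ∑ j, R i j θ γ x := by
      funext θ γ x; exact hP θ γ x
    rw [this, psum_sub, psum_sum, sub_mul, sum_mul]
    congr 1
    refine sum_congr rfl fun i _ => ?_
    rw [psum_sum, sum_mul]
  simp only [e]
  rw [integral_sub ((sP.tameO.sqInt_psum θ S d).integrable_mul sψ)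
    (integrable_finsetSum _ fun i _ => integrable_finsetSum _ fun j _ => i1 i j),
    integral_finsetSum _ fun i _ => integrable_finsetSum _ fun j _ => i1 i j]
  simp only [integral_finsetSum _ fun j _ => i1 _ j, add_mul, sum_mul]
  exact (norm_sub_le _ _).trans (add_le_add hA ((norm_sum_le _ _).trans
    (sum_le_sum fun i _ => (norm_sum_le _ _).trans (sum_le_sum fun j _ => hC i j))))

/-- Weak bound for the wave operator on packet sums, for the lowest Sobolev index. -/
lemma weakBound_amp : Y.WeakBound Y.amp := by
  obtain ⟨P, sP, hP⟩ := Y.exists_norm_integral_psum_amp_le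
  obtain ⟨A, hA, bA⟩ := sP.weakBound
  choose C hC bC using fun i j => weakBound_rem (Y.c11 i j) (sym_logD j) (sym_hessD i j)
    (hasPartial_pk j) (hasPartial_logD_mul_pk i j)
  exact ⟨A + ∑ i, ∑ j, C i j, add_nonneg hA (sum_nonneg fun i _ => sum_nonneg fun j _ => hC i j),
    fun θ S d ψ ψ' sψ sψ' hψ => hP θ S d ψ sψ _ _ _ (bA θ S d ψ ψ' sψ sψ' hψ)
      fun i j => bC i j θ S d ψ ψ' sψ sψ' hψ⟩

/-- Weak bound for the wave operator on packet sums, for the highest Sobolev index. -/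
lemma weakBoundTwo_amp (l : Fin n) : Y.WeakBoundTwo l 6 Y.amp := by
  obtain ⟨P, sP, hP⟩ := Y.exists_norm_integral_psum_amp_le
  obtain ⟨A, hA, bA⟩ := sP.weakBoundTwo l
  choose C hC bC using fun i j => weakBoundTwo_rem (Y := Y.toPacketSystem) (Y.c11 i j) (sym_hessD i j) l
  exact ⟨A + ∑ i, ∑ j, C i j, add_nonneg hA (sum_nonneg fun i _ => sum_nonneg fun j _ => hC i j),
    fun θ S d χ χ' ψ sχ sχ' sψ h1 h2 => hP θ S d ψ sψ _ _ _ (bA θ S d χ χ' ψ sχ sχ' sψ h1 h2)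
      fun i j => bC i j θ S d χ χ' ψ sχ sχ' sψ h1 h2⟩

/-- The wave operator on packet sums is bounded in `L²`, with a loss of one derivative. -/
lemma exists_strong_bound : (∀ θ S d, SqInt (Y.psum Y.amp θ S d)) ∧
    ∃ K : ℝ, 0 ≤ K ∧ ∀ θ S d, nrm (Y.psum Y.amp θ S d) ≤ K * Y.wn 2 S d := by
  obtain ⟨P, sP, hP⟩ := Y.exists_amp_eq
  have t : Y.TameD 2 Y.amp := by
    have h := sP.tameD.add ((TameD.const (Y := Y.toPacketSystem) (α := 0) (b := fun _ _ => (-1 : ℂ))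
      (K := 1) (by simp)).mul (TameD.sum (S := Finset.univ) fun i _ => TameD.sum (S := Finset.univ)
        fun j _ => (tameD_rem (Y.c11 i j)).mul (sym_hessD i j).tameD (κ := 2))
        (κ := 2))
    convert h using 4 with θ γ x
    rw [hP]
    ring
  exact ⟨t.1.sqInt_psum, t.exists_nrm_psum_le⟩

end WavePackets

/-! ### The packets transported by the Hamilton flow -/

section transport

variable {Λ : FrequencyLattice n} {T K σ ε C : ℝ} {a : CoeffField n}

lemma one_le_growth (hT : 0 < T) : 1 ≤ growth n T K := by
  rw [growth]
  apply one_le_exp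
  have : 0 ≤ T - -T := by linarith
  positivity

lemma isHamCurve_frameCurve (ha : IsC11Coefficient T a) (h : CoeffBounds T a K) (hσ : |σ| ≤ 1)
    {t' : ℝ} (ht' : t' ∈ Icc (-T) T) (γ : FrameIndex Λ) :
    IsHamCurve T a σ (frameCurve ε C T a σ t' γ) :=
  (isBicharacteristic_bichar ha hσ ht' _ γ.freq_ne_zero).isHamCurve ha h hσ ht' γ.freq_ne_zero

lemma frameCurve_self (ha : IsC11Coefficient T a) (hσ : |σ| ≤ 1)
    {t' : ℝ} (ht' : t' ∈ Icc (-T) T) (γ : FrameIndex Λ) :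
    frameCurve ε C T a σ t' γ t' = (γ.centre ε C, γ.freq) :=
  (isBicharacteristic_bichar ha hσ ht' _ γ.freq_ne_zero).initial

/-- Along a Hamilton curve the frequency stays comparable to its initial value. -/
lemma IsHamCurve.norm_freq_mem {z : ℝ → Space n × Space n} (hz : IsHamCurve T a σ z)
    (h : CoeffBounds T a K) (hσ : |σ| ≤ 1) {s t r R : ℝ} (hs : s ∈ Icc (-T) T)
    (ht : t ∈ Icc (-T) T) (h1 : r ≤ ‖(z s).2‖) (h2 : ‖(z s).2‖ ≤ R) :
    r / growth n T K ≤ ‖(z t).2‖ ∧ ‖(z t).2‖ ≤ growth n T K * R := by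
  have hg := growth_pos n T K
  refine ⟨?_, (hz.norm_freq_le h hσ hs ht).trans (by gcongr)⟩
  rw [div_le_iff₀' hg]
  exact h1.trans (hz.norm_freq_le h hσ ht hs)

lemma frameCurve_freq_mem (ha : IsC11Coefficient T a) (h : CoeffBounds T a K) (hσ : |σ| ≤ 1)
    {t' t : ℝ} (ht' : t' ∈ Icc (-T) T) (ht : t ∈ Icc (-T) T) (γ : FrameIndex Λ) :
    2 ^ γ.k / 2 / growth n T K ≤ ‖(frameCurve ε C T a σ t' γ t).2‖ ∧
      ‖(frameCurve ε C T a σ t' γ t).2‖ ≤ growth n T K * 2 ^ γ.k := by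
  refine (isHamCurve_frameCurve ha h hσ ht' γ).norm_freq_mem h hσ ht' ht ?_ ?_
  · rw [frameCurve_self ha hσ ht']; exact γ.norm_freq_mem.1
  · rw [frameCurve_self ha hσ ht']; exact γ.norm_freq_mem.2.le

lemma norm_rescale_snd {c : ℝ} (hc : 0 < c) (z : Space n × Space n) :
    ‖(rescale c z).2‖ = ‖z.2‖ / c := by
  rw [rescale, norm_smul, norm_inv, norm_of_nonneg hc.le, inv_mul_eq_div]

/-- The rescaled curves lie in a fixed annulus. -/
lemma rescale_mem_phaseAnnulus {z : ℝ → Space n × Space n} (hz : IsHamCurve T a σ z)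
    (h : CoeffBounds T a K) (hσ : |σ| ≤ 1) {s r R c : ℝ} (hc : 0 < c) (hs : s ∈ Icc (-T) T)
    (h1 : r * c ≤ ‖(z s).2‖) (h2 : ‖(z s).2‖ ≤ R * c) {t : ℝ} (ht : t ∈ Icc (-T) T) :
    (t, rescale c (z t)) ∈ phaseAnnulus n T (r / growth n T K) (growth n T K * R) := by
  have h3 := hz.norm_freq_mem h hσ hs ht h1 h2
  refine ⟨ht, ?_, ?_⟩
  · rw [norm_rescale_snd hc, le_div_iff₀ hc, div_mul_eq_mul_div]
    exact h3.1
  · rw [norm_rescale_snd hc, div_le_iff₀ hc, mul_assoc]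
    exact h3.2

/-- The sum over a level is bounded because the flow, suitably rescaled, is bi-Lipschitz. -/
lemma exists_frame_count (ha : IsC11Coefficient T a) (h : CoeffBounds T a K) (hT : 0 < T)
    (hε : 0 < ε) (hC : 0 < C) {c : ℝ} (hc : 0 < c) : ∃ D : ℝ, ∀ σ : ℝ, |σ| ≤ 1 →
    ∀ t' ∈ Icc (-T) T, ∀ t ∈ Icc (-T) T, ∀ (z : Space n) (γ' : FrameIndex Λ)
      (S : Finset (FrameIndex Λ)), (∀ γ ∈ S, γ.k = γ'.k) →
      ∑ γ ∈ S, (γ.step ε C * scl γ.k) ^ n * exp (-(c * (2 ^ γ.k *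
        ‖z - (frameCurve ε C T a σ t' γ t).1‖ ^ 2 + ((2 : ℝ) ^ γ.k)⁻¹ *
        ‖(frameCurve ε C T a σ t' γ t).2 - (frameCurve ε C T a σ t' γ' t).2‖ ^ 2))) ≤ D := by
  set g := growth n T K with hg
  have hg0 : 0 < g := growth_pos n T K
  have hg1 : 1 ≤ g := one_le_growth hT
  obtain ⟨L, hL, hsep⟩ := h.exists_separation (R₁ := 1 / 2 / g / g) (R₂ := g * (g * 1)) (by positivity)
  obtain ⟨D₁, hD₁, hF⟩ := exists_sum_freq_le n (c := c / (2 * L ^ 2)) (by positivity)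
  obtain ⟨D₂, hD₂, hP⟩ := exists_sum_lattice_le n
  set c' := c / (2 * L ^ 2) with hc'
  have hc'0 : 0 < c' := by positivity
  refine ⟨D₁ * (D₂ * exp (c' * C ^ 2 / 2) * (c' ^ ((n : ℝ) / 2))⁻¹), fun σ hσ t' ht' t ht z γ' S hS => ?_⟩
  set k := γ'.k with hk
  have hk0 : (0 : ℝ) < 2 ^ k := by positivity
  set Z := fun γ : FrameIndex Λ => frameCurve ε C T a σ t' γ with hZ
  have hZham : ∀ γ, IsHamCurve T a σ (Z γ) := fun γ => isHamCurve_frameCurve ha h hσ ht' γ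
  have hmem : ∀ γ : FrameIndex Λ, γ.k = k → 1 / 2 / g * 2 ^ k ≤ ‖(Z γ t).2‖ ∧
      ‖(Z γ t).2‖ ≤ g * 1 * 2 ^ k := fun γ hγ => by
    have := frameCurve_freq_mem (ε := ε) (C := C) ha h hσ ht' ht γ
    rw [hγ] at this
    refine ⟨le_trans (le_of_eq ?_) this.1, this.2.trans (le_of_eq (by ring))⟩
    rw [← hg]; ring
  have h0 : (Z γ' t).2 ≠ 0 := (hZham γ').ne_zero t ht
  -- the curve which passes through `(z, Ξ_γ')` at the time `t`
  set w := bichar T a σ t z (Z γ' t).2 with hw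
  have hwb := isBicharacteristic_bichar ha hσ ht z h0
  have hwham : IsHamCurve T a σ w := hwb.isHamCurve ha h hσ ht h0
  have hwt : w t = (z, (Z γ' t).2) := hwb.initial
  set x₁ := (w t').1 with hx₁
  set ξ₁ := (w t').2 with hξ₁
  have key : ∀ γ ∈ S, c' * 2 ^ k * ‖x₁ - γ.centre ε C‖ ^ 2 + c' * ((2 : ℝ) ^ k)⁻¹ * ‖ξ₁ - γ.freq‖ ^ 2 ≤
      c * (2 ^ k * ‖z - (Z γ t).1‖ ^ 2 + ((2 : ℝ) ^ k)⁻¹ * ‖(Z γ t).2 - (Z γ' t).2‖ ^ 2) := by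
    intro γ hγ
    have hγk := hS γ hγ
    have hs := hsep σ hσ _ _ (hwham.rescale hk0) ((hZham γ).rescale hk0)
      (fun s hs => rescale_mem_phaseAnnulus hwham h hσ hk0 ht
        (by rw [hwt]; exact (hmem γ' rfl).1) (by rw [hwt]; exact (hmem γ' rfl).2) hs)
      (fun s hs => rescale_mem_phaseAnnulus (hZham γ) h hσ hk0 ht (hmem γ hγk).1 (hmem γ hγk).2 hs)
      t ht t' ht'
    have ez : Z γ t' = (γ.centre ε C, γ.freq) := frameCurve_self ha hσ ht' γ
    rw [ez, hwt] at hs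
    simp only [rescale] at hs
    set u := ‖z - (Z γ t).1‖ with hu
    set v := ‖(Z γ t).2 - (Z γ' t).2‖ with hv
    set κ := ((2 : ℝ) ^ k)⁻¹ with hκ
    have hκ0 : 0 < κ := by positivity
    have e1 : ‖((z, κ • (Z γ' t).2) : Space n × Space n) -
        ((Z γ t).1, κ • (Z γ t).2)‖ = max u (κ * v) := by
      rw [Prod.mk_sub_mk, Prod.norm_mk, ← smul_sub, norm_smul, norm_of_nonneg (by positivity),
        norm_sub_rev (Z γ' t).2]
    have e2 : ‖((x₁, κ • ξ₁) : Space n × Space n) -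
        (γ.centre ε C, κ • γ.freq)‖ =
        max ‖x₁ - γ.centre ε C‖ (κ * ‖ξ₁ - γ.freq‖) := by
      rw [Prod.mk_sub_mk, Prod.norm_mk, ← smul_sub, norm_smul, norm_of_nonneg (by positivity)]
    rw [e1, e2] at hs
    set m := max u (κ * v) with hm
    have hm2 : m ^ 2 ≤ u ^ 2 + (κ * v) ^ 2 := by
      rcases max_cases u (κ * v) with ⟨e, -⟩ | ⟨e, -⟩ <;> rw [hm, e]
      · linarith [sq_nonneg (κ * v)]
      · linarith [sq_nonneg u]
    have b1 : ‖x₁ - γ.centre ε C‖ ^ 2 ≤ (L * m) ^ 2 :=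
      pow_le_pow_left₀ (norm_nonneg _) ((le_max_left _ _).trans hs) 2
    have b2 : (κ * ‖ξ₁ - γ.freq‖) ^ 2 ≤ (L * m) ^ 2 :=
      pow_le_pow_left₀ (by positivity) ((le_max_right _ _).trans hs) 2
    have e3 : c' * 2 ^ k * ‖x₁ - γ.centre ε C‖ ^ 2 + c' * κ * ‖ξ₁ - γ.freq‖ ^ 2 =
        c' * 2 ^ k * (‖x₁ - γ.centre ε C‖ ^ 2 + (κ * ‖ξ₁ - γ.freq‖) ^ 2) := by
      rw [hκ]; field_simp
    have e4 : c * (2 ^ k * u ^ 2 + κ * v ^ 2) =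
        c' * 2 ^ k * (2 * L ^ 2 * (u ^ 2 + (κ * v) ^ 2)) := by
      rw [hc', hκ]; field_simp
    rw [e3, e4]
    refine mul_le_mul_of_nonneg_left ?_ (by positivity)
    nlinarith [mul_le_mul_of_nonneg_left hm2 (sq_nonneg L)]
  set δ := levelStep ε C k with hδ
  have hδ0 : 0 < δ := levelStep_pos ε hC k
  have hδC : 2 ^ k * δ ^ 2 ≤ C ^ 2 := by
    have := sq_levelStep_mul_le (C := C) hε k
    linarith
  set F : ℕ → Space n → (Fin n → ℤ) → ℝ := fun j ζ α => if j = k then (δ * scl k) ^ n *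
    (exp (-(c' * ((2 : ℝ) ^ k)⁻¹ * ‖ξ₁ - ζ‖ ^ 2)) *
      exp (-(c' * 2 ^ k * ‖x₁ - latticePt δ α‖ ^ 2))) else 0 with hFdef
  have hscl := scl_pos k
  have hF0 : ∀ j ζ α, 0 ≤ F j ζ α := fun j ζ α => by
    simp only [hFdef]; split_ifs <;> positivity
  obtain ⟨J, A, -, hsum⟩ := sum_frame_le S
  calc _ ≤ ∑ γ ∈ S, F γ.k γ.freq γ.pos := by
        refine sum_le_sum fun γ hγ => ?_
        have hγk := hS γ hγ
        have e : γ.step ε C = δ := by rw [hδ, ← hγk]; rfl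
        have e' : γ.centre ε C = latticePt δ γ.pos := by rw [← e]; rfl
        simp only [hFdef, hγk, if_true]
        rw [e, ← exp_add]
        gcongr
        have := key γ hγ
        rw [e'] at this
        linarith
    _ ≤ _ := hsum F hF0
    _ ≤ ∑ ζ ∈ Λ.pts k, ∑ α ∈ A, F k ζ α := by
        rw [← Finset.sum_filter_add_sum_filter_not J (fun j => j = k)]
        have z0 : ∑ j ∈ J.filter (fun j => ¬ j = k), ∑ ζ ∈ Λ.pts j, ∑ α ∈ A, F j ζ α = 0 :=
          Finset.sum_eq_zero fun j hj => Finset.sum_eq_zero fun ζ _ => Finset.sum_eq_zero fun α _ => by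
            simp only [hFdef, if_neg (Finset.mem_filter.1 hj).2]
        rw [z0, add_zero, Finset.filter_eq']
        split_ifs
        · rw [Finset.sum_singleton]
        · rw [Finset.sum_empty]
          exact sum_nonneg fun ζ _ => sum_nonneg fun α _ => hF0 _ _ _
    _ = (∑ ζ ∈ Λ.pts k, exp (-(c' * ((2 : ℝ) ^ k)⁻¹ * ‖ξ₁ - ζ‖ ^ 2))) *
        ((δ * scl k) ^ n * ∑ α ∈ A, exp (-(c' * 2 ^ k * ‖x₁ - latticePt δ α‖ ^ 2))) := by
        rw [sum_mul]
        refine sum_congr rfl fun ζ _ => ?_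
        rw [mul_sum, mul_sum]
        refine sum_congr rfl fun α _ => ?_
        simp only [hFdef, if_true]
        ring
    _ ≤ _ := by
        have hs0 : (δ * scl k) ^ 2 = 2 ^ k * δ ^ 2 := by rw [mul_pow, sq_scl, mul_comm]
        have e1 : (c' * 2 ^ k * δ ^ 2) ^ ((n : ℝ) / 2) = c' ^ ((n : ℝ) / 2) * (δ * scl k) ^ n := by
          rw [mul_assoc, ← hs0, mul_rpow hc'0.le (by positivity), ← rpow_natCast _ 2,
            ← rpow_mul (by positivity), ← rpow_natCast _ n]
          congr 2
          push_cast
          ring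
        refine mul_le_mul (hF Λ k ξ₁) ?_ (mul_nonneg (by positivity)
          (sum_nonneg fun _ _ => (exp_pos _).le)) hD₁.le
        calc _ ≤ (δ * scl k) ^ n * (D₂ * exp (c' * 2 ^ k * δ ^ 2 / 2) *
              ((c' * 2 ^ k * δ ^ 2) ^ ((n : ℝ) / 2))⁻¹) := by
              gcongr
              exact hP A _ δ (by positivity) hδ0 x₁
          _ = D₂ * exp (c' * (2 ^ k * δ ^ 2) / 2) * (c' ^ ((n : ℝ) / 2))⁻¹ := by
              rw [e1, mul_assoc c']
              have : (δ * scl k) ^ n ≠ 0 := by positivity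
              have : c' ^ ((n : ℝ) / 2) ≠ 0 := by positivity
              field_simp
          _ ≤ _ := by gcongr

end transport

/-! ### Regular times and the wave operator on transported packets -/

section transport

variable {Λ : FrequencyLattice n} {T K σ ε C : ℝ} {a : CoeffField n}

lemma norm_deriv_le_of_eventually_lipschitz {E : Type*} [NormedAddCommGroup E] [NormedSpace ℝ E]
    {f : ℝ → E} {T L t : ℝ} (hL : 0 ≤ L) (ht : t ∈ Ioo (-T) T)
    (hf : ∀ s ∈ Ioo (-T) T, ‖f s - f t‖ ≤ L * |s - t|) : ‖deriv f t‖ ≤ L := by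
  refine norm_deriv_le_of_lip' hL ?_
  filter_upwards [Ioo_mem_nhds ht.1 ht.2] with s hs
  exact hf s hs

lemma deriv_rescale {z : ℝ → Space n × Space n} {c t : ℝ} (h : DifferentiableAt ℝ z t) :
    deriv (fun s => rescale c (z s)) t = rescale c (deriv z t) := by
  have h1 := hasDerivWithinAt_fst (h.hasDerivAt.hasDerivWithinAt (s := univ))
  have h2 := (hasDerivWithinAt_snd (h.hasDerivAt.hasDerivWithinAt (s := univ))).const_smul c⁻¹
  exact ((h1.prodMk h2).hasDerivAt (by simp)).deriv

/-- The time derivatives of the transported positions and frequencies; the latter are measured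
relative to `2^k`. -/
lemma exists_frameCurve_bound (ha : IsC11Coefficient T a) (h : CoeffBounds T a K) :
    ∃ B : ℝ, 0 ≤ B ∧ ∀ σ : ℝ, |σ| ≤ 1 → ∀ t' ∈ Icc (-T) T, ∀ γ : FrameIndex Λ,
      (∀ s ∈ Ioo (-T) T, ∀ t ∈ Ioo (-T) T, ‖deriv (frameCurve ε C T a σ t' γ) t -
        deriv (frameCurve ε C T a σ t' γ) s‖ ≤ B * 2 ^ γ.k * |t - s|) ∧
      ∀ t ∈ Ioo (-T) T, ‖(deriv (frameCurve ε C T a σ t' γ) t).1‖ ≤ B ∧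
        ‖(deriv (frameCurve ε C T a σ t' γ) t).2‖ ≤ B * 2 ^ γ.k ∧
        (DifferentiableAt ℝ (deriv (frameCurve ε C T a σ t' γ)) t →
          ‖(deriv (deriv (frameCurve ε C T a σ t' γ)) t).1‖ ≤ B ∧
          ‖(deriv (deriv (frameCurve ε C T a σ t' γ)) t).2‖ ≤ B * 2 ^ γ.k) := by
  have hg := growth_pos n T K
  obtain ⟨L, hL, hlip⟩ := h.exists_lipschitz_deriv (R₁ := 1 / 2 / growth n T K)
    (R₂ := growth n T K * 1) (by positivity)
  refine ⟨L, hL.le, fun σ hσ t' ht' γ => ?_⟩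
  set z := frameCurve ε C T a σ t' γ with hzdef
  set c : ℝ := 2 ^ γ.k with hc
  have hc0 : 0 < c := by positivity
  have hc1 : 1 ≤ c := one_le_pow₀ (by norm_num)
  have hz : IsHamCurve T a σ z := isHamCurve_frameCurve ha h hσ ht' γ
  have hz0 : z t' = (γ.centre ε C, γ.freq) := frameCurve_self ha hσ ht' γ
  have hd : ∀ t ∈ Ioo (-T) T, deriv (fun s => rescale c (z s)) t = rescale c (deriv z t) :=
    fun t ht => deriv_rescale (hz.hasDerivAt ht).differentiableAt
  obtain ⟨l1, l2⟩ := hlip σ hσ _ (hz.rescale hc0) fun t ht => rescale_mem_phaseAnnulus hz h hσ hc0 ht'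
    (by rw [hz0]; refine le_trans (le_of_eq ?_) γ.norm_freq_mem.1; ring)
    (by rw [hz0]; exact γ.norm_freq_mem.2.le.trans (le_of_eq (by ring))) ht
  have hfst : ∀ (w : Space n × Space n) {b : ℝ}, ‖rescale c w‖ ≤ b → ‖w.1‖ ≤ b := fun w b hb =>
    (norm_fst_le (rescale c w)).trans hb
  have hsnd : ∀ (w : Space n × Space n) {b : ℝ}, ‖rescale c w‖ ≤ b → ‖w.2‖ ≤ b * c := fun w b hb => by
    have := (norm_snd_le (rescale c w)).trans hb
    rwa [norm_rescale_snd hc0, div_le_iff₀ hc0] at this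
  refine ⟨fun s hs t ht => ?_, fun t ht => ⟨hfst _ ?_, hsnd _ ?_, fun hdiff => ?_⟩⟩
  · have e := l2 s hs t ht
    rw [hd s hs, hd t ht] at e
    have e' : rescale c (deriv z t) - rescale c (deriv z s) = rescale c (deriv z t - deriv z s) := by
      simp only [rescale, Prod.mk_sub_mk, Prod.fst_sub, Prod.snd_sub, smul_sub]
    rw [e'] at e
    rw [Prod.norm_def]
    refine max_le ((hfst _ e).trans ?_) ((hsnd _ e).trans (le_of_eq (by ring)))
    have : 0 ≤ L * |t - s| := by positivity
    nlinarith
  · rw [← hd t ht]; exact l1 t ht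
  · rw [← hd t ht]; exact l1 t ht
  · have e : deriv (deriv fun s => rescale c (z s)) t = rescale c (deriv (deriv z) t) := by
      rw [← deriv_rescale hdiff]
      refine Filter.EventuallyEq.deriv_eq ?_
      filter_upwards [Ioo_mem_nhds ht.1 ht.2] with s hs
      exact hd s hs
    have b : ‖rescale c (deriv (deriv z) t)‖ ≤ L := by
      rw [← e]
      exact norm_deriv_le_of_eventually_lipschitz hL.le ht fun s hs => l2 t ht s hs
    exact ⟨hfst _ b, hsnd _ b⟩

/-- The velocities along the countably many curves are Lipschitz, so Rademacher's theorem applies. -/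
lemma ae_isRegularTime (ha : IsC11Coefficient T a) {t' : ℝ} (ht' : t' ∈ Icc (-T) T) :
    ∀ᵐ t ∂(volume.restrict (Ioo (-T) T)), IsRegularTime ε C T a Λ t' t := by
  obtain ⟨K, h⟩ := ha.exists_bounds
  obtain ⟨B, hB, hb⟩ := exists_frameCurve_bound (Λ := Λ) (ε := ε) (C := C) ha h
  have : Countable (FrameIndex Λ) := (frameIndexEquiv Λ).injective.countable
  have hσ : ∀ σ ∈ ({1, -1} : Set ℝ), |σ| ≤ 1 := by
    rintro σ (rfl | rfl) <;> simp
  unfold IsRegularTime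
  rw [ae_all_iff]
  intro γ
  rw [ae_ball_iff (Set.Finite.countable (by simp))]
  intro σ hσ'
  exact deriv_lipschitz_ae_differentiableAt (hb σ (hσ σ hσ') t' ht' γ).1

/-- The initial time, the time and the sign, for regular times. -/
abbrev WaveParam (Λ : FrequencyLattice n) (ε C T : ℝ) (a : CoeffField n) : Type :=
  {θ : ℝ × ℝ × ℝ // θ.1 ∈ Icc (-T) T ∧ θ.2.1 ∈ Ioo (-T) T ∧ θ.2.2 ∈ ({1, -1} : Set ℝ) ∧
    IsRegularTime ε C T a Λ θ.1 θ.2.1}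

/-- The curve with the sign and the initial time given by the parameter. -/
def WaveParam.curve (θ : WaveParam Λ ε C T a) (γ : FrameIndex Λ) : ℝ → Space n × Space n :=
  frameCurve ε C T a θ.1.2.2 θ.1.1 γ

lemma WaveParam.abs_sign_le (θ : WaveParam Λ ε C T a) : |θ.1.2.2| ≤ 1 := by
  rcases θ.2.2.2.1 with h | h
  · rw [h]; simp
  · rw [Set.mem_singleton_iff.1 h]; simp

lemma WaveParam.mem_Icc (θ : WaveParam Λ ε C T a) : θ.1.2.1 ∈ Icc (-T) T :=
  Ioo_subset_Icc_self θ.2.2.1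

/-- The transported frame functions as a family of wave packets. -/
lemma exists_wavePackets (ha : IsC11Coefficient T a) (hT : 0 < T) (hε : 0 < ε) (hC : 0 < C) :
    ∃ Y : WavePackets n (WaveParam Λ ε C T a) (FrameIndex Λ), (∀ γ, Y.lev γ = γ.k) ∧
      (∀ γ, Y.step γ = γ.step ε C) ∧ (∀ i j θ x, Y.f i j θ x = a θ.1.2.1 x i j) ∧
      (∀ θ γ, Y.X θ γ = (θ.curve γ θ.1.2.1).1) ∧ (∀ θ γ, Y.Ξ θ γ = (θ.curve γ θ.1.2.1).2) ∧
      (∀ θ γ, Y.X₁ θ γ = (deriv (θ.curve γ) θ.1.2.1).1) ∧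
      (∀ θ γ, Y.Ξ₁ θ γ = (deriv (θ.curve γ) θ.1.2.1).2) ∧
      (∀ θ γ, Y.X₂ θ γ = (deriv (deriv (θ.curve γ)) θ.1.2.1).1) ∧
      (∀ θ γ, Y.Ξ₂ θ γ = (deriv (deriv (θ.curve γ)) θ.1.2.1).2) := by
  obtain ⟨K, h⟩ := ha.exists_bounds
  have hg := growth_pos n T K
  have hg1 : 1 ≤ growth n T K := one_le_growth hT
  obtain ⟨B, hB, hb⟩ := exists_frameCurve_bound (Λ := Λ) (ε := ε) (C := C) ha h
  have hham : ∀ (θ : WaveParam Λ ε C T a) γ, IsHamCurve T a θ.1.2.2 (θ.curve γ) := fun θ γ =>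
    isHamCurve_frameCurve ha h θ.abs_sign_le θ.2.1 γ
  have hfreq := fun (θ : WaveParam Λ ε C T a) (γ : FrameIndex Λ) => frameCurve_freq_mem (ε := ε) (C := C) ha h
    θ.abs_sign_le θ.2.1 θ.mem_Icc γ
  refine ⟨{
    lev := fun γ => γ.k
    step := fun γ => γ.step ε C
    X := fun θ γ => (θ.curve γ θ.1.2.1).1
    Ξ := fun θ γ => (θ.curve γ θ.1.2.1).2
    R := 2 * growth n T K
    one_le_R := by linarith
    step_pos := fun γ => levelStep_pos ε hC γ.k
    step_eq := fun γ γ' e => by simp only [FrameIndex.step, e]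
    le_norm := fun θ γ => by
      refine le_trans (le_of_eq ?_) (hfreq θ γ).1
      rw [div_div]
    norm_le := fun θ γ => (hfreq θ γ).2.trans (by
      have : (0 : ℝ) < 2 ^ γ.k := by positivity
      nlinarith)
    count := fun c hc => by
      obtain ⟨D, hD⟩ := exists_frame_count (Λ := Λ) ha h hT hε hC hc
      exact ⟨D, fun θ z γ' S hS => hD _ θ.abs_sign_le _ θ.2.1 _ θ.mem_Icc z γ' S hS⟩
    f := fun i j θ x => a θ.1.2.1 x i j
    df := fun i j θ x => coeffGrad a θ.1.2.1 x i j
    M := K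
    c11 := fun i j => ⟨h.pos.le, fun θ x => h.bound _ θ.mem_Icc _ _ _,
      fun θ x => (ha.differentiable _ θ.mem_Icc i j x).hasGradientAt,
      fun θ x => h.grad_bound _ θ.mem_Icc _ _ _, fun θ x y => by
        have := h.grad_lip _ θ.mem_Icc _ θ.mem_Icc x y i j
        rwa [sub_self, abs_zero, zero_add] at this⟩
    symm := fun i j θ x => (ha.symm _ θ.mem_Icc x).apply j i
    σ := fun θ => θ.1.2.2
    sq_σ := fun θ => by
      rcases θ.2.2.2.1 with e | e
      · rw [e]; norm_num
      · rw [Set.mem_singleton_iff.1 e]; norm_num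
    q := fun θ γ => symbolQ a θ.1.2.1 (θ.curve γ θ.1.2.1).1 (θ.curve γ θ.1.2.1).2
    q_ne_zero := fun θ γ => (h.symbolQ_pos θ.mem_Icc _ ((hham θ γ).ne_zero _ θ.mem_Icc)).ne'
    sq_q := fun θ γ => h.sq_symbolQ θ.mem_Icc _ _
    X₁ := fun θ γ => (deriv (θ.curve γ) θ.1.2.1).1
    X₂ := fun θ γ => (deriv (deriv (θ.curve γ)) θ.1.2.1).1
    Ξ₁ := fun θ γ => (deriv (θ.curve γ) θ.1.2.1).2
    Ξ₂ := fun θ γ => (deriv (deriv (θ.curve γ)) θ.1.2.1).2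
    B := B
    norm_X₁ := fun θ γ => ((hb _ θ.abs_sign_le _ θ.2.1 γ).2 _ θ.2.2.1).1
    norm_X₂ := fun θ γ => (((hb _ θ.abs_sign_le _ θ.2.1 γ).2 _ θ.2.2.1).2.2
      (θ.2.2.2.2 γ _ θ.2.2.2.1)).1
    norm_Ξ₁ := fun θ γ => ((hb _ θ.abs_sign_le _ θ.2.1 γ).2 _ θ.2.2.1).2.1
    norm_Ξ₂ := fun θ γ => (((hb _ θ.abs_sign_le _ θ.2.1 γ).2 _ θ.2.2.1).2.2
      (θ.2.2.2.2 γ _ θ.2.2.2.1)).2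
    eq_X₁ := fun θ γ i => by
      rw [((hham θ γ).hasDerivAt θ.2.2.1).deriv]
      rfl
    eq_Ξ₁ := fun θ γ l => by
      rw [((hham θ γ).hasDerivAt θ.2.2.1).deriv]
      simp only [gradX, PiLp.smul_apply, WithLp.ofLp_sum, Finset.sum_apply, smul_eq_mul] },
    fun _ => rfl, fun _ => rfl, fun _ _ _ _ => rfl, fun _ _ => rfl, fun _ _ => rfl, fun _ _ => rfl,
    fun _ _ => rfl, fun _ _ => rfl, fun _ _ => rfl⟩

/-- `W` is the value at time `t` of the wave operator on `u`, and all the derivatives exist. -/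
def HasWaveOp (a : CoeffField n) (t : ℝ) (u : ℝ → Space n → ℂ) (W : Space n → ℂ) : Prop :=
  ∃ (A : Space n → ℂ) (D : Fin n → Space n → ℂ) (H : Fin n → Fin n → Space n → ℂ),
    (∀ x, ∀ᶠ τ in nhds t, DifferentiableAt ℝ (fun s => u s x) τ) ∧
    (∀ x, HasDerivAt (fun τ => deriv (fun s => u s x) τ) (A x) t) ∧
    (∀ j, HasPartial j (u t) (D j)) ∧ (∀ i j, HasPartial i (D j) (H i j)) ∧
    ∀ x, W x = A x - ∑ i, ∑ j, (a t x i j : ℂ) * H i j x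

lemma HasWaveOp.waveOp_eq {t : ℝ} {u : ℝ → Space n → ℂ} {W : Space n → ℂ}
    (h : HasWaveOp a t u W) (x : Space n) : waveOp a u t x = W x := by
  obtain ⟨A, D, H, -, hA, hD, hH, e⟩ := h
  rw [waveOp, (hA x).deriv, e x]
  congr 1
  refine sum_congr rfl fun i _ => sum_congr rfl fun j _ => ?_
  have : (fun y => lineDeriv ℝ (u t) y (EuclideanSpace.single j 1)) = D j :=
    funext fun y => (hD j y).lineDeriv
  rw [this, (hH i j x).lineDeriv]

lemma HasWaveOp.comb {t : ℝ} {u v : ℝ → Space n → ℂ} {W V : Space n → ℂ}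
    (hu : HasWaveOp a t u W) (hv : HasWaveOp a t v V) (c d : ℂ) :
    HasWaveOp a t (fun s x => c * u s x + d * v s x) (fun x => c * W x + d * V x) := by
  obtain ⟨A, D, H, h1, hA, hD, hH, e⟩ := hu
  obtain ⟨A', D', H', h1', hA', hD', hH', e'⟩ := hv
  refine ⟨fun x => c * A x + d * A' x, fun j x => c * D j x + d * D' j x,
    fun i j x => c * H i j x + d * H' i j x, fun x => ?_, fun x => ?_,
    fun j => ((hD j).const_mul c).add ((hD' j).const_mul d),
    fun i j => ((hH i j).const_mul c).add ((hH' i j).const_mul d), fun x => ?_⟩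
  · filter_upwards [h1 x, h1' x] with τ h h'
    exact (h.const_mul c).add (h'.const_mul d)
  · refine (((hA x).const_mul c).add ((hA' x).const_mul d)).congr_of_eventuallyEq ?_
    filter_upwards [h1 x, h1' x] with τ h h'
    exact ((h.hasDerivAt.const_mul c).add (h'.hasDerivAt.const_mul d)).deriv
  · simp only [e, e', mul_sub, mul_sum, mul_add, sum_add_distrib]
    simp only [mul_left_comm c, mul_left_comm d]
    ring

/-- The wave packets which the wave operator makes of the transported frame functions. -/
lemma exists_wave_amplitude (ha : IsC11Coefficient T a) (hT : 0 < T) (hε : 0 < ε) (hC : 0 < C) :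
    ∃ Y : WavePackets n (WaveParam Λ ε C T a) (FrameIndex Λ), (∀ γ, Y.lev γ = γ.k) ∧
      ∀ (θ : WaveParam Λ ε C T a) γ, HasWaveOp a θ.1.2.1 (propagated ε C T a θ.1.2.2 θ.1.1 γ)
        (fun x => Y.amp θ γ x * Y.pk θ γ x) := by
  obtain ⟨Y, hlev, hstep, hf, hX, hΞ, hX₁, hΞ₁, hX₂, hΞ₂⟩ :=
    exists_wavePackets (Λ := Λ) ha hT hε hC
  refine ⟨Y, hlev, fun θ γ => ?_⟩
  obtain ⟨K, h⟩ := ha.exists_bounds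
  set z := θ.curve γ with hz
  set t := θ.1.2.1 with ht
  have hham : IsHamCurve T a θ.1.2.2 z := isHamCurve_frameCurve ha h θ.abs_sign_le θ.2.1 γ
  have hδ : 0 < γ.step ε C := levelStep_pos ε hC γ.k
  have hd : ∀ᶠ s in nhds t, HasDerivAt z (deriv z s) s := by
    filter_upwards [Ioo_mem_nhds θ.2.2.1.1 θ.2.2.1.2] with s hs
    exact (hham.hasDerivAt hs).differentiableAt.hasDerivAt
  have fst' : ∀ {w : ℝ → Space n × Space n} {w' s}, HasDerivAt w w' s →
      HasDerivAt (fun u => (w u).1) w'.1 s := fun h =>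
    (hasDerivWithinAt_fst (h.hasDerivWithinAt (s := univ))).hasDerivAt (by simp)
  have snd' : ∀ {w : ℝ → Space n × Space n} {w' s}, HasDerivAt w w' s →
      HasDerivAt (fun u => (w u).2) w'.2 s := fun h =>
    (hasDerivWithinAt_snd (h.hasDerivWithinAt (s := univ))).hasDerivAt (by simp)
  have hdX : ∀ᶠ s in nhds t, HasDerivAt (fun s => (z s).1) (deriv z s).1 s := hd.mono fun _ h => fst' h
  have hdΞ : ∀ᶠ s in nhds t, HasDerivAt (fun s => (z s).2) (deriv z s).2 s := hd.mono fun _ h => snd' h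
  have hdd : HasDerivAt (deriv z) (deriv (deriv z) t) t := (θ.2.2.2.2 γ _ θ.2.2.2.1).hasDerivAt
  have h0 : (z t).2 ≠ 0 := hham.ne_zero _ θ.mem_Icc
  have epk : ∀ x, Y.pk θ γ x = packet (γ.step ε C) (z t).1 (z t).2 x := fun x => by
    rw [PacketSystem.pk, hstep, hX, hΞ]
  refine ⟨fun x => (Y.ampL θ γ x ^ 2 + Y.ampL' θ γ x) * Y.pk θ γ x,
    fun j x => Y.logD j θ γ x * Y.pk θ γ x, fun i j x => Y.hessD i j θ γ x * Y.pk θ γ x,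
    fun x => ?_, fun x => ?_, fun j => ?_, fun i j => PacketSystem.hasPartial_logD_mul_pk i j θ γ,
    fun x => ?_⟩
  · have hev : ∀ᶠ s in nhds t, (z s).2 ≠ 0 := (hdΞ.self_of_nhds).continuousAt.eventually_ne h0
    filter_upwards [hdX, hdΞ, hev] with s h1 h2 h3
    exact (hasDerivAt_packet hδ h1 h2 h3 x).differentiableAt
  · have := deriv_deriv_packet hδ hdX hdΞ (fst' hdd) (snd' hdd) h0 x rfl rfl rfl
    refine this.congr_deriv ?_
    beta_reduce
    rw [epk]
    rw [WavePackets.ampL, WavePackets.ampL', WavePackets.ρ', WavePackets.ρ, hX, hΞ, hX₁, hΞ₁, hX₂, hΞ₂]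
  · exact (PacketSystem.hasPartial_pk j θ γ).congr (fun x => (epk x).symm) fun _ => rfl
  · simp only [WavePackets.amp, hf]
    rw [sub_mul, sum_mul]
    congr 1
    refine sum_congr rfl fun i _ => ?_
    rw [sum_mul]
    exact sum_congr rfl fun j _ => by ring

end transport

/-! ### Sobolev norms of Schwartz functions -/

open scoped LineDeriv in
/-- The partial derivative of a Schwartz function. -/
def partialD (j : Fin n) (u : 𝓢(Space n, ℂ)) : 𝓢(Space n, ℂ) :=
  ∂_{(EuclideanSpace.single j 1 : Space n)} u

lemma hasPartial_partialD (j : Fin n) (u : 𝓢(Space n, ℂ)) : HasPartial j u (partialD j u) := fun x =>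
  (u.differentiableAt (x := x)).hasFDerivAt.hasLineDerivAt _

lemma sqInt_schwartz (u : 𝓢(Space n, ℂ)) : SqInt u :=
  ⟨u.continuous, (memLp_two_iff_integrable_sq_norm u.continuous.aestronglyMeasurable).1 (u.memLp 2)⟩

lemma nrm_conj (f : Space n → ℂ) : nrm (fun x => conj (f x)) = nrm f := by
  simp only [nrm, RCLike.norm_conj]

lemma nrm_schwartz (u : 𝓢(Space n, ℂ)) : nrm u = ‖(u.toLp 2 : L2 n)‖ := by
  rw [nrm, ← norm_sq_L2_eq _ (u.coeFn_toLp 2 volume), sqrt_sq (norm_nonneg _)]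

lemma norm_toLp_le {u v : 𝓢(Space n, ℂ)} {c : ℝ} (h : ∀ η, ‖u η‖ ≤ c * ‖v η‖) :
    ‖(u.toLp 2 : L2 n)‖ ≤ c * ‖(v.toLp 2 : L2 n)‖ := by
  refine Lp.norm_le_mul_norm_of_ae_le_mul ?_
  filter_upwards [u.coeFn_toLp 2 volume, v.coeFn_toLp 2 volume] with η h1 h2
  rw [h1, h2]
  exact h η

lemma norm_weight (s : ℝ) (η : Space n) : ‖weight s η‖ = bracket η ^ s := by
  rw [weight_eq, norm_real, norm_of_nonneg (rpow_nonneg (bracket_pos η).le _)]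

lemma weight_add (s r : ℝ) (η : Space n) : weight (s + r) η = weight s η * weight r η := by
  rw [weight_eq, weight_eq, weight_eq, rpow_add (bracket_pos η), ofReal_mul]

lemma wFourier_zero (u : 𝓢(Space n, ℂ)) : wFourier 0 u = 𝓕 u := by
  ext η
  rw [wFourier_apply, weight]
  simp

lemma nrm_eq_norm_wFourierL2 (u : 𝓢(Space n, ℂ)) : nrm u = ‖wFourierL2 0 u‖ := by
  rw [wFourierL2, wFourier_zero, SchwartzMap.norm_fourier_toL2_eq, nrm_schwartz]

lemma norm_wFourierL2_mono {s r : ℝ} (h : s ≤ r) (u : 𝓢(Space n, ℂ)) :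
    ‖wFourierL2 s u‖ ≤ ‖wFourierL2 r u‖ := by
  have := norm_toLp_le (u := wFourier s u) (v := wFourier r u) (c := 1) fun η => by
    rw [one_mul, wFourier_apply, wFourier_apply, norm_mul, norm_mul, norm_weight, norm_weight]
    gcongr
    exact one_le_bracket η
  rwa [one_mul] at this

lemma fourier_partialD (j : Fin n) (u : 𝓢(Space n, ℂ)) (η : Space n) :
    (𝓕 (partialD j u)) η = 2 * π * I * (η j : ℂ) * (𝓕 u) η := by
  have h : (inner ℝ · (EuclideanSpace.single j 1 : Space n) : Space n → ℝ).HasTemperateGrowth := by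
    fun_prop
  rw [partialD, SchwartzMap.fourier_lineDerivOp_eq, _root_.smul_apply,
    SchwartzMap.smulLeftCLM_apply_apply h, smul_eq_mul, Complex.real_smul, mul_assoc _ (η j : ℂ),
    EuclideanSpace.inner_single_right]
  simp

lemma nrm_partialD_le (j : Fin n) (u : 𝓢(Space n, ℂ)) :
    nrm (partialD j u) ≤ 2 * π * ‖wFourierL2 1 u‖ := by
  rw [nrm_eq_norm_wFourierL2]
  refine norm_toLp_le fun η => ?_
  have h1 : |η j| ≤ bracket η := (abs_coord_le η j).trans (norm_le_bracket η)
  rw [wFourier_zero, fourier_partialD, wFourier_apply, norm_mul, norm_mul, norm_mul, norm_mul, norm_mul,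
    norm_weight, rpow_one, Complex.norm_I, norm_real, norm_real,
    norm_of_nonneg pi_pos.le, Complex.norm_ofNat, norm_eq_abs, mul_one, mul_assoc (2 * π)]
  gcongr

/-- Inversion of `1 - Δ / 4π²`. -/
lemma exists_sub_laplacian (ψ : 𝓢(Space n, ℂ)) : ∃ χ : 𝓢(Space n, ℂ),
    nrm χ = ‖wFourierL2 (-2) ψ‖ ∧
      ∀ x, ψ x = χ x - ∑ j, (4 * π ^ 2 : ℂ)⁻¹ * partialD j (partialD j χ) x := by
  obtain ⟨χ, hχ⟩ := wFourier_surjective 0 (wFourier (-2) ψ)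
  refine ⟨χ, by rw [nrm_eq_norm_wFourierL2, wFourierL2, hχ, wFourierL2], fun x => ?_⟩
  have hF : ∀ η, (𝓕 χ) η = weight (-2) η * (𝓕 ψ) η := fun η => by
    rw [← wFourier_zero, hχ, wFourier_apply]
  have key : ψ = χ - ∑ j, (4 * π ^ 2 : ℂ)⁻¹ • partialD j (partialD j χ) := by
    have : 𝓕 ψ = 𝓕 (χ - ∑ j, (4 * π ^ 2 : ℂ)⁻¹ • partialD j (partialD j χ)) := by
      change FourierTransform.fourierCLM ℂ 𝓢(Space n, ℂ) ψ = FourierTransform.fourierCLM ℂ 𝓢(Space n, ℂ) _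
      rw [map_sub, map_sum]
      ext η
      simp only [map_smul, FourierTransform.fourierCLM_apply, _root_.sub_apply, _root_.sum_apply,
        _root_.smul_apply, fourier_partialD, smul_eq_mul]
      have hw : weight 2 η = 1 + ∑ j, (η j : ℂ) * (η j : ℂ) := by
        have := ofReal_norm_sq η
        simp only [cvec] at this
        rw [weight, div_self two_ne_zero, rpow_one, Complex.ofReal_add, this, Complex.ofReal_one]
      have e1 : (𝓕 ψ) η = weight 2 η * (𝓕 χ) η := by
        rw [hF, ← mul_assoc, weight_mul_weight_neg, one_mul]
      rw [e1, hw, add_mul, one_mul, sum_mul, sub_eq_add_neg, ← sum_neg_distrib]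
      congr 1
      refine sum_congr rfl fun j _ => ?_
      have hpi : (π : ℂ) ≠ 0 := by exact_mod_cast pi_ne_zero
      field_simp
      linear_combination 4 * (η j : ℂ) ^ 2 * (𝓕 χ) η * Complex.I_sq
    have h2 := congrArg (𝓕⁻ : 𝓢(Space n, ℂ) → 𝓢(Space n, ℂ)) this
    rwa [FourierTransform.fourierInv_fourier_eq, FourierTransform.fourierInv_fourier_eq] at h2
  have := congrArg (fun v : 𝓢(Space n, ℂ) => v x) key
  simp only [_root_.sub_apply, _root_.sum_apply, _root_.smul_apply, smul_eq_mul] at this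
  exact this

/-! ### Riesz representation -/

/-- `wFourierL2` as a linear map. -/
def wFourierLM (s : ℝ) : 𝓢(Space n, ℂ) →ₗ[ℂ] L2 n :=
  ((SchwartzMap.toLpCLM ℂ ℂ 2 volume) ∘L (SchwartzMap.smulLeftCLM ℂ (weight s)) ∘L
    (FourierTransform.fourierCLM ℂ 𝓢(Space n, ℂ))).toLinearMap

lemma wFourierLM_apply (s : ℝ) (u : 𝓢(Space n, ℂ)) : wFourierLM s u = wFourierL2 s u := rfl

/-- A square integrable function which is bounded on test functions by the norm of `H^s` is given by an
element of the dual space. -/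
lemma exists_riesz {G : Space n → ℂ} (hG : SqInt G) {s K : ℝ}
    (h : ∀ ψ : 𝓢(Space n, ℂ), ‖∫ x, conj (ψ x) * G x‖ ≤ K * ‖wFourierL2 s ψ‖) :
    ∃ v : L2 n, ∀ ψ : 𝓢(Space n, ℂ), inner ℂ (wFourierL2 s ψ) v = ∫ x, conj (ψ x) * G x := by
  have hint : ∀ ψ : 𝓢(Space n, ℂ), Integrable (fun x => ψ x * conj (G x)) := fun ψ =>
    (sqInt_schwartz ψ).integrable_mul hG.conjugate
  let φ : 𝓢(Space n, ℂ) →ₗ[ℂ] ℂ :=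
    { toFun := fun ψ => ∫ x, ψ x * conj (G x)
      map_add' := fun ψ ψ' => by
        rw [← integral_add (hint ψ) (hint ψ')]
        simp only [_root_.add_apply, add_mul]
      map_smul' := fun c ψ => by
        rw [RingHom.id_apply, smul_eq_mul, ← integral_const_mul]
        simp only [_root_.smul_apply, smul_eq_mul, mul_assoc] }
  have hφ : ∀ ψ : 𝓢(Space n, ℂ), conj (φ ψ) = ∫ x, conj (ψ x) * G x := fun ψ => by
    change conj (∫ x, ψ x * conj (G x)) = _
    rw [← integral_conj]
    simp only [map_mul, Complex.conj_conj]
  have hb : ∀ ψ, ‖φ ψ‖ ≤ K * ‖wFourierLM s ψ‖ := fun ψ => by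
    rw [← RCLike.norm_conj, hφ]
    exact h ψ
  have hd : DenseRange (wFourierLM (n := n) s) := denseRange_wFourierL2 s
  let ℓ : L2 n →L[ℂ] ℂ := φ.extendOfNorm (wFourierLM s)
  refine ⟨(InnerProductSpace.toDual ℂ (L2 n)).symm ℓ, fun ψ => ?_⟩
  rw [← inner_conj_symm, InnerProductSpace.toDual_symm_apply, ← hφ, ← wFourierLM_apply]
  congr 1
  exact LinearMap.extendOfNorm_eq hd ⟨K, hb⟩ ψ

lemma norm_le_of_dense {s K : ℝ} (hK : 0 ≤ K) {v : L2 n}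
    (h : ∀ ψ : 𝓢(Space n, ℂ), ‖inner ℂ (wFourierL2 s ψ) v‖ ≤ K * ‖wFourierL2 s ψ‖) : ‖v‖ ≤ K := by
  have hall : ∀ u : L2 n, ‖inner ℂ u v‖ ≤ K * ‖u‖ := fun u =>
    (denseRange_wFourierL2 s).induction_on u (isClosed_le (by fun_prop) (by fun_prop)) h
  rcases eq_or_ne v 0 with rfl | hv
  · rwa [norm_zero]
  · have := hall v
    rw [inner_self_eq_norm_sq_to_K] at this
    have hp := norm_pos_iff.2 hv
    have e : ‖((‖v‖ : ℂ)) ^ 2‖ = ‖v‖ * ‖v‖ := by rw [norm_pow, norm_real, norm_norm, sq]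
    rw [show ((RCLike.ofReal ‖v‖ : ℂ)) = (‖v‖ : ℂ) from rfl, e] at this
    exact le_of_mul_le_mul_right this hp

/-! ### Multiplication by weights -/

lemma memLp_weight_mul {s : ℝ} (hs : s ≤ 0) (g : L2 n) : MemLp (fun η => weight s η * g η) 2 volume := by
  refine (Lp.memLp g).mono ?_ (.of_forall fun η => ?_)
  · exact ((hasTemperateGrowth_weight s).1.continuous.aestronglyMeasurable).mul (Lp.aestronglyMeasurable g)
  · rw [norm_mul, norm_weight]
    exact mul_le_of_le_one_left (norm_nonneg _) (rpow_le_one_of_one_le_of_nonpos (one_le_bracket η) hs)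

/-- Multiplication by the weight of order `min s 0`. -/
def mulW (s : ℝ) : L2 n →ₗ[ℂ] L2 n where
  toFun g := (memLp_weight_mul (min_le_right s 0) g).toLp
  map_add' g h := by
    refine Lp.ext ?_
    filter_upwards [(memLp_weight_mul (min_le_right s 0) (g + h)).coeFn_toLp,
      (memLp_weight_mul (min_le_right s 0) g).coeFn_toLp, (memLp_weight_mul (min_le_right s 0) h).coeFn_toLp,
      Lp.coeFn_add g h, Lp.coeFn_add (memLp_weight_mul (min_le_right s 0) g).toLp
        (memLp_weight_mul (min_le_right s 0) h).toLp] with η h1 h2 h3 h4 h5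
    rw [h1, h5, Pi.add_apply, h2, h3, h4, Pi.add_apply, mul_add]
  map_smul' c g := by
    refine Lp.ext ?_
    filter_upwards [(memLp_weight_mul (min_le_right s 0) (c • g)).coeFn_toLp,
      (memLp_weight_mul (min_le_right s 0) g).coeFn_toLp,
      Lp.coeFn_smul c g, Lp.coeFn_smul c (memLp_weight_mul (min_le_right s 0) g).toLp] with η h1 h2 h4 h5
    rw [h1, RingHom.id_apply, h5, Pi.smul_apply, h2, h4, Pi.smul_apply, smul_eq_mul, smul_eq_mul]
    ring

lemma coeFn_mulW {s : ℝ} (hs : s ≤ 0) (g : L2 n) : mulW s g =ᵐ[volume] fun η => weight s η * g η := by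
  refine (memLp_weight_mul (min_le_right s 0) g).coeFn_toLp.trans ?_
  rw [min_eq_left hs]

lemma inner_mulW {s : ℝ} (hs : s ≤ 0) (r : ℝ) (ψ : 𝓢(Space n, ℂ)) (g : L2 n) :
    inner ℂ (wFourierL2 r ψ) (mulW s g) = inner ℂ (wFourierL2 (r + s) ψ) g := by
  rw [wFourierL2, wFourierL2, inner_toLp_left, inner_toLp_left]
  refine integral_congr_ae ?_
  filter_upwards [coeFn_mulW hs g] with η h
  rw [h, wFourier_apply, wFourier_apply, weight_add, map_mul, map_mul, map_mul]
  have : conj (weight s η) = weight s η := by rw [weight, conj_ofReal]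
  rw [this]
  ring

/-! ### Interpolation between the extreme orders -/

/-- The pointwise form of the interpolation: at the frequency `w` only the levels with `2^k` near `w`
matter. -/
lemma exists_interpolation {m : ℝ} (h1 : -1 < m) (h2 : m < 2) : ∃ D : ℝ, 0 < D ∧
    ∀ (J : Finset ℕ) (w : ℝ) (a : ℕ → ℝ), 0 < w → (∀ k, 0 ≤ a k) →
      (w ^ (m - 2) * ∑ k ∈ J, a k) ^ 2 ≤
        D * ∑ k ∈ J, (((2 : ℝ) ^ k) ^ (m + 1)) ^ 2 *
          (2 * ((w ^ (-3 : ℝ) * a k) ^ 2 + ((((2 : ℝ) ^ k) ^ 3)⁻¹ * a k) ^ 2)) := by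
  obtain ⟨D, hD, h⟩ := exists_sum_min_rpow_le (a := m + 1) (b := 2 - m) (by linarith) (by linarith)
  refine ⟨D, hD, fun J w a hw ha => ?_⟩
  -- `τ` is summable over the levels uniformly in `w`, which allows Cauchy–Schwarz
  set τ : ℕ → ℝ := fun k => min ((w / 2 ^ k) ^ (m + 1)) ((w / 2 ^ k) ^ (-(2 - m))) with hτ
  set b : ℕ → ℝ := fun k => ((2 : ℝ) ^ k) ^ (m + 1) * (w ^ (-3 : ℝ) * a k + (((2 : ℝ) ^ k) ^ 3)⁻¹ * a k) with hb
  have hτ0 : ∀ k, 0 ≤ τ k := fun k => le_min (by positivity) (by positivity)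
  have hb0 : ∀ k, 0 ≤ b k := fun k => by have := ha k; positivity
  have hτ1 : ∀ k, τ k ≤ 1 := fun k => by
    have hx : 0 < w / 2 ^ k := by positivity
    rcases le_total (w / 2 ^ k) 1 with h3 | h3
    · exact (min_le_left _ _).trans (rpow_le_one hx.le h3 (by linarith))
    · exact (min_le_right _ _).trans (rpow_le_one_of_one_le_of_nonpos h3 (by linarith))
  have key : ∀ k, w ^ (m - 2) * a k ≤ τ k * b k := fun k => by
    have hk : (0 : ℝ) < 2 ^ k := by positivity
    have hak := ha k
    have e1 : w ^ (m - 2) * a k = (w / 2 ^ k) ^ (m + 1) * (((2 : ℝ) ^ k) ^ (m + 1) * (w ^ (-3 : ℝ) * a k)) := by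
      have : (w / 2 ^ k) ^ (m + 1) * ((2 : ℝ) ^ k) ^ (m + 1) = w ^ (m + 1) := by
        rw [← mul_rpow (by positivity) hk.le, div_mul_cancel₀ _ hk.ne']
      rw [← mul_assoc, this, ← mul_assoc, ← rpow_add hw]
      congr 2
      ring
    have e2 : w ^ (m - 2) * a k = (w / 2 ^ k) ^ (-(2 - m)) *
        (((2 : ℝ) ^ k) ^ (m + 1) * ((((2 : ℝ) ^ k) ^ 3)⁻¹ * a k)) := by
      have e3 : ((2 : ℝ) ^ k) ^ (m + 1) * (((2 : ℝ) ^ k) ^ 3)⁻¹ = ((2 : ℝ) ^ k) ^ (m - 2) := by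
        rw [← rpow_natCast _ 3, ← rpow_neg hk.le, ← rpow_add hk]
        congr 1
        push_cast
        ring
      have : (w / 2 ^ k) ^ (-(2 - m)) * ((2 : ℝ) ^ k) ^ (m - 2) = w ^ (m - 2) := by
        rw [neg_sub, ← mul_rpow (by positivity) hk.le, div_mul_cancel₀ _ hk.ne']
      rw [← mul_assoc _ _ (a k), e3, ← mul_assoc, this]
    have hle1 : ((2 : ℝ) ^ k) ^ (m + 1) * (w ^ (-3 : ℝ) * a k) ≤ b k := by
      simp only [hb]
      gcongr
      exact le_add_of_nonneg_right (by positivity)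
    have hle2 : ((2 : ℝ) ^ k) ^ (m + 1) * ((((2 : ℝ) ^ k) ^ 3)⁻¹ * a k) ≤ b k := by
      simp only [hb]
      gcongr
      exact le_add_of_nonneg_left (by positivity)
    rcases min_choice ((w / 2 ^ k) ^ (m + 1)) ((w / 2 ^ k) ^ (-(2 - m))) with e | e
    · rw [e1, show τ k = _ from e]
      gcongr
    · rw [e2, show τ k = _ from e]
      gcongr
  calc (w ^ (m - 2) * ∑ k ∈ J, a k) ^ 2 ≤ (∑ k ∈ J, τ k * b k) ^ 2 := by
        rw [mul_sum]
        refine pow_le_pow_left₀ (sum_nonneg fun k _ => ?_) (sum_le_sum fun k _ => key k) 2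
        have := ha k
        positivity
    _ ≤ (∑ k ∈ J, τ k) * ∑ k ∈ J, τ k * b k ^ 2 :=
        Finset.sum_sq_le_sum_mul_sum_of_sq_le_mul J (fun k _ => hτ0 k)
          (fun k _ => mul_nonneg (hτ0 k) (sq_nonneg _)) fun k _ => le_of_eq (by ring)
    _ ≤ D * ∑ k ∈ J, b k ^ 2 := by
        refine mul_le_mul (h J w hw) (sum_le_sum fun k _ =>
          mul_le_of_le_one_left (sq_nonneg _) (hτ1 k))
          (sum_nonneg fun k _ => mul_nonneg (hτ0 k) (sq_nonneg _)) hD.le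
    _ ≤ _ := by
        gcongr with k _
        simp only [hb, mul_pow]
        gcongr
        nlinarith [sq_nonneg (w ^ (-3 : ℝ) * a k - (((2 : ℝ) ^ k) ^ 3)⁻¹ * a k)]

lemma norm_sq_mulW {s : ℝ} (hs : s ≤ 0) (g : L2 n) :
    ‖mulW s g‖ ^ 2 = ∫ η, (bracket η ^ s * ‖g η‖) ^ 2 := by
  rw [norm_sq_L2_eq _ (coeFn_mulW hs g)]
  simp only [norm_mul, norm_weight]

lemma integrable_sq_mulW {s : ℝ} (hs : s ≤ 0) (g : L2 n) :
    Integrable (fun η => (bracket η ^ s * ‖g η‖) ^ 2) := by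
  have h := memLp_weight_mul hs g
  have := (memLp_two_iff_integrable_sq_norm h.1).1 h
  simpa only [norm_mul, norm_weight] using this

/-- Sums of vectors `V k` which satisfy at every level the bounds of orders `2` and `-1` satisfy the
bounds of all orders between, with square summation over the levels. -/
lemma exists_norm_mulW_sum_le (n : ℕ) {m : ℝ} (h1 : -1 < m) (h2 : m < 2) : ∃ D : ℝ, 0 < D ∧
    ∀ (J : Finset ℕ) (V : ℕ → L2 n) (A : ℕ → ℝ), (∀ k ∈ J, ‖V k‖ ≤ ((2 : ℝ) ^ k) ^ 3 * A k) →
      (∀ k ∈ J, ‖mulW (-3) (V k)‖ ≤ A k) →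
      ‖mulW (m - 2) (∑ k ∈ J, V k)‖ ^ 2 ≤ D * ∑ k ∈ J, (((2 : ℝ) ^ k) ^ (m + 1) * A k) ^ 2 := by
  obtain ⟨D, hD, h⟩ := exists_interpolation h1 h2
  refine ⟨4 * D, by positivity, fun J V A hV hW => ?_⟩
  have i1 : ∀ k, Integrable (fun η => (bracket η ^ (-3 : ℝ) * ‖V k η‖) ^ 2) := fun k =>
    integrable_sq_mulW (by norm_num) (V k)
  have i3 : ∀ k, Integrable (fun η => ((((2 : ℝ) ^ k) ^ 3)⁻¹ * ‖V k η‖) ^ 2) := fun k => by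
    simpa only [mul_pow] using ((memLp_two_iff_integrable_sq_norm (Lp.aestronglyMeasurable _)).1
      (Lp.memLp (V k))).const_mul ((((2 : ℝ) ^ k) ^ 3)⁻¹ ^ 2)
  let G : ℕ → Space n → ℝ := fun k η => (((2 : ℝ) ^ k) ^ (m + 1)) ^ 2 *
    (2 * ((bracket η ^ (-3 : ℝ) * ‖V k η‖) ^ 2 + ((((2 : ℝ) ^ k) ^ 3)⁻¹ * ‖V k η‖) ^ 2))
  have i4 : ∀ k, Integrable (G k) := fun k =>
    (((i1 k).add (i3 k)).const_mul 2).const_mul _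
  have hsum : ⇑(∑ k ∈ J, V k) =ᵐ[volume] fun η => ∑ k ∈ J, V k η := by
    filter_upwards [Lp.coeFn_finsetSum J V] with η h
    rw [h, Finset.sum_apply]
  calc ‖mulW (m - 2) (∑ k ∈ J, V k)‖ ^ 2
      ≤ ∫ η, D * ∑ k ∈ J, G k η := by
        rw [norm_sq_mulW (by linarith)]
        refine integral_mono_ae (integrable_sq_mulW (by linarith) _)
          ((integrable_finsetSum J fun k _ => i4 k).const_mul D) ?_
        filter_upwards [hsum] with η e
        refine le_trans ?_ (h J (bracket η) (fun k => ‖V k η‖) (bracket_pos η) fun k => norm_nonneg _)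
        have := bracket_pos η
        rw [e]
        gcongr
        exact norm_sum_le _ _
    _ = D * ∑ k ∈ J, (((2 : ℝ) ^ k) ^ (m + 1)) ^ 2 *
          (2 * (‖mulW (-3) (V k)‖ ^ 2 + ((((2 : ℝ) ^ k) ^ 3)⁻¹ * ‖V k‖) ^ 2)) := by
        rw [integral_const_mul, integral_finsetSum J fun k _ => i4 k]
        congr 1
        refine sum_congr rfl fun k _ => ?_
        rw [integral_const_mul, integral_const_mul, integral_add (i1 k) (i3 k), norm_sq_mulW (by norm_num),
          mul_pow (((2 : ℝ) ^ k) ^ 3)⁻¹ ‖V k‖, norm_sq_L2_eq (V k) (Filter.EventuallyEq.refl _ _),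
          ← integral_const_mul]
        simp only [mul_pow]
    _ ≤ _ := by
        rw [mul_comm 4 D, mul_assoc D]
        refine mul_le_mul_of_nonneg_left ?_ hD.le
        rw [mul_sum]
        refine sum_le_sum fun k hk => ?_
        have b1 := hW k hk
        have hA : 0 ≤ A k := (norm_nonneg _).trans b1
        have b2 : (((2 : ℝ) ^ k) ^ 3)⁻¹ * ‖V k‖ ≤ A k := by
          rw [inv_mul_le_iff₀ (by positivity)]
          exact hV k hk
        rw [mul_pow]
        have c1 := pow_le_pow_left₀ (norm_nonneg _) b1 2
        have c2 := pow_le_pow_left₀ (by positivity) b2 2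
        have : 0 ≤ (((2 : ℝ) ^ k) ^ (m + 1)) ^ 2 := by positivity
        nlinarith

/-! ### The image of a wave packet under the wave operator in Sobolev spaces -/

namespace WavePackets

variable {Θ ι : Type} (Y : WavePackets n Θ ι)

/-- The bound on test functions in `H^{-2}`: the test function is `(1 - Δ / 4π²) χ` with `χ` in `L²`. -/
lemma exists_dual_bound_two : ∃ K : ℝ, 0 ≤ K ∧ ∀ θ S d (ψ : 𝓢(Space n, ℂ)),
    ‖∫ x, conj (ψ x) * Y.psum Y.amp θ S d x‖ ≤ K * Y.wn 6 S d * ‖wFourierL2 (-2) ψ‖ := by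
  obtain ⟨hs, K₀, hK₀, h₀⟩ := Y.exists_strong_bound
  choose K₁ hK₁ h₁ using fun l => weakBoundTwo_amp (Y := Y) l
  refine ⟨K₀ + ∑ l, K₁ l, add_nonneg hK₀ (sum_nonneg fun l _ => hK₁ l), fun θ S d ψ => ?_⟩
  obtain ⟨χ, hχ, e⟩ := exists_sub_laplacian ψ
  set G := Y.psum Y.amp θ S d with hG
  set c : ℂ := (4 * π ^ 2 : ℂ)⁻¹ with hc
  have e1 : c = (((4 * π ^ 2)⁻¹ : ℝ) : ℂ) := by rw [hc]; push_cast; rfl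
  have hc1 : ‖c‖ ≤ 1 := by
    rw [e1, norm_real, norm_of_nonneg (by positivity)]
    refine inv_le_one_of_one_le₀ ?_
    nlinarith [pi_gt_three]
  have hcc : conj c = c := by rw [e1, conj_ofReal]
  set D₂ : Fin n → Space n → ℂ := fun l x => conj (partialD l (partialD l χ) x) with hD₂
  have hχs : SqInt (fun x => conj (χ x)) := (sqInt_schwartz χ).conjugate
  have hD₂s : ∀ l, SqInt (D₂ l) := fun l => (sqInt_schwartz _).conjugate
  have i0 : Integrable (fun x => G x * conj (χ x)) := (hs θ S d).integrable_mul hχs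
  have i1 : ∀ l, Integrable (fun x => c * (G x * D₂ l x)) := fun l =>
    ((hs θ S d).integrable_mul (hD₂s l)).const_mul c
  have eint : ∫ x, conj (ψ x) * G x =
      (∫ x, G x * conj (χ x)) - ∑ l, c * ∫ x, G x * D₂ l x := by
    have : ∀ x, conj (ψ x) * G x = G x * conj (χ x) - ∑ l, c * (G x * D₂ l x) := by
      intro x
      rw [e x, map_sub, map_sum, sub_mul, sum_mul, mul_comm]
      congr 1
      refine sum_congr rfl fun l _ => ?_
      rw [map_mul, hcc, hD₂]
      ring
    simp only [this]
    rw [integral_sub i0 (integrable_finsetSum _ fun l _ => i1 l), integral_finsetSum _ fun l _ => i1 l]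
    simp only [integral_const_mul]
  have hn : nrm (fun x => conj (χ x)) = ‖wFourierL2 (-2) ψ‖ := by rw [nrm_conj, hχ]
  have b0 : ‖∫ x, G x * conj (χ x)‖ ≤ K₀ * Y.wn 6 S d * ‖wFourierL2 (-2) ψ‖ := by
    refine ((hs θ S d).norm_integral_mul_le hχs).trans ?_
    rw [hn]
    gcongr
    exact (h₀ θ S d).trans (by gcongr; exact PacketSystem.wn_mono (by norm_num) S d)
  have b1 : ∀ l, ‖c * ∫ x, G x * D₂ l x‖ ≤ K₁ l * Y.wn 6 S d * ‖wFourierL2 (-2) ψ‖ := fun l => by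
    rw [norm_mul]
    refine (mul_le_of_le_one_left (norm_nonneg _) hc1).trans ?_
    have := h₁ l θ S d (fun x => conj (χ x)) (fun x => conj (partialD l χ x)) (D₂ l)
      hχs (sqInt_schwartz _).conjugate (hD₂s l) (hasPartial_partialD l χ).conjugate (hasPartial_partialD l _).conjugate
    rwa [hn, ← mul_assoc] at this
  rw [eint, add_mul, add_mul, sum_mul, sum_mul]
  exact (norm_sub_le _ _).trans (add_le_add b0 ((norm_sum_le _ _).trans (sum_le_sum fun l _ => b1 l)))

/-- The bound on test functions in `H^1`. -/
lemma exists_dual_bound_one : ∃ K : ℝ, 0 ≤ K ∧ ∀ θ S d (ψ : 𝓢(Space n, ℂ)),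
    ‖∫ x, conj (ψ x) * Y.psum Y.amp θ S d x‖ ≤ K * Y.wn 0 S d * ‖wFourierL2 1 ψ‖ := by
  obtain ⟨K, hK, h⟩ := weakBound_amp (Y := Y)
  refine ⟨K * (1 + n * (2 * π)), by positivity, fun θ S d ψ => ?_⟩
  have := h θ S d (fun x => conj (ψ x)) (fun j x => conj (partialD j ψ x))
    (sqInt_schwartz ψ).conjugate (fun j => (sqInt_schwartz _).conjugate) fun j => (hasPartial_partialD j ψ).conjugate
  simp only [mul_comm (Y.psum Y.amp θ S d _)] at this
  refine this.trans ?_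
  have b1 : nrm ψ ≤ ‖wFourierL2 1 ψ‖ := by
    rw [nrm_eq_norm_wFourierL2]
    exact norm_wFourierL2_mono zero_le_one ψ
  have b2 : ∑ j, nrm (partialD j ψ) ≤ n * (2 * π * ‖wFourierL2 1 ψ‖) := by
    refine (sum_le_sum fun j _ => nrm_partialD_le j ψ).trans (le_of_eq ?_)
    rw [Finset.sum_const, Finset.card_univ, Fintype.card_fin, nsmul_eq_mul]
  simp only [nrm_conj]
  have hw : 0 ≤ Y.wn 0 S d := PacketSystem.wn_nonneg _ _ _
  calc _ ≤ K * (Y.wn 0 S d * (‖wFourierL2 1 ψ‖ + n * (2 * π * ‖wFourierL2 1 ψ‖))) := by gcongr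
    _ = _ := by ring

/-- The elements of the dual of `H^{-2}` which represent the wave operator on the packets. -/
lemma exists_dual_vectors : ∃ K : ℝ, 0 ≤ K ∧ ∀ θ, ∃ v : ι → L2 n,
    (∀ γ (ψ : 𝓢(Space n, ℂ)), inner ℂ (wFourierL2 (-2) ψ) (v γ) =
      ∫ x, conj (ψ x) * (Y.amp θ γ x * Y.pk θ γ x)) ∧
    (∀ S (d : ι → ℂ), ‖∑ γ ∈ S, d γ • v γ‖ ≤ K * Y.wn 6 S d) ∧
    ∀ S (d : ι → ℂ), ‖mulW (-3) (∑ γ ∈ S, d γ • v γ)‖ ≤ K * Y.wn 0 S d := by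
  obtain ⟨K₁, hK₁, h₁⟩ := Y.exists_dual_bound_two
  obtain ⟨K₂, hK₂, h₂⟩ := Y.exists_dual_bound_one
  obtain ⟨hs, -⟩ := Y.exists_strong_bound
  refine ⟨K₁ + K₂, by positivity, fun θ => ?_⟩
  have single : ∀ γ x, Y.psum Y.amp θ {γ} (fun _ => 1) x = Y.amp θ γ x * Y.pk θ γ x := fun γ x => by
    rw [PacketSystem.psum, Finset.sum_singleton, one_mul]
  have hF : ∀ γ, SqInt (fun x => Y.amp θ γ x * Y.pk θ γ x) := fun γ => by
    have := hs θ {γ} (fun _ => 1)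
    rwa [funext (single γ)] at this
  choose v hv using fun γ => exists_riesz (hs θ {γ} (fun _ => 1)) (h₁ θ {γ} (fun _ => 1))
  simp only [single] at hv
  have hsum : ∀ S (d : ι → ℂ) (ψ : 𝓢(Space n, ℂ)), inner ℂ (wFourierL2 (-2) ψ) (∑ γ ∈ S, d γ • v γ) =
      ∫ x, conj (ψ x) * Y.psum Y.amp θ S d x := fun S d ψ => by
    rw [inner_sum]
    simp only [inner_smul_right, hv, PacketSystem.psum, mul_sum, ← integral_const_mul]
    rw [integral_finsetSum]
    · exact sum_congr rfl fun γ _ => integral_congr_ae (.of_forall fun x => by ring)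
    · intro γ _
      have := ((sqInt_schwartz ψ).conjugate.integrable_mul (hF γ)).const_mul (d γ)
      refine this.congr (.of_forall fun x => ?_)
      ring
  refine ⟨v, hv, fun S d => ?_, fun S d => ?_⟩
  · have hw : 0 ≤ Y.wn 6 S d := PacketSystem.wn_nonneg _ _ _
    refine (norm_le_of_dense (K := K₁ * Y.wn 6 S d) (by positivity) (s := -2) fun ψ => ?_).trans
      (by gcongr; linarith)
    rw [hsum]
    exact h₁ θ S d ψ
  · have hw : 0 ≤ Y.wn 0 S d := PacketSystem.wn_nonneg _ _ _
    refine (norm_le_of_dense (K := K₂ * Y.wn 0 S d) (by positivity) (s := 1) fun ψ => ?_).trans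
      (by gcongr; linarith)
    rw [inner_mulW (by norm_num), show (1 : ℝ) + -3 = -2 by norm_num, hsum]
    exact h₂ θ S d ψ

lemma wn_sq (α : ℤ) (S : Finset ι) (d : ι → ℂ) :
    Y.wn α S d ^ 2 = ∑ γ ∈ S, (scl (Y.lev γ) ^ α * ‖d γ‖) ^ 2 :=
  sq_sqrt (sum_nonneg fun _ _ => sq_nonneg _)

end WavePackets

namespace WavePackets

variable {Θ ι : Type} (Y : WavePackets n Θ ι)

lemma scl_zpow_six (k : ℕ) : scl k ^ (6 : ℤ) = ((2 : ℝ) ^ k) ^ 3 := by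
  rw [← sq_scl, ← pow_mul]
  rfl

lemma wn_six_filter (S : Finset ι) (d : ι → ℂ) (k : ℕ) :
    Y.wn 6 (S.filter fun γ => Y.lev γ = k) d = ((2 : ℝ) ^ k) ^ 3 * Y.wn 0 (S.filter fun γ => Y.lev γ = k) d := by
  rw [PacketSystem.wn, PacketSystem.wn, ← sqrt_sq (x := ((2 : ℝ) ^ k) ^ 3) (by positivity),
    ← sqrt_mul (by positivity), mul_sum]
  congr 1
  refine sum_congr rfl fun γ hγ => ?_
  rw [(Finset.mem_filter.1 hγ).2, scl_zpow_six, zpow_zero, one_mul, mul_pow]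

/-- The elements of the dual of `H^{-m}` which represent the wave operator on the packets; the wave
operator has order two, and packets of level `k` gain one order by the Hamilton equations. -/
lemma exists_sobolev_vectors {m : ℝ} (hm : m ∈ Icc (-1 : ℝ) 2) : ∃ K : ℝ, 0 ≤ K ∧ ∀ θ, ∃ v : ι → L2 n,
    (∀ γ (ψ : 𝓢(Space n, ℂ)), inner ℂ (wFourierL2 (-m) ψ) (v γ) =
      ∫ x, conj (ψ x) * (Y.amp θ γ x * Y.pk θ γ x)) ∧
    ∀ S (d : ι → ℂ), ‖∑ γ ∈ S, d γ • v γ‖ ^ 2 ≤ K * ∑ γ ∈ S, (((2 : ℝ) ^ Y.lev γ) ^ (m + 1) * ‖d γ‖) ^ 2 := by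
  classical
  obtain ⟨K, hK, h⟩ := Y.exists_dual_vectors
  have hm2 : m - 2 ≤ 0 := by linarith [hm.2]
  suffices hmain : ∃ K' : ℝ, 0 ≤ K' ∧ ∀ v : ι → L2 n, (∀ S (d : ι → ℂ), ‖∑ γ ∈ S, d γ • v γ‖ ≤ K * Y.wn 6 S d) →
      (∀ S (d : ι → ℂ), ‖mulW (-3) (∑ γ ∈ S, d γ • v γ)‖ ≤ K * Y.wn 0 S d) →
      ∀ S (d : ι → ℂ), ‖mulW (m - 2) (∑ γ ∈ S, d γ • v γ)‖ ^ 2 ≤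
        K' * ∑ γ ∈ S, (((2 : ℝ) ^ Y.lev γ) ^ (m + 1) * ‖d γ‖) ^ 2 by
    obtain ⟨K', hK', h'⟩ := hmain
    refine ⟨K', hK', fun θ => ?_⟩
    obtain ⟨v, hv, b6, b0⟩ := h θ
    refine ⟨fun γ => mulW (m - 2) (v γ), fun γ ψ => ?_, fun S d => ?_⟩
    · rw [inner_mulW hm2, show -m + (m - 2) = -2 by ring, hv]
    · have := h' v b6 b0 S d
      rw [map_sum] at this
      simpa only [map_smul] using this
  rcases hm.1.eq_or_lt with e1 | h1
  · refine ⟨K ^ 2, sq_nonneg K, fun v _ b0 S d => ?_⟩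
    rw [← e1, show (-1 : ℝ) - 2 = -3 by norm_num]
    refine (pow_le_pow_left₀ (norm_nonneg _) (b0 S d) 2).trans (le_of_eq ?_)
    rw [mul_pow, wn_sq]
    simp
  rcases hm.2.eq_or_lt with e2 | h2
  · refine ⟨K ^ 2, sq_nonneg K, fun v b6 _ S d => ?_⟩
    have hle : ‖mulW (m - 2) (∑ γ ∈ S, d γ • v γ)‖ ≤ ‖∑ γ ∈ S, d γ • v γ‖ := by
      refine Lp.norm_le_norm_of_ae_le ?_
      filter_upwards [coeFn_mulW hm2 (∑ γ ∈ S, d γ • v γ)] with η e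
      rw [e, norm_mul, norm_weight]
      exact mul_le_of_le_one_left (norm_nonneg _)
        (rpow_le_one_of_one_le_of_nonpos (one_le_bracket η) hm2)
    refine (pow_le_pow_left₀ (norm_nonneg _) (hle.trans (b6 S d)) 2).trans (le_of_eq ?_)
    rw [mul_pow, wn_sq]
    congr 1
    refine sum_congr rfl fun γ _ => ?_
    rw [scl_zpow_six, e2, ← rpow_natCast _ 3]
    norm_num
  · obtain ⟨D, hD, hsum⟩ := exists_norm_mulW_sum_le n h1 h2
    refine ⟨D * K ^ 2, by positivity, fun v b6 b0 S d => ?_⟩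
    set J := S.image Y.lev with hJ
    set f := fun k => S.filter fun γ => Y.lev γ = k with hf
    have hmaps : ∀ γ ∈ S, Y.lev γ ∈ J := fun γ hγ => Finset.mem_image_of_mem _ hγ
    have e : ∑ γ ∈ S, d γ • v γ = ∑ k ∈ J, ∑ γ ∈ f k, d γ • v γ :=
      (Finset.sum_fiberwise_of_maps_to hmaps _).symm
    rw [e]
    refine (hsum J (fun k => ∑ γ ∈ f k, d γ • v γ) (fun k => K * Y.wn 0 (f k) d) (fun k _ => ?_)
      fun k _ => b0 _ _).trans (le_of_eq ?_)
    · refine (b6 (f k) d).trans (le_of_eq ?_)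
      rw [hf]
      beta_reduce
      rw [wn_six_filter]
      ring
    · rw [mul_assoc]
      congr 1
      rw [mul_sum, ← Finset.sum_fiberwise_of_maps_to hmaps
        (fun γ => K ^ 2 * (((2 : ℝ) ^ Y.lev γ) ^ (m + 1) * ‖d γ‖) ^ 2)]
      refine sum_congr rfl fun k _ => ?_
      rw [mul_pow, mul_pow, wn_sq, mul_sum, mul_sum]
      refine sum_congr rfl fun γ hγ => ?_
      rw [(Finset.mem_filter.1 hγ).2, zpow_zero, one_mul, mul_pow]
      ring

end WavePackets

/-! ### The operators determined by the wave matrices -/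

section operator

variable {Λ : FrequencyLattice n} {ε C : ℝ}

lemma frameCoeff_ofL2 (s : ℝ) (g : L2 n) (γ : FrameIndex Λ) :
    frameCoeff ε C (ofL2 s g) γ = inner ℂ (frameVec ε C (-s) γ) g :=
  ofL2_apply_conj s g _ _ fun _ => rfl

/-- A convergent frame expansion in `L²` is a synthesis in the sense of distributions. -/
lemma isSynthesis_ofL2 {s : ℝ} {c : FrameIndex Λ → ℂ} {g : L2 n}
    (h : HasSum (fun γ => c γ • frameVec ε C s γ) g) : IsSynthesis ε C c (ofL2 s g) := by
  have := (ofL2 s).hasSum h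
  unfold IsSynthesis
  simpa only [map_smul, frameVec, ← toTemperedDistribution_eq_ofL2] using this

/-- A matrix with the entries `⟨φ_γ, v_γ'⟩` defines a bounded operator if synthesis with the vectors `v` is
bounded. The operator is synthesis with `v` after analysis, composed with the inverse of `Π⁰`. -/
lemma definesBoundedOperator_of_vectors {r s K B D : ℝ} {b : FrameIndex Λ → FrameIndex Λ → ℂ}
    {v : FrameIndex Λ → L2 n} (hK : 0 ≤ K) (hB : 0 ≤ B)
    (hv : ∀ S (d : FrameIndex Λ → ℂ), ‖∑ γ ∈ S, d γ • v γ‖ ^ 2 ≤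
      K * ∑ γ ∈ S, (((2 : ℝ) ^ γ.k) ^ r * ‖d γ‖) ^ 2)
    (hb : ∀ γ γ', b γ γ' = inner ℂ (frameVec ε C (-s) γ) (v γ'))
    (hbessel : ∀ (S : Finset (FrameIndex Λ)) (g : L2 n),
      ∑ γ ∈ S, ((((2 : ℝ) ^ γ.k) ^ (-r))⁻¹ * ‖inner ℂ (frameVec ε C (-r) γ) g‖) ^ 2 ≤ B * ‖g‖ ^ 2)
    {P Q : L2 n ≃ₗ[ℂ] L2 n}
    (hP : ∀ f, HasSum (fun γ : FrameIndex Λ => (inner ℂ (frameVec ε C (-r) γ) f : ℂ) • frameVec ε C r γ) (P f))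
    (hP' : ∀ f, ‖P.symm f‖ ≤ D * ‖f‖)
    (hQ : ∀ f, HasSum (fun γ : FrameIndex Λ => (inner ℂ (frameVec ε C (-s) γ) f : ℂ) • frameVec ε C s γ) (Q f)) :
    DefinesBoundedOperator ε C b r s (√(K * B) * D) := by
  set c : L2 n → FrameIndex Λ → ℂ := fun g γ => inner ℂ (frameVec ε C (-r) γ) g with hc
  have hw : ∀ γ : FrameIndex Λ, (((2 : ℝ) ^ γ.k) ^ (-r))⁻¹ = ((2 : ℝ) ^ γ.k) ^ r := fun γ => by
    rw [rpow_neg (by positivity), inv_inv]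
  have hbes : ∀ (g : L2 n) (S : Finset (FrameIndex Λ)),
      ∑ γ ∈ S, (((2 : ℝ) ^ γ.k) ^ r * ‖c g γ‖) ^ 2 ≤ B * ‖g‖ ^ 2 := fun g S => by
    simpa only [hw] using hbessel S g
  have hsum : ∀ g, HasSum (fun γ => c g γ • v γ) (∑' γ, c g γ • v γ) := fun g =>
    (summable_smul_of_sq hK (fun S => hv S (c g))
      (summable_of_sum_le (fun _ => sq_nonneg _) (hbes g))).hasSum
  let V : L2 n →ₗ[ℂ] L2 n :=
    { toFun := fun g => ∑' γ, c g γ • v γ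
      map_add' := fun g g' => by
        refine HasSum.unique (hsum (g + g')) ?_
        have := (hsum g).add (hsum g')
        refine this.congr_fun ?_
        intro γ
        rw [hc]
        beta_reduce
        rw [inner_add_right, add_smul]
      map_smul' := fun z g => by
        refine HasSum.unique (hsum (z • g)) ?_
        have := (hsum g).const_smul z
        refine this.congr_fun ?_
        intro γ
        rw [hc]
        beta_reduce
        rw [inner_smul_right, mul_smul] }
  have hV : ∀ g, HasSum (fun γ => c g γ • v γ) (V g) := hsum
  have hVn : ∀ g, ‖V g‖ ≤ √(K * B) * ‖g‖ := fun g => by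
    have := norm_tsum_smul_sq_le hK (fun S => hv S (c g)) (hbes g) (hV g)
    rw [← mul_assoc] at this
    have h2 := sqrt_le_sqrt this
    rwa [sqrt_sq (norm_nonneg _), sqrt_mul (by positivity), sqrt_sq (norm_nonneg _)] at h2
  have hd : ∀ g γ, HasSum (fun γ' => b γ γ' * c g γ') (inner ℂ (frameVec ε C (-s) γ) (V g)) := fun g γ => by
    have := (innerSL ℂ (frameVec ε C (-s) γ)).hasSum (hV g)
    simpa only [innerSL_apply_apply, inner_smul_right, hb, mul_comm (c g _)] using this
  set A : Sobolev n r →ₗ[ℂ] Sobolev n s := (sobolevEquiv n s).toLinearMap ∘ₗ V ∘ₗ P.symm.toLinearMap ∘ₗ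
    (sobolevEquiv n r).symm.toLinearMap with hA
  have hAval : ∀ g, A (sobolevEquiv n r g) = sobolevEquiv n s (V (P.symm g)) := fun g => by
    simp [hA]
  refine ⟨A, fun f => ?_, fun A' hA' => ?_, fun f => ?_⟩
  · obtain ⟨g, rfl⟩ := (sobolevEquiv n r).surjective f
    have hfc : frameCoeff (Λ := Λ) ε C (ofL2 r g) = c g := funext fun γ => frameCoeff_ofL2 r g γ
    refine ⟨sobolevEquiv n r (P g), fun γ => inner ℂ (frameVec ε C (-s) γ) (V g), ofL2 s (Q (V g)),
      ?_, ?_, isSynthesis_ofL2 (hQ _), ?_⟩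
    · rw [coe_sobolevEquiv, coe_sobolevEquiv, hfc]
      exact isSynthesis_ofL2 (hP g)
    · rw [coe_sobolevEquiv, hfc]
      exact hd g
    · rw [hAval, LinearEquiv.symm_apply_apply, coe_sobolevEquiv]
      have : frameCoeff (Λ := Λ) ε C (ofL2 s (V g)) = fun γ => inner ℂ (frameVec ε C (-s) γ) (V g) :=
        funext fun γ => frameCoeff_ofL2 s _ γ
      rw [this]
      exact isSynthesis_ofL2 (hQ _)
  -- `Π⁰ (A' h) = Π⁰ (V g)`, and `Π⁰` is injective
  · refine LinearMap.ext fun f => ?_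
    obtain ⟨f', rfl⟩ := (sobolevEquiv n r).surjective f
    obtain ⟨g, rfl⟩ := P.surjective f'
    obtain ⟨h, d, gd, h1, h2, h3, h4⟩ := hA' (sobolevEquiv n r g)
    have hfc : frameCoeff (Λ := Λ) ε C (ofL2 r g) = c g := funext fun γ => frameCoeff_ofL2 r g γ
    rw [coe_sobolevEquiv, hfc] at h1 h2
    have eh : h = sobolevEquiv n r (P g) :=
      Subtype.ext (HasSum.unique h1 (isSynthesis_ofL2 (hP g)))
    have ed : d = fun γ => inner ℂ (frameVec ε C (-s) γ) (V g) :=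
      funext fun γ => HasSum.unique (h2 γ) (hd g γ)
    obtain ⟨w, hw⟩ := (sobolevEquiv n s).surjective (A' h)
    have e5 : frameCoeff (Λ := Λ) ε C (ofL2 s w) = fun γ => inner ℂ (frameVec ε C (-s) γ) w :=
      funext fun γ => frameCoeff_ofL2 s _ γ
    rw [← hw, coe_sobolevEquiv, e5] at h4
    rw [ed] at h3
    have e6 : gd = ofL2 s (Q w) := HasSum.unique h4 (isSynthesis_ofL2 (hQ w))
    have e7 : gd = ofL2 s (Q (V g)) := HasSum.unique h3 (isSynthesis_ofL2 (hQ _))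
    have e8 : w = V g := Q.injective (ofL2_injective s (e6.symm.trans e7))
    rw [hAval, LinearEquiv.symm_apply_apply, ← e8, hw, eh]
  · obtain ⟨g, rfl⟩ := (sobolevEquiv n r).surjective f
    rw [hAval, sobolevNorm_sobolevEquiv, sobolevNorm_sobolevEquiv, mul_assoc]
    exact (hVn _).trans (mul_le_mul_of_nonneg_left (hP' g) (sqrt_nonneg _))

end operator

section conclusion

variable {Λ : FrequencyLattice n} {T ε C : ℝ} {a : CoeffField n}

/-- The vectors which represent the wave operator on a combination of the two half waves. -/
lemma exists_halfwave_vectors (ha : IsC11Coefficient T a) (hT : 0 < T) (hε : 0 < ε) (hC : 0 < C) {m r N : ℝ}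
    (hm : m ∈ Icc (-1 : ℝ) 2) (c₁ c₂ : ℝ → FrameIndex Λ → ℂ) (u : ℝ → FrameIndex Λ → ℝ → Space n → ℂ)
    (hu : ∀ t' γ s x, u t' γ s x = c₁ t' γ * propagated ε C T a 1 t' γ s x +
      c₂ t' γ * propagated ε C T a (-1) t' γ s x)
    (h₁ : ∀ t' ∈ Icc (-T) T, ∀ γ, ((2 : ℝ) ^ γ.k) ^ (m + 1) * ‖c₁ t' γ‖ ≤ N * ((2 : ℝ) ^ γ.k) ^ r)
    (h₂ : ∀ t' ∈ Icc (-T) T, ∀ γ, ((2 : ℝ) ^ γ.k) ^ (m + 1) * ‖c₂ t' γ‖ ≤ N * ((2 : ℝ) ^ γ.k) ^ r) :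
    ∃ K : ℝ, 0 ≤ K ∧ ∀ t' ∈ Icc (-T) T, ∀ t ∈ Ioo (-T) T, IsRegularTime ε C T a Λ t' t →
      ∃ v : FrameIndex Λ → L2 n,
        (∀ γ γ', waveMatrix ε C a (u t') t γ γ' = inner ℂ (frameVec ε C (-m) γ) (v γ')) ∧
        ∀ S (d : FrameIndex Λ → ℂ), ‖∑ γ ∈ S, d γ • v γ‖ ^ 2 ≤
          K * ∑ γ ∈ S, (((2 : ℝ) ^ γ.k) ^ r * ‖d γ‖) ^ 2 := by
  obtain ⟨Y, hlev, hwave⟩ := exists_wave_amplitude (Λ := Λ) ha hT hε hC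
  obtain ⟨K, hK, hvec⟩ := Y.exists_sobolev_vectors hm
  obtain ⟨hs, -⟩ := Y.exists_strong_bound
  have hF : ∀ θ γ, SqInt (fun x => Y.amp θ γ x * Y.pk θ γ x) := fun θ γ => by
    have := hs θ {γ} (fun _ => 1)
    have e : Y.psum Y.amp θ {γ} (fun _ => 1) = fun x => Y.amp θ γ x * Y.pk θ γ x := funext fun x => by
      rw [PacketSystem.psum, Finset.sum_singleton, one_mul]
    rwa [e] at this
  refine ⟨4 * (K * N ^ 2), by positivity, fun t' ht' t ht hreg => ?_⟩
  let θ₁ : WaveParam Λ ε C T a := ⟨(t', t, 1), ht', ht, by simp, hreg⟩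
  let θ₂ : WaveParam Λ ε C T a := ⟨(t', t, -1), ht', ht, by simp, hreg⟩
  obtain ⟨v₁, hv₁, b₁⟩ := hvec θ₁
  obtain ⟨v₂, hv₂, b₂⟩ := hvec θ₂
  refine ⟨fun γ => c₁ t' γ • v₁ γ + c₂ t' γ • v₂ γ, fun γ γ' => ?_, fun S d => ?_⟩
  · have hw : ∀ x, waveOp a (u t' γ') t x = c₁ t' γ' * (Y.amp θ₁ γ' x * Y.pk θ₁ γ' x) +
        c₂ t' γ' * (Y.amp θ₂ γ' x * Y.pk θ₂ γ' x) := fun x => by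
      have e : u t' γ' = fun s x => c₁ t' γ' * propagated ε C T a 1 t' γ' s x +
          c₂ t' γ' * propagated ε C T a (-1) t' γ' s x := by
        funext s x; exact hu t' γ' s x
      rw [e]
      exact ((hwave θ₁ γ').comb (hwave θ₂ γ') (c₁ t' γ') (c₂ t' γ')).waveOp_eq x
    have hi : ∀ θ, Integrable (fun x => conj (γ.frameFun ε C x) * (Y.amp θ γ' x * Y.pk θ γ' x)) :=
      fun θ => (sqInt_schwartz (γ.frameFun ε C)).conjugate.integrable_mul (hF θ γ')
    rw [waveMatrix, frameVec, inner_add_right, inner_smul_right, inner_smul_right, hv₁, hv₂,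
      ← integral_const_mul, ← integral_const_mul, ← integral_add ((hi θ₁).const_mul _) ((hi θ₂).const_mul _)]
    refine integral_congr_ae (.of_forall fun x => ?_)
    beta_reduce
    rw [hw]
    ring
  · have key : ∀ (c : ℝ → FrameIndex Λ → ℂ) (v : FrameIndex Λ → L2 n),
        (∀ γ, ((2 : ℝ) ^ γ.k) ^ (m + 1) * ‖c t' γ‖ ≤ N * ((2 : ℝ) ^ γ.k) ^ r) →
        (∀ S (d : FrameIndex Λ → ℂ), ‖∑ γ ∈ S, d γ • v γ‖ ^ 2 ≤
          K * ∑ γ ∈ S, (((2 : ℝ) ^ Y.lev γ) ^ (m + 1) * ‖d γ‖) ^ 2) →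
        ‖∑ γ ∈ S, (d γ * c t' γ) • v γ‖ ^ 2 ≤ K * (N ^ 2 * ∑ γ ∈ S, (((2 : ℝ) ^ γ.k) ^ r * ‖d γ‖) ^ 2) := by
      intro c v hc b
      refine (b S fun γ => d γ * c t' γ).trans (mul_le_mul_of_nonneg_left ?_ hK)
      rw [mul_sum]
      refine sum_le_sum fun γ _ => ?_
      rw [hlev, ← mul_pow, norm_mul]
      refine pow_le_pow_left₀ (by positivity) ?_ 2
      calc ((2 : ℝ) ^ γ.k) ^ (m + 1) * (‖d γ‖ * ‖c t' γ‖)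
          = ((2 : ℝ) ^ γ.k) ^ (m + 1) * ‖c t' γ‖ * ‖d γ‖ := by ring
        _ ≤ N * ((2 : ℝ) ^ γ.k) ^ r * ‖d γ‖ := mul_le_mul_of_nonneg_right (hc γ) (norm_nonneg _)
        _ = _ := by ring
    have e : ∑ γ ∈ S, d γ • (c₁ t' γ • v₁ γ + c₂ t' γ • v₂ γ) =
        ∑ γ ∈ S, (d γ * c₁ t' γ) • v₁ γ + ∑ γ ∈ S, (d γ * c₂ t' γ) • v₂ γ := by
      rw [← sum_add_distrib]
      exact sum_congr rfl fun γ _ => by rw [smul_add, smul_smul, smul_smul]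
    rw [e]
    have k1 := key c₁ v₁ (h₁ t' ht') b₁
    have k2 := key c₂ v₂ (h₂ t' ht') b₂
    set x := ∑ γ ∈ S, (d γ * c₁ t' γ) • v₁ γ
    set y := ∑ γ ∈ S, (d γ * c₂ t' γ) • v₂ γ
    have := pow_le_pow_left₀ (norm_nonneg _) (norm_add_le x y) 2
    nlinarith [sq_nonneg (‖x‖ - ‖y‖)]

/-- The coefficient `1 / q` of the sine packets gains one order. -/
lemma exists_inv_symbolQ_le (ha : IsC11Coefficient T a) : ∃ N : ℝ, 0 ≤ N ∧
    ∀ t' ∈ Icc (-T) T, ∀ γ : FrameIndex Λ, ‖(1 / 2 : ℂ) / (symbolQ a t' (γ.centre ε C) γ.freq : ℂ)‖ ≤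
      N * ((2 : ℝ) ^ γ.k)⁻¹ := by
  obtain ⟨K, h⟩ := ha.exists_bounds
  have hK := h.pos
  refine ⟨K, hK.le, fun t' ht' γ => ?_⟩
  have hq := h.le_symbolQ ht' (γ.centre ε C) γ.freq
  have hq0 := h.symbolQ_pos ht' (γ.centre ε C) γ.freq_ne_zero
  have hf := γ.norm_freq_mem.1
  have hk : (0 : ℝ) < 2 ^ γ.k := by positivity
  rw [norm_div, norm_real, norm_of_nonneg hq0.le, div_le_iff₀ hq0]
  have e : ‖(1 / 2 : ℂ)‖ = 1 / 2 := by norm_num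
  rw [e]
  have h3 : (2 : ℝ) ^ γ.k / 2 / K ≤ symbolQ a t' (γ.centre ε C) γ.freq := le_trans (by gcongr) hq
  calc (1 / 2 : ℝ) = K * ((2 : ℝ) ^ γ.k)⁻¹ * ((2 : ℝ) ^ γ.k / 2 / K) := by field_simp
    _ ≤ _ := by gcongr

end conclusion

end

theorem theorem4 (n : ℕ) (hn : 1 ≤ n) (ε : ℝ) (hε : 0 < ε) :
    ∃ C₀ > (0 : ℝ), ∀ (Λ : FrequencyLattice n) (C : ℝ), 0 < C → C ≤ C₀ →
      ∀ (T : ℝ), 0 < T → ∀ a : CoeffField n, IsC11Coefficient T a →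
        (∀ σ ∈ ({1, -1} : Set ℝ), ∀ t' ∈ Icc (-T) T, ∀ x₀ ξ₀ : Space n, ξ₀ ≠ 0 →
          IsBicharacteristic T a σ t' x₀ ξ₀ (bichar T a σ t' x₀ ξ₀)) ∧
        (∀ t' ∈ Icc (-T) T, ∀ᵐ t ∂(volume.restrict (Ioo (-T) T)),
          IsRegularTime ε C T a Λ t' t) ∧
        ∀ m ∈ Icc (-1 : ℝ) 2, ∃ K : ℝ, ∀ t' ∈ Icc (-T) T, ∀ t ∈ Ioo (-T) T,
          IsRegularTime ε C T a Λ t' t →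
            DefinesBoundedOperator ε C
              (waveMatrix (Λ := Λ) ε C a (cosFun ε C T a t') t) (m + 1) m K ∧
            DefinesBoundedOperator ε C
              (waveMatrix (Λ := Λ) ε C a (sinFun ε C T a t') t) m m K := by
  obtain ⟨C₀, D, hC₀, hC₁, hD, hinv⟩ := exists_frame_inverse n hn 3
  obtain ⟨B, hB, hbes⟩ := exists_bessel n 3
  refine ⟨C₀, hC₀, fun Λ C hC hCC T hT a ha => ⟨fun σ hσ t' ht' x₀ ξ₀ hξ => ?_,
    fun t' ht' => ae_isRegularTime ha ht', fun m hm => ?_⟩⟩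
  · refine isBicharacteristic_bichar ha ?_ ht' x₀ hξ
    rcases hσ with rfl | rfl <;> simp
  obtain ⟨N, hN, hq⟩ := exists_inv_symbolQ_le (Λ := Λ) (ε := ε) (C := C) ha
  obtain ⟨K₁, hK₁, hcos⟩ := exists_halfwave_vectors (Λ := Λ) (r := m + 1) (N := 1) ha hT hε hC hm
    (fun _ _ => 1 / 2) (fun _ _ => 1 / 2) (cosFun ε C T a) (fun t' γ s x => by rw [cosFun]; ring)
    (fun t' _ γ => by rw [mul_comm]; gcongr; norm_num)
    (fun t' _ γ => by rw [mul_comm]; gcongr; norm_num)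
  have hpow : ∀ (k : ℕ), ((2 : ℝ) ^ k) ^ (m + 1) * (N * ((2 : ℝ) ^ k)⁻¹) = N * ((2 : ℝ) ^ k) ^ m := fun k => by
    have : (0 : ℝ) < 2 ^ k := by positivity
    rw [Real.rpow_add_one this.ne']
    field_simp
  obtain ⟨K₂, hK₂, hsin⟩ := exists_halfwave_vectors (Λ := Λ) (r := m) (N := N) ha hT hε hC hm
    (fun t' γ => 1 / 2 / (symbolQ a t' (γ.centre ε C) γ.freq : ℂ))
    (fun t' γ => -(1 / 2 / (symbolQ a t' (γ.centre ε C) γ.freq : ℂ))) (sinFun ε C T a)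
    (fun t' γ s x => by rw [sinFun]; ring)
    (fun t' ht' γ => by rw [← hpow]; gcongr; exact hq t' ht' γ)
    (fun t' ht' γ => by rw [← hpow, norm_neg]; gcongr; exact hq t' ht' γ)
  have m1 : |m| ≤ 3 := abs_le.2 ⟨by linarith [hm.1], by linarith [hm.2]⟩
  have m2 : |m + 1| ≤ 3 := abs_le.2 ⟨by linarith [hm.1], by linarith [hm.2]⟩
  have m1' : |-m| ≤ 3 := by rwa [abs_neg]
  have m2' : |-(m + 1)| ≤ 3 := by rwa [abs_neg]
  obtain ⟨P, hP, hP'⟩ := hinv Λ ε C hε hC hCC (m + 1) m2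
  obtain ⟨Q, hQ, hQ'⟩ := hinv Λ ε C hε hC hCC m m1
  have mono : ∀ {b : FrameIndex Λ → FrameIndex Λ → ℂ} {r s K K' : ℝ}, K ≤ K' →
      DefinesBoundedOperator ε C b r s K → DefinesBoundedOperator ε C b r s K' := by
    rintro b r s K K' hKK ⟨A, h1, h2, h3⟩
    exact ⟨A, h1, h2, fun f => (h3 f).trans (mul_le_mul_of_nonneg_right hKK (norm_nonneg _))⟩
  refine ⟨max (√(K₁ * B) * D) (√(K₂ * B) * D), fun t' ht' t ht hreg => ⟨?_, ?_⟩⟩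
  · obtain ⟨v, hb, hv⟩ := hcos t' ht' t ht hreg
    exact mono (le_max_left _ _) (definesBoundedOperator_of_vectors hK₁ hB.le hv hb
      (fun S g => hbes Λ ε C hε hC (hCC.trans hC₁) _ m2' S g) hP hP' hQ)
  · obtain ⟨v, hb, hv⟩ := hsin t' ht' t ht hreg
    exact mono (le_max_right _ _) (definesBoundedOperator_of_vectors hK₂ hB.le hv hb
      (fun S g => hbes Λ ε C hε hC (hCC.trans hC₁) _ m1' S g) hQ hQ' hQ)
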